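/- **Theorem 1.4 (A priori sparseness).** Let $d\ge 3$ and $p\in(d,+\infty]$ (with the convention $1/\infty=0$). Write $L^q_\sigma$ for the space of vector fields in $L^q(\mathbb R^d;\mathbb R^d)$ that are divergence free in the sense of distributions. A *mild solution* on a time interval $I=(0,T)$ or $I=(0,T]$ with initial datum $u_0\in L^p_\sigma$ is a function $u\in C(I;L^p_\sigma)$ with $\sup_{0<s\le t}\|u(s)\|_{L^p}<\infty$ for every $t\in I$ and $$u(t)=e^{t\Delta}u_0-\int_0^t e^{(t-s)\Delta}\,\mathbb P\,\nabla\cdot(u\otimes u)(s)\,ds\qquad (t\in I),$$ where $\mathbb P$ is the Leray projection. Let $T^*(u_0)\in(0,\infty]$ be the supremum of the $T$ for which a mild solution on $(0,T)$ exists; the *strong solution* with datum $u_0$ is the mild solution $u$ on $(0,T^*(u_0))$. A vector field $f\in L^p$ is *$(\varepsilon,\beta,\ell)$-sparse in $L^p$* ($\varepsilon,\beta\in(0,1)$, $\ell>0$) if there is a measurable set $S\subset\mathbb R^d$ with $$\|f\|_{L^p(S^c)}<\beta\|f\|_{L^p}\quad\text{and}\quad \sup_{x_0\in\mathbb R^d}\frac{|S\cap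 B_\ell(x_0)|}{|B_\ell(x_0)|}\le\varepsilon .$$ Let $u_0\in L^2_\sigma\cap L^p_\sigma$, let $u$ be the strong solution with datum $u_0$, and let $T^*=T^*(u_0)$. Then $u(\cdot,t)\in L^2\cap L^p$ for all $t\in(0,T^*)$. Whenever $u(\cdot,t)\ne0$, set $$\ell_0(t)=\left(\frac{\|u(\cdot,t)\|_{L^2}}{\|u(\cdot,t)\|_{L^p}}\right)^{\mu_p},\qquad \frac1{\mu_p}=d\left(\frac12-\frac1p\right).$$ 1. For all $\varepsilon,\beta\in(0,1)$ there exists $a\ge1$, depending only on $d,p,\varepsilon,\beta$, such that $u(\cdot,t)$ is $(\varepsilon,\beta,a\,\ell_0(t))$-sparse in $L^p$ for every $t\in(0,T^*)$ with $u(\cdot,t)\neq0$. 2. There is a constant $c_p\in(0,1]$, depending only on $d$ and $p$, with the following two properties. First, for every $v_0\in L^p_\sigma$ and every $T>0$ with $\|v_0\|_{L^p}T^{\frac12(1-\frac dp)}=c_p$, there is a unique mild solution with datum $v_0$ on $(0,T]$, and its $L^p$ norm is at most $2\|v_0\|_{L^p}$ on $(0,T)$. Second, if $T^*<\infty$, then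 for all $t\in(0,T^*)$ one has $u(\cdot,t)\ne0$ and $$\ell_0(t)^{1/\mu_p}\le c_p^{-1}\|u_0\|_{L^2}\,(T^*-t)^{\frac12\left(1-\frac dp\right)},$$ where the right-hand side, and hence also $\ell_0(t)$, tends to $0$ as $t\to T^*$ from below. -/

import Mathlib

open MeasureTheory Set Filter Topology
open scoped ENNReal

noncomputable section

namespace NavierStokes

/-- The Euclidean space of dimension `d`. -/
abbrev Sp (d : ℕ) : Type := EuclideanSpace ℝ (Fin d)

/-- The `i`-th partial derivative of a scalar function. -/
def pd {d : ℕ} (i : Fin d) (f : Sp d → ℝ) (x : Sp d) : ℝ :=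
  fderiv ℝ f x (EuclideanSpace.single i 1)

/-- Membership in `L^p_σ`: the vector field is in `L^p` and is divergence free in the sense of
distributions. -/
def InLpSigma {d : ℕ} (p : ℝ≥0∞) (f : Sp d → Sp d) : Prop :=
  MemLp f p volume ∧
    ∀ φ : Sp d → ℝ, ContDiff ℝ (⊤ : ℕ∞) φ → HasCompactSupport φ →
      ∫ x, fderiv ℝ φ x (f x) = 0

/-- The heat kernel, that is, the convolution kernel of `e^{tΔ}`. -/
def heatKernel (d : ℕ) (t : ℝ) (x : Sp d) : ℝ :=
  (4 * Real.pi * t) ^ (-(d : ℝ) / 2) * Real.exp (-‖x‖ ^ 2 / (4 * t))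

/-- The heat semigroup `e^{tΔ} f`, for `t > 0`. -/
def heatFlow {d : ℕ} (t : ℝ) (f : Sp d → Sp d) (x : Sp d) : Sp d :=
  ∫ y, heatKernel d t (x - y) • f y

/-- The convolution kernel (Oseen kernel) of the operator `e^{tΔ} ℙ_{ij} ∂_k`, for `t > 0`, where
`ℙ_{ij} = δ_{ij} + ∂_i ∂_j (-Δ)⁻¹` is the Leray projection. Since
`(-Δ)⁻¹ e^{tΔ} = ∫_t^∞ e^{sΔ} ds`, the kernel is
`δ_{ij} ∂_k G_t + ∫_t^∞ ∂_i ∂_j ∂_k G_s ds`, where `G` is the heat kernel. -/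
def oseenKernel {d : ℕ} (i j k : Fin d) (t : ℝ) (x : Sp d) : ℝ :=
  (if i = j then pd k (heatKernel d t) x else 0)
    + ∫ s in Ioi t, pd i (pd j (pd k (heatKernel d s))) x

/-- The bilinear Duhamel term `∫_0^t e^{(t-s)Δ} ℙ ∇ · (u ⊗ u)(s) ds`, evaluated at `x`. -/
def duhamel {d : ℕ} (u : ℝ → Sp d → Sp d) (t : ℝ) (x : Sp d) : Sp d :=
  WithLp.toLp 2 fun i => ∑ j, ∑ k,
    ∫ s in (0 : ℝ)..t, ∫ y, oseenKernel i j k (t - s) (x - y) * (u s y j * u s y k)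

/-- `u` is a mild solution in `L^p` of the Navier--Stokes equations (with unit viscosity) on the
time interval `I` (of the form `(0, T)` or `(0, T]`) with initial datum `u₀`: it lies in
`C(I; L^p_σ)`, is bounded in `L^p` as `t → 0⁺`, and satisfies
`u(t) = e^{tΔ} u₀ - ∫_0^t e^{(t-s)Δ} ℙ ∇ · (u ⊗ u)(s) ds`. -/
structure IsMildSolution {d : ℕ} (p : ℝ≥0∞) (u₀ : Sp d → Sp d) (I : Set ℝ)
    (u : ℝ → Sp d → Sp d) : Prop where
  mem : ∀ t ∈ I, InLpSigma p (u t)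
  cont : ∀ t ∈ I, Tendsto (fun s => eLpNorm (u s - u t) p volume) (𝓝[I] t) (𝓝 0)
  bdd : ∀ t ∈ I, ∃ M : ℝ≥0∞, M < ∞ ∧ ∀ s ∈ Ioc 0 t, eLpNorm (u s) p volume ≤ M
  duhamel_eq : ∀ t ∈ I, ∀ᵐ x ∂(volume : Measure (Sp d)),
    u t x = heatFlow t u₀ x - duhamel u t x

/-- The open time interval `(0, T)`, where `T = ∞` is allowed. -/
def timeInterval (T : ℝ≥0∞) : Set ℝ := {t | 0 < t ∧ ENNReal.ofReal t < T}

/-- The maximal time of existence `T^*(u₀) ∈ [0, ∞]` of the solution in `L^p`. -/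
def maximalTime {d : ℕ} (p : ℝ≥0∞) (u₀ : Sp d → Sp d) : ℝ≥0∞ :=
  sSup {T | ∃ u, IsMildSolution p u₀ (timeInterval T) u}

/-- `u` is the strong solution with initial datum `u₀`: the mild solution in `L^p`, with `p > d`,
on its maximal interval of existence `(0, T^*(u₀))`. -/
def IsStrongSolution {d : ℕ} (p : ℝ≥0∞) (u₀ : Sp d → Sp d) (u : ℝ → Sp d → Sp d) : Prop :=
  IsMildSolution p u₀ (timeInterval (maximalTime p u₀)) u

/-- The exponent `(1 - d/p)/2` (with `d/∞ = 0`). -/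
def timeExponent (d : ℕ) (p : ℝ≥0∞) : ℝ := (1 - d * (p⁻¹).toReal) / 2

/-- `c` is admissible as the constant in the guaranteed existence time `T`, which is given by
`‖u₀‖_p T^{(1 - d/p)/2} = c`: every `u₀ ∈ L^p_σ` has a unique mild solution in `L^p` on `(0, T]`,
and this solution is bounded by `2 ‖u₀‖_p`. -/
def IsExistenceConstant (d : ℕ) (p : ℝ≥0∞) (c : ℝ) : Prop :=
  ∀ u₀ : Sp d → Sp d, InLpSigma p u₀ →
    ∀ T : ℝ, 0 < T → (eLpNorm u₀ p volume).toReal * T ^ timeExponent d p = c →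
      ∃ u, IsMildSolution p u₀ (Ioc 0 T) u ∧
        (∀ t ∈ Ioo 0 T, eLpNorm (u t) p volume ≤ 2 * eLpNorm u₀ p volume) ∧
        ∀ v, IsMildSolution p u₀ (Ioc 0 T) v → ∀ t ∈ Ioc 0 T, v t =ᵐ[volume] u t

/-- The vector field `f ∈ L^p` is `(ε, β, ℓ)`-sparse in `L^p`. -/
def IsSparse {d : ℕ} (p : ℝ≥0∞) (ε β ℓ : ℝ) (f : Sp d → Sp d) : Prop :=
  MemLp f p volume ∧ 0 < ℓ ∧
    ∃ S : Set (Sp d), MeasurableSet S ∧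
      eLpNorm f p (volume.restrict Sᶜ) < ENNReal.ofReal β * eLpNorm f p volume ∧
      (⨆ x₀ : Sp d, volume (S ∩ Metric.ball x₀ ℓ) / volume (Metric.ball x₀ ℓ)) ≤
        ENNReal.ofReal ε

/-- The exponent `μ_p`, given by `1 / μ_p = d (1/2 - 1/p)` (with `1/∞ = 0`). -/
def mu (d : ℕ) (p : ℝ≥0∞) : ℝ := 1 / (d * (1 / 2 - (p⁻¹).toReal))

/-- The length scale `(‖f‖_2 / ‖f‖_p) ^ μ_p` of a vector field `f ∈ L^2 ∩ L^p`, `f ≠ 0`. -/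
def lengthScale {d : ℕ} (p : ℝ≥0∞) (f : Sp d → Sp d) : ℝ :=
  ((eLpNorm f 2 volume).toReal / (eLpNorm f p volume).toReal) ^ mu d p

end NavierStokes

end

/-! Sparseness is a static fact. For a nonzero field f in L² ∩ L^p with p > 2, take S = {|f| > λ}.
Off S one has |f|^p ≤ λ^(p-2) |f|², so a suitable λ makes the L^p norm there at most (β/2)‖f‖_p,
while Chebyshev bounds |S| by a constant times (‖f‖₂/‖f‖_p)^(d μ_p) = ℓ₀^d. For large a, the volume
of a ball of radius a ℓ₀ exceeds |S|/ε (`exists_isSparse`). The equation only has to supply u(t) ∈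
L², and this follows from an iteration that is linear in one argument of the Duhamel term
(`Mild.eLpNorm_le`).

The second part divides two inequalities. The Oseen kernel at time t has mass of order t^(-1/2) and
size of order t^(-1/2-d/2), so the bilinear Duhamel term acts in L^p with the singularity
(t-s)^(-1/2-d/(2p)), which is integrable because p > d. Picard iteration then gives a solution on
(0,T] once ‖v₀‖_p T^((1-d/p)/2) is below an explicit constant (`exists_mild`), and exponential
weights in time give uniqueness (`Mild.unique`). If ‖u(t)‖_p (T*-t)^((1-d/p)/2) were smaller than
that constant, restarting at time t and gluing (`Mild.glue`) would continue u past T*. This is the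
lower bound `IsStrongSolution.exC_le`. Dividing ‖u(t)‖₂ ≤ ‖u₀‖₂ by it gives the claim.

The energy inequality is the main labour, since it is proved without any differentiability of mild
solutions. For positive times u is bounded (`exists_smoothing`), hence Hölder continuous in time
with exponent 3/8 and values in L², and ‖u - e^{σΔ}u‖₂ = O(σ^(3/8)). The squared norm of e^{εΔ}u is
followed over time steps h ≤ ε². The heat flow decreases it, and the square of the Duhamel increment
is negligible. In the cross term the Leray projection drops out on divergence free fields; what is
left is a transport term that vanishes when every factor is regularized, and that is O(ε^(1/4))
otherwise (`EnergyCurve.energy_step`). Summing the steps and letting ε → 0 gives the inequality from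
any positive initial time, and the Duhamel formula extends it to time 0 (`Mild.eLpNorm_two_le`). -/

noncomputable section

/-! ### Explicit derivatives of the heat kernel and their Gaussian bounds. -/

namespace NavierStokes

variable {d : ℕ}

/-- The Kronecker symbol. -/
def kd (i j : Fin d) : ℝ := if i = j then 1 else 0

/-- First derivatives of the heat kernel. -/
def g1 (k : Fin d) (t : ℝ) (x : Sp d) : ℝ := -(x k / (2 * t)) * heatKernel d t x

/-- Second derivatives of the heat kernel. -/
def g2 (j k : Fin d) (t : ℝ) (x : Sp d) : ℝ :=
  (x j * x k / (4 * t ^ 2) - kd j k / (2 * t)) * heatKernel d t x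

/-- Third derivatives of the heat kernel. -/
def g3 (i j k : Fin d) (t : ℝ) (x : Sp d) : ℝ :=
  (-(x i * x j * x k) / (8 * t ^ 3) + (kd i j * x k + kd i k * x j + kd j k * x i) / (4 * t ^ 2))
    * heatKernel d t x

lemma heatKernel_pos {t : ℝ} (ht : 0 < t) (x : Sp d) : 0 < heatKernel d t x := by
  unfold heatKernel; have := Real.pi_pos; positivity

lemma contDiff_heatKernel {n : WithTop ℕ∞} (t : ℝ) : ContDiff ℝ n (heatKernel d t) := by
  unfold heatKernel
  have : ContDiff ℝ n (fun x : Sp d => ‖x‖ ^ 2) := contDiff_norm_sq ℝ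
  fun_prop

@[fun_prop]
lemma contDiff_coord {n : WithTop ℕ∞} (k : Fin d) : ContDiff ℝ n (fun x : Sp d => x k) :=
  (EuclideanSpace.proj k : Sp d →L[ℝ] ℝ).contDiff

lemma contDiff_g1 {n : WithTop ℕ∞} (k : Fin d) (t : ℝ) : ContDiff ℝ n (g1 k t) := by
  unfold g1
  have := contDiff_heatKernel (d := d) (n := n) t
  simp only [div_eq_mul_inv]
  fun_prop

lemma contDiff_g2 {n : WithTop ℕ∞} (j k : Fin d) (t : ℝ) : ContDiff ℝ n (g2 j k t) := by
  unfold g2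
  have := contDiff_heatKernel (d := d) (n := n) t
  simp only [div_eq_mul_inv]
  fun_prop

lemma contDiff_g3 {n : WithTop ℕ∞} (i j k : Fin d) (t : ℝ) : ContDiff ℝ n (g3 i j k t) := by
  unfold g3
  have := contDiff_heatKernel (d := d) (n := n) t
  simp only [div_eq_mul_inv]
  fun_prop

lemma hasFDerivAt_heatKernel (t : ℝ) (x : Sp d) :
    HasFDerivAt (heatKernel d t) ((-(1 / (2 * t)) * heatKernel d t x) • innerSL ℝ x) x := by
  unfold heatKernel
  have h := (hasStrictFDerivAt_norm_sq x).hasFDerivAt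
  have h2 := ((h.const_mul (-(1 / (4 * t)))).exp).const_mul ((4 * Real.pi * t) ^ (-(d : ℝ) / 2))
  refine (h2.congr_of_eventuallyEq ?_).congr_fderiv ?_
  · filter_upwards with y
    congr 2; ring
  · ext v
    simp
    rw [show -(t⁻¹ * 4⁻¹ * ‖x‖ ^ 2) = -‖x‖ ^ 2 / (4 * t) by ring]
    ring

lemma pd_heatKernel (k : Fin d) (t : ℝ) : pd k (heatKernel d t) = g1 k t := by
  funext x
  simp only [pd, (hasFDerivAt_heatKernel t x).fderiv, g1]
  simp [EuclideanSpace.inner_single_right]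
  ring

lemma pd_mul {f g : Sp d → ℝ} (k : Fin d) (x : Sp d) (hf : DifferentiableAt ℝ f x)
    (hg : DifferentiableAt ℝ g x) :
    pd k (fun x => f x * g x) x = pd k f x * g x + f x * pd k g x := by
  simp only [pd]
  rw [fderiv_fun_mul hf hg]
  simp; ring

lemma pd_coord (j k : Fin d) (x : Sp d) : pd j (fun x : Sp d => x k) x = kd j k := by
  have : HasFDerivAt (fun x : Sp d => x k) (EuclideanSpace.proj k : Sp d →L[ℝ] ℝ) x :=
    (EuclideanSpace.proj k : Sp d →L[ℝ] ℝ).hasFDerivAt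
  simp only [pd, this.fderiv, kd]
  simp [eq_comm]

lemma differentiable_coord (k : Fin d) : Differentiable ℝ (fun x : Sp d => x k) :=
  (contDiff_coord (n := 1) k).differentiable (by norm_num)

lemma pd_const_mul {f : Sp d → ℝ} (k : Fin d) (c : ℝ) (x : Sp d) (hf : DifferentiableAt ℝ f x) :
    pd k (fun x => c * f x) x = c * pd k f x := by
  simp only [pd]
  rw [fderiv_const_mul hf]
  simp

lemma pd_add {f g : Sp d → ℝ} (k : Fin d) (x : Sp d) (hf : DifferentiableAt ℝ f x)
    (hg : DifferentiableAt ℝ g x) :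
    pd k (fun x => f x + g x) x = pd k f x + pd k g x := by
  simp only [pd]
  rw [fderiv_fun_add hf hg]
  simp

lemma pd_const (k : Fin d) (c : ℝ) (x : Sp d) : pd k (fun _ => c) x = 0 := by
  simp [pd]

lemma kd_comm (i j : Fin d) : kd i j = kd j i := by simp [kd, eq_comm]

lemma differentiable_heatKernel (t : ℝ) : Differentiable ℝ (heatKernel d t) :=
  (contDiff_heatKernel (n := 1) t).differentiable (by norm_num)

lemma pd_g1 (j k : Fin d) (t : ℝ) : pd j (g1 k t) = g2 j k t := by
  funext x
  have h0 : g1 k t = fun x : Sp d => (-(1 / (2 * t)) * x k) * heatKernel d t x := by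
    funext x; simp only [g1]; ring
  have hx := differentiable_coord (d := d) k x
  rw [h0, pd_mul j x (hx.const_mul _) (differentiable_heatKernel t x),
    pd_const_mul _ _ _ hx, pd_coord, pd_heatKernel]
  simp only [g1, g2]
  ring

lemma pd_g2 (i j k : Fin d) (t : ℝ) : pd i (g2 j k t) = g3 i j k t := by
  funext x
  have h0 : g2 j k t = fun x : Sp d => ((1 / (4 * t ^ 2)) * (x j * x k) + -(kd j k / (2 * t)))
      * heatKernel d t x := by
    funext x; simp only [g2]; ring
  have hx := differentiable_coord (d := d) k x
  have hy := differentiable_coord (d := d) j x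
  have hyx : DifferentiableAt ℝ (fun x : Sp d => x j * x k) x := hy.mul hx
  rw [h0, pd_mul i x ((hyx.const_mul _).add_const _) (differentiable_heatKernel t x),
    pd_add _ _ (hyx.const_mul _) (differentiableAt_const _), pd_const,
    pd_const_mul _ _ _ hyx, pd_mul _ _ hy hx, pd_coord, pd_coord, pd_heatKernel]
  simp only [g1, g3]
  ring

lemma oseenKernel_eq (i j k : Fin d) (t : ℝ) (x : Sp d) :
    oseenKernel i j k t x = kd i j * g1 k t x + ∫ s in Ioi t, g3 i j k s x := by
  simp only [oseenKernel, pd_heatKernel, pd_g1, pd_g2, kd]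
  split_ifs <;> simp

/-- Gaussian absorption of powers of `‖x‖ / √t`. -/
lemma exp_absorb (z : ℝ) :
    (1 + z + z ^ 2 + z ^ 3) * Real.exp (-(z ^ 2 / 8)) ≤ 512 := by
  have h1 : (1 + z + z ^ 2 + z ^ 3) ≤ 4 * (1 + z ^ 4) := by
    nlinarith [sq_nonneg (z - 1), sq_nonneg (z ^ 2 - 1), sq_nonneg (z ^ 2 - z), sq_nonneg z]
  -- The quadratic term is (z²/8)²/2 = z⁴/128; hence the 128 below, and 512 = 4 · 128.
  have h2 := Real.quadratic_le_exp_of_nonneg (x := z ^ 2 / 8) (by positivity)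
  have h3 : 1 + z ^ 4 ≤ 128 * Real.exp (z ^ 2 / 8) := by nlinarith [sq_nonneg (z^2)]
  calc _ ≤ 4 * (128 * Real.exp (z ^ 2 / 8)) * Real.exp (-(z ^ 2 / 8)) := by
        gcongr; linarith
    _ = 512 := by rw [Real.exp_neg]; field_simp; norm_num

/-- The constant of the Gaussian absorption. -/
def gC (d : ℕ) : ℝ := 512 * 2 ^ ((d : ℝ) / 2)

lemma gC_pos (d : ℕ) : 0 < gC d := by unfold gC; positivity

/-- With z = ‖x‖/√t the Gaussian exponent is -z²/4. One half of it is the exponent of the kernel at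
time 2t and the other half absorbs the polynomial; the two normalizations differ by 2^(d/2). -/
lemma heatKernel_absorb {t : ℝ} (ht : 0 < t) (x : Sp d) :
    (1 + ‖x‖ / √t + (‖x‖ / √t) ^ 2 + (‖x‖ / √t) ^ 3) * heatKernel d t x
      ≤ gC d * heatKernel d (2 * t) x := by
  set z := ‖x‖ / √t with hz
  have hz0 : 0 ≤ z := by positivity
  have hzsq : ‖x‖ ^ 2 = z ^ 2 * t := by
    rw [hz, div_pow, Real.sq_sqrt ht.le]; field_simp
  have h1 : heatKernel d t x = 2 ^ ((d : ℝ) / 2) * heatKernel d (2 * t) x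
      * Real.exp (-(z ^ 2 / 8)) := by
    unfold heatKernel
    have hpi := Real.pi_pos
    have h4 : (4 * Real.pi * (2 * t)) ^ (-(d : ℝ) / 2)
        = 2 ^ (-(d : ℝ) / 2) * (4 * Real.pi * t) ^ (-(d : ℝ) / 2) := by
      rw [← Real.mul_rpow (by norm_num) (by positivity)]; congr 1; ring
    rw [h4, hzsq]
    have : (2 : ℝ) ^ ((d : ℝ) / 2) * 2 ^ (-(d : ℝ) / 2) = 1 := by
      rw [← Real.rpow_add (by norm_num)]; simp [neg_div]
    rw [show -(z ^ 2 * t) / (4 * t) = -(z ^ 2 * t) / (4 * (2 * t)) + -(z ^ 2 / 8) by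
      field_simp; ring, Real.exp_add]
    linear_combination (-((4 * Real.pi * t) ^ (-(d : ℝ) / 2)
      * (Real.exp (-(z ^ 2 * t) / (4 * (2 * t))) * Real.exp (-(z ^ 2 / 8))))) * this
  have h2 := exp_absorb z
  rw [h1]
  have h3 := (heatKernel_pos (d := d) (by positivity : 0 < 2 * t) x).le
  calc _ = ((1 + z + z ^ 2 + z ^ 3) * Real.exp (-(z ^ 2 / 8)))
        * (2 ^ ((d : ℝ) / 2) * heatKernel d (2 * t) x) := by ring
    _ ≤ 512 * (2 ^ ((d : ℝ) / 2) * heatKernel d (2 * t) x) := by gcongr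
    _ = _ := by unfold gC; ring

lemma abs_coord_le (x : Sp d) (k : Fin d) : |x k| ≤ ‖x‖ := by
  simpa using PiLp.norm_apply_le x k

lemma abs_kd_le (i j : Fin d) : |kd i j| ≤ 1 := by unfold kd; split_ifs <;> simp

/-- All derivatives of the kernel are a polynomial in x times the kernel, so each derivative bound
reduces to bounding that polynomial in the variable ‖x‖/√t. -/
lemma poly_bound {t c : ℝ} (ht : 0 < t) (x : Sp d) {P : ℝ} (hc : 0 ≤ c)
    (hP : |P| ≤ c * (1 + ‖x‖ / √t + (‖x‖ / √t) ^ 2 + (‖x‖ / √t) ^ 3)) :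
    |P * heatKernel d t x| ≤ c * (gC d * heatKernel d (2 * t) x) := by
  rw [abs_mul, abs_of_pos (heatKernel_pos ht x)]
  calc _ ≤ c * (1 + ‖x‖ / √t + (‖x‖ / √t) ^ 2 + (‖x‖ / √t) ^ 3) * heatKernel d t x := by
        have := (heatKernel_pos ht x).le
        gcongr
    _ = c * ((1 + ‖x‖ / √t + (‖x‖ / √t) ^ 2 + (‖x‖ / √t) ^ 3) * heatKernel d t x) := by ring
    _ ≤ _ := mul_le_mul_of_nonneg_left (heatKernel_absorb ht x) hc

lemma abs_g1_le (k : Fin d) {t : ℝ} (ht : 0 < t) (x : Sp d) :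
    |g1 k t x| ≤ t ^ (-(1 / 2) : ℝ) * (gC d * heatKernel d (2 * t) x) := by
  refine poly_bound ht x (by positivity) ?_
  have hs : √t * √t = t := Real.mul_self_sqrt ht.le
  have hs0 : 0 < √t := Real.sqrt_pos.2 ht
  rw [Real.rpow_neg ht.le, ← Real.sqrt_eq_rpow, abs_neg, abs_div, abs_of_pos (by positivity : 0 < 2 * t)]
  set r := √t
  have hz : 0 ≤ ‖x‖ / r := by positivity
  have := abs_coord_le x k
  calc |x k| / (2 * t) ≤ ‖x‖ / t := by
        gcongr; linarith
    _ = r⁻¹ * (‖x‖ / r) := by rw [← hs]; field_simp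
    _ ≤ _ := by
        refine mul_le_mul_of_nonneg_left ?_ (by positivity)
        nlinarith [pow_nonneg hz 2, pow_nonneg hz 3]

lemma abs_g2_le (j k : Fin d) {t : ℝ} (ht : 0 < t) (x : Sp d) :
    |g2 j k t x| ≤ t⁻¹ * (gC d * heatKernel d (2 * t) x) := by
  refine poly_bound ht x (by positivity) ?_
  have hs : √t * √t = t := Real.mul_self_sqrt ht.le
  have hs0 : 0 < √t := Real.sqrt_pos.2 ht
  set r := √t
  have hz : 0 ≤ ‖x‖ / r := by positivity
  calc |x j * x k / (4 * t ^ 2) - kd j k / (2 * t)|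
      ≤ |x j * x k / (4 * t ^ 2)| + |kd j k / (2 * t)| := abs_sub _ _
    _ = |x j| * |x k| / (4 * t ^ 2) + |kd j k| / (2 * t) := by
        rw [abs_div, abs_div, abs_mul, abs_of_pos (by positivity : 0 < 4 * t ^ 2),
          abs_of_pos (by positivity : 0 < 2 * t)]
    _ ≤ ‖x‖ * ‖x‖ / (1 * t ^ 2) + 1 / (1 * t) := by
        have := abs_coord_le x k
        have := abs_coord_le x j
        have := abs_kd_le j k
        gcongr <;> norm_num
    _ = t⁻¹ * ((‖x‖ / r) ^ 2 + 1) := by rw [← hs]; field_simp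
    _ ≤ _ := by
        refine mul_le_mul_of_nonneg_left ?_ (by positivity)
        nlinarith [pow_nonneg hz 2, pow_nonneg hz 3]

lemma rpow_neg_three_half {t : ℝ} (ht : 0 < t) : t ^ (-(3 / 2) : ℝ) = (t * √t)⁻¹ := by
  rw [Real.rpow_neg ht.le, Real.sqrt_eq_rpow]
  nth_rewrite 2 [← Real.rpow_one t]
  rw [← Real.rpow_add ht]; norm_num

lemma abs_g3_le (i j k : Fin d) {t : ℝ} (ht : 0 < t) (x : Sp d) :
    |g3 i j k t x| ≤ t ^ (-(3 / 2) : ℝ) * (gC d * heatKernel d (2 * t) x) := by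
  refine poly_bound ht x (by positivity) ?_
  have hs : √t * √t = t := Real.mul_self_sqrt ht.le
  have hs0 : 0 < √t := Real.sqrt_pos.2 ht
  rw [rpow_neg_three_half ht]
  set r := √t
  have hz : 0 ≤ ‖x‖ / r := by positivity
  have a1 := abs_coord_le x i
  have a2 := abs_coord_le x j
  have a3 := abs_coord_le x k
  have b1 := abs_kd_le i j
  have b2 := abs_kd_le i k
  have b3 := abs_kd_le j k
  have e1 : |kd i j * x k| ≤ 1 * ‖x‖ := by rw [abs_mul]; gcongr
  have e2 : |kd i k * x j| ≤ 1 * ‖x‖ := by rw [abs_mul]; gcongr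
  have e3 : |kd j k * x i| ≤ 1 * ‖x‖ := by rw [abs_mul]; gcongr
  have e4 : |kd i j * x k + kd i k * x j + kd j k * x i| ≤ 3 * ‖x‖ :=
    (abs_add_three _ _ _).trans (by linarith)
  calc |-(x i * x j * x k) / (8 * t ^ 3) + (kd i j * x k + kd i k * x j + kd j k * x i) / (4 * t ^ 2)|
      ≤ |-(x i * x j * x k) / (8 * t ^ 3)| + |(kd i j * x k + kd i k * x j + kd j k * x i) / (4 * t ^ 2)| :=
        abs_add_le _ _
    _ = |x i| * |x j| * |x k| / (8 * t ^ 3) + |kd i j * x k + kd i k * x j + kd j k * x i| / (4 * t ^ 2) := by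
        rw [abs_div, abs_div, abs_neg, abs_mul, abs_mul, abs_of_pos (by positivity : 0 < 8 * t ^ 3),
          abs_of_pos (by positivity : 0 < 4 * t ^ 2)]
    _ ≤ ‖x‖ * ‖x‖ * ‖x‖ / (1 * t ^ 3) + 3 * ‖x‖ / (3 * t ^ 2) := by
        gcongr <;> norm_num
    _ = (t * r)⁻¹ * ((‖x‖ / r) ^ 3 + ‖x‖ / r) := by rw [← hs]; field_simp
    _ ≤ _ := by
        refine mul_le_mul_of_nonneg_left ?_ (by positivity)
        nlinarith [pow_nonneg hz 2, pow_nonneg hz 3]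

end NavierStokes

/-! ### Convolution inequalities for kernels controlled by mass and size. -/

namespace NavierStokes

variable {d : ℕ}

/-- The convolution `k * f`. -/
def conv (k f : Sp d → ℝ) (x : Sp d) : ℝ := ∫ y, k (x - y) * f y

/-- `k` is a kernel of mass at most `m` and of size at most `m τ ^ (-d/2)`. -/
structure KerBd (k : Sp d → ℝ) (m τ : ℝ) : Prop where
  meas : Measurable k
  mass : ∫⁻ x, ‖k x‖ₑ ≤ ENNReal.ofReal m
  sup : ∀ x, ‖k x‖ₑ ≤ ENNReal.ofReal (m * τ ^ (-(d : ℝ) / 2))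

/-- The exponent `1 / p`. -/
def rexp (p : ℝ≥0∞) : ℝ := (p⁻¹).toReal

/-- The measure with density `|k (x - ·)|`. -/
def kmeas (k : Sp d → ℝ) (x : Sp d) : Measure (Sp d) := volume.withDensity fun y => ‖k (x - y)‖ₑ

/-- This turns convolution with |k| into integration against a measure of mass at most m and density
at most m τ^(-d/2). Young's inequality with mixed exponents then becomes Hölder's inequality for a
finite measure. -/
lemma lintegral_kmeas {k : Sp d → ℝ} (hk : Measurable k) (x : Sp d) (f : Sp d → ℝ≥0∞) :
    ∫⁻ y, f y ∂(kmeas k x) = ∫⁻ y, ‖k (x - y)‖ₑ * f y := by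
  unfold kmeas
  rw [lintegral_withDensity_eq_lintegral_mul_non_measurable _ (by fun_prop) (by simp)]
  rfl

lemma KerBd.kmeas_univ {k : Sp d → ℝ} {m τ : ℝ} (hk : KerBd k m τ) (x : Sp d) :
    kmeas k x univ ≤ ENNReal.ofReal m := by
  rw [← lintegral_one, lintegral_kmeas hk.meas]
  simp only [mul_one]
  rw [lintegral_sub_left_eq_self (fun y => ‖k y‖ₑ)]
  exact hk.mass

lemma KerBd.kmeas_le {k : Sp d → ℝ} {m τ : ℝ} (hk : KerBd k m τ) (x : Sp d) :
    kmeas k x ≤ ENNReal.ofReal (m * τ ^ (-(d : ℝ) / 2)) • volume := by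
  rw [← withDensity_const]
  exact withDensity_mono (ae_of_all _ fun y => hk.sup _)

lemma kmeas_ac (k : Sp d → ℝ) (x : Sp d) : kmeas k x ≪ volume := withDensity_absolutelyContinuous _ _

variable {E F : Type*} [NormedAddCommGroup E] [NormedAddCommGroup F]

lemma KerBd.eLpNorm_kmeas_le {k : Sp d → ℝ} {m τ : ℝ} (hk : KerBd k m τ) (x : Sp d) (p : ℝ≥0∞)
    (u : Sp d → E) :
    eLpNorm u p (kmeas k x)
      ≤ ENNReal.ofReal (m * τ ^ (-(d : ℝ) / 2)) ^ rexp p * eLpNorm u p volume := by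
  refine (eLpNorm_mono_measure u (hk.kmeas_le x)).trans ?_
  refine (eLpNorm_smul_measure_le _ _ _ _).trans_eq ?_
  simp [rexp]

lemma rexp_nonneg (p : ℝ≥0∞) : 0 ≤ rexp p := ENNReal.toReal_nonneg

lemma one_div_toReal (p : ℝ≥0∞) : 1 / p.toReal = rexp p := by simp [rexp, ENNReal.toReal_inv]

lemma rexp_le_one {p : ℝ≥0∞} (hp : 1 ≤ p) : rexp p ≤ 1 := by
  have : p⁻¹ ≤ 1 := ENNReal.inv_le_one.2 hp
  simpa [rexp] using ENNReal.toReal_mono (by simp) this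

/-- The r-th power of the inner norm is the convolution of |k| with ‖v‖^r, so Tonelli extracts the
mass of k. For r = ∞ only absolute continuity is used. -/
lemma eLpNorm_kmeas_eLpNorm {k : Sp d → ℝ} {m τ : ℝ} (hk : KerBd k m τ) {r : ℝ≥0∞} (hr : 1 ≤ r)
    {v : Sp d → F} (hv : AEStronglyMeasurable v volume) :
    eLpNorm (fun x => eLpNorm v r (kmeas k x)) r volume
      ≤ ENNReal.ofReal m ^ rexp r * eLpNorm v r volume := by
  have hr0 : r ≠ 0 := (zero_lt_one.trans_le hr).ne'
  by_cases hrt : r = ∞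
  · subst hrt
    simp only [rexp, ENNReal.inv_top, ENNReal.toReal_zero, ENNReal.rpow_zero, one_mul,
      eLpNorm_exponent_top]
    refine eLpNormEssSup_le_of_ae_enorm_bound (ae_of_all _ fun x => ?_)
    exact eLpNormEssSup_mono_measure _ (kmeas_ac k x)
  have hrp : 0 < r.toReal := ENNReal.toReal_pos hr0 hrt
  have hvm : AEMeasurable (fun y => ‖v y‖ₑ ^ r.toReal) volume := hv.enorm.pow_const _
  have key : ∀ x, eLpNorm v r (kmeas k x) ^ r.toReal = ∫⁻ y, ‖k (x - y)‖ₑ * ‖v y‖ₑ ^ r.toReal := by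
    intro x
    rw [eLpNorm_eq_lintegral_rpow_enorm_toReal hr0 hrt, ← ENNReal.rpow_mul,
      one_div_mul_cancel hrp.ne', ENNReal.rpow_one, lintegral_kmeas hk.meas]
  rw [eLpNorm_eq_lintegral_rpow_enorm_toReal hr0 hrt]
  simp only [enorm_eq_self, key]
  have hkm := hk.meas
  have hsw : ∫⁻ x, ∫⁻ y, ‖k (x - y)‖ₑ * ‖v y‖ₑ ^ r.toReal
      ≤ ENNReal.ofReal m * ∫⁻ y, ‖v y‖ₑ ^ r.toReal := by
    rw [lintegral_lintegral_swap]
    · calc _ = ∫⁻ y, (∫⁻ x, ‖k x‖ₑ) * ‖v y‖ₑ ^ r.toReal := by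
            refine lintegral_congr fun y => ?_
            rw [lintegral_mul_const _ (by fun_prop),
              lintegral_sub_right_eq_self (fun x => ‖k x‖ₑ) y]
        _ ≤ ∫⁻ y, ENNReal.ofReal m * ‖v y‖ₑ ^ r.toReal := by
            refine lintegral_mono fun y => ?_
            gcongr
            exact hk.mass
        _ = _ := by rw [lintegral_const_mul' _ _ (by simp)]
    · refine AEMeasurable.mul (by fun_prop) ?_
      exact hvm.comp_snd
  calc _ ≤ (ENNReal.ofReal m * ∫⁻ y, ‖v y‖ₑ ^ r.toReal) ^ (1 / r.toReal) := by gcongr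
    _ = _ := by
      rw [ENNReal.mul_rpow_of_nonneg _ _ (by positivity),
        eLpNorm_eq_lintegral_rpow_enorm_toReal hr0 hrt, one_div_toReal]

/-- Hölder's inequality with respect to a finite measure, with exponents `1/p + 1/r ≤ 1`. -/
lemma lintegral_mul_le_of_inv_add_inv_le {α : Type*} [MeasurableSpace α] {μ : Measure α}
    {p r : ℝ≥0∞} (hpr : p⁻¹ + r⁻¹ ≤ 1) {u : α → E} {v : α → F}
    (hu : AEStronglyMeasurable u μ) (hv : AEStronglyMeasurable v μ) :
    ∫⁻ y, ‖u y‖ₑ * ‖v y‖ₑ ∂μ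
      ≤ eLpNorm u p μ * eLpNorm v r μ * μ univ ^ (1 - rexp p - rexp r) := by
  have hp : 1 ≤ p := ENNReal.inv_le_one.1 (le_self_add.trans hpr)
  -- The Hölder conjugate of p satisfies q ≤ r; the gap between q and r is paid for by the total
  -- mass of the measure.
  set q : ℝ≥0∞ := (1 - p⁻¹)⁻¹ with hq
  have hpq : p.HolderConjugate q := ENNReal.HolderConjugate.inv_one_sub_inv' hp
  have hqr : q ≤ r := by
    rw [hq, ENNReal.inv_le_iff_inv_le]
    exact ENNReal.le_sub_of_add_le_left (by simpa using (zero_lt_one.trans_le hp).ne') hpr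
  have h1 : ∫⁻ y, ‖u y‖ₑ * ‖v y‖ₑ ∂μ = eLpNorm ((fun y => ‖u y‖) • (fun y => ‖v y‖)) 1 μ := by
    rw [eLpNorm_one_eq_lintegral_enorm]
    simp [enorm_mul]
  rw [h1]
  refine (eLpNorm_smul_le_mul_eLpNorm (p := p) (q := q) hv.norm hu.norm).trans ?_
  rw [eLpNorm_norm, eLpNorm_norm, mul_assoc]
  gcongr
  refine (eLpNorm_le_eLpNorm_mul_rpow_measure_univ hqr hv).trans_eq ?_
  rw [one_div_toReal, one_div_toReal]
  congr 2
  simp only [rexp, hq, inv_inv]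
  rw [ENNReal.toReal_sub_of_le (ENNReal.inv_le_one.2 hp) (by simp)]
  simp

/-- Interpolation between size, to the power e, and mass, to the power 1 - e: the powers of m
recombine to m and only τ keeps the exponent e. -/
lemma ofReal_ker_exponent {m τ : ℝ} (hτ : 0 < τ) (hm : 0 ≤ m) {e : ℝ} (he : 0 ≤ e) (he1 : e ≤ 1) :
    ENNReal.ofReal (m * τ ^ (-(d : ℝ) / 2)) ^ e * ENNReal.ofReal m ^ (1 - e)
      = ENNReal.ofReal (m * τ ^ (-(d : ℝ) / 2 * e)) := by
  rw [ENNReal.ofReal_mul hm, ENNReal.mul_rpow_of_nonneg _ _ he, mul_right_comm,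
    ← ENNReal.rpow_add_of_nonneg _ _ he (by linarith), ENNReal.ofReal_mul hm]
  simp only [add_sub_cancel, ENNReal.rpow_one]
  congr 1
  rw [ENNReal.ofReal_rpow_of_pos (by positivity), Real.rpow_mul hτ.le]

lemma rexp_add_le {p r : ℝ≥0∞} (hpr : p⁻¹ + r⁻¹ ≤ 1) : rexp p + rexp r ≤ 1 := by
  unfold rexp
  rw [← ENNReal.toReal_add]
  · simpa using ENNReal.toReal_mono (by simp) hpr
  · exact ne_top_of_le_ne_top (by simp) (le_self_add.trans hpr)
  · exact ne_top_of_le_ne_top (by simp) (le_add_self.trans hpr)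

/-- The bilinear convolution estimate `‖|k| * |u v|‖_r ≤ m τ ^ (-d/(2p)) ‖u‖_p ‖v‖_r`. -/
lemma KerBd.eLpNorm_lintegral_le {k : Sp d → ℝ} {m τ : ℝ} (hk : KerBd k m τ) (hτ : 0 < τ)
    (hm : 0 ≤ m) {p r : ℝ≥0∞} (hpr : p⁻¹ + r⁻¹ ≤ 1) {u : Sp d → E} {v : Sp d → F}
    (hu : MemLp u p volume) (hv : AEStronglyMeasurable v volume) :
    eLpNorm (fun x => ∫⁻ y, ‖k (x - y)‖ₑ * (‖u y‖ₑ * ‖v y‖ₑ)) r volume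
      ≤ ENNReal.ofReal (m * τ ^ (-(d : ℝ) / 2 * rexp p))
        * (eLpNorm u p volume * eLpNorm v r volume) := by
  have hr : 1 ≤ r := ENNReal.inv_le_one.1 (le_add_self.trans hpr)
  have hp1 := rexp_nonneg p
  have hp2 := rexp_nonneg r
  have hp3 := rexp_add_le hpr
  set B := ENNReal.ofReal (m * τ ^ (-(d : ℝ) / 2)) with hB
  set c : ℝ≥0∞ := B ^ rexp p * eLpNorm u p volume * ENNReal.ofReal m ^ (1 - rexp p - rexp r) with hc
  have hct : c ≠ ∞ := by
    refine ENNReal.mul_ne_top (ENNReal.mul_ne_top ?_ hu.eLpNorm_ne_top) ?_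
    · exact ENNReal.rpow_ne_top_of_nonneg hp1 (by simp [hB])
    · exact ENNReal.rpow_ne_top_of_nonneg (by linarith) (by simp)
  lift c to NNReal using hct with c' hc'
  -- The factor u is estimated uniformly in x through the density bound. The local norm of v is
  -- kept, to be integrated in x by Tonelli.
  have hpt : ∀ x, ∫⁻ y, ‖k (x - y)‖ₑ * (‖u y‖ₑ * ‖v y‖ₑ) ≤ c' * eLpNorm v r (kmeas k x) := by
    intro x
    rw [← lintegral_kmeas hk.meas, hc]
    refine (lintegral_mul_le_of_inv_add_inv_le hpr (hu.1.mono_ac (kmeas_ac k x))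
      (hv.mono_ac (kmeas_ac k x))).trans ?_
    calc _ ≤ (B ^ rexp p * eLpNorm u p volume) * eLpNorm v r (kmeas k x)
          * ENNReal.ofReal m ^ (1 - rexp p - rexp r) := by
          gcongr
          · exact hk.eLpNorm_kmeas_le x p u
          · linarith
          · exact hk.kmeas_univ x
      _ = _ := by ring
  have h1 : eLpNorm (fun x => ∫⁻ y, ‖k (x - y)‖ₑ * (‖u y‖ₑ * ‖v y‖ₑ)) r volume
      ≤ c' • eLpNorm (fun x => eLpNorm v r (kmeas k x)) r volume :=
    eLpNorm_le_nnreal_smul_eLpNorm_of_ae_le_mul' (ae_of_all _ fun x => by simpa using hpt x) r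
  refine h1.trans ?_
  rw [ENNReal.smul_def, smul_eq_mul, hc]
  calc _ ≤ B ^ rexp p * eLpNorm u p volume * ENNReal.ofReal m ^ (1 - rexp p - rexp r)
        * (ENNReal.ofReal m ^ rexp r * eLpNorm v r volume) := by
        gcongr; exact eLpNorm_kmeas_eLpNorm hk hr hv
    _ = (B ^ rexp p * (ENNReal.ofReal m ^ (1 - rexp p - rexp r) * ENNReal.ofReal m ^ rexp r))
        * (eLpNorm u p volume * eLpNorm v r volume) := by ring
    _ = _ := by
        rw [← ENNReal.rpow_add_of_nonneg _ _ (by linarith) hp2, sub_add_cancel,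
          ofReal_ker_exponent hτ hm hp1 (by linarith)]

/-- The pointwise convolution estimate. -/
lemma KerBd.lintegral_le {k : Sp d → ℝ} {m τ : ℝ} (hk : KerBd k m τ) (hτ : 0 < τ)
    (hm : 0 ≤ m) {q : ℝ≥0∞} (hq : 1 ≤ q) {f : Sp d → E}
    (hf : AEStronglyMeasurable f volume) (x : Sp d) :
    ∫⁻ y, ‖k (x - y)‖ₑ * ‖f y‖ₑ
      ≤ ENNReal.ofReal (m * τ ^ (-(d : ℝ) / 2 * rexp q)) * eLpNorm f q volume := by
  have h1 : ∫⁻ y, ‖k (x - y)‖ₑ * ‖f y‖ₑ = eLpNorm f 1 (kmeas k x) := by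
    rw [eLpNorm_one_eq_lintegral_enorm, lintegral_kmeas hk.meas]
  rw [h1]
  refine (eLpNorm_le_eLpNorm_mul_rpow_measure_univ hq (hf.mono_ac (kmeas_ac k x))).trans ?_
  rw [one_div_toReal, one_div_toReal]
  have h2 : rexp 1 = 1 := by simp [rexp]
  have h3 := rexp_le_one hq
  rw [h2, ← ofReal_ker_exponent hτ hm (rexp_nonneg q) h3]
  calc _ ≤ (ENNReal.ofReal (m * τ ^ (-(d : ℝ) / 2)) ^ rexp q * eLpNorm f q volume)
        * ENNReal.ofReal m ^ (1 - rexp q) := by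
        gcongr
        · exact hk.eLpNorm_kmeas_le x q f
        · exact hk.kmeas_univ x
    _ = _ := by ring

lemma KerBd.integrable {k : Sp d → ℝ} {m τ : ℝ} (hk : KerBd k m τ) (hτ : 0 < τ)
    (hm : 0 ≤ m) {q : ℝ≥0∞} (hq : 1 ≤ q) {f : Sp d → ℝ} (hf : MemLp f q volume) (x : Sp d) :
    Integrable (fun y => k (x - y) * f y) := by
  have hkm := hk.meas
  refine ⟨AEStronglyMeasurable.mul (Measurable.aestronglyMeasurable (by fun_prop)) hf.1, ?_⟩
  simp only [hasFiniteIntegral_iff_enorm, enorm_mul]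
  exact (hk.lintegral_le hτ hm hq hf.1 x).trans_lt
    (ENNReal.mul_lt_top (by simp) hf.2)

lemma KerBd.enorm_conv_le {k : Sp d → ℝ} {m τ : ℝ} (hk : KerBd k m τ) (hτ : 0 < τ)
    (hm : 0 ≤ m) {q : ℝ≥0∞} (hq : 1 ≤ q) {f : Sp d → ℝ}
    (hf : AEStronglyMeasurable f volume) (x : Sp d) :
    ‖conv k f x‖ₑ ≤ ENNReal.ofReal (m * τ ^ (-(d : ℝ) / 2 * rexp q)) * eLpNorm f q volume := by
  refine (enorm_integral_le_lintegral_enorm _).trans ?_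
  simp only [enorm_mul]
  exact hk.lintegral_le hτ hm hq hf x

lemma conv_congr {k f g : Sp d → ℝ} (h : f =ᵐ[volume] g) (x : Sp d) : conv k f x = conv k g x :=
  integral_congr_ae (by filter_upwards [h] with y hy; rw [hy])

/-- The convolution is defined at every point and depends only on the class of f, so a measurable
representative of f makes it Borel measurable and not merely a.e. measurable. -/
lemma measurable_conv {k f : Sp d → ℝ} (hk : Measurable k) (hf : AEStronglyMeasurable f volume) :
    Measurable (conv k f) := by
  have h1 : conv k f = conv k (hf.mk f) := funext fun x => conv_congr hf.ae_eq_mk x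
  rw [h1]
  have hm := hf.stronglyMeasurable_mk.measurable
  have : StronglyMeasurable (Function.uncurry fun x y => k (x - y) * hf.mk f y) := by
    refine Measurable.stronglyMeasurable ?_
    simp only [Function.uncurry_def]
    fun_prop
  exact this.integral_prod_right.measurable

lemma KerBd.eLpNorm_conv_mul_le {k : Sp d → ℝ} {m τ : ℝ} (hk : KerBd k m τ) (hτ : 0 < τ)
    (hm : 0 ≤ m) {p r : ℝ≥0∞} (hpr : p⁻¹ + r⁻¹ ≤ 1) {u v : Sp d → ℝ}
    (hu : MemLp u p volume) (hv : AEStronglyMeasurable v volume) :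
    eLpNorm (conv k (fun y => u y * v y)) r volume
      ≤ ENNReal.ofReal (m * τ ^ (-(d : ℝ) / 2 * rexp p))
        * (eLpNorm u p volume * eLpNorm v r volume) := by
  refine le_trans ?_ (hk.eLpNorm_lintegral_le hτ hm hpr hu hv)
  refine eLpNorm_mono_enorm fun x => ?_
  refine (enorm_integral_le_lintegral_enorm _).trans ?_
  simp [enorm_mul]

/-- Young's inequality with an integrable kernel, as the case p = ∞, u = 1 of the bilinear estimate.
-/
lemma KerBd.eLpNorm_conv_le {k : Sp d → ℝ} {m τ : ℝ} (hk : KerBd k m τ) (hτ : 0 < τ)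
    (hm : 0 ≤ m) {r : ℝ≥0∞} (hr : 1 ≤ r) {v : Sp d → ℝ} (hv : AEStronglyMeasurable v volume) :
    eLpNorm (conv k v) r volume ≤ ENNReal.ofReal m * eLpNorm v r volume := by
  have := hk.eLpNorm_conv_mul_le hτ hm (p := ∞) (r := r) (u := fun _ => (1 : ℝ))
    (by simpa using hr) (memLp_top_const 1) hv
  simp only [one_mul, rexp, ENNReal.inv_top, ENNReal.toReal_zero, mul_zero, Real.rpow_zero,
    mul_one] at this
  refine this.trans ?_
  gcongr
  refine mul_le_of_le_one_left zero_le ?_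
  rw [eLpNorm_exponent_top]
  exact eLpNormEssSup_le_of_ae_enorm_bound (ae_of_all _ fun x => by simp)

lemma KerBd.memLp_conv {k : Sp d → ℝ} {m τ : ℝ} (hk : KerBd k m τ) (hτ : 0 < τ)
    (hm : 0 ≤ m) {r : ℝ≥0∞} (hr : 1 ≤ r) {v : Sp d → ℝ} (hv : MemLp v r volume) :
    MemLp (conv k v) r volume :=
  ⟨(measurable_conv hk.meas hv.1).aestronglyMeasurable,
    (hk.eLpNorm_conv_le hτ hm hr hv.1).trans_lt (ENNReal.mul_lt_top (by simp) hv.2)⟩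

/-- Convolution of kernels. -/
lemma KerBd.conv {k₁ k₂ : Sp d → ℝ} {m₁ τ₁ m₂ τ : ℝ} (h₁ : KerBd k₁ m₁ τ₁) (h₂ : KerBd k₂ m₂ τ)
    (hm₁ : 0 ≤ m₁) (hτ₁ : 0 < τ₁) : KerBd (conv k₁ k₂) (m₁ * m₂) τ where
  meas := measurable_conv h₁.meas h₂.meas.aestronglyMeasurable
  mass := by
    have := h₁.eLpNorm_conv_le hτ₁ hm₁ le_rfl h₂.meas.aestronglyMeasurable
    rw [eLpNorm_one_eq_lintegral_enorm, eLpNorm_one_eq_lintegral_enorm] at this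
    refine this.trans ?_
    rw [ENNReal.ofReal_mul hm₁]
    gcongr
    exact h₂.mass
  sup := fun x => by
    refine (h₁.enorm_conv_le hτ₁ hm₁ (q := ∞) le_top h₂.meas.aestronglyMeasurable x).trans ?_
    simp only [rexp, ENNReal.inv_top, ENNReal.toReal_zero, mul_zero, Real.rpow_zero, mul_one]
    rw [mul_assoc, ENNReal.ofReal_mul hm₁]
    gcongr
    rw [eLpNorm_exponent_top]
    exact eLpNormEssSup_le_of_ae_enorm_bound (ae_of_all _ h₂.sup)

/-- Associativity of convolution. -/
lemma conv_assoc {k₁ k₂ : Sp d → ℝ} {m₁ τ₁ m₂ τ₂ : ℝ} (h₁ : KerBd k₁ m₁ τ₁) (h₂ : KerBd k₂ m₂ τ₂)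
    (hm₂ : 0 ≤ m₂) (hτ₂ : 0 < τ₂) {q : ℝ≥0∞} (hq : 1 ≤ q)
    {f : Sp d → ℝ} (hf : MemLp f q volume) (x : Sp d) :
    NavierStokes.conv k₁ (NavierStokes.conv k₂ f) x
      = NavierStokes.conv (NavierStokes.conv k₁ k₂) f x := by
  have hk₁ := h₁.meas
  have hk₂ := h₂.meas
  have hm : AEStronglyMeasurable
      (Function.uncurry fun y z => k₁ (x - y) * (k₂ (y - z) * f z)) (volume.prod volume) := by
    simp only [Function.uncurry_def]
    refine AEStronglyMeasurable.mul (Measurable.aestronglyMeasurable (by fun_prop)) (AEStronglyMeasurable.mul (Measurable.aestronglyMeasurable (by fun_prop)) ?_)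
    exact hf.1.comp_snd
  have hint : Integrable (Function.uncurry fun y z => k₁ (x - y) * (k₂ (y - z) * f z))
      (volume.prod volume) := by
    refine ⟨hm, ?_⟩
    rw [hasFiniteIntegral_iff_enorm, lintegral_prod _ hm.enorm]
    simp only [Function.uncurry_apply_pair, enorm_mul]
    calc _ = ∫⁻ y, ‖k₁ (x - y)‖ₑ * ∫⁻ z, ‖k₂ (y - z)‖ₑ * ‖f z‖ₑ := by
          refine lintegral_congr fun y => ?_
          rw [lintegral_const_mul' _ _ (by simp)]
      _ ≤ ∫⁻ y, ‖k₁ (x - y)‖ₑ * (ENNReal.ofReal (m₂ * τ₂ ^ (-(d : ℝ) / 2 * rexp q))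
            * eLpNorm f q volume) := by
          refine lintegral_mono fun y => ?_
          gcongr
          exact h₂.lintegral_le hτ₂ hm₂ hq hf.1 y
      _ < ∞ := by
          rw [lintegral_mul_const _ (by fun_prop),
            lintegral_sub_left_eq_self (fun y => ‖k₁ y‖ₑ)]
          exact ENNReal.mul_lt_top (h₁.mass.trans_lt (by simp))
            (ENNReal.mul_lt_top (by simp) hf.2)
  calc ∫ y, k₁ (x - y) * ∫ z, k₂ (y - z) * f z
      = ∫ y, ∫ z, k₁ (x - y) * (k₂ (y - z) * f z) := by
        simp only [integral_const_mul]
    _ = ∫ z, ∫ y, k₁ (x - y) * (k₂ (y - z) * f z) := integral_integral_swap hint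
    _ = ∫ z, (∫ y, k₁ (x - z - y) * k₂ y) * f z := by
        refine integral_congr_ae (ae_of_all _ fun z => ?_)
        simp only [← mul_assoc]
        rw [integral_mul_const]
        congr 1
        rw [← integral_sub_right_eq_self (fun y => k₁ (x - z - y) * k₂ y) z]
        simp

/-- The adjoint of a convolution. -/
lemma integral_mul_conv {k : Sp d → ℝ} {m τ : ℝ} (hk : KerBd k m τ) (hτ : 0 < τ)
    (hm : 0 ≤ m) {q q' : ℝ≥0∞} [hqq : q'.HolderConjugate q]
    {f φ : Sp d → ℝ} (hf : MemLp f q volume) (hφ : MemLp φ q' volume) :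
    ∫ x, φ x * conv k f x = ∫ y, conv (fun z => k (-z)) φ y * f y := by
  have hkm := hk.meas
  have hq : 1 ≤ q := ENNReal.HolderConjugate.one_le q q'
  have hmeas : AEStronglyMeasurable
      (Function.uncurry fun x y => φ x * (k (x - y) * f y)) (volume.prod volume) := by
    simp only [Function.uncurry_def]
    refine AEStronglyMeasurable.mul hφ.1.comp_fst (AEStronglyMeasurable.mul (Measurable.aestronglyMeasurable (by fun_prop)) ?_)
    exact hf.1.comp_snd
  have hint : Integrable (Function.uncurry fun x y => φ x * (k (x - y) * f y))
      (volume.prod volume) := by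
    refine ⟨hmeas, ?_⟩
    rw [hasFiniteIntegral_iff_enorm, lintegral_prod _ hmeas.enorm]
    simp only [Function.uncurry_apply_pair, enorm_mul]
    -- Absolute integrability for Fubini comes from Young's inequality for |k| and |f|, followed by
    -- Hölder's inequality against φ.
    have hb := hk.eLpNorm_lintegral_le hτ hm (p := ∞) (r := q) (u := fun _ => (1 : ℝ))
      (by simpa using hq) (memLp_top_const 1) hf.1
    simp only [enorm_one, one_mul] at hb
    have hIm : AEMeasurable (fun x => ∫⁻ y, ‖k (x - y)‖ₑ * ‖f y‖ₑ) volume := by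
      refine AEMeasurable.lintegral_prod_right' (f := fun z : Sp d × Sp d => ‖k (z.1 - z.2)‖ₑ * ‖f z.2‖ₑ) ?_
      exact AEMeasurable.mul (by fun_prop) hf.1.enorm.comp_snd
    calc _ = ∫⁻ x, ‖φ x‖ₑ * ∫⁻ y, ‖k (x - y)‖ₑ * ‖f y‖ₑ := by
          refine lintegral_congr fun y => ?_
          rw [lintegral_const_mul' _ _ (by simp)]
      _ ≤ eLpNorm φ q' volume * eLpNorm (fun x => ∫⁻ y, ‖k (x - y)‖ₑ * ‖f y‖ₑ) q volume := by
          have hfin : ∀ x, ∫⁻ y, ‖k (x - y)‖ₑ * ‖f y‖ₑ ≠ ∞ := fun x =>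
            ((hk.lintegral_le hτ hm hq hf.1 x).trans_lt (ENNReal.mul_lt_top (by simp) hf.2)).ne
          have hen : ∀ x, ‖(∫⁻ y, ‖k (x - y)‖ₑ * ‖f y‖ₑ).toReal‖ₑ
              = ∫⁻ y, ‖k (x - y)‖ₑ * ‖f y‖ₑ := fun x => by
            rw [Real.enorm_eq_ofReal ENNReal.toReal_nonneg, ENNReal.ofReal_toReal (hfin x)]
          have hinv : q'⁻¹ + q⁻¹ = 1 := ENNReal.HolderConjugate.inv_add_inv_eq_one q' q
          have h := lintegral_mul_le_of_inv_add_inv_le hinv.le hφ.1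
            hIm.ennreal_toReal.aestronglyMeasurable
          have he : rexp q' + rexp q = 1 := by
            unfold rexp
            rw [← ENNReal.toReal_add, hinv, ENNReal.toReal_one]
            · exact ne_top_of_le_ne_top (by simp) (le_self_add.trans hinv.le)
            · exact ne_top_of_le_ne_top (by simp) (le_add_self.trans hinv.le)
          simp only [hen] at h
          rw [show 1 - rexp q' - rexp q = 0 by linarith, ENNReal.rpow_zero, mul_one] at h
          refine h.trans_eq ?_
          congr 1
          exact eLpNorm_congr_enorm_ae (ae_of_all _ fun x => by simp [hen])
      _ < ∞ := by
          refine ENNReal.mul_lt_top hφ.2 (hb.trans_lt ?_)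
          refine ENNReal.mul_lt_top (by simp) (ENNReal.mul_lt_top ?_ hf.2)
          exact (memLp_top_const (1 : ℝ)).2
  calc ∫ x, φ x * ∫ y, k (x - y) * f y
      = ∫ x, ∫ y, φ x * (k (x - y) * f y) := by
        simp only [integral_const_mul]
    _ = ∫ y, ∫ x, φ x * (k (x - y) * f y) := integral_integral_swap hint
    _ = _ := by
        refine integral_congr_ae (ae_of_all _ fun y => ?_)
        simp only [conv, neg_sub]
        rw [← integral_mul_const]
        refine integral_congr_ae (ae_of_all _ fun x => ?_)
        ring

end NavierStokes

/-! ### Mass and size of the heat and Oseen kernels and of their time increments. -/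

namespace NavierStokes

variable {d : ℕ}

lemma heatKernel_eq_const_mul (t : ℝ) (x : Sp d) :
    heatKernel d t x = (4 * Real.pi * t) ^ (-(d : ℝ) / 2) * Real.exp (-(1 / (4 * t)) * ‖x‖ ^ 2) := by
  unfold heatKernel; congr 2; ring

lemma integral_heatKernel {t : ℝ} (ht : 0 < t) : ∫ x, heatKernel d t x = 1 := by
  simp only [heatKernel_eq_const_mul]
  rw [integral_const_mul, GaussianFourier.integral_rexp_neg_mul_sq_norm (by positivity)]
  have : 0 < 4 * Real.pi * t := by have := Real.pi_pos; positivity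
  rw [show Real.pi / (1 / (4 * t)) = 4 * Real.pi * t by field_simp]
  simp only [finrank_euclideanSpace, Fintype.card_fin]
  rw [← Real.rpow_add this]
  simp [neg_div]

lemma integrable_heatKernel {t : ℝ} (ht : 0 < t) : Integrable (heatKernel d t) := by
  -- A nonintegrable function would have Bochner integral 0, whereas this integral is 1.
  by_contra h
  have := integral_undef h
  rw [integral_heatKernel ht] at this
  exact one_ne_zero this

lemma lintegral_heatKernel {t : ℝ} (ht : 0 < t) : ∫⁻ x : Sp d, ‖heatKernel d t x‖ₑ = 1 := by
  have h := ofReal_integral_norm_eq_lintegral_enorm (integrable_heatKernel (d := d) ht)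
  rw [← h]
  simp only [Real.norm_eq_abs, abs_of_pos (heatKernel_pos ht _), integral_heatKernel ht,
    ENNReal.ofReal_one]

lemma heatKernel_le {t : ℝ} (ht : 0 < t) (x : Sp d) : heatKernel d t x ≤ t ^ (-(d : ℝ) / 2) := by
  unfold heatKernel
  have hpi := Real.pi_gt_three
  have h1 : (4 * Real.pi * t) ^ (-(d : ℝ) / 2) ≤ t ^ (-(d : ℝ) / 2) := by
    refine Real.rpow_le_rpow_of_nonpos ht (by nlinarith) ?_
    have : (0 : ℝ) ≤ d := by positivity
    linarith
  have h2 : Real.exp (-‖x‖ ^ 2 / (4 * t)) ≤ 1 := by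
    rw [Real.exp_le_one_iff, neg_div]
    have : 0 ≤ ‖x‖ ^ 2 / (4 * t) := by positivity
    linarith
  calc _ ≤ t ^ (-(d : ℝ) / 2) * 1 := by gcongr
    _ = _ := mul_one _

lemma heatKernel_le_of_le {t s : ℝ} (ht : 0 < t) (hts : t ≤ s) (x : Sp d) :
    heatKernel d s x ≤ t ^ (-(d : ℝ) / 2) := by
  refine (heatKernel_le (ht.trans_le hts) x).trans ?_
  refine Real.rpow_le_rpow_of_nonpos ht hts ?_
  have : (0 : ℝ) ≤ d := by positivity
  linarith

lemma kerBd_heatKernel {t : ℝ} (ht : 0 < t) : KerBd (heatKernel d t) 1 t where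
  meas := (contDiff_heatKernel (n := 1) t).continuous.measurable
  mass := by rw [lintegral_heatKernel ht]; simp
  sup := fun x => by
    rw [Real.enorm_eq_ofReal (heatKernel_pos ht x).le, one_mul]
    exact ENNReal.ofReal_le_ofReal (heatKernel_le ht x)

/-- Kernels obtained by superposition of Gaussians. -/
lemma kerBd_setIntegral {κ : ℝ → Sp d → ℝ} (hκ : Measurable (Function.uncurry κ)) {A : Set ℝ}
    (hA : MeasurableSet A) {τ : ℝ} (hτ : 0 < τ) (hAτ : A ⊆ Ici τ) {φ : ℝ → ℝ} {m : ℝ} (hm : 0 ≤ m)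
    (hφ : ∀ s ∈ A, 0 ≤ φ s) (hφm : ∫⁻ s in A, ENNReal.ofReal (φ s) ≤ ENNReal.ofReal m)
    (hb : ∀ s ∈ A, ∀ x, |κ s x| ≤ φ s * heatKernel d (2 * s) x) :
    KerBd (fun x => ∫ s in A, κ s x) m τ := by
  have hen : ∀ s ∈ A, ∀ x, ‖κ s x‖ₑ ≤ ENNReal.ofReal (φ s) * ‖heatKernel d (2 * s) x‖ₑ := by
    intro s hs x
    have hs0 : 0 < s := hτ.trans_le (hAτ hs)
    rw [Real.enorm_eq_ofReal (heatKernel_pos (by positivity) x).le, ← ENNReal.ofReal_mul (hφ s hs),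
      Real.enorm_eq_ofReal_abs]
    exact ENNReal.ofReal_le_ofReal (hb s hs x)
  refine ⟨?_, ?_, ?_⟩
  · have : StronglyMeasurable (Function.uncurry fun (x : Sp d) s => κ s x) :=
      (hκ.comp measurable_swap).stronglyMeasurable
    exact this.integral_prod_right.measurable
  · calc ∫⁻ x, ‖∫ s in A, κ s x‖ₑ ≤ ∫⁻ x, ∫⁻ s in A, ‖κ s x‖ₑ :=
          lintegral_mono fun x => enorm_integral_le_lintegral_enorm _
      _ = ∫⁻ s in A, ∫⁻ x, ‖κ s x‖ₑ := by
          refine lintegral_lintegral_swap (f := fun x s => ‖κ s x‖ₑ) ?_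
          exact ((hκ.comp measurable_swap).enorm).aemeasurable
      _ ≤ ∫⁻ s in A, ENNReal.ofReal (φ s) := by
          refine setLIntegral_mono' hA fun s hs => ?_
          have hs0 : 0 < s := hτ.trans_le (hAτ hs)
          calc _ ≤ ∫⁻ x, ENNReal.ofReal (φ s) * ‖heatKernel d (2 * s) x‖ₑ :=
                lintegral_mono fun x => hen s hs x
            _ = _ := by
              rw [lintegral_const_mul' _ _ (by simp), lintegral_heatKernel (by positivity), mul_one]
      _ ≤ _ := hφm
  -- All scales in A are at least τ, so each Gaussian is at most τ^(-d/2); this is why the size is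
  -- measured at the smallest scale.
  · intro x
    calc ‖∫ s in A, κ s x‖ₑ ≤ ∫⁻ s in A, ‖κ s x‖ₑ := enorm_integral_le_lintegral_enorm _
      _ ≤ ∫⁻ s in A, ENNReal.ofReal (φ s) * ENNReal.ofReal (τ ^ (-(d : ℝ) / 2)) := by
          refine setLIntegral_mono' hA fun s hs => (hen s hs x).trans ?_
          have hs0 : 0 < s := hτ.trans_le (hAτ hs)
          gcongr
          rw [Real.enorm_eq_ofReal (heatKernel_pos (by positivity) x).le]
          refine ENNReal.ofReal_le_ofReal (heatKernel_le_of_le hτ ?_ x)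
          have := hAτ hs
          simp only [mem_Ici] at this
          linarith
      _ ≤ _ := by
          rw [lintegral_mul_const' _ _ (by simp), ENNReal.ofReal_mul hm]
          gcongr

lemma kerBd_of_le {k : Sp d → ℝ} (hk : Measurable k) {t c : ℝ} (ht : 0 < t) (hc : 0 ≤ c)
    (hb : ∀ x, |k x| ≤ c * heatKernel d (2 * t) x) : KerBd k c t := by
  have hen : ∀ x, ‖k x‖ₑ ≤ ENNReal.ofReal c * ‖heatKernel d (2 * t) x‖ₑ := by
    intro x
    rw [Real.enorm_eq_ofReal (heatKernel_pos (by positivity) x).le, ← ENNReal.ofReal_mul hc,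
      Real.enorm_eq_ofReal_abs]
    exact ENNReal.ofReal_le_ofReal (hb x)
  refine ⟨hk, (lintegral_mono hen).trans ?_, fun x => (hen x).trans ?_⟩
  · rw [lintegral_const_mul' _ _ (by simp), lintegral_heatKernel (by positivity), mul_one]
  · rw [ENNReal.ofReal_mul hc]
    gcongr
    rw [Real.enorm_eq_ofReal (heatKernel_pos (by positivity) x).le]
    exact ENNReal.ofReal_le_ofReal (heatKernel_le_of_le ht (by linarith) x)

lemma kerBd_g1 (k : Fin d) {t : ℝ} (ht : 0 < t) : KerBd (g1 k t) (gC d * t ^ (-(1 / 2) : ℝ)) t := by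
  refine kerBd_of_le (contDiff_g1 (n := 1) k t).continuous.measurable ht
    (mul_nonneg (gC_pos d).le (by positivity)) fun x => (abs_g1_le k ht x).trans_eq (by ring)

lemma kerBd_g2 (j k : Fin d) {t : ℝ} (ht : 0 < t) : KerBd (g2 j k t) (gC d * t⁻¹) t := by
  refine kerBd_of_le (contDiff_g2 (n := 1) j k t).continuous.measurable ht
    (mul_nonneg (gC_pos d).le (by positivity)) fun x => (abs_g2_le j k ht x).trans_eq (by ring)

lemma kerBd_g3 (i j k : Fin d) {t : ℝ} (ht : 0 < t) :
    KerBd (g3 i j k t) (gC d * t ^ (-(3 / 2) : ℝ)) t := by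
  refine kerBd_of_le (contDiff_g3 (n := 1) i j k t).continuous.measurable ht
    (mul_nonneg (gC_pos d).le (by positivity)) fun x => (abs_g3_le i j k ht x).trans_eq (by ring)

/-- The time derivative of the heat kernel. -/
def gt (t : ℝ) (x : Sp d) : ℝ := (‖x‖ ^ 2 / (4 * t ^ 2) - d / (2 * t)) * heatKernel d t x

/-- The time derivative of `g1`. -/
def g1t (k : Fin d) (t : ℝ) (x : Sp d) : ℝ :=
  (x k / (2 * t ^ 2) - x k / (2 * t) * (‖x‖ ^ 2 / (4 * t ^ 2) - d / (2 * t))) * heatKernel d t x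

lemma hasDerivAt_heatKernel {t : ℝ} (ht : 0 < t) (x : Sp d) :
    HasDerivAt (fun s => heatKernel d s x) (gt t x) t := by
  unfold heatKernel gt
  have hpi := Real.pi_pos
  have h1 : HasDerivAt (fun s : ℝ => (4 * Real.pi * s) ^ (-(d : ℝ) / 2))
      ((4 * Real.pi) * (-(d : ℝ) / 2) * (4 * Real.pi * t) ^ (-(d : ℝ) / 2 - 1)) t := by
    have := ((hasDerivAt_id t).const_mul (4 * Real.pi)).rpow_const (p := -(d : ℝ) / 2)
      (Or.inl (by simp; positivity))
    simpa using this
  have h2 : HasDerivAt (fun s : ℝ => Real.exp (-‖x‖ ^ 2 / (4 * s)))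
      (Real.exp (-‖x‖ ^ 2 / (4 * t)) * (‖x‖ ^ 2 / (4 * t ^ 2))) t := by
    refine HasDerivAt.exp ?_
    have := ((hasDerivAt_id t).const_mul 4).fun_inv (by simp; positivity) |>.const_mul (-‖x‖ ^ 2)
    simp only [id] at this
    refine (this.congr_of_eventuallyEq (Eventually.of_forall fun s => ?_)).congr_deriv ?_
    · simp only; ring
    · field_simp
  refine (h1.mul h2).congr_deriv ?_
  rw [Real.rpow_sub_one (by positivity)]
  simp only [heatKernel]
  field_simp
  ring

lemma hasDerivAt_g1 (k : Fin d) {t : ℝ} (ht : 0 < t) (x : Sp d) :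
    HasDerivAt (fun s => g1 k s x) (g1t k t x) t := by
  have h := hasDerivAt_heatKernel ht x
  have h1 : HasDerivAt (fun s : ℝ => -(x k / (2 * s))) (x k / (2 * t ^ 2)) t := by
    have := ((hasDerivAt_id t).const_mul 2).fun_inv (by simp; positivity) |>.const_mul (-(x k))
    simp only [id] at this
    refine (this.congr_of_eventuallyEq (Eventually.of_forall fun s => ?_)).congr_deriv ?_
    · simp only; ring
    · field_simp
  refine (h1.mul h).congr_deriv ?_
  simp only [g1t, gt]
  ring

lemma abs_gt_le {t : ℝ} (ht : 0 < t) (x : Sp d) :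
    |gt t x| ≤ (1 + d) * t⁻¹ * (gC d * heatKernel d (2 * t) x) := by
  refine poly_bound ht x (by positivity) ?_
  have hs : √t * √t = t := Real.mul_self_sqrt ht.le
  have hs0 : 0 < √t := Real.sqrt_pos.2 ht
  set r := √t
  have hz : 0 ≤ ‖x‖ / r := by positivity
  have hd : (0 : ℝ) ≤ d := by positivity
  calc |‖x‖ ^ 2 / (4 * t ^ 2) - d / (2 * t)| ≤ |‖x‖ ^ 2 / (4 * t ^ 2)| + |d / (2 * t)| := abs_sub _ _
    _ = ‖x‖ ^ 2 / (4 * t ^ 2) + d / (2 * t) := by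
        rw [abs_of_nonneg (by positivity), abs_of_nonneg (by positivity)]
    _ ≤ ‖x‖ ^ 2 / (1 * t ^ 2) + d / (1 * t) := by gcongr <;> norm_num
    _ = t⁻¹ * ((‖x‖ / r) ^ 2 + d) := by rw [← hs]; field_simp
    _ ≤ t⁻¹ * ((1 + d) * (1 + ‖x‖ / r + (‖x‖ / r) ^ 2 + (‖x‖ / r) ^ 3)) := by
        refine mul_le_mul_of_nonneg_left ?_ (by positivity)
        nlinarith [mul_nonneg hd hz, mul_nonneg hd (pow_nonneg hz 2), mul_nonneg hd (pow_nonneg hz 3),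
          pow_nonneg hz 2, pow_nonneg hz 3]
    _ = _ := by ring

lemma abs_g1t_le (k : Fin d) {t : ℝ} (ht : 0 < t) (x : Sp d) :
    |g1t k t x| ≤ (2 + d) * t ^ (-(3 / 2) : ℝ) * (gC d * heatKernel d (2 * t) x) := by
  refine poly_bound ht x (by positivity) ?_
  have hs : √t * √t = t := Real.mul_self_sqrt ht.le
  have hs0 : 0 < √t := Real.sqrt_pos.2 ht
  rw [rpow_neg_three_half ht]
  set r := √t
  have hz : 0 ≤ ‖x‖ / r := by positivity
  have hd : (0 : ℝ) ≤ d := by positivity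
  have hk := abs_coord_le x k
  calc |x k / (2 * t ^ 2) - x k / (2 * t) * (‖x‖ ^ 2 / (4 * t ^ 2) - d / (2 * t))|
      ≤ |x k / (2 * t ^ 2)| + |x k / (2 * t) * (‖x‖ ^ 2 / (4 * t ^ 2) - d / (2 * t))| := abs_sub _ _
    _ ≤ |x k / (2 * t ^ 2)| + |x k / (2 * t)| * (|‖x‖ ^ 2 / (4 * t ^ 2)| + |d / (2 * t)|) := by
        rw [abs_mul]; gcongr; exact abs_sub _ _
    _ = |x k| / (2 * t ^ 2) + |x k| / (2 * t) * (‖x‖ ^ 2 / (4 * t ^ 2) + d / (2 * t)) := by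
        rw [abs_of_nonneg (by positivity : 0 ≤ ‖x‖ ^ 2 / (4 * t ^ 2)),
          abs_of_nonneg (by positivity : 0 ≤ d / (2 * t)), abs_div, abs_div,
          abs_of_nonneg (by positivity : 0 ≤ 2 * t ^ 2), abs_of_nonneg (by positivity : 0 ≤ 2 * t)]
    _ ≤ ‖x‖ / (1 * t ^ 2) + ‖x‖ / (1 * t) * (‖x‖ ^ 2 / (1 * t ^ 2) + d / (1 * t)) := by
        gcongr <;> norm_num
    _ = (t * r)⁻¹ * (‖x‖ / r + ‖x‖ / r * ((‖x‖ / r) ^ 2 + d)) := by rw [← hs]; field_simp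
    _ ≤ (t * r)⁻¹ * ((2 + d) * (1 + ‖x‖ / r + (‖x‖ / r) ^ 2 + (‖x‖ / r) ^ 3)) := by
        refine mul_le_mul_of_nonneg_left ?_ (by positivity)
        nlinarith [mul_nonneg hd hz, mul_nonneg hd (pow_nonneg hz 2), mul_nonneg hd (pow_nonneg hz 3),
          pow_nonneg hz 2, pow_nonneg hz 3]
    _ = _ := by ring

/-- The density of the Oseen kernel with respect to the scale. -/
def kap (i j k : Fin d) (s : ℝ) (x : Sp d) : ℝ := g3 i j k s x - kd i j * g1t k s x

/-- The constant in the bounds of the Oseen kernel. -/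
def kC (d : ℕ) : ℝ := (3 + d) * gC d

lemma kC_pos (d : ℕ) : 0 < kC d := by have := gC_pos d; unfold kC; positivity

lemma abs_kap_le (i j k : Fin d) {t : ℝ} (ht : 0 < t) (x : Sp d) :
    |kap i j k t x| ≤ kC d * t ^ (-(3 / 2) : ℝ) * heatKernel d (2 * t) x := by
  have h1 := abs_g3_le i j k ht x
  have h2 := abs_g1t_le k ht x
  have h3 := abs_kd_le i j
  calc |kap i j k t x| ≤ |g3 i j k t x| + |kd i j * g1t k t x| := abs_sub _ _
    _ ≤ |g3 i j k t x| + 1 * |g1t k t x| := by rw [abs_mul]; gcongr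
    -- The factor 3 + d in `kC` is 1 from `g3` plus 2 + d from `g1t`.
    _ ≤ _ := by unfold kC; nlinarith

lemma measurable_heatKernel_uncurry : Measurable (Function.uncurry (heatKernel d)) := by
  unfold heatKernel
  simp only [Function.uncurry_def]
  fun_prop

lemma measurable_g3_uncurry (i j k : Fin d) : Measurable (Function.uncurry (g3 i j k)) := by
  have h : Measurable fun p : ℝ × Sp d => heatKernel d p.1 p.2 := measurable_heatKernel_uncurry
  unfold g3
  simp only [Function.uncurry_def]
  fun_prop

lemma measurable_gt_uncurry : Measurable (Function.uncurry (gt (d := d))) := by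
  have h : Measurable fun p : ℝ × Sp d => heatKernel d p.1 p.2 := measurable_heatKernel_uncurry
  unfold gt
  simp only [Function.uncurry_def]
  fun_prop

lemma measurable_g1t_uncurry (k : Fin d) : Measurable (Function.uncurry (g1t k)) := by
  have h : Measurable fun p : ℝ × Sp d => heatKernel d p.1 p.2 := measurable_heatKernel_uncurry
  unfold g1t
  simp only [Function.uncurry_def]
  fun_prop

lemma measurable_kap_uncurry (i j k : Fin d) : Measurable (Function.uncurry (kap i j k)) := by
  have h1 := measurable_g3_uncurry i j k
  have h2 := measurable_g1t_uncurry k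
  exact h1.sub (h2.const_mul (kd i j))

lemma integrableOn_of_le_three_half {f : ℝ → ℝ} (hf : Measurable f) {τ c : ℝ} (hτ : 0 < τ)
    (x : Sp d)
    (hb : ∀ s, τ < s → |f s| ≤ c * s ^ (-(3 / 2) : ℝ) * heatKernel d (2 * s) x) :
    IntegrableOn f (Ioi τ) := by
  have h := (integrableOn_Ioi_rpow_of_lt (a := -(3 / 2)) (by norm_num) hτ).const_mul
    (|c| * τ ^ (-(d : ℝ) / 2))
  refine Integrable.mono' h hf.aestronglyMeasurable ?_
  filter_upwards [ae_restrict_mem measurableSet_Ioi] with s hs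
  simp only [mem_Ioi] at hs
  have hs0 : 0 < s := hτ.trans hs
  rw [Real.norm_eq_abs]
  calc |f s| ≤ c * s ^ (-(3 / 2) : ℝ) * heatKernel d (2 * s) x := hb s hs
    _ ≤ |c| * s ^ (-(3 / 2) : ℝ) * τ ^ (-(d : ℝ) / 2) := by
        have := heatKernel_le_of_le hτ (by linarith : τ ≤ 2 * s) x
        have := heatKernel_pos (d := d) (by linarith : 0 < 2 * s) x
        gcongr
        exact le_abs_self c
    _ = _ := by ring

lemma integrableOn_g3 (i j k : Fin d) {τ : ℝ} (hτ : 0 < τ) (x : Sp d) :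
    IntegrableOn (fun s => g3 i j k s x) (Ioi τ) := by
  refine integrableOn_of_le_three_half (c := gC d)
    ((measurable_g3_uncurry i j k).comp (measurable_id.prodMk measurable_const)) hτ x fun s hs => ?_
  exact (abs_g3_le i j k (hτ.trans hs) x).trans_eq (by ring)

lemma integrableOn_g1t (k : Fin d) {τ : ℝ} (hτ : 0 < τ) (x : Sp d) :
    IntegrableOn (fun s => g1t k s x) (Ioi τ) := by
  refine integrableOn_of_le_three_half (c := (2 + d) * gC d)
    ((measurable_g1t_uncurry k).comp (measurable_id.prodMk measurable_const)) hτ x fun s hs => ?_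
  exact (abs_g1t_le k (hτ.trans hs) x).trans_eq (by ring)

lemma integrableOn_kap (i j k : Fin d) {τ : ℝ} (hτ : 0 < τ) (x : Sp d) :
    IntegrableOn (fun s => kap i j k s x) (Ioi τ) :=
  (integrableOn_g3 i j k hτ x).sub ((integrableOn_g1t k hτ x).const_mul _)

/-- Fundamental theorem of calculus in the time variable; the boundary term at infinity vanishes
since `g1` decays at least like s^(-1/2). -/
lemma integral_g1t (k : Fin d) {τ : ℝ} (hτ : 0 < τ) (x : Sp d) :
    ∫ s in Ioi τ, g1t k s x = - g1 k τ x := by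
  rw [integral_Ioi_of_hasDerivAt_of_tendsto (f := fun s => g1 k s x) (m := 0)
    (hasDerivAt_g1 k hτ x).continuousAt.continuousWithinAt
    (fun s hs => hasDerivAt_g1 k (hτ.trans hs) x) (integrableOn_g1t k hτ x) ?_, zero_sub]
  have h0 : Tendsto (fun s : ℝ => gC d * s ^ (-(1 / 2) : ℝ)) atTop (𝓝 0) := by
    simpa using (tendsto_rpow_neg_atTop (by norm_num : (0 : ℝ) < 1 / 2)).const_mul (gC d)
  refine squeeze_zero_norm' ?_ h0
  filter_upwards [eventually_ge_atTop 1] with s hs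
  have hs0 : 0 < s := by linarith
  refine (abs_g1_le k hs0 x).trans ?_
  have h1 : heatKernel d (2 * s) x ≤ 1 :=
    (heatKernel_le_of_le one_pos (by linarith) x).trans_eq (by simp)
  have := gC_pos d
  calc _ ≤ s ^ (-(1 / 2) : ℝ) * (gC d * 1) := by gcongr
    _ = _ := by ring

/-- The local term δᵢⱼ ∂ₖG_τ is itself minus the integral of its time derivative over (τ, ∞). The
whole kernel thus becomes a superposition over scales above τ, and the difference of two such
kernels is an integral over the scales between them. -/
lemma oseenKernel_eq_integral (i j k : Fin d) {τ : ℝ} (hτ : 0 < τ) (x : Sp d) :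
    oseenKernel i j k τ x = ∫ s in Ioi τ, kap i j k s x := by
  rw [oseenKernel_eq]
  simp only [kap]
  rw [integral_sub (integrableOn_g3 i j k hτ x) ((integrableOn_g1t k hτ x).const_mul _),
    integral_const_mul, integral_g1t k hτ]
  ring

lemma lintegral_three_half {τ : ℝ} (hτ : 0 < τ) (c : ℝ) (hc : 0 ≤ c) :
    ∫⁻ s in Ioi τ, ENNReal.ofReal (c * s ^ (-(3 / 2) : ℝ))
      ≤ ENNReal.ofReal (c * (2 * τ ^ (-(1 / 2) : ℝ))) := by
  rw [← ofReal_integral_eq_lintegral_ofReal]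
  · rw [integral_const_mul, integral_Ioi_rpow_of_lt (by norm_num) hτ]
    refine ENNReal.ofReal_le_ofReal (le_of_eq ?_)
    rw [show (-(3 / 2) + 1 : ℝ) = -(1 / 2) by norm_num]
    ring
  · exact (integrableOn_Ioi_rpow_of_lt (by norm_num) hτ).const_mul _
  · filter_upwards [ae_restrict_mem measurableSet_Ioi] with s hs
    have : 0 < s := hτ.trans hs
    positivity

lemma kerBd_oseenKernel (i j k : Fin d) {τ : ℝ} (hτ : 0 < τ) :
    KerBd (oseenKernel i j k τ) (kC d * (2 * τ ^ (-(1 / 2) : ℝ))) τ := by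
  have hC := kC_pos d
  have h := kerBd_setIntegral (measurable_kap_uncurry i j k) (A := Ioi τ) measurableSet_Ioi hτ
    Ioi_subset_Ici_self (φ := fun s => kC d * s ^ (-(3 / 2) : ℝ))
    (m := kC d * (2 * τ ^ (-(1 / 2) : ℝ))) (by positivity)
    (fun s hs => by have : 0 < s := hτ.trans hs; positivity) (lintegral_three_half hτ _ hC.le)
    (fun s hs x => abs_kap_le i j k (hτ.trans hs) x)
  convert h using 1
  funext x
  exact oseenKernel_eq_integral i j k hτ x

/-- The mass of the scales between a and b is at most a constant times a^(-1/2) min(1, (b-a)/a), and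
min(1, r) ≤ r^θ for 0 ≤ θ ≤ 1. Hölder continuity in time is thus bought with an additional
singularity a^(-θ). -/
lemma kerBd_oseenKernel_sub (i j k : Fin d) {a b θ : ℝ} (ha : 0 < a) (hab : a ≤ b) (hθ : 0 ≤ θ)
    (hθ1 : θ ≤ 1) :
    KerBd (fun x => oseenKernel i j k a x - oseenKernel i j k b x)
      (2 * kC d * ((b - a) ^ θ * a ^ (-(1 / 2) - θ : ℝ))) a := by
  have hC := kC_pos d
  have hba : 0 ≤ b - a := by linarith
  have hmass : ∫⁻ s in Ioc a b, ENNReal.ofReal (kC d * s ^ (-(3 / 2) : ℝ))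
      ≤ ENNReal.ofReal (2 * kC d * ((b - a) ^ θ * a ^ (-(1 / 2) - θ : ℝ))) := by
    have hsplit : (b - a) ^ θ * a ^ (-(1 / 2) - θ : ℝ) = ((b - a) / a) ^ θ * a ^ (-(1 / 2) : ℝ) := by
      rw [Real.div_rpow hba ha.le, Real.rpow_sub ha]
      ring
    rw [hsplit]
    -- On short bands the density is bounded by its value at a; on long bands the integral over all
    -- scales above a suffices.
    by_cases hcase : b - a ≤ a
    · have h1 : (b - a) / a ≤ 1 := by rw [div_le_one ha]; exact hcase
      have h2 : (b - a) / a ≤ ((b - a) / a) ^ θ := by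
        rcases hba.eq_or_lt with h0 | h0
        · rw [← h0]; simp only [zero_div]; positivity
        · nth_rewrite 1 [← Real.rpow_one ((b - a) / a)]
          exact Real.rpow_le_rpow_of_exponent_ge (by positivity) h1 hθ1
      calc _ ≤ ∫⁻ s in Ioc a b, ENNReal.ofReal (kC d * a ^ (-(3 / 2) : ℝ)) := by
            refine setLIntegral_mono' measurableSet_Ioc fun s hs => ENNReal.ofReal_le_ofReal ?_
            exact mul_le_mul_of_nonneg_left
              (Real.rpow_le_rpow_of_nonpos ha hs.1.le (by norm_num)) hC.le
        _ = ENNReal.ofReal (kC d * a ^ (-(3 / 2) : ℝ) * (b - a)) := by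
            rw [setLIntegral_const, Real.volume_Ioc, ← ENNReal.ofReal_mul (by positivity)]
        _ ≤ _ := by
            refine ENNReal.ofReal_le_ofReal ?_
            have h3 : a ^ (-(3 / 2) : ℝ) = a ^ (-(1 / 2) : ℝ) / a := by
              rw [← Real.rpow_sub_one ha.ne']; norm_num
            rw [h3]
            calc _ = kC d * (((b - a) / a) * a ^ (-(1 / 2) : ℝ)) := by field_simp
              _ ≤ (2 * kC d) * (((b - a) / a) ^ θ * a ^ (-(1 / 2) : ℝ)) := by
                gcongr
                linarith
    · have h1 : 1 ≤ ((b - a) / a) ^ θ := by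
        refine Real.one_le_rpow ?_ hθ
        rw [one_le_div ha]; linarith
      calc _ ≤ ∫⁻ s in Ioi a, ENNReal.ofReal (kC d * s ^ (-(3 / 2) : ℝ)) :=
            lintegral_mono_set Ioc_subset_Ioi_self
        _ ≤ _ := lintegral_three_half ha _ hC.le
        _ ≤ _ := by
            refine ENNReal.ofReal_le_ofReal ?_
            calc _ = 2 * kC d * (1 * a ^ (-(1 / 2) : ℝ)) := by ring
              _ ≤ _ := by gcongr
  have h := kerBd_setIntegral (measurable_kap_uncurry i j k) (A := Ioc a b) measurableSet_Ioc ha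
    (fun s hs => hs.1.le) (φ := fun s => kC d * s ^ (-(3 / 2) : ℝ))
    (m := 2 * kC d * ((b - a) ^ θ * a ^ (-(1 / 2) - θ : ℝ))) (by positivity)
    (fun s hs => by have : 0 < s := ha.trans hs.1; positivity) hmass
    (fun s hs x => abs_kap_le i j k (ha.trans hs.1) x)
  convert h using 1
  funext x
  rw [oseenKernel_eq_integral i j k ha, oseenKernel_eq_integral i j k (ha.trans_le hab),
    ← Ioc_union_Ioi_eq_Ioi hab, setIntegral_union (Ioc_disjoint_Ioi le_rfl) measurableSet_Ioi
    ((integrableOn_kap i j k ha x).mono_set Ioc_subset_Ioi_self)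
    (integrableOn_kap i j k (ha.trans_le hab) x)]
  ring

/-- The increment is the integral of `gt` over (a, b], and there `gt` is at most a constant times
a⁻¹ times a Gaussian. -/
lemma kerBd_heatKernel_sub {a b : ℝ} (ha : 0 < a) (hab : a ≤ b) :
    KerBd (fun x => heatKernel d b x - heatKernel d a x) ((1 + d) * gC d * ((b - a) / a)) a := by
  have hC := gC_pos d
  have hba : 0 ≤ b - a := by linarith
  have h := kerBd_setIntegral (measurable_gt_uncurry (d := d)) (A := Ioc a b) measurableSet_Ioc ha
    (fun s hs => hs.1.le) (φ := fun s => (1 + d) * gC d * a⁻¹)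
    (m := (1 + d) * gC d * ((b - a) / a)) (by positivity)
    (fun s hs => by positivity) (by
      rw [setLIntegral_const, Real.volume_Ioc, ← ENNReal.ofReal_mul (by positivity)]
      refine ENNReal.ofReal_le_ofReal (le_of_eq ?_)
      ring)
    (fun s hs x => by
      have hs0 := ha.trans hs.1
      refine (abs_gt_le hs0 x).trans ?_
      have := heatKernel_pos (d := d) (by linarith : 0 < 2 * s) x
      calc _ = (1 + d) * gC d * s⁻¹ * heatKernel d (2 * s) x := by ring
        _ ≤ _ := by gcongr; exact hs.1.le)
  convert h using 1
  funext x
  rw [← intervalIntegral.integral_of_le hab]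
  refine (intervalIntegral.integral_eq_sub_of_hasDerivAt (f := fun s => heatKernel d s x) ?_ ?_).symm
  · intro s hs
    rw [uIcc_of_le hab] at hs
    exact hasDerivAt_heatKernel (ha.trans_le hs.1) x
  · rw [intervalIntegrable_iff_integrableOn_Ioc_of_le hab]
    refine Measure.integrableOn_of_bounded (M := (1 + d) * a⁻¹ * (gC d * a ^ (-(d : ℝ) / 2)))
      (by simp) ((measurable_gt_uncurry (d := d)).comp
        (measurable_id.prodMk measurable_const)).aestronglyMeasurable ?_
    filter_upwards [ae_restrict_mem measurableSet_Ioc] with s hs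
    have hs0 := ha.trans hs.1
    refine (abs_gt_le hs0 x).trans ?_
    have := hs.1.le
    have := heatKernel_le_of_le ha (by linarith : a ≤ 2 * s) x
    have := heatKernel_pos (d := d) (by linarith : 0 < 2 * s) x
    gcongr

end NavierStokes

/-! ### Algebraic identities and the semigroup property of the kernels. -/

namespace NavierStokes

variable {d : ℕ}

lemma heatKernel_neg (t : ℝ) (x : Sp d) : heatKernel d t (-x) = heatKernel d t x := by
  simp [heatKernel]

lemma g1_neg (k : Fin d) (t : ℝ) (x : Sp d) : g1 k t (-x) = - g1 k t x := by
  simp [g1, heatKernel_neg]; ring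

lemma g3_neg (i j k : Fin d) (t : ℝ) (x : Sp d) : g3 i j k t (-x) = - g3 i j k t x := by
  simp [g3, heatKernel_neg]; ring

/-- Each term is an odd number of derivatives of an even kernel. Oddness makes the adjoint of the
convolution its negative. -/
lemma oseenKernel_neg (i j k : Fin d) (t : ℝ) (x : Sp d) :
    oseenKernel i j k t (-x) = - oseenKernel i j k t x := by
  simp only [oseenKernel_eq, g1_neg, g3_neg, integral_neg]
  ring

lemma g3_comm (i j k : Fin d) (t : ℝ) : (g3 i j k t : Sp d → ℝ) = g3 j i k t := by
  funext x; simp only [g3, kd_comm i j]; ring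

/-- The heat equation for ∂ₖG: both sides are Δ∂ₖG = ∂_t∂ₖG in explicit form. -/
lemma sum_g3 (k : Fin d) (t : ℝ) (ht : t ≠ 0) (x : Sp d) : ∑ l, g3 l l k t x = g1t k t x := by
  simp only [g3, g1t]
  rw [← Finset.sum_mul]
  congr 1
  have hn : ‖x‖ ^ 2 = ∑ l, x l * x l := by
    rw [EuclideanSpace.norm_sq_eq]
    simp [sq]
  have h1 : ∑ l : Fin d, kd l k * x l = x k := by simp [kd]
  calc _ = ∑ l : Fin d, (-(x k / (8 * t ^ 3)) * (x l * x l)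
        + (x k / (4 * t ^ 2) + (2 / (4 * t ^ 2)) * (kd l k * x l))) := by
        refine Finset.sum_congr rfl fun l _ => ?_
        simp only [kd, if_true]
        ring
    _ = _ := by
        rw [Finset.sum_add_distrib, Finset.sum_add_distrib, ← Finset.mul_sum, ← Finset.mul_sum, h1,
          ← hn]
        simp
        field_simp
        ring

/-- The density is (∂ᵢ∂ⱼ - δᵢⱼΔ)∂ₖ applied to the heat kernel, and contraction with ∂ᵢ annihilates
this operator. This is where the divergence free range comes from. -/
lemma kap_eq (i j k : Fin d) {s : ℝ} (hs : s ≠ 0) (x : Sp d) :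
    kap i j k s x = g3 i j k s x - kd i j * ∑ l, g3 l l k s x := by
  rw [sum_g3 k s hs, kap]

lemma conv_comm (k f : Sp d → ℝ) (x : Sp d) : conv k f x = conv f k x := by
  unfold conv
  rw [← integral_sub_left_eq_self _ volume x]
  simp [mul_comm]

/-- Completing the square in y: the product is a Gaussian of time ab/(a+b) centred at b x/(a+b),
times a factor independent of y. -/
lemma heatKernel_mul {a b : ℝ} (ha : 0 < a) (hb : 0 < b) (x y : Sp d) :
    heatKernel d a (x - y) * heatKernel d b y
      = heatKernel d (a + b) x * heatKernel d (a * b / (a + b)) (y - (b / (a + b)) • x) := by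
  unfold heatKernel
  have hpi := Real.pi_pos
  have hab : 0 < a + b := by positivity
  have h1 : (4 * Real.pi * a) ^ (-(d : ℝ) / 2) * (4 * Real.pi * b) ^ (-(d : ℝ) / 2)
      = (4 * Real.pi * (a + b)) ^ (-(d : ℝ) / 2)
        * (4 * Real.pi * (a * b / (a + b))) ^ (-(d : ℝ) / 2) := by
    rw [← Real.mul_rpow (by positivity) (by positivity),
      ← Real.mul_rpow (by positivity) (by positivity)]
    congr 1; field_simp
  have h2 : Real.exp (-‖x - y‖ ^ 2 / (4 * a)) * Real.exp (-‖y‖ ^ 2 / (4 * b))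
      = Real.exp (-‖x‖ ^ 2 / (4 * (a + b)))
        * Real.exp (-‖y - (b / (a + b)) • x‖ ^ 2 / (4 * (a * b / (a + b)))) := by
    rw [← Real.exp_add, ← Real.exp_add]
    congr 1
    rw [norm_sub_sq_real, norm_sub_sq_real, norm_smul, inner_smul_right, real_inner_comm,
      Real.norm_eq_abs, mul_pow, sq_abs]
    field_simp
    ring
  calc _ = ((4 * Real.pi * a) ^ (-(d : ℝ) / 2) * (4 * Real.pi * b) ^ (-(d : ℝ) / 2))
        * (Real.exp (-‖x - y‖ ^ 2 / (4 * a)) * Real.exp (-‖y‖ ^ 2 / (4 * b))) := by ring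
    _ = _ := by rw [h1, h2]; ring

lemma conv_heatKernel {a b : ℝ} (ha : 0 < a) (hb : 0 < b) (x : Sp d) :
    conv (heatKernel d a) (heatKernel d b) x = heatKernel d (a + b) x := by
  unfold conv
  simp only [heatKernel_mul ha hb]
  rw [integral_const_mul, integral_sub_right_eq_self (fun y => heatKernel d (a * b / (a + b)) y),
    integral_heatKernel (by positivity), mul_one]

/-- Differentiation under the convolution. -/
lemma conv_pd {φ f F : Sp d → ℝ} (hφ : Integrable φ) (hf : ContDiff ℝ 1 f) {M₀ M₁ : ℝ}
    (hf0 : ∀ x, |f x| ≤ M₀) (i : Fin d) (hf1 : ∀ x, |pd i f x| ≤ M₁) (hF : Differentiable ℝ F)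
    (h : ∀ x, conv φ f x = F x) (x : Sp d) : conv φ (pd i f) x = pd i F x := by
  set e : Sp d := EuclideanSpace.single i 1 with he
  have hline : ∀ z : Sp d, ∀ t : ℝ, HasDerivAt (fun t : ℝ => f (z + t • e)) (pd i f (z + t • e)) t := by
    intro z t
    have h1 : HasFDerivAt f (fderiv ℝ f (z + t • e)) (z + t • e) :=
      (hf.differentiable (by norm_num) _).hasFDerivAt
    have h2 : HasDerivAt (fun t : ℝ => z + t • e) e t := by
      simpa using ((hasDerivAt_id t).smul_const e).const_add z
    exact h1.comp_hasDerivAt t h2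
  have hpdm : Continuous (pd i f) := by
    unfold pd
    exact (hf.continuous_fderiv (by norm_num)).clm_apply continuous_const
  -- The derivative is taken along the line x + t e, which leaves a one-parameter integral dominated
  -- by |φ| M₁.
  have key := hasDerivAt_integral_of_dominated_loc_of_deriv_le (μ := (volume : Measure (Sp d)))
    (F := fun t y => φ y * f (x - y + t • e)) (F' := fun t y => φ y * pd i f (x - y + t • e))
    (x₀ := (0 : ℝ)) (s := univ) (bound := fun y => ‖φ y‖ * M₁) univ_mem ?_ ?_ ?_ ?_ ?_ ?_
  · have h3 := key.2
    have hFx : HasDerivAt (fun t : ℝ => F (x + t • e)) (pd i F x) 0 := by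
      have h1 : HasFDerivAt F (fderiv ℝ F x) (x + (0 : ℝ) • e) := by
        simpa using (hF x).hasFDerivAt
      have h2 : HasDerivAt (fun t : ℝ => x + t • e) e 0 := by
        simpa using ((hasDerivAt_id (0 : ℝ)).smul_const e).const_add x
      exact h1.comp_hasDerivAt 0 h2
    have h4 : (fun t : ℝ => ∫ y, φ y * f (x - y + t • e)) = fun t : ℝ => F (x + t • e) := by
      funext t
      rw [← h, conv_comm, conv]
      refine integral_congr_ae (ae_of_all _ fun y => ?_)
      simp only [mul_comm (φ y)]
      congr 2; abel
    rw [h4] at h3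
    rw [← h3.unique hFx, conv_comm, conv]
    refine integral_congr_ae (ae_of_all _ fun y => ?_)
    simp [mul_comm (φ y)]
  · exact Eventually.of_forall fun t => hφ.1.mul (by
      have := hf.continuous; exact Continuous.aestronglyMeasurable (by fun_prop))
  · refine (hφ.norm.mul_const M₀).mono' (hφ.1.mul (by
      have := hf.continuous; exact Continuous.aestronglyMeasurable (by fun_prop)))
      (ae_of_all _ fun y => ?_)
    rw [norm_mul]
    gcongr
    exact hf0 _
  · exact hφ.1.mul (Continuous.aestronglyMeasurable (by fun_prop))
  · refine ae_of_all _ fun y t _ => ?_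
    rw [norm_mul]
    gcongr
    exact hf1 _
  · exact hφ.norm.mul_const M₁
  · exact ae_of_all _ fun y t _ => (hline (x - y) t).const_mul (φ y)

lemma KerBd.abs_le {k : Sp d → ℝ} {m τ : ℝ} (hk : KerBd k m τ) (hm : 0 ≤ m) (hτ : 0 < τ) (x : Sp d) :
    |k x| ≤ m * τ ^ (-(d : ℝ) / 2) := by
  have := hk.sup x
  rw [Real.enorm_eq_ofReal_abs] at this
  exact (ENNReal.ofReal_le_ofReal_iff (by positivity)).1 this

lemma KerBd.integrable_self {k : Sp d → ℝ} {m τ : ℝ} (hk : KerBd k m τ) : Integrable k :=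
  ⟨hk.meas.aestronglyMeasurable, by
    rw [hasFiniteIntegral_iff_enorm]; exact hk.mass.trans_lt (by simp)⟩

lemma conv_heatKernel_g1 (k : Fin d) {a b : ℝ} (ha : 0 < a) (hb : 0 < b) (x : Sp d) :
    conv (heatKernel d a) (g1 k b) x = g1 k (a + b) x := by
  have hC := (gC_pos d).le
  rw [← pd_heatKernel, ← pd_heatKernel]
  exact conv_pd (integrable_heatKernel ha) (contDiff_heatKernel b)
    ((kerBd_heatKernel hb).abs_le zero_le_one hb) k
    (by rw [pd_heatKernel]; exact (kerBd_g1 k hb).abs_le (by positivity) hb)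
    (differentiable_heatKernel _) (fun x => conv_heatKernel ha hb x) x

lemma conv_heatKernel_g2 (j k : Fin d) {a b : ℝ} (ha : 0 < a) (hb : 0 < b) (x : Sp d) :
    conv (heatKernel d a) (g2 j k b) x = g2 j k (a + b) x := by
  have hC := (gC_pos d).le
  rw [← pd_g1, ← pd_g1]
  exact conv_pd (integrable_heatKernel ha) (contDiff_g1 k b)
    ((kerBd_g1 k hb).abs_le (by positivity) hb) j
    (by rw [pd_g1]; exact (kerBd_g2 j k hb).abs_le (by positivity) hb)
    ((contDiff_g1 (n := 1) k _).differentiable (by norm_num))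
    (fun x => conv_heatKernel_g1 k ha hb x) x

lemma conv_heatKernel_g3 (i j k : Fin d) {a b : ℝ} (ha : 0 < a) (hb : 0 < b) (x : Sp d) :
    conv (heatKernel d a) (g3 i j k b) x = g3 i j k (a + b) x := by
  have hC := (gC_pos d).le
  rw [← pd_g2, ← pd_g2]
  exact conv_pd (integrable_heatKernel ha) (contDiff_g2 j k b)
    ((kerBd_g2 j k hb).abs_le (by positivity) hb) i
    (by rw [pd_g2]; exact (kerBd_g3 i j k hb).abs_le (by positivity) hb)
    ((contDiff_g2 (n := 1) j k _).differentiable (by norm_num))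
    (fun x => conv_heatKernel_g2 j k ha hb x) x

/-- Convolution with a superposition of Gaussians. -/
lemma conv_setIntegral {κ : ℝ → Sp d → ℝ} (hκ : Measurable (Function.uncurry κ)) {A : Set ℝ}
    (hA : MeasurableSet A) {τ : ℝ} (hτ : 0 < τ) (hAτ : A ⊆ Ici τ) {φ : ℝ → ℝ} {m : ℝ}
    (hφ : ∀ s ∈ A, 0 ≤ φ s) (hφm : ∫⁻ s in A, ENNReal.ofReal (φ s) ≤ ENNReal.ofReal m)
    (hb : ∀ s ∈ A, ∀ x, |κ s x| ≤ φ s * heatKernel d (2 * s) x) {q : ℝ≥0∞} (hq : 1 ≤ q)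
    {f : Sp d → ℝ} (hf : MemLp f q volume) (x : Sp d) :
    conv (fun x => ∫ s in A, κ s x) f x = ∫ s in A, conv (κ s) f x ∧
      IntegrableOn (fun s => conv (κ s) f x) A := by
  have hmeas : AEStronglyMeasurable (Function.uncurry fun y s => κ s (x - y) * f y)
      (volume.prod (volume.restrict A)) := by
    simp only [Function.uncurry_def]
    refine AEStronglyMeasurable.mul (Measurable.aestronglyMeasurable ?_) hf.1.comp_fst
    exact hκ.comp (measurable_snd.prodMk (measurable_const.sub measurable_fst))
  have hint : Integrable (Function.uncurry fun y s => κ s (x - y) * f y)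
      (volume.prod (volume.restrict A)) := by
    refine ⟨hmeas, ?_⟩
    rw [hasFiniteIntegral_iff_enorm, lintegral_prod_symm _ hmeas.enorm]
    simp only [Function.uncurry_apply_pair, enorm_mul]
    calc _ ≤ ∫⁻ s in A, ENNReal.ofReal (φ s)
          * (ENNReal.ofReal (τ ^ (-(d : ℝ) / 2 * rexp q)) * eLpNorm f q volume) := by
          refine setLIntegral_mono' hA fun s hs => ?_
          have hs0 : 0 < s := hτ.trans_le (hAτ hs)
          have hk := kerBd_of_le (k := κ s) (hκ.comp (measurable_const.prodMk measurable_id)) hs0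
            (hφ s hs) (hb s hs)
          refine (hk.lintegral_le hs0 (hφ s hs) hq hf.1 x).trans ?_
          rw [ENNReal.ofReal_mul (hφ s hs), mul_assoc]
          have h1 := rexp_nonneg q
          have h2 : (0 : ℝ) ≤ d / 2 := by positivity
          have h3 : s ^ (-(d : ℝ) / 2 * rexp q) ≤ τ ^ (-(d : ℝ) / 2 * rexp q) :=
            Real.rpow_le_rpow_of_nonpos hτ (hAτ hs) (by nlinarith)
          gcongr
      _ < ∞ := by
          rw [lintegral_mul_const' _ _ (ENNReal.mul_ne_top (by simp) hf.eLpNorm_ne_top)]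
          exact ENNReal.mul_lt_top (hφm.trans_lt (by simp)) (ENNReal.mul_lt_top (by simp) hf.2)
  refine ⟨?_, hint.integral_prod_right⟩
  calc ∫ y, (∫ s in A, κ s (x - y)) * f y = ∫ y, ∫ s in A, κ s (x - y) * f y := by
        simp only [integral_mul_const]
    _ = _ := integral_integral_swap hint

lemma conv_oseenKernel (i j k : Fin d) {τ : ℝ} (hτ : 0 < τ) {q : ℝ≥0∞} (hq : 1 ≤ q)
    {f : Sp d → ℝ} (hf : MemLp f q volume) (x : Sp d) :
    conv (oseenKernel i j k τ) f x = ∫ s in Ioi τ, conv (kap i j k s) f x ∧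
      IntegrableOn (fun s => conv (kap i j k s) f x) (Ioi τ) := by
  have hC := kC_pos d
  have h := conv_setIntegral (measurable_kap_uncurry i j k) (A := Ioi τ) measurableSet_Ioi hτ
    Ioi_subset_Ici_self (φ := fun s => kC d * s ^ (-(3 / 2) : ℝ))
    (fun s hs => by have : 0 < s := hτ.trans hs; positivity) (lintegral_three_half hτ _ hC.le)
    (fun s hs x => abs_kap_le i j k (hτ.trans hs) x) hq hf x
  have hK : oseenKernel i j k τ = fun x => ∫ s in Ioi τ, kap i j k s x :=
    funext fun x => oseenKernel_eq_integral i j k hτ x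
  rw [hK]
  exact h

/-- The kernel `∂ᵢ∂ⱼ∂ₖ (-Δ)⁻¹ e^{τΔ}`. -/
def g3int (i j k : Fin d) (τ : ℝ) (x : Sp d) : ℝ := ∫ s in Ioi τ, g3 i j k s x

lemma conv_g3int (i j k : Fin d) {τ : ℝ} (hτ : 0 < τ) {q : ℝ≥0∞} (hq : 1 ≤ q)
    {f : Sp d → ℝ} (hf : MemLp f q volume) (x : Sp d) :
    conv (g3int i j k τ) f x = ∫ s in Ioi τ, conv (g3 i j k s) f x ∧
      IntegrableOn (fun s => conv (g3 i j k s) f x) (Ioi τ) := by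
  have hC := gC_pos d
  exact conv_setIntegral (measurable_g3_uncurry i j k) (A := Ioi τ) measurableSet_Ioi hτ
    Ioi_subset_Ici_self (φ := fun s => gC d * s ^ (-(3 / 2) : ℝ))
    (fun s hs => by have : 0 < s := hτ.trans hs; positivity) (lintegral_three_half hτ _ hC.le)
    (fun s hs x => (abs_g3_le i j k (hτ.trans hs) x).trans_eq (by ring)) hq hf x

lemma kerBd_g3int (i j k : Fin d) {τ : ℝ} (hτ : 0 < τ) :
    KerBd (g3int i j k τ) (gC d * (2 * τ ^ (-(1 / 2) : ℝ))) τ := by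
  have hC := gC_pos d
  exact kerBd_setIntegral (measurable_g3_uncurry i j k) (A := Ioi τ) measurableSet_Ioi hτ
    Ioi_subset_Ici_self (φ := fun s => gC d * s ^ (-(3 / 2) : ℝ)) (by positivity)
    (fun s hs => by have : 0 < s := hτ.trans hs; positivity) (lintegral_three_half hτ _ hC.le)
    (fun s hs x => (abs_g3_le i j k (hτ.trans hs) x).trans_eq (by ring))

lemma memLp_one_heatKernel {a : ℝ} (ha : 0 < a) : MemLp (heatKernel d a) 1 volume :=
  memLp_one_iff_integrable.2 (integrable_heatKernel ha)

lemma integral_Ioi_add (f : ℝ → ℝ) (a b : ℝ) :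
    ∫ s in Ioi b, f (a + s) = ∫ s in Ioi (a + b), f s := by
  rw [← integral_indicator measurableSet_Ioi, ← integral_indicator measurableSet_Ioi,
    ← integral_add_left_eq_self ((Ioi (a + b)).indicator f) a]
  congr 1
  funext s
  simp [indicator]

/-- The semigroup property of the Oseen kernel. -/
lemma conv_heatKernel_oseenKernel (i j k : Fin d) {a b : ℝ} (ha : 0 < a) (hb : 0 < b) :
    conv (heatKernel d a) (oseenKernel i j k b) = oseenKernel i j k (a + b) := by
  funext x
  -- Convolution with the heat kernel translates the scale variable by a, which moves the lower
  -- limit from b to a + b.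
  have h3 : ∀ i j k : Fin d, ∫ s in Ioi b, conv (g3 i j k s) (heatKernel d a) x
      = ∫ s in Ioi (a + b), g3 i j k s x := by
    intro i j k
    rw [← integral_Ioi_add]
    refine setIntegral_congr_fun measurableSet_Ioi fun s hs => ?_
    rw [conv_comm, conv_heatKernel_g3 i j k ha (hb.trans hs)]
  have hk : oseenKernel i j k b = fun x => kd i j * g1 k b x + g3int i j k b x := by
    funext x; rw [oseenKernel_eq]; rfl
  rw [hk, oseenKernel_eq]
  have hI1 := (kerBd_heatKernel ha).integrable ha zero_le_one le_rfl
    (memLp_one_iff_integrable.2 (kerBd_g1 k hb).integrable_self) x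
  have hI2 := (kerBd_heatKernel ha).integrable ha zero_le_one le_rfl
    (memLp_one_iff_integrable.2 (kerBd_g3int i j k hb).integrable_self) x
  have hsplit : conv (heatKernel d a) (fun x => kd i j * g1 k b x + g3int i j k b x) x
      = kd i j * conv (heatKernel d a) (g1 k b) x + conv (heatKernel d a) (g3int i j k b) x := by
    unfold conv
    rw [← integral_const_mul, ← integral_add (hI1.const_mul _) hI2]
    congr 1
    funext y; ring
  rw [hsplit, conv_heatKernel_g1 k ha hb, conv_comm _ (g3int i j k b),
    (conv_g3int i j k hb le_rfl (memLp_one_heatKernel ha) x).1, h3]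

/-- Derivatives can be moved to the other factor of a convolution. -/
lemma conv_pd_left {f φ : Sp d → ℝ} (hf : ContDiff ℝ 1 f) (hφ : ContDiff ℝ 1 φ)
    (hc : HasCompactSupport φ) (i : Fin d) (x : Sp d) :
    conv (pd i f) φ x = conv f (pd i φ) x := by
  have hcont : ∀ {h : Sp d → ℝ}, ContDiff ℝ 1 h → Continuous (pd i h) := fun {h} hh => by
    unfold pd
    exact (hh.continuous_fderiv (by norm_num)).clm_apply continuous_const
  have hcpd : HasCompactSupport (pd i φ) := hc.fderiv_apply (𝕜 := ℝ) _
  have hder : ∀ y, fderiv ℝ (fun y => f (x - y)) y (EuclideanSpace.single i 1) = - pd i f (x - y) := by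
    intro y
    have h1 : HasFDerivAt f (fderiv ℝ f (x - y)) (x - y) :=
      (hf.differentiable (by norm_num) _).hasFDerivAt
    have h2 : HasFDerivAt (fun y : Sp d => x - y) (-(ContinuousLinearMap.id ℝ (Sp d))) y := by
      simpa using (hasFDerivAt_id y).const_sub x
    have h3 : HasFDerivAt (fun y => f (x - y)) _ y := h1.comp y h2
    rw [h3.fderiv]
    simp [pd]
  have hf' : Continuous fun y => f (x - y) := hf.continuous.comp (by fun_prop)
  have hpf' : Continuous fun y => pd i f (x - y) := (hcont hf).comp (by fun_prop)
  have h := integral_mul_fderiv_eq_neg_fderiv_mul_of_integrable (μ := (volume : Measure (Sp d)))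
    (f := fun y => f (x - y)) (g := φ) (v := EuclideanSpace.single i 1) ?_ ?_ ?_ ?_ ?_
  · simp only [hder] at h
    unfold conv
    simp only [neg_mul, integral_neg, neg_neg] at h
    exact h.symm
  · simp only [hder]
    exact (hpf'.neg.mul hφ.continuous).integrable_of_hasCompactSupport hc.mul_left
  · exact (hf'.mul (hcont hφ)).integrable_of_hasCompactSupport hcpd.mul_left
  · exact (hf'.mul hφ.continuous).integrable_of_hasCompactSupport hc.mul_left
  · exact fun y _ => (hf.differentiable (by norm_num) _).comp y (by fun_prop)
  · exact fun y _ => hφ.differentiable (by norm_num) _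

lemma contDiff_pd {f : Sp d → ℝ} (hf : ContDiff ℝ (⊤ : ℕ∞) f) (i : Fin d) :
    ContDiff ℝ (⊤ : ℕ∞) (pd i f) := by
  unfold pd
  exact (hf.fderiv_right (m := (⊤ : ℕ∞)) (by simp)).clm_apply contDiff_const

lemma hasCompactSupport_pd {f : Sp d → ℝ} (hf : HasCompactSupport f) (i : Fin d) :
    HasCompactSupport (pd i f) := hf.fderiv_apply (𝕜 := ℝ) _

lemma pd_pd_comm {f : Sp d → ℝ} (hf : ContDiff ℝ (⊤ : ℕ∞) f) (i j : Fin d) :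
    pd i (pd j f) = pd j (pd i f) := by
  funext x
  have h2 : ContDiff ℝ 2 f := hf.of_le (WithTop.coe_le_coe.2 (le_top : (2 : ℕ∞) ≤ ⊤))
  have hs : IsSymmSndFDerivAt ℝ f x := h2.contDiffAt.isSymmSndFDerivAt (by simp)
  have hd : DifferentiableAt ℝ (fderiv ℝ f) x :=
    (h2.fderiv_right (m := 1) (by norm_num)).differentiable (by norm_num) x
  have : ∀ i j : Fin d, pd i (pd j f) x
      = fderiv ℝ (fderiv ℝ f) x (EuclideanSpace.single i 1) (EuclideanSpace.single j 1) := by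
    intro i j
    unfold pd
    rw [fderiv_clm_apply hd (differentiableAt_const _)]
    simp
  rw [this, this]
  exact hs _ _

lemma conv_sub_left {k₁ k₂ f : Sp d → ℝ} (x : Sp d) (h1 : Integrable fun y => k₁ (x - y) * f y)
    (h2 : Integrable fun y => k₂ (x - y) * f y) :
    conv (fun x => k₁ x - k₂ x) f x = conv k₁ f x - conv k₂ f x := by
  unfold conv
  rw [← integral_sub h1 h2]
  congr 1; funext y; ring

/-- The range of the operator `e^{τΔ} ℙ ∂ₖ` is orthogonal to gradients. -/
lemma sum_conv_oseenKernel_pd (j k : Fin d) {τ : ℝ} (hτ : 0 < τ) {φ : Sp d → ℝ}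
    (hφ : ContDiff ℝ (⊤ : ℕ∞) φ) (hc : HasCompactSupport φ) (x : Sp d) :
    ∑ i, conv (oseenKernel i j k τ) (pd i φ) x = 0 := by
  have hC := kC_pos d
  have hg := gC_pos d
  have hmem : ∀ i, MemLp (pd i φ) 1 volume := fun i => memLp_one_iff_integrable.2
    ((contDiff_pd hφ i).continuous.integrable_of_hasCompactSupport (hasCompactSupport_pd hc i))
  have h1le : ∀ {f : Sp d → ℝ}, ContDiff ℝ (⊤ : ℕ∞) f → ContDiff ℝ 1 f := fun hf =>
    hf.of_le (by exact_mod_cast le_top)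
  have hg3 : ∀ (a b c : Fin d) {s : ℝ}, 0 < s → ∀ l, Integrable fun y => g3 a b c s (x - y) * pd l φ y :=
    fun a b c s hs l => (kerBd_g3 a b c hs).integrable hs (by positivity) le_rfl (hmem l) x
  -- One derivative is moved onto the test function in each term, with index j in the first and the
  -- trace index in the second. Both then have the form ∂ₗ∂ₖG * ∂ₗ∂ⱼφ, and summation over i cancels
  -- them.
  have hkap : ∀ i, ∀ s ∈ Ioi τ, conv (kap i j k s) (pd i φ) x
      = conv (g2 i k s) (pd i (pd j φ)) x - kd i j * ∑ l, conv (g2 l k s) (pd l (pd j φ)) x := by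
    intro i s hs
    have hs0 : 0 < s := hτ.trans hs
    have e1 : kap i j k s = fun x => g3 i j k s x - kd i j * ∑ l, g3 l l k s x := by
      funext x; exact kap_eq i j k hs0.ne' x
    have e2 : conv (kap i j k s) (pd i φ) x
        = conv (g3 i j k s) (pd i φ) x - kd i j * ∑ l, conv (g3 l l k s) (pd i φ) x := by
      rw [e1]
      unfold conv
      rw [← integral_finsetSum _ (fun l _ => hg3 l l k hs0 i), ← integral_const_mul,
        ← integral_sub (hg3 i j k hs0 i) ((integrable_finsetSum _ fun l _ => hg3 l l k hs0 i).const_mul _)]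
      congr 1; funext y
      rw [← Finset.sum_mul]; ring
    have e3 : ∀ l, kd i j * conv (g3 l l k s) (pd i φ) x = kd i j * conv (g2 l k s) (pd l (pd j φ)) x := by
      intro l
      by_cases hij : i = j
      · subst hij
        rw [← pd_g2, conv_pd_left (contDiff_g2 _ _ _) (h1le (contDiff_pd hφ i)) (hasCompactSupport_pd hc i)]
      · simp [kd, hij]
    rw [e2, Finset.mul_sum, Finset.sum_congr rfl fun l _ => e3 l, ← Finset.mul_sum]
    congr 1
    rw [g3_comm, ← pd_g2, conv_pd_left (contDiff_g2 _ _ _) (h1le (contDiff_pd hφ i))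
      (hasCompactSupport_pd hc i), pd_pd_comm hφ]
  rw [Finset.sum_congr rfl fun i _ => (conv_oseenKernel i j k hτ le_rfl (hmem i) x).1,
    ← integral_finsetSum _ fun i _ => (conv_oseenKernel i j k hτ le_rfl (hmem i) x).2]
  rw [setIntegral_congr_fun (g := fun _ => (0 : ℝ)) measurableSet_Ioi]
  · simp
  · intro s hs
    simp only
    rw [Finset.sum_congr rfl fun i _ => hkap i s hs, Finset.sum_sub_distrib, ← Finset.sum_mul]
    simp [kd]

end NavierStokes

/-! ### Minkowski's integral inequality and measurability of time integrals. -/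

namespace NavierStokes

section Minkowski

variable {α β : Type*} [MeasurableSpace α] [MeasurableSpace β] {ν : Measure α} {μ : Measure β}
  [SFinite μ]

/-- With dν' = n dν and h = g/n every slice of h has L^r norm at most 1. Hölder's inequality in s on
ν', whose mass is N = ∫ n dν, bounds (∫ g dν)^r by N^(r-1) ∫ h^r dν', and Tonelli finishes.
Positivity of n is what permits the division. -/
lemma eLpNorm_lintegral_le_of_pos [SFinite ν] {g : α → β → ℝ≥0∞}
    (hg : Measurable (Function.uncurry g)) {r : ℝ≥0∞} (hr : 1 ≤ r) {n : α → ℝ} (hn : Measurable n)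
    (hn0 : ∀ s, 0 < n s) (hgn : ∀ᵐ s ∂ν, eLpNorm (g s) r μ ≤ ENNReal.ofReal (n s)) :
    eLpNorm (fun x => ∫⁻ s, g s x ∂ν) r μ ≤ ∫⁻ s, ENNReal.ofReal (n s) ∂ν := by
  have hr0 : r ≠ 0 := (zero_lt_one.trans_le hr).ne'
  have hpos : ∀ s, ENNReal.ofReal (n s) ≠ 0 := fun s => by simpa using hn0 s
  by_cases hrt : r = ∞
  · subst hrt
    rw [eLpNorm_exponent_top]
    have h1 : ∀ᵐ s ∂ν, ∀ᵐ x ∂μ, g s x ≤ ENNReal.ofReal (n s) := by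
      filter_upwards [hgn] with s hs
      rw [eLpNorm_exponent_top] at hs
      filter_upwards [ae_le_eLpNormEssSup (f := g s) (μ := μ)] with x hx
      exact le_trans (by simpa using hx) hs
    have h2 : ∀ᵐ x ∂μ, ∀ᵐ s ∂ν, g s x ≤ ENNReal.ofReal (n s) := by
      rw [Measure.ae_ae_comm] at h1
      · exact h1
      · exact measurableSet_le hg (hn.ennreal_ofReal.comp measurable_fst)
    refine eLpNormEssSup_le_of_ae_enorm_bound ?_
    filter_upwards [h2] with x hx
    simpa using lintegral_mono_ae hx
  set N := ∫⁻ s, ENNReal.ofReal (n s) ∂ν with hN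
  by_cases hNt : N = ∞
  · rw [hNt]; exact le_top
  have hrp : 0 < r.toReal := ENNReal.toReal_pos hr0 hrt
  have hr1 : 1 ≤ r.toReal := by
    simpa using ENNReal.toReal_mono hrt hr
  set ν' := ν.withDensity fun s => ENNReal.ofReal (n s) with hν'
  have hν'u : ν' univ = N := by rw [hν', withDensity_apply _ MeasurableSet.univ]; simp [hN]
  have hden : ∀ f : α → ℝ≥0∞, ∫⁻ s, f s ∂ν' = ∫⁻ s, ENNReal.ofReal (n s) * f s ∂ν := fun f => by
    rw [hν', lintegral_withDensity_eq_lintegral_mul_non_measurable _ (by fun_prop) (by simp)]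
    rfl
  set h : β → α → ℝ≥0∞ := fun x s => g s x / ENNReal.ofReal (n s) with hh
  have hhm : Measurable (Function.uncurry h) := by
    refine Measurable.div (hg.comp measurable_swap) ?_
    exact hn.ennreal_ofReal.comp measurable_snd
  have hF : ∀ x, ∫⁻ s, g s x ∂ν ≤ eLpNorm (h x) r ν' * N ^ (1 - 1 / r.toReal) := by
    intro x
    have e1 : ∫⁻ s, g s x ∂ν = eLpNorm (h x) 1 ν' := by
      rw [eLpNorm_one_eq_lintegral_enorm, hden]
      refine lintegral_congr fun s => ?_
      simp only [enorm_eq_self, hh]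
      rw [ENNReal.mul_div_cancel (hpos s) (by simp)]
    rw [e1]
    refine (eLpNorm_le_eLpNorm_mul_rpow_measure_univ hr
      (hhm.comp (measurable_const.prodMk measurable_id)).aestronglyMeasurable).trans_eq ?_
    simp only [hν'u, ENNReal.toReal_one, div_one, one_div]
    rfl
  have key : ∀ x, eLpNorm (h x) r ν' ^ r.toReal = ∫⁻ s, h x s ^ r.toReal ∂ν' := by
    intro x
    rw [eLpNorm_eq_lintegral_rpow_enorm_toReal hr0 hrt, ← ENNReal.rpow_mul,
      one_div_mul_cancel hrp.ne', ENNReal.rpow_one]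
    simp
  rw [eLpNorm_eq_lintegral_rpow_enorm_toReal hr0 hrt]
  simp only [enorm_eq_self]
  have hNr : N ^ (1 - 1 / r.toReal) ≠ ∞ := by
    refine ENNReal.rpow_ne_top_of_nonneg ?_ hNt
    rw [sub_nonneg, div_le_one hrp]; exact hr1
  calc (∫⁻ x, (∫⁻ s, g s x ∂ν) ^ r.toReal ∂μ) ^ (1 / r.toReal)
      ≤ (∫⁻ x, (∫⁻ s, h x s ^ r.toReal ∂ν') * (N ^ (1 - 1 / r.toReal)) ^ r.toReal ∂μ)
          ^ (1 / r.toReal) := by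
        gcongr with x
        rw [← key, ← ENNReal.mul_rpow_of_nonneg _ _ hrp.le]
        gcongr
        exact hF x
    _ = ((∫⁻ x, ∫⁻ s, h x s ^ r.toReal ∂ν' ∂μ) * (N ^ (1 - 1 / r.toReal)) ^ r.toReal)
          ^ (1 / r.toReal) := by
        rw [lintegral_mul_const' _ _ (ENNReal.rpow_ne_top_of_nonneg hrp.le hNr)]
    _ ≤ (N * (N ^ (1 - 1 / r.toReal)) ^ r.toReal) ^ (1 / r.toReal) := by
        gcongr
        rw [lintegral_lintegral_swap (hhm.pow_const _).aemeasurable]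
        have hone : ∀ᵐ s ∂ν', ∫⁻ x, h x s ^ r.toReal ∂μ ≤ 1 := by
          have hac : ν' ≪ ν := withDensity_absolutelyContinuous _ _
          filter_upwards [hac.ae_le hgn] with s hs
          have e2 : ∫⁻ x, h x s ^ r.toReal ∂μ
              = (∫⁻ x, g s x ^ r.toReal ∂μ) / ENNReal.ofReal (n s) ^ r.toReal := by
            simp only [hh, div_eq_mul_inv]
            rw [← lintegral_mul_const' _ _ (by
              simp only [ne_eq, ENNReal.inv_eq_top]
              simpa [hrp.le, hrp] using hn0 s)]
            refine lintegral_congr fun x => ?_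
            rw [ENNReal.mul_rpow_of_nonneg _ _ hrp.le, ENNReal.inv_rpow]
          rw [e2]
          refine ENNReal.div_le_of_le_mul ?_
          rw [one_mul]
          have := ENNReal.rpow_le_rpow hs hrp.le
          rw [eLpNorm_eq_lintegral_rpow_enorm_toReal hr0 hrt, ← ENNReal.rpow_mul,
            one_div_mul_cancel hrp.ne', ENNReal.rpow_one] at this
          simpa using this
        calc _ ≤ ∫⁻ s, 1 ∂ν' := lintegral_mono_ae hone
          _ = N := by simp [hν'u]
    _ = N := by
        rw [ENNReal.mul_rpow_of_nonneg _ _ (by positivity), ← ENNReal.rpow_mul,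
          mul_one_div_cancel hrp.ne', ENNReal.rpow_one, ← ENNReal.rpow_add_of_nonneg]
        · simp
        · positivity
        · rw [sub_nonneg, div_le_one hrp]; exact hr1

/-- **Minkowski's integral inequality**. -/
lemma eLpNorm_lintegral_le [IsFiniteMeasure ν] {g : α → β → ℝ≥0∞}
    (hg : Measurable (Function.uncurry g)) {r : ℝ≥0∞} (hr : 1 ≤ r) {n : α → ℝ} (hn : Measurable n)
    (hn0 : ∀ s, 0 ≤ n s) (hgn : ∀ᵐ s ∂ν, eLpNorm (g s) r μ ≤ ENNReal.ofReal (n s)) :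
    eLpNorm (fun x => ∫⁻ s, g s x ∂ν) r μ ≤ ∫⁻ s, ENNReal.ofReal (n s) ∂ν := by
  refine ENNReal.le_of_forall_pos_le_add fun ε hε _ => ?_
  -- Adding η makes the weight positive; since ν is finite the cost η ν(univ) is at most ε. The +1
  -- avoids division by zero.
  set η : ℝ := ε / ((ν univ).toReal + 1) with hη
  have hu : 0 ≤ (ν univ).toReal := ENNReal.toReal_nonneg
  have hη0 : 0 < η := by have : (0 : ℝ) < ε := hε; positivity
  refine (eLpNorm_lintegral_le_of_pos hg hr (n := fun s => n s + η) (by fun_prop)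
    (fun s => by have := hn0 s; positivity) ?_).trans ?_
  · filter_upwards [hgn] with s hs
    exact hs.trans (ENNReal.ofReal_le_ofReal (by linarith))
  · calc _ = ∫⁻ s, (ENNReal.ofReal (n s) + ENNReal.ofReal η) ∂ν := by
          refine lintegral_congr fun s => ?_
          rw [ENNReal.ofReal_add (hn0 s) hη0.le]
      _ = ∫⁻ s, ENNReal.ofReal (n s) ∂ν + ENNReal.ofReal η * ν univ := by
          rw [lintegral_add_right _ measurable_const, lintegral_const]
      _ ≤ _ := by
          gcongr
          rw [← ENNReal.ofReal_toReal (measure_ne_top ν univ), ← ENNReal.ofReal_mul hη0.le,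
            ← ENNReal.ofReal_coe_nnreal]
          refine ENNReal.ofReal_le_ofReal ?_
          rw [hη, div_mul_eq_mul_div, div_le_iff₀ (by positivity)]
          have : (0 : ℝ) ≤ ε := ε.2
          nlinarith

end Minkowski

variable {d : ℕ}

/-- `w` agrees on `(0, t)` with a jointly measurable function. -/
def JMeas (t : ℝ) (w : ℝ → Sp d → ℝ) : Prop :=
  ∃ w' : ℝ → Sp d → ℝ, Measurable (Function.uncurry w') ∧ ∀ s ∈ Ioo 0 t, w' s = w s

/-- Curves in L^p carry no joint measurability, which Fubini needs. Continuity in s at each fixed x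
supplies it: after clamping s to a compact subinterval the function is of Carathéodory type, and the
clamped functions converge pointwise. -/
lemma jMeas_of_continuousOn {t : ℝ} {w : ℝ → Sp d → ℝ}
    (hc : ∀ x, ContinuousOn (fun s => w s x) (Ioo 0 t)) (hm : ∀ s ∈ Ioo 0 t, Measurable (w s)) :
    JMeas t w := by
  rcases le_or_gt t 0 with ht | ht
  · exact ⟨fun _ _ => 0, measurable_const, fun s hs => absurd (hs.1.trans hs.2) (not_lt.2 ht)⟩
  -- The shift by 3 gives 3 δ ≤ t for every n, so that [δ, t - δ] is a nonempty subset of (0, t)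
  -- already for n = 0.
  set δ : ℕ → ℝ := fun n => t / (n + 3) with hδ
  have hδ0 : ∀ n, 0 < δ n := fun n => by positivity
  have hδt : ∀ n, 3 * δ n ≤ t := fun n => by
    simp only [hδ]
    rw [mul_div_assoc', div_le_iff₀ (by positivity)]
    have : (0 : ℝ) ≤ n := by positivity
    nlinarith
  set c : ℕ → ℝ → ℝ := fun n s => max (min s (t - δ n)) (δ n) with hcdef
  have hcmem : ∀ n s, c n s ∈ Ioo 0 t := fun n s => by
    have h1 := hδ0 n; have h2 := hδt n
    refine ⟨h1.trans_le (le_max_right _ _), max_lt ((min_le_right _ _).trans_lt ?_) ?_⟩ <;> linarith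
  have hmeas : ∀ n, Measurable (Function.uncurry fun s x => w (c n s) x) := fun n => by
    refine measurable_uncurry_of_continuous_of_measurable (u := fun s x => w (c n s) x) (fun x => ?_)
      fun s => hm _ (hcmem n s)
    exact (hc x).comp_continuous (by fun_prop) (hcmem n)
  refine ⟨fun s x => if s ∈ Ioo 0 t then w s x else 0, ?_, fun s hs => by simp only [hs, if_true]⟩
  refine measurable_of_tendsto_metrizable (f := fun n : ℕ =>
    fun q : ℝ × Sp d => if q.1 ∈ Ioo 0 t then w (c n q.1) q.2 else 0) (fun n => ?_) ?_
  · exact Measurable.ite (measurable_fst measurableSet_Ioo) (hmeas n) measurable_const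
  · rw [tendsto_pi_nhds]
    rintro ⟨s, x⟩
    by_cases hs : s ∈ Ioo 0 t
    · simp only [Function.uncurry_apply_pair, hs, if_true]
      refine tendsto_const_nhds.congr' ?_
      have hδl : Tendsto δ atTop (𝓝 0) :=
        tendsto_const_nhds.div_atTop (tendsto_atTop_add_const_right _ _ tendsto_natCast_atTop_atTop)
      filter_upwards [hδl.eventually_lt_const hs.1,
        hδl.eventually_lt_const (by linarith [hs.2] : 0 < t - s)] with n h1 h2
      have : c n s = s := by
        simp only [hcdef]
        rw [min_eq_left (by linarith), max_eq_left h1.le]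
      rw [this]
    · simp only [Function.uncurry_apply_pair, hs, if_false]
      exact tendsto_const_nhds

lemma intervalIntegral_eq_Ioo {t : ℝ} (ht : 0 ≤ t) (f : ℝ → ℝ) :
    ∫ s in (0 : ℝ)..t, f s = ∫ s in Ioo 0 t, f s := by
  rw [intervalIntegral.integral_of_le ht, integral_Ioc_eq_integral_Ioo]

lemma JMeas.aestronglyMeasurable_integral {t : ℝ} (ht : 0 ≤ t) {w : ℝ → Sp d → ℝ} (hw : JMeas t w) :
    AEStronglyMeasurable (fun x => ∫ s in (0 : ℝ)..t, w s x) volume := by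
  obtain ⟨w', hw', he⟩ := hw
  have : (fun x => ∫ s in (0 : ℝ)..t, w s x) = fun x => ∫ s in Ioo 0 t, w' s x := by
    funext x
    rw [intervalIntegral_eq_Ioo ht]
    exact setIntegral_congr_fun measurableSet_Ioo fun s hs => by simp only [he s hs]
  rw [this]
  have h : StronglyMeasurable (Function.uncurry fun (x : Sp d) s => w' s x) :=
    (hw'.comp measurable_swap).stronglyMeasurable
  exact h.integral_prod_right.aestronglyMeasurable

lemma JMeas.eLpNorm_lintegral_le {t : ℝ} {w : ℝ → Sp d → ℝ} (hw : JMeas t w)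
    {r : ℝ≥0∞} (hr : 1 ≤ r) {n : ℝ → ℝ} (hn : Measurable n) (hn0 : ∀ s, 0 ≤ n s)
    (hwn : ∀ s ∈ Ioo 0 t, eLpNorm (w s) r volume ≤ ENNReal.ofReal (n s)) :
    eLpNorm (fun x => ∫⁻ s in Ioo 0 t, ‖w s x‖ₑ) r volume ≤ ∫⁻ s in Ioo 0 t, ENNReal.ofReal (n s) := by
  obtain ⟨w', hw', he⟩ := hw
  have : (fun x => ∫⁻ s in Ioo 0 t, ‖w s x‖ₑ) = fun x => ∫⁻ s in Ioo 0 t, ‖w' s x‖ₑ := by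
    funext x
    exact setLIntegral_congr_fun measurableSet_Ioo fun s hs => by simp only [he s hs]
  rw [this]
  refine NavierStokes.eLpNorm_lintegral_le (g := fun s x => ‖w' s x‖ₑ) hw'.enorm hr hn hn0 ?_
  filter_upwards [ae_restrict_mem measurableSet_Ioo] with s hs
  rw [eLpNorm_enorm, he s hs]
  exact hwn s hs

lemma JMeas.eLpNorm_integral_le {t : ℝ} (ht : 0 ≤ t) {w : ℝ → Sp d → ℝ} (hw : JMeas t w)
    {r : ℝ≥0∞} (hr : 1 ≤ r) {n : ℝ → ℝ} (hn : Measurable n) (hn0 : ∀ s, 0 ≤ n s)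
    (hwn : ∀ s ∈ Ioo 0 t, eLpNorm (w s) r volume ≤ ENNReal.ofReal (n s)) :
    eLpNorm (fun x => ∫ s in (0 : ℝ)..t, w s x) r volume ≤ ∫⁻ s in Ioo 0 t, ENNReal.ofReal (n s) := by
  refine le_trans (eLpNorm_mono_enorm fun x => ?_) (hw.eLpNorm_lintegral_le hr hn hn0 hwn)
  rw [intervalIntegral_eq_Ioo ht]
  simpa using enorm_integral_le_lintegral_enorm (μ := volume.restrict (Ioo 0 t)) fun s => w s x

lemma JMeas.aestronglyMeasurable_slice {t : ℝ} {w : ℝ → Sp d → ℝ} (hw : JMeas t w) (x : Sp d) :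
    AEStronglyMeasurable (fun s => w s x) (volume.restrict (Ioo 0 t)) := by
  obtain ⟨w', hw', he⟩ := hw
  refine (hw'.comp (measurable_id.prodMk (measurable_const (a := x)))).aestronglyMeasurable.congr ?_
  filter_upwards [ae_restrict_mem measurableSet_Ioo] with s hs
  simp [he s hs]

/-- Minkowski puts x ↦ ∫ |w s x| ds in L^r, so it is finite almost everywhere. Without this the time
integrals might take the default value 0 and would not be additive. -/
lemma JMeas.ae_integrableOn {t : ℝ} {w : ℝ → Sp d → ℝ} (hw : JMeas t w)
    {r : ℝ≥0∞} (hr : 1 ≤ r) {n : ℝ → ℝ} (hn : Measurable n) (hn0 : ∀ s, 0 ≤ n s)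
    (hwn : ∀ s ∈ Ioo 0 t, eLpNorm (w s) r volume ≤ ENNReal.ofReal (n s))
    (hfin : ∫⁻ s in Ioo 0 t, ENNReal.ofReal (n s) < ∞) :
    ∀ᵐ x ∂(volume : Measure (Sp d)), IntegrableOn (fun s => w s x) (Ioo 0 t) := by
  have h := (hw.eLpNorm_lintegral_le hr hn hn0 hwn).trans_lt hfin
  have h2 : ∀ᵐ x ∂(volume : Measure (Sp d)), ∫⁻ s in Ioo 0 t, ‖w s x‖ₑ < ∞ := by
    obtain ⟨w', hw', he⟩ := id hw
    have e : (fun x => ∫⁻ s in Ioo 0 t, ‖w s x‖ₑ) = fun x => ∫⁻ s in Ioo 0 t, ‖w' s x‖ₑ := by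
      funext x
      exact setLIntegral_congr_fun measurableSet_Ioo fun s hs => by simp only [he s hs]
    have hm : Measurable fun x => ∫⁻ s in Ioo 0 t, ‖w s x‖ₑ := by
      rw [e]
      exact Measurable.lintegral_prod_right' (f := fun q : Sp d × ℝ => ‖w' q.2 q.1‖ₑ)
        (hw'.comp measurable_swap).enorm
    have hr0 : r ≠ 0 := (zero_lt_one.trans_le hr).ne'
    by_cases hrt : r = ∞
    · subst hrt
      rw [eLpNorm_exponent_top] at h
      filter_upwards [ae_le_eLpNormEssSup (f := fun x => ∫⁻ s in Ioo 0 t, ‖w s x‖ₑ) (μ := volume)]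
        with x hx
      exact lt_of_le_of_lt (by simpa using hx) h
    · have h3 := lintegral_rpow_enorm_lt_top_of_eLpNorm_lt_top hr0 hrt h
      have h4 := ae_lt_top (by simpa using hm.pow_const _) h3.ne
      filter_upwards [h4] with x hx
      simp only [enorm_eq_self] at hx
      exact (ENNReal.rpow_lt_top_iff_of_pos (ENNReal.toReal_pos hr0 hrt)).1 hx
  filter_upwards [h2] with x hx
  exact ⟨hw.aestronglyMeasurable_slice x, by rwa [hasFiniteIntegral_iff_enorm]⟩

/-- Fubini's theorem for the pairing of a time integral with a function of the space variable. -/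
lemma JMeas.integral_mul_integral {t : ℝ} (ht : 0 ≤ t) {w : ℝ → Sp d → ℝ} (hw : JMeas t w)
    {r r' : ℝ≥0∞} [hrr : r'.HolderConjugate r] {n : ℝ → ℝ}
    (hwn : ∀ s ∈ Ioo 0 t, eLpNorm (w s) r volume ≤ ENNReal.ofReal (n s))
    (hfin : ∫⁻ s in Ioo 0 t, ENNReal.ofReal (n s) < ∞) {φ : Sp d → ℝ} (hφ : MemLp φ r' volume) :
    ∫ x, φ x * ∫ s in (0 : ℝ)..t, w s x = ∫ s in (0 : ℝ)..t, ∫ x, φ x * w s x := by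
  obtain ⟨w', hw', he⟩ := hw
  have e1 : ∀ x, ∫ s in (0 : ℝ)..t, w s x = ∫ s in Ioo 0 t, w' s x := fun x => by
    rw [intervalIntegral_eq_Ioo ht]
    exact setIntegral_congr_fun measurableSet_Ioo fun s hs => by simp only [he s hs]
  have e2 : ∫ s in (0 : ℝ)..t, ∫ x, φ x * w s x = ∫ s in Ioo 0 t, ∫ x, φ x * w' s x := by
    rw [intervalIntegral_eq_Ioo ht]
    exact setIntegral_congr_fun measurableSet_Ioo fun s hs => by simp only [he s hs]
  have hmeas : AEStronglyMeasurable (Function.uncurry fun x s => φ x * w' s x)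
      (volume.prod (volume.restrict (Ioo 0 t))) := by
    simp only [Function.uncurry_def]
    exact hφ.1.comp_fst.mul (hw'.comp measurable_swap).aestronglyMeasurable
  have hint : Integrable (Function.uncurry fun x s => φ x * w' s x)
      (volume.prod (volume.restrict (Ioo 0 t))) := by
    refine ⟨hmeas, ?_⟩
    rw [hasFiniteIntegral_iff_enorm, lintegral_prod_symm _ hmeas.enorm]
    simp only [Function.uncurry_apply_pair, enorm_mul]
    calc _ ≤ ∫⁻ s in Ioo 0 t, eLpNorm φ r' volume * ENNReal.ofReal (n s) := by
          refine setLIntegral_mono' measurableSet_Ioo fun s hs => ?_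
          have hinv : r'⁻¹ + r⁻¹ = 1 := ENNReal.HolderConjugate.inv_add_inv_eq_one r' r
          have h := lintegral_mul_le_of_inv_add_inv_le hinv.le hφ.1
            (hw'.comp (measurable_const.prodMk measurable_id : Measurable fun x : Sp d => (s, x))).aestronglyMeasurable
          have hr : rexp r' + rexp r = 1 := by
            unfold rexp
            rw [← ENNReal.toReal_add, hinv, ENNReal.toReal_one]
            · exact ne_top_of_le_ne_top (by simp) (le_self_add.trans hinv.le)
            · exact ne_top_of_le_ne_top (by simp) (le_add_self.trans hinv.le)
          rw [show 1 - rexp r' - rexp r = 0 by linarith, ENNReal.rpow_zero, mul_one] at h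
          refine h.trans ?_
          gcongr
          have := hwn s hs
          rw [← he s hs] at this
          exact this
      _ < ∞ := by
          rw [lintegral_const_mul' _ _ hφ.eLpNorm_ne_top]
          exact ENNReal.mul_lt_top hφ.2 hfin
  rw [e2]
  simp only [e1, ← integral_const_mul]
  exact integral_integral_swap hint

end NavierStokes

/-! ### Families of kernels and curves in L^p that are continuous in time. -/

namespace NavierStokes

variable {d : ℕ}

lemma KerBd.mono {k : Sp d → ℝ} {m m' τ τ' : ℝ} (hk : KerBd k m τ) (hm : 0 ≤ m) (hmm : m ≤ m')
    (hτ' : 0 < τ') (hτ : τ' ≤ τ) : KerBd k m' τ' where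
  meas := hk.meas
  mass := hk.mass.trans (ENNReal.ofReal_le_ofReal hmm)
  sup := fun x => (hk.sup x).trans (ENNReal.ofReal_le_ofReal (by
    have h2 : (0 : ℝ) ≤ d / 2 := by positivity
    have : 0 < τ := hτ'.trans_le hτ
    have h3 : τ ^ (-(d : ℝ) / 2) ≤ τ' ^ (-(d : ℝ) / 2) :=
      Real.rpow_le_rpow_of_nonpos hτ' hτ (by linarith)
    gcongr
    linarith))

lemma KerBd.neg {k : Sp d → ℝ} {m τ : ℝ} (hk : KerBd k m τ) : KerBd (fun x => -k x) m τ where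
  meas := hk.meas.neg
  mass := by simpa using hk.mass
  sup := fun x => by simpa using hk.sup x

lemma KerBd.add {k₁ k₂ : Sp d → ℝ} {m₁ m₂ τ : ℝ} (h₁ : KerBd k₁ m₁ τ) (h₂ : KerBd k₂ m₂ τ)
    (hm₁ : 0 ≤ m₁) (hm₂ : 0 ≤ m₂) (hτ : 0 < τ) : KerBd (fun x => k₁ x + k₂ x) (m₁ + m₂) τ where
  meas := h₁.meas.add h₂.meas
  mass := by
    rw [ENNReal.ofReal_add hm₁ hm₂]
    refine le_trans (lintegral_mono fun x => enorm_add_le _ _) ?_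
    have := h₁.meas
    rw [lintegral_add_left (by fun_prop)]
    exact add_le_add h₁.mass h₂.mass
  sup := fun x => by
    rw [add_mul, ENNReal.ofReal_add (by positivity) (by positivity)]
    exact (enorm_add_le _ _).trans (add_le_add (h₁.sup x) (h₂.sup x))

lemma KerBd.sub {k₁ k₂ : Sp d → ℝ} {m₁ m₂ τ : ℝ} (h₁ : KerBd k₁ m₁ τ) (h₂ : KerBd k₂ m₂ τ)
    (hm₁ : 0 ≤ m₁) (hm₂ : 0 ≤ m₂) (hτ : 0 < τ) : KerBd (fun x => k₁ x - k₂ x) (m₁ + m₂) τ := by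
  simpa [sub_eq_add_neg] using h₁.add h₂.neg hm₁ hm₂ hτ

/-- Kernels belong to all Lebesgue spaces. -/
lemma KerBd.memLp {k : Sp d → ℝ} {m τ : ℝ} (hk : KerBd k m τ) {q : ℝ≥0∞} (hq : 1 ≤ q) :
    MemLp k q volume := by
  have hm := hk.meas
  have hq0 : q ≠ 0 := (zero_lt_one.trans_le hq).ne'
  refine ⟨hm.aestronglyMeasurable, ?_⟩
  by_cases hqt : q = ∞
  · subst hqt
    rw [eLpNorm_exponent_top]
    exact (eLpNormEssSup_le_of_ae_enorm_bound (ae_of_all _ hk.sup)).trans_lt (by simp)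
  have hq1 : 1 ≤ q.toReal := by simpa using ENNReal.toReal_mono hqt hq
  rw [eLpNorm_lt_top_iff_lintegral_rpow_enorm_lt_top hq0 hqt]
  calc ∫⁻ x, ‖k x‖ₑ ^ q.toReal
      ≤ ∫⁻ x, ENNReal.ofReal (m * τ ^ (-(d : ℝ) / 2)) ^ (q.toReal - 1) * ‖k x‖ₑ := by
        refine lintegral_mono fun x => ?_
        have : ‖k x‖ₑ ^ q.toReal = ‖k x‖ₑ ^ (q.toReal - 1) * ‖k x‖ₑ := by
          nth_rewrite 3 [← ENNReal.rpow_one ‖k x‖ₑ]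
          rw [← ENNReal.rpow_add_of_nonneg _ _ (by linarith) zero_le_one, sub_add_cancel]
        simp only
        rw [this]
        gcongr
        exact hk.sup x
    _ < ∞ := by
        rw [lintegral_const_mul' _ _ (ENNReal.rpow_ne_top_of_nonneg (by linarith) (by simp))]
        exact ENNReal.mul_lt_top
          (ENNReal.rpow_lt_top_of_nonneg (by linarith) (by simp)) (hk.mass.trans_lt (by simp))

lemma KerBd.memLp_shift {k : Sp d → ℝ} {m τ : ℝ} (hk : KerBd k m τ) {q : ℝ≥0∞} (hq : 1 ≤ q)
    (x : Sp d) : MemLp (fun y => k (x - y)) q volume :=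
  (hk.memLp hq).comp_measurePreserving (Measure.measurePreserving_sub_left volume x)

/-- The Lipschitz case θ = 1, made symmetric in the two times by measuring the singularity at a
common lower bound c. -/
lemma kerBd_oseenKernel_sub' (i j k : Fin d) {a b c : ℝ} (hc : 0 < c) (ha : c ≤ a) (hb : c ≤ b) :
    KerBd (fun x => oseenKernel i j k a x - oseenKernel i j k b x)
      (2 * kC d * (|b - a| * c ^ (-(3 / 2) : ℝ))) c := by
  have hC := kC_pos d
  have key : ∀ {a b : ℝ}, c ≤ a → a ≤ b →
      KerBd (fun x => oseenKernel i j k a x - oseenKernel i j k b x)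
      (2 * kC d * (|b - a| * c ^ (-(3 / 2) : ℝ))) c := by
    intro a b ha hab
    have ha0 := hc.trans_le ha
    have hba : 0 ≤ b - a := by linarith
    refine (kerBd_oseenKernel_sub i j k ha0 hab zero_le_one le_rfl).mono (by positivity) ?_ hc ha
    rw [Real.rpow_one, abs_of_nonneg hba, show (-(1 / 2) - 1 : ℝ) = -(3 / 2) by norm_num]
    have := Real.rpow_le_rpow_of_nonpos hc ha (by norm_num : (-(3 / 2) : ℝ) ≤ 0)
    gcongr
  rcases le_total a b with h | h
  · exact key ha h
  · have := (key hb h).neg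
    rw [abs_sub_comm] at this
    simpa using this

/-- A family of kernels on `(0, t)` that is continuous in time. -/
structure KerFam (t : ℝ) (k : ℝ → Sp d → ℝ) : Prop where
  bd : ∀ s ∈ Ioo 0 t, ∃ m τ : ℝ, 0 ≤ m ∧ 0 < τ ∧ KerBd (k s) m τ
  cont : ∀ s₀ ∈ Ioo 0 t, ∃ τ : ℝ, 0 < τ ∧ ∃ m : ℝ → ℝ,
    (∀ᶠ s in 𝓝[Ioo 0 t] s₀, 0 ≤ m s ∧ KerBd (fun x => k s x - k s₀ x) (m s) τ) ∧
      Tendsto m (𝓝[Ioo 0 t] s₀) (𝓝 0)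

lemma kerFam_oseenKernel (i j k : Fin d) {t t' : ℝ} (h : t ≤ t') :
    KerFam t fun s => oseenKernel i j k (t' - s) where
  bd := fun s hs => by
    have hC := kC_pos d
    have : 0 < t' - s := by linarith [hs.2]
    exact ⟨_, _, by positivity, this, kerBd_oseenKernel i j k this⟩
  cont := fun s₀ hs₀ => by
    have hC := kC_pos d
    have h0 : 0 < t' - s₀ := by linarith [hs₀.2]
    refine ⟨(t' - s₀) / 2, by positivity,
      fun s => 2 * kC d * (|(t' - s₀) - (t' - s)| * ((t' - s₀) / 2) ^ (-(3 / 2) : ℝ)), ?_, ?_⟩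
    · have : ∀ᶠ s in 𝓝 s₀, s < s₀ + (t' - s₀) / 2 := eventually_lt_nhds (by linarith)
      filter_upwards [nhdsWithin_le_nhds this] with s hs
      exact ⟨by positivity, kerBd_oseenKernel_sub' i j k (by positivity) (by linarith) (by linarith)⟩
    · refine Tendsto.mono_left ?_ nhdsWithin_le_nhds
      have : Continuous fun s : ℝ => 2 * kC d * (|(t' - s₀) - (t' - s)| * ((t' - s₀) / 2) ^ (-(3 / 2) : ℝ)) := by
        fun_prop
      simpa using this.tendsto s₀

lemma KerFam.sub {t : ℝ} {k₁ k₂ : ℝ → Sp d → ℝ} (h₁ : KerFam t k₁) (h₂ : KerFam t k₂) :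
    KerFam t fun s x => k₁ s x - k₂ s x where
  bd := fun s hs => by
    obtain ⟨m₁, τ₁, hm₁, hτ₁, hk₁⟩ := h₁.bd s hs
    obtain ⟨m₂, τ₂, hm₂, hτ₂, hk₂⟩ := h₂.bd s hs
    have hτ : 0 < min τ₁ τ₂ := lt_min hτ₁ hτ₂
    exact ⟨m₁ + m₂, min τ₁ τ₂, by positivity, hτ,
      (hk₁.mono hm₁ le_rfl hτ (min_le_left _ _)).sub (hk₂.mono hm₂ le_rfl hτ (min_le_right _ _))
        hm₁ hm₂ hτ⟩
  cont := fun s₀ hs₀ => by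
    obtain ⟨τ₁, hτ₁, m₁, he₁, ht₁⟩ := h₁.cont s₀ hs₀
    obtain ⟨τ₂, hτ₂, m₂, he₂, ht₂⟩ := h₂.cont s₀ hs₀
    have hτ : 0 < min τ₁ τ₂ := lt_min hτ₁ hτ₂
    refine ⟨min τ₁ τ₂, hτ, fun s => m₁ s + m₂ s, ?_, by simpa using ht₁.add ht₂⟩
    filter_upwards [he₁, he₂] with s h1 h2
    refine ⟨add_nonneg h1.1 h2.1, ?_⟩
    have := (h1.2.mono h1.1 le_rfl hτ (min_le_left _ _)).sub
      (h2.2.mono h2.1 le_rfl hτ (min_le_right _ _)) h1.1 h2.1 hτ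
    convert this using 2
    ring

/-- A family of scalar functions on `(0, t)` that is continuous in `L^q`. -/
structure Src (q : ℝ≥0∞) (t : ℝ) (f : ℝ → Sp d → ℝ) : Prop where
  mem : ∀ s ∈ Ioo 0 t, MemLp (f s) q volume
  cont : ∀ s₀ ∈ Ioo 0 t, Tendsto (fun s => eLpNorm (f s - f s₀) q volume) (𝓝[Ioo 0 t] s₀) (𝓝 0)

lemma eLpNorm_le_add_sub {E : Type*} [NormedAddCommGroup E] {q : ℝ≥0∞} (hq : 1 ≤ q)
    {f g : Sp d → E} (hf : AEStronglyMeasurable f volume) (hg : AEStronglyMeasurable g volume) :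
    eLpNorm f q volume ≤ eLpNorm g q volume + eLpNorm (f - g) q volume := by
  have : f = g + (f - g) := by simp
  nth_rewrite 1 [this]
  exact eLpNorm_add_le hg (hf.sub hg) hq

/-- The increment splits into the increment of the kernel acting on f(s) and the fixed kernel acting
on the increment of f. Both are small at every point, by the pointwise form of Young's inequality.
-/
lemma continuousOn_conv {t : ℝ} {k f : ℝ → Sp d → ℝ} (hk : KerFam t k) {q : ℝ≥0∞} (hq : 1 ≤ q)
    (hf : Src q t f) (x : Sp d) : ContinuousOn (fun s => conv (k s) (f s) x) (Ioo 0 t) := by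
  intro s₀ hs₀
  obtain ⟨m₀, τ₀, hm₀, hτ₀, hk₀⟩ := hk.bd s₀ hs₀
  obtain ⟨τ, hτ, m, he, hm⟩ := hk.cont s₀ hs₀
  have hc := hf.cont s₀ hs₀
  rw [ContinuousWithinAt, tendsto_iff_edist_tendsto_0]
  set F : ℝ → ℝ≥0∞ := fun s => eLpNorm (f s - f s₀) q volume with hF
  set N := eLpNorm (f s₀) q volume with hN
  have hNt : N ≠ ∞ := (hf.mem s₀ hs₀).eLpNorm_ne_top
  set D : ℝ → ℝ≥0∞ := fun s =>
    ENNReal.ofReal (m s * τ ^ (-(d : ℝ) / 2 * rexp q)) * (N + F s)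
      + ENNReal.ofReal (m₀ * τ₀ ^ (-(d : ℝ) / 2 * rexp q)) * F s with hD
  have hDlim : Tendsto D (𝓝[Ioo 0 t] s₀) (𝓝 0) := by
    have h1 : Tendsto (fun s => ENNReal.ofReal (m s * τ ^ (-(d : ℝ) / 2 * rexp q)))
        (𝓝[Ioo 0 t] s₀) (𝓝 0) := by
      have := ENNReal.tendsto_ofReal (hm.mul_const (τ ^ (-(d : ℝ) / 2 * rexp q)))
      simpa using this
    have h2 : Tendsto (fun s => N + F s) (𝓝[Ioo 0 t] s₀) (𝓝 N) := by
      simpa using tendsto_const_nhds.add hc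
    have h3 := ENNReal.Tendsto.mul h1 (Or.inr hNt) h2 (Or.inr (by simp))
    have h4 : Tendsto (fun s => ENNReal.ofReal (m₀ * τ₀ ^ (-(d : ℝ) / 2 * rexp q)) * F s)
        (𝓝[Ioo 0 t] s₀) (𝓝 0) := by
      simpa using ENNReal.Tendsto.const_mul hc (Or.inr (by simp))
    simpa using h3.add h4
  refine tendsto_of_tendsto_of_tendsto_of_le_of_le' tendsto_const_nhds hDlim
    (Eventually.of_forall fun _ => zero_le) ?_
  filter_upwards [he, self_mem_nhdsWithin] with s hs hsI
  obtain ⟨hms, hks⟩ := hs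
  obtain ⟨m₁, τ₁, hm₁, hτ₁, hk₁⟩ := hk.bd s hsI
  have hfs := hf.mem s hsI
  have hfs₀ := hf.mem s₀ hs₀
  have i1 := hks.integrable hτ hms hq hfs x
  have i2 := hk₀.integrable hτ₀ hm₀ hq (hfs.sub hfs₀) x
  have i3 := hk₁.integrable hτ₁ hm₁ hq hfs x
  have i4 := hk₀.integrable hτ₀ hm₀ hq hfs₀ x
  have e : conv (k s) (f s) x - conv (k s₀) (f s₀) x
      = conv (fun x => k s x - k s₀ x) (f s) x + conv (k s₀) (f s - f s₀) x := by
    unfold conv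
    rw [← integral_sub i3 i4, ← integral_add i1 i2]
    congr 1; funext y
    simp only [Pi.sub_apply]; ring
  rw [edist_eq_enorm_sub, e]
  refine (enorm_add_le _ _).trans ?_
  refine add_le_add ?_ ?_
  · refine (hks.enorm_conv_le hτ hms hq hfs.1 x).trans ?_
    gcongr
    exact eLpNorm_le_add_sub hq hfs.1 hfs₀.1
  · exact hk₀.enorm_conv_le hτ₀ hm₀ hq (hfs.1.sub hfs₀.1) x

lemma jMeas_conv {t : ℝ} {k f : ℝ → Sp d → ℝ} (hk : KerFam t k) {q : ℝ≥0∞} (hq : 1 ≤ q)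
    (hf : Src q t f) : JMeas t fun s => conv (k s) (f s) := by
  refine jMeas_of_continuousOn (fun x => continuousOn_conv hk hq hf x) fun s hs => ?_
  obtain ⟨m, τ, -, -, h⟩ := hk.bd s hs
  exact measurable_conv h.meas (hf.mem s hs).1

/-- A bounded curve in `L^p` on `(0, T]`. -/
structure IsCurve {E : Type*} [NormedAddCommGroup E] (p : ℝ≥0∞) (T : ℝ) (u : ℝ → Sp d → E) :
    Prop where
  mem : ∀ t ∈ Ioc 0 T, MemLp (u t) p volume
  cont : ∀ t ∈ Ioc 0 T, Tendsto (fun s => eLpNorm (u s - u t) p volume) (𝓝[Ioc 0 T] t) (𝓝 0)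
  bdd : ∃ M : ℝ, 0 ≤ M ∧ ∀ s ∈ Ioc 0 T, eLpNorm (u s) p volume ≤ ENNReal.ofReal M

section Curve

variable {E : Type*} [NormedAddCommGroup E]

lemma IsCurve.mono {p : ℝ≥0∞} {T T' : ℝ} {u : ℝ → Sp d → E} (hu : IsCurve p T u) (h : T' ≤ T) :
    IsCurve p T' u where
  mem := fun t ht => hu.mem t ⟨ht.1, ht.2.trans h⟩
  cont := fun t ht => (hu.cont t ⟨ht.1, ht.2.trans h⟩).mono_left
    (nhdsWithin_mono _ fun _ hs => ⟨hs.1, hs.2.trans h⟩)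
  bdd := by
    obtain ⟨M, hM, hb⟩ := hu.bdd
    exact ⟨M, hM, fun s hs => hb s ⟨hs.1, hs.2.trans h⟩⟩

lemma IsCurve.sub {p : ℝ≥0∞} (hp : 1 ≤ p) {T : ℝ} {u v : ℝ → Sp d → E} (hu : IsCurve p T u)
    (hv : IsCurve p T v) : IsCurve p T fun s => u s - v s where
  mem := fun t ht => (hu.mem t ht).sub (hv.mem t ht)
  cont := fun t ht => by
    refine tendsto_of_tendsto_of_tendsto_of_le_of_le' tendsto_const_nhds
      (by simpa using (hu.cont t ht).add (hv.cont t ht)) (Eventually.of_forall fun _ => zero_le) ?_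
    filter_upwards [self_mem_nhdsWithin] with s hs
    rw [show u s - v s - (u t - v t) = (u s - u t) - (v s - v t) by abel]
    exact eLpNorm_sub_le ((hu.mem s hs).1.sub (hu.mem t ht).1) ((hv.mem s hs).1.sub (hv.mem t ht).1) hp
  bdd := by
    obtain ⟨M, hM, hb⟩ := hu.bdd
    obtain ⟨N, hN, hc⟩ := hv.bdd
    refine ⟨M + N, by positivity, fun s hs => ?_⟩
    rw [ENNReal.ofReal_add hM hN]
    exact (eLpNorm_sub_le (hu.mem s hs).1 (hv.mem s hs).1 hp).trans (add_le_add (hb s hs) (hc s hs))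

/-- Time translation of a curve. -/
lemma IsCurve.shift {p : ℝ≥0∞} {T t₀ : ℝ} {u : ℝ → Sp d → E} (hu : IsCurve p T u) (ht₀ : 0 ≤ t₀) :
    IsCurve p (T - t₀) fun s => u (t₀ + s) where
  mem := fun t ht => hu.mem _ ⟨by linarith [ht.1], by linarith [ht.2]⟩
  cont := fun t ht => by
    refine (hu.cont (t₀ + t) ⟨by linarith [ht.1], by linarith [ht.2]⟩).comp ?_
    refine tendsto_nhdsWithin_iff.2 ⟨?_, ?_⟩
    · exact Tendsto.mono_left (by
        have : Continuous fun s : ℝ => t₀ + s := by fun_prop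
        exact this.tendsto t) nhdsWithin_le_nhds
    · filter_upwards [self_mem_nhdsWithin] with s hs
      exact ⟨by linarith [hs.1], by linarith [hs.2]⟩
  bdd := by
    obtain ⟨M, hM, hb⟩ := hu.bdd
    exact ⟨M, hM, fun s hs => hb _ ⟨by linarith [hs.1], by linarith [hs.2]⟩⟩

end Curve

lemma eLpNorm_coord_le (f : Sp d → Sp d) (j : Fin d) (p : ℝ≥0∞) :
    eLpNorm (fun y => f y j) p volume ≤ eLpNorm f p volume :=
  eLpNorm_mono fun y => by simpa using PiLp.norm_apply_le (f y) j

lemma memLp_coord {f : Sp d → Sp d} {p : ℝ≥0∞} (hf : MemLp f p volume) (j : Fin d) :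
    MemLp (fun y => f y j) p volume := hf.eval_piLp j

lemma holder_half (p : ℝ≥0∞) : ENNReal.HolderTriple p p (p / 2) where
  inv_add_inv_eq_inv := by
    rw [ENNReal.inv_div (by simp) (by simp), ENNReal.div_eq_inv_mul, mul_comm, two_mul]

/-- Products of components of curves. -/
lemma IsCurve.src {p : ℝ≥0∞} (hp : 2 ≤ p) {T t : ℝ} (ht : t ≤ T) {u v : ℝ → Sp d → Sp d}
    (hu : IsCurve p T u) (hv : IsCurve p T v) (j k : Fin d) :
    Src (p / 2) t fun s y => u s y j * v s y k := by
  have hH := holder_half p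
  have hp2 : 1 ≤ p / 2 := by
    rw [ENNReal.le_div_iff_mul_le (by simp) (by simp)]; simpa using hp
  have hsub : ∀ {s : ℝ}, s ∈ Ioo 0 t → s ∈ Ioc 0 T := fun hs => ⟨hs.1, hs.2.le.trans ht⟩
  refine ⟨fun s hs => ?_, fun s₀ hs₀ => ?_⟩
  · exact (memLp_coord (hv.mem s (hsub hs)) k).mul (memLp_coord (hu.mem s (hsub hs)) j)
  have hu₀ := hu.mem s₀ (hsub hs₀)
  have hv₀ := hv.mem s₀ (hsub hs₀)
  have hnhds : 𝓝[Ioo 0 t] s₀ ≤ 𝓝[Ioc 0 T] s₀ := nhdsWithin_mono _ fun _ hs => hsub hs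
  have hcu := (hu.cont s₀ (hsub hs₀)).mono_left hnhds
  have hcv := (hv.cont s₀ (hsub hs₀)).mono_left hnhds
  obtain ⟨N, hN, hNb⟩ := hv.bdd
  have hlim : Tendsto (fun s => eLpNorm (u s - u s₀) p volume * ENNReal.ofReal N
      + eLpNorm (u s₀) p volume * eLpNorm (v s - v s₀) p volume) (𝓝[Ioo 0 t] s₀) (𝓝 0) := by
    have h1 := ENNReal.Tendsto.mul_const hcu (b := ENNReal.ofReal N) (Or.inr (by simp))
    have h2 := ENNReal.Tendsto.const_mul hcv (a := eLpNorm (u s₀) p volume)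
      (Or.inr hu₀.eLpNorm_ne_top)
    simpa using h1.add h2
  refine tendsto_of_tendsto_of_tendsto_of_le_of_le' tendsto_const_nhds hlim
    (Eventually.of_forall fun _ => zero_le) ?_
  filter_upwards [self_mem_nhdsWithin] with s hs
  have hus := hu.mem s (hsub hs)
  have hvs := hv.mem s (hsub hs)
  -- The increment of the product is split as (δu) v(s) + u(s₀) (δv); each summand is estimated in
  -- L^{p/2}.
  have e : (fun y => u s y j * v s y k) - (fun y => u s₀ y j * v s₀ y k)
      = (fun y => (u s - u s₀) y j * v s y k) + fun y => u s₀ y j * (v s - v s₀) y k := by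
    funext y; simp; ring
  have mul_le : ∀ {f g : Sp d → Sp d}, MemLp f p volume → MemLp g p volume →
      eLpNorm (fun y => f y j * g y k) (p / 2) volume ≤ eLpNorm f p volume * eLpNorm g p volume := by
    intro f g hf hg
    have h := eLpNorm_smul_le_mul_eLpNorm (p := p) (q := p) (r := p / 2)
      (memLp_coord hg k).1 (memLp_coord hf j).1
    exact h.trans (mul_le_mul' (eLpNorm_coord_le f j p) (eLpNorm_coord_le g k p))
  have m1 : MemLp (fun y => (u s - u s₀) y j * v s y k) (p / 2) volume :=
    (memLp_coord hvs k).mul (memLp_coord (hus.sub hu₀) j)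
  have m2 : MemLp (fun y => u s₀ y j * (v s - v s₀) y k) (p / 2) volume :=
    (memLp_coord (hvs.sub hv₀) k).mul (memLp_coord hu₀ j)
  rw [e]
  refine (eLpNorm_add_le m1.1 m2.1 hp2).trans (add_le_add ?_ ?_)
  · exact (mul_le (hus.sub hu₀) hvs).trans (by gcongr; exact hNb s (hsub hs))
  · exact mul_le hu₀ (hvs.sub hv₀)

end NavierStokes

/-! ### Duhamel integrals with a general matrix of kernels. -/

namespace NavierStokes

variable {d : ℕ}

/-- The exponent `1/2 + d/(2p)` of the singularity of the bilinear estimate. -/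
def sing (d : ℕ) (p : ℝ≥0∞) : ℝ := 1 / 2 + d / 2 * rexp p

lemma sing_pos (d : ℕ) (p : ℝ≥0∞) : 0 < sing d p := by
  have := rexp_nonneg p
  unfold sing; positivity

/-- A trilinear Duhamel integral with a general matrix of kernels. -/
def trip (K : Fin d → Fin d → Fin d → ℝ → Sp d → ℝ) (u v : ℝ → Sp d → Sp d) (t : ℝ) (x : Sp d) :
    Sp d :=
  WithLp.toLp 2 fun i => ∑ j, ∑ k,
    ∫ s in (0 : ℝ)..t, conv (K i j k s) (fun y => u s y j * v s y k) x

/-- A matrix of kernels on `(0, t)` whose bilinear bound is controlled by the integrable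
function `n`. -/
structure Ker3 (p : ℝ≥0∞) (t : ℝ) (K : Fin d → Fin d → Fin d → ℝ → Sp d → ℝ) (n : ℝ → ℝ) :
    Prop where
  fam : ∀ i j k, KerFam t (K i j k)
  meas : Measurable n
  nonneg : ∀ s ∈ Ioo 0 t, 0 ≤ n s
  fin : ∫⁻ s in Ioo 0 t, ENNReal.ofReal (n s) < ∞
  bd : ∀ s ∈ Ioo 0 t, ∀ i j k, ∃ m τ : ℝ, 0 ≤ m ∧ 0 < τ ∧ KerBd (K i j k s) m τ ∧
    m * τ ^ (-(d : ℝ) / 2 * rexp p) ≤ n s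

lemma eLpNorm_sum_le_of_le {ι : Type*} {s : Finset ι} {r : ℝ≥0∞} (hr : 1 ≤ r) {f : ι → Sp d → ℝ}
    (hf : ∀ i ∈ s, AEStronglyMeasurable (f i) volume) {b : ι → ℝ≥0∞}
    (hb : ∀ i ∈ s, eLpNorm (f i) r volume ≤ b i) :
    eLpNorm (fun x => ∑ i ∈ s, f i x) r volume ≤ ∑ i ∈ s, b i := by
  have : (fun x => ∑ i ∈ s, f i x) = ∑ i ∈ s, f i := by funext x; simp
  rw [this]
  exact (eLpNorm_sum_le hf hr).trans (Finset.sum_le_sum hb)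

lemma norm_toLp_le (f : Fin d → ℝ) : ‖(WithLp.toLp 2 f : Sp d)‖ ≤ ∑ i, ‖f i‖ := by
  have : (WithLp.toLp 2 f : Sp d) = ∑ i, f i • EuclideanSpace.single i (1 : ℝ) := by
    ext j
    simp [Finset.sum_apply, Pi.single_apply]
  rw [this]
  exact (norm_sum_le _ _).trans_eq (by simp [norm_smul])

section Trip

variable {p : ℝ≥0∞} {T t : ℝ} {u v : ℝ → Sp d → Sp d}
  {K : Fin d → Fin d → Fin d → ℝ → Sp d → ℝ} {n : ℝ → ℝ}

lemma one_le_half (hp : 2 ≤ p) : 1 ≤ p / 2 := by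
  rw [ENNReal.le_div_iff_mul_le (by simp) (by simp)]; simpa using hp

lemma jMeas_trip (hp : 2 ≤ p) (ht : t ≤ T) (hK : ∀ i j k, KerFam t (K i j k)) (hu : IsCurve p T u)
    (hv : IsCurve p T v) (i j k : Fin d) :
    JMeas t fun s => conv (K i j k s) (fun y => u s y j * v s y k) :=
  jMeas_conv (hK i j k) (one_le_half hp) (IsCurve.src hp ht hu hv j k)

lemma aestronglyMeasurable_trip (hp : 2 ≤ p) (ht0 : 0 ≤ t) (ht : t ≤ T)
    (hK : ∀ i j k, KerFam t (K i j k)) (hu : IsCurve p T u) (hv : IsCurve p T v) :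
    AEStronglyMeasurable (trip K u v t) volume := by
  have h : AEStronglyMeasurable (fun x => fun i => ∑ j, ∑ k,
      ∫ s in (0 : ℝ)..t, conv (K i j k s) (fun y => u s y j * v s y k) x) volume := by
    refine (aemeasurable_pi_lambda _ fun i => ?_).aestronglyMeasurable
    refine Finset.aemeasurable_fun_sum _ fun j _ => Finset.aemeasurable_fun_sum _ fun k _ => ?_
    exact ((jMeas_trip hp ht hK hu hv i j k).aestronglyMeasurable_integral ht0).aemeasurable
  exact (PiLp.continuous_toLp 2 _).comp_aestronglyMeasurable h

lemma eLpNorm_conv_coord_le {p r : ℝ≥0∞} (hpr : p⁻¹ + r⁻¹ ≤ 1) {k : Sp d → ℝ} {m τ n A B : ℝ}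
    (hm : 0 ≤ m) (hτ : 0 < τ) (hk : KerBd k m τ) (hn : m * τ ^ (-(d : ℝ) / 2 * rexp p) ≤ n)
    {u v : Sp d → Sp d} (hum : AEStronglyMeasurable u volume) (hv : AEStronglyMeasurable v volume)
    (hA0 : 0 ≤ A) (hA : eLpNorm u p volume ≤ ENNReal.ofReal A)
    (hB : eLpNorm v r volume ≤ ENNReal.ofReal B) (j l : Fin d) :
    eLpNorm (conv k (fun y => u y j * v y l)) r volume ≤ ENNReal.ofReal (n * (A * B)) := by
  have hu : MemLp u p volume := ⟨hum, hA.trans_lt (by simp)⟩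
  have hn0 : 0 ≤ n := le_trans (by positivity) hn
  have hvl : AEStronglyMeasurable (fun y => v y l) volume :=
    (PiLp.continuous_apply 2 _ l).comp_aestronglyMeasurable hv
  refine (hk.eLpNorm_conv_mul_le hτ hm hpr (memLp_coord hu j) hvl).trans ?_
  rw [ENNReal.ofReal_mul hn0, ENNReal.ofReal_mul hA0]
  gcongr
  · exact (eLpNorm_coord_le u j p).trans hA
  · exact (eLpNorm_coord_le v l r).trans hB

/-- The pieces of the trilinear integral are bounded in `L^r` by integrable functions. -/
lemma eLpNorm_trip_piece_le {p₁ r : ℝ≥0∞} (hK : Ker3 p₁ t K n)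
    (hpr : p₁⁻¹ + r⁻¹ ≤ 1) (ht : t ≤ T) (hu : IsCurve p T u) (hv : IsCurve p T v) {A B : ℝ → ℝ}
    (hA0 : ∀ s ∈ Ioo 0 t, 0 ≤ A s)
    (hA : ∀ s ∈ Ioo 0 t, eLpNorm (u s) p₁ volume ≤ ENNReal.ofReal (A s))
    (hB : ∀ s ∈ Ioo 0 t, eLpNorm (v s) r volume ≤ ENNReal.ofReal (B s))
    (i j k : Fin d) : ∀ s ∈ Ioo 0 t,
      eLpNorm (conv (K i j k s) (fun y => u s y j * v s y k)) r volume
        ≤ ENNReal.ofReal (n s * (A s * B s)) := by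
  intro s hs
  obtain ⟨m, τ, hm, hτ, hk, hmn⟩ := hK.bd s hs i j k
  have hsT : s ∈ Ioc 0 T := ⟨hs.1, hs.2.le.trans ht⟩
  exact eLpNorm_conv_coord_le hpr hm hτ hk hmn (hu.mem s hsT).1 (hv.mem s hsT).1 (hA0 s hs)
    (hA s hs) (hB s hs) j k

/-- The bilinear estimate. -/
lemma eLpNorm_trip_le (hp : 2 ≤ p) {p₁ r : ℝ≥0∞} (hK : Ker3 p₁ t K n)
    (hpr : p₁⁻¹ + r⁻¹ ≤ 1) (ht0 : 0 ≤ t) (ht : t ≤ T) (hu : IsCurve p T u) (hv : IsCurve p T v)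
    {A B : ℝ → ℝ} (hAm : Measurable A) (hBm : Measurable B)
    (hA0 : ∀ s ∈ Ioo 0 t, 0 ≤ A s) (hB0 : ∀ s ∈ Ioo 0 t, 0 ≤ B s)
    (hA : ∀ s ∈ Ioo 0 t, eLpNorm (u s) p₁ volume ≤ ENNReal.ofReal (A s))
    (hB : ∀ s ∈ Ioo 0 t, eLpNorm (v s) r volume ≤ ENNReal.ofReal (B s)) :
    eLpNorm (trip K u v t) r volume
      ≤ ENNReal.ofReal (d ^ 3) * ∫⁻ s in Ioo 0 t, ENNReal.ofReal (n s * (A s * B s)) := by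
  have hr : 1 ≤ r := ENNReal.inv_le_one.1 (le_add_self.trans hpr)
  have hnm := hK.meas
  set I := ∫⁻ s in Ioo 0 t, ENNReal.ofReal (n s * (A s * B s)) with hI
  have hJ := jMeas_trip hp ht hK.fam hu hv
  have piece : ∀ i j k, eLpNorm (fun x => ∫ s in (0 : ℝ)..t,
      conv (K i j k s) (fun y => u s y j * v s y k) x) r volume ≤ I := by
    intro i j k
    -- The bound is cut off outside (0, t), because Minkowski's inequality is stated for weights
    -- that are nonnegative at all times.
    have h := (hJ i j k).eLpNorm_integral_le ht0 hr
      (n := (Ioo 0 t).indicator fun s => n s * (A s * B s))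
      (Measurable.indicator (by fun_prop) measurableSet_Ioo)
      (fun s => indicator_nonneg (fun s hs => by
        have := hK.nonneg s hs; have := hA0 s hs; have := hB0 s hs; positivity) s)
      (fun s hs => by
        rw [indicator_of_mem hs]
        exact eLpNorm_trip_piece_le hK hpr ht hu hv hA0 hA hB i j k s hs)
    refine h.trans_eq ?_
    exact setLIntegral_congr_fun measurableSet_Ioo fun s hs => by simp only [indicator_of_mem hs]
  calc eLpNorm (trip K u v t) r volume
      ≤ eLpNorm (fun x => ∑ i, ∑ j, ∑ k, ‖∫ s in (0 : ℝ)..t,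
          conv (K i j k s) (fun y => u s y j * v s y k) x‖) r volume := by
        refine eLpNorm_mono_real fun x => (norm_toLp_le _).trans ?_
        refine Finset.sum_le_sum fun i _ => (norm_sum_le _ _).trans ?_
        exact Finset.sum_le_sum fun j _ => norm_sum_le _ _
    _ ≤ ∑ i : Fin d, ∑ j : Fin d, ∑ k : Fin d, I := by
        have hm : ∀ i j k, AEStronglyMeasurable (fun x => ‖∫ s in (0 : ℝ)..t,
          conv (K i j k s) (fun y => u s y j * v s y k) x‖) volume := fun i j k =>
          ((hJ i j k).aestronglyMeasurable_integral ht0).norm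
        refine eLpNorm_sum_le_of_le hr (fun i _ => ?_) fun i _ =>
          eLpNorm_sum_le_of_le hr (fun j _ => ?_) fun j _ =>
          eLpNorm_sum_le_of_le hr (fun k _ => hm i j k) fun k _ => ?_
        · exact Finset.aestronglyMeasurable_fun_sum _ fun j _ =>
            Finset.aestronglyMeasurable_fun_sum _ fun k _ => hm i j k
        · exact Finset.aestronglyMeasurable_fun_sum _ fun k _ => hm i j k
        rw [eLpNorm_norm]
        exact piece i j k
    _ = _ := by
        simp only [Finset.sum_const, Finset.card_univ, Fintype.card_fin, nsmul_eq_mul]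
        rw [ENNReal.ofReal_pow (by positivity), ENNReal.ofReal_natCast]
        ring

lemma inv_add_inv_le_one (hp : 2 ≤ p) : p⁻¹ + p⁻¹ ≤ 1 := by
  have h : p⁻¹ ≤ 2⁻¹ := ENNReal.inv_le_inv.2 hp
  exact (add_le_add h h).trans_eq ENNReal.inv_two_add_inv_two

lemma one_le_of_two_le (hp : 2 ≤ p) : 1 ≤ p := le_trans (by norm_num) hp

/-- Needed wherever two Duhamel integrals are added or subtracted under the integral sign:
additivity of the Bochner integral requires true integrability in s. -/
lemma ae_integrableOn_trip (hp : 2 ≤ p) (hK : Ker3 p t K n) (ht : t ≤ T)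
    (hu : IsCurve p T u) (hv : IsCurve p T v) :
    ∀ᵐ x ∂(volume : Measure (Sp d)), ∀ i j k,
      IntegrableOn (fun s => conv (K i j k s) (fun y => u s y j * v s y k) x) (Ioo 0 t) := by
  obtain ⟨A, hA0, hA⟩ := hu.bdd
  obtain ⟨B, hB0, hB⟩ := hv.bdd
  have hnm := hK.meas
  have hsub : ∀ {s : ℝ}, s ∈ Ioo 0 t → s ∈ Ioc 0 T := fun hs => ⟨hs.1, hs.2.le.trans ht⟩
  simp only [ae_all_iff]
  intro i j k
  refine (jMeas_trip hp ht hK.fam hu hv i j k).ae_integrableOn (one_le_of_two_le hp)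
      (n := (Ioo 0 t).indicator fun s => n s * (A * B))
      (Measurable.indicator (by fun_prop) measurableSet_Ioo)
      (fun s => indicator_nonneg (fun s hs => by
        have := hK.nonneg s hs; positivity) s)
      (fun s hs => by
        rw [indicator_of_mem hs]
        exact eLpNorm_trip_piece_le (A := fun _ => A) (B := fun _ => B) hK (inv_add_inv_le_one hp) ht hu hv
          (fun _ _ => hA0) (fun s hs => hA s (hsub hs)) (fun s hs => hB s (hsub hs)) i j k s hs) ?_
  calc _ = ∫⁻ s in Ioo 0 t, ENNReal.ofReal (n s) * ENNReal.ofReal (A * B) := by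
        refine setLIntegral_congr_fun measurableSet_Ioo fun s hs => ?_
        simp only [indicator_of_mem hs]
        rw [ENNReal.ofReal_mul (hK.nonneg s hs)]
    _ < ∞ := by
        rw [lintegral_mul_const' _ _ (by simp)]
        exact ENNReal.mul_lt_top hK.fin (by simp)

lemma conv_sub_right {k : Sp d → ℝ} {m τ : ℝ} (hk : KerBd k m τ) (hτ : 0 < τ) (hm : 0 ≤ m)
    {q : ℝ≥0∞} (hq : 1 ≤ q) {f g : Sp d → ℝ} (hf : MemLp f q volume) (hg : MemLp g q volume)
    (x : Sp d) : conv k (f - g) x = conv k f x - conv k g x := by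
  unfold conv
  rw [← integral_sub (hk.integrable hτ hm hq hf x) (hk.integrable hτ hm hq hg x)]
  exact integral_congr_ae (ae_of_all _ fun y => mul_sub _ _ _)

/-- Additivity of the trilinear integral in the product of its arguments. -/
lemma trip_sub (hp : 2 ≤ p) (hK : Ker3 p t K n) (ht0 : 0 ≤ t) (ht : t ≤ T)
    {u' v' : ℝ → Sp d → Sp d} {u'' v'' : ℝ → Sp d → Sp d}
    (hu : IsCurve p T u) (hv : IsCurve p T v) (hu' : IsCurve p T u') (hv' : IsCurve p T v')
    (h : ∀ s y j k, u s y j * v s y k - u' s y j * v' s y k = u'' s y j * v'' s y k) :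
    ∀ᵐ x ∂(volume : Measure (Sp d)), trip K u v t x - trip K u' v' t x = trip K u'' v'' t x := by
  filter_upwards [ae_integrableOn_trip hp hK ht hu hv, ae_integrableOn_trip hp hK ht hu' hv']
    with x h1 h2
  ext i
  simp only [trip, PiLp.sub_apply]
  rw [← Finset.sum_sub_distrib]
  refine Finset.sum_congr rfl fun j _ => ?_
  rw [← Finset.sum_sub_distrib]
  refine Finset.sum_congr rfl fun k _ => ?_
  rw [intervalIntegral_eq_Ioo ht0, intervalIntegral_eq_Ioo ht0, intervalIntegral_eq_Ioo ht0,
    ← integral_sub (h1 i j k) (h2 i j k)]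
  refine setIntegral_congr_fun measurableSet_Ioo fun s hs => ?_
  obtain ⟨m, τ, hm, hτ, hk, -⟩ := hK.bd s hs i j k
  rw [← conv_sub_right hk hτ hm (one_le_half hp) ((IsCurve.src hp ht hu hv j k).mem s hs)
    ((IsCurve.src hp ht hu' hv' j k).mem s hs)]
  congr 1
  funext y
  exact h s y j k

/-- Equality holds at every point although the fields agree only almost everywhere, because a
convolution sees only the class of its argument. -/
lemma trip_congr {K' : Fin d → Fin d → Fin d → ℝ → Sp d → ℝ} {u' v' : ℝ → Sp d → Sp d} (ht0 : 0 ≤ t)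
    (hK : ∀ s ∈ Ioo 0 t, ∀ i j k, K i j k s = K' i j k s)
    (hu : ∀ s ∈ Ioo 0 t, u s =ᵐ[volume] u' s)
    (hv : ∀ s ∈ Ioo 0 t, v s =ᵐ[volume] v' s) : trip K u v t = trip K' u' v' t := by
  funext x
  unfold trip
  congr 1; funext i
  refine Finset.sum_congr rfl fun j _ => Finset.sum_congr rfl fun k _ => ?_
  rw [intervalIntegral_eq_Ioo ht0, intervalIntegral_eq_Ioo ht0]
  refine setIntegral_congr_fun measurableSet_Ioo fun s hs => ?_
  simp only
  rw [hK s hs]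
  refine conv_congr ?_ x
  filter_upwards [hu s hs, hv s hs] with y h1 h2
  rw [h1, h2]

/-- Splitting of the time interval. -/
lemma trip_add {h : ℝ} (hp : 2 ≤ p) (ht0 : 0 ≤ t) (hh : 0 ≤ h) (hK : Ker3 p (t + h) K n)
    (ht : t + h ≤ T) (hu : IsCurve p T u) (hv : IsCurve p T v) :
    ∀ᵐ x ∂(volume : Measure (Sp d)), trip K u v (t + h) x = trip K u v t x
      + trip (fun i j k s => K i j k (t + s)) (fun s => u (t + s)) (fun s => v (t + s)) h x := by
  filter_upwards [ae_integrableOn_trip hp hK ht hu hv] with x hx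
  ext i
  simp only [trip, PiLp.add_apply]
  rw [← Finset.sum_add_distrib]
  refine Finset.sum_congr rfl fun j _ => ?_
  rw [← Finset.sum_add_distrib]
  refine Finset.sum_congr rfl fun k _ => ?_
  have hint : IntervalIntegrable (fun s => conv (K i j k s) (fun y => u s y j * v s y k) x) volume
      0 (t + h) := (intervalIntegrable_iff_integrableOn_Ioo_of_le (by linarith)).2 (hx i j k)
  rw [intervalIntegral.integral_comp_add_left
    (fun s => conv (K i j k s) (fun y => u s y j * v s y k) x) t]
  rw [add_zero, intervalIntegral.integral_add_adjacent_intervals]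
  · exact hint.mono_set (by
      rw [uIcc_of_le ht0, uIcc_of_le (by linarith)]; exact Icc_subset_Icc_right (by linarith))
  · exact hint.mono_set (by
      rw [uIcc_of_le (by linarith), uIcc_of_le (by linarith)]; exact Icc_subset_Icc_left ht0)

end Trip

end NavierStokes

/-! ### Time singularities of the Duhamel kernels; heat flow and divergence free fields. -/

namespace NavierStokes

variable {d : ℕ}

lemma lintegral_sub_rpow {t b : ℝ} (ht : 0 ≤ t) (hb : b < 1) :
    ∫⁻ s in Ioo 0 t, ENNReal.ofReal ((t - s) ^ (-b)) = ENNReal.ofReal (t ^ (1 - b) / (1 - b)) := by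
  have hint : IntervalIntegrable (fun s : ℝ => (t - s) ^ (-b)) volume 0 t := by
    have := (intervalIntegral.intervalIntegrable_rpow' (a := 0) (b := t) (r := -b)
      (by linarith)).comp_sub_left t
    simpa using this.symm
  rw [← ofReal_integral_eq_lintegral_ofReal]
  · congr 1
    rw [← intervalIntegral_eq_Ioo ht, intervalIntegral.integral_comp_sub_left (fun s => s ^ (-b)),
      sub_self, sub_zero, integral_rpow (Or.inl (by linarith)), Real.zero_rpow (by linarith)]
    rw [sub_zero, neg_add_eq_sub]
  · exact (intervalIntegrable_iff_integrableOn_Ioo_of_le ht).1 hint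
  · filter_upwards [ae_restrict_mem measurableSet_Ioo] with s hs
    exact Real.rpow_nonneg (by linarith [hs.2]) _

lemma lintegral_const_mul_sub_rpow {t b C : ℝ} (ht : 0 ≤ t) (hb : b < 1) (hC : 0 ≤ C) :
    ∫⁻ s in Ioo 0 t, ENNReal.ofReal (C * (t - s) ^ (-b))
      = ENNReal.ofReal (C * (t ^ (1 - b) / (1 - b))) := by
  simp only [ENNReal.ofReal_mul hC]
  rw [lintegral_const_mul' _ _ (by simp), lintegral_sub_rpow ht hb]

/-- The mass (t+h-s)^(-1/2) and the factor (t+h-s)^(-d/(2p)) multiply to the power -`sing`. The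
offset h is additional smoothing, so the bound for h = 0 serves all h ≥ 0. -/
lemma ker3_oseenKernel {p : ℝ≥0∞} (hp : sing d p < 1) {t h : ℝ} (ht : 0 ≤ t) (hh : 0 ≤ h) :
    Ker3 p t (fun i j k s => (oseenKernel i j k (t + h - s) : Sp d → ℝ))
      fun s => 2 * kC d * (t - s) ^ (-sing d p) where
  fam := fun i j k => kerFam_oseenKernel i j k (by linarith)
  meas := by fun_prop
  nonneg := fun s hs => by
    have := kC_pos d
    have : 0 < t - s := by linarith [hs.2]
    positivity
  fin := by
    rw [lintegral_const_mul_sub_rpow ht hp (by have := kC_pos d; positivity)]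
    simp
  bd := fun s hs i j k => by
    have hC := kC_pos d
    have h0 : 0 < t - s := by linarith [hs.2]
    have h1 : 0 < t + h - s := by linarith [hs.2]
    refine ⟨_, _, by positivity, h1, kerBd_oseenKernel i j k h1, ?_⟩
    have e : kC d * (2 * (t + h - s) ^ (-(1 / 2) : ℝ)) * (t + h - s) ^ (-(d : ℝ) / 2 * rexp p)
        = 2 * kC d * (t + h - s) ^ (-sing d p) := by
      rw [sing, neg_add, Real.rpow_add h1]
      ring_nf
    rw [e]
    have := Real.rpow_le_rpow_of_nonpos h0 (show t - s ≤ t + h - s by linarith)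
      (neg_nonpos.2 (sing_pos d p).le)
    gcongr

/-- The gain h^θ worsens the singularity by θ, which is affordable as long as `sing` + θ < 1. -/
lemma ker3_oseenKernel_sub {p : ℝ≥0∞} {θ : ℝ} (hθ : 0 ≤ θ) (hp : sing d p + θ < 1) {t h : ℝ}
    (ht : 0 ≤ t) (hh : 0 ≤ h) :
    Ker3 p t (fun i j k s (x : Sp d) => (oseenKernel i j k (t + 0 - s) x - oseenKernel i j k (t + h - s) x : ℝ))
      fun s => 2 * kC d * h ^ θ * (t - s) ^ (-(sing d p + θ)) where
  fam := fun i j k => (kerFam_oseenKernel i j k (by linarith)).sub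
    (kerFam_oseenKernel i j k (by linarith))
  meas := by fun_prop
  nonneg := fun s hs => by
    have := kC_pos d
    have : 0 < t - s := by linarith [hs.2]
    positivity
  fin := by
    rw [lintegral_const_mul_sub_rpow ht hp (by have := kC_pos d; positivity)]
    simp
  bd := fun s hs i j k => by
    have hC := kC_pos d
    have h0 : 0 < t - s := by linarith [hs.2]
    have hsing := sing_pos d p
    rw [add_zero]
    refine ⟨_, _, ?_, h0, kerBd_oseenKernel_sub i j k h0 (show t - s ≤ t + h - s by linarith) hθ
      (by linarith), ?_⟩
    · rw [show t + h - s - (t - s) = h by ring]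
      positivity
    · rw [show t + h - s - (t - s) = h by ring]
      refine le_of_eq ?_
      have : (t - s) ^ (-(sing d p + θ))
          = (t - s) ^ (-(1 / 2) - θ : ℝ) * (t - s) ^ (-(d : ℝ) / 2 * rexp p) := by
        rw [← Real.rpow_add h0, sing]; ring_nf
      rw [this]; ring

/-! ### Convolution with vector fields -/

/-- The convolution of a kernel with a vector field. -/
def vconv (k : Sp d → ℝ) (f : Sp d → Sp d) (x : Sp d) : Sp d := ∫ y, k (x - y) • f y

lemma heatFlow_eq (t : ℝ) (f : Sp d → Sp d) : heatFlow t f = vconv (heatKernel d t) f := rfl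

section Vconv

variable {k : Sp d → ℝ} {m τ : ℝ} {q : ℝ≥0∞} {f g : Sp d → Sp d}

lemma integrable_vconv (hk : KerBd k m τ) (hτ : 0 < τ) (hm : 0 ≤ m) (hq : 1 ≤ q)
    (hf : MemLp f q volume) (x : Sp d) : Integrable fun y => k (x - y) • f y := by
  have hkm := hk.meas
  have hks : Measurable fun y => k (x - y) := by fun_prop
  refine ⟨hks.aestronglyMeasurable.smul hf.1, ?_⟩
  simp only [hasFiniteIntegral_iff_enorm, enorm_smul]
  exact (hk.lintegral_le hτ hm hq hf.1 x).trans_lt (ENNReal.mul_lt_top (by simp) hf.2)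

lemma vconv_apply (hk : KerBd k m τ) (hτ : 0 < τ) (hm : 0 ≤ m) (hq : 1 ≤ q)
    (hf : MemLp f q volume) (x : Sp d) (i : Fin d) : vconv k f x i = conv k (fun y => f y i) x := by
  have := (EuclideanSpace.proj (𝕜 := ℝ) i).integral_comp_comm (integrable_vconv hk hτ hm hq hf x)
  simpa [vconv, conv] using this.symm

lemma enorm_vconv_le (hk : KerBd k m τ) (hτ : 0 < τ) (hm : 0 ≤ m) (hq : 1 ≤ q)
    (hf : AEStronglyMeasurable f volume) (x : Sp d) :
    ‖vconv k f x‖ₑ ≤ ENNReal.ofReal (m * τ ^ (-(d : ℝ) / 2 * rexp q)) * eLpNorm f q volume := by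
  refine (enorm_integral_le_lintegral_enorm _).trans ?_
  simp only [enorm_smul]
  exact hk.lintegral_le hτ hm hq hf x

lemma eLpNorm_vconv_le (hk : KerBd k m τ) (hτ : 0 < τ) (hm : 0 ≤ m) (hq : 1 ≤ q)
    (hf : AEStronglyMeasurable f volume) :
    eLpNorm (vconv k f) q volume ≤ ENNReal.ofReal m * eLpNorm f q volume := by
  have := hk.eLpNorm_lintegral_le hτ hm (p := ∞) (r := q) (u := fun _ => (1 : ℝ))
    (by simpa using hq) (memLp_top_const 1) hf
  simp only [rexp, ENNReal.inv_top, ENNReal.toReal_zero, mul_zero, Real.rpow_zero,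
    mul_one, enorm_one, one_mul] at this
  refine (eLpNorm_mono_enorm fun x => ?_).trans (this.trans ?_)
  · refine (enorm_integral_le_lintegral_enorm _).trans ?_
    simp [enorm_smul]
  · gcongr
    refine mul_le_of_le_one_left' ?_
    rw [eLpNorm_exponent_top]
    exact eLpNormEssSup_le_of_ae_enorm_bound (by simp)

lemma vconv_eq_toLp (hk : KerBd k m τ) (hτ : 0 < τ) (hm : 0 ≤ m) (hq : 1 ≤ q)
    (hf : MemLp f q volume) :
    vconv k f = fun x => WithLp.toLp 2 fun i => conv k (fun y => f y i) x := by
  funext x; ext i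
  exact vconv_apply hk hτ hm hq hf x i

lemma aestronglyMeasurable_vconv (hk : KerBd k m τ) (hτ : 0 < τ) (hm : 0 ≤ m) (hq : 1 ≤ q)
    (hf : MemLp f q volume) : AEStronglyMeasurable (vconv k f) volume := by
  rw [vconv_eq_toLp hk hτ hm hq hf]
  refine (PiLp.continuous_toLp 2 _).comp_aestronglyMeasurable ?_
  exact (measurable_pi_lambda _ fun i =>
    measurable_conv hk.meas (memLp_coord hf i).1).aestronglyMeasurable

lemma memLp_vconv (hk : KerBd k m τ) (hτ : 0 < τ) (hm : 0 ≤ m) (hq : 1 ≤ q)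
    (hf : MemLp f q volume) : MemLp (vconv k f) q volume :=
  ⟨aestronglyMeasurable_vconv hk hτ hm hq hf,
    (eLpNorm_vconv_le hk hτ hm hq hf.1).trans_lt (ENNReal.mul_lt_top (by simp) hf.2)⟩

lemma vconv_sub_right (hk : KerBd k m τ) (hτ : 0 < τ) (hm : 0 ≤ m) (hq : 1 ≤ q)
    (hf : MemLp f q volume) (hg : MemLp g q volume) :
    vconv k (f - g) = vconv k f - vconv k g := by
  funext x
  simp only [vconv, Pi.sub_apply]
  rw [← integral_sub (integrable_vconv hk hτ hm hq hf x) (integrable_vconv hk hτ hm hq hg x)]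
  exact integral_congr_ae (ae_of_all _ fun y => smul_sub _ _ _)

lemma vconv_congr (h : f =ᵐ[volume] g) : vconv k f = vconv k g := by
  funext x
  exact integral_congr_ae (by filter_upwards [h] with y hy; rw [hy])

lemma vconv_sub_left {k' : Sp d → ℝ} {m' τ' : ℝ} (hk : KerBd k m τ) (hτ : 0 < τ) (hm : 0 ≤ m)
    (hk' : KerBd k' m' τ') (hτ' : 0 < τ') (hm' : 0 ≤ m') (hq : 1 ≤ q)
    (hf : MemLp f q volume) : vconv (fun x => k x - k' x) f = vconv k f - vconv k' f := by
  funext x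
  simp only [vconv, Pi.sub_apply]
  rw [← integral_sub (integrable_vconv hk hτ hm hq hf x) (integrable_vconv hk' hτ' hm' hq hf x)]
  exact integral_congr_ae (ae_of_all _ fun y => sub_smul _ _ _)

lemma vconv_vconv {k' : Sp d → ℝ} {m' τ' : ℝ} (hk : KerBd k m τ) (hτ : 0 < τ) (hm : 0 ≤ m)
    (hk' : KerBd k' m' τ') (hτ' : 0 < τ') (hm' : 0 ≤ m') (hq : 1 ≤ q)
    (hf : MemLp f q volume) : vconv k (vconv k' f) = vconv (conv k k') f := by
  funext x; ext i
  rw [vconv_apply hk hτ hm hq (memLp_vconv hk' hτ' hm' hq hf),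
    vconv_apply (hk.conv hk' hm hτ) hτ' (by positivity) hq hf, ← conv_assoc hk hk' hm' hτ' hq
      (memLp_coord hf i)]
  congr 1; funext y
  exact vconv_apply hk' hτ' hm' hq hf y i

end Vconv

/-! ### The heat flow -/

section Heat

variable {q : ℝ≥0∞} {f g : Sp d → Sp d} {s t : ℝ}

lemma memLp_heatFlow (ht : 0 < t) (hq : 1 ≤ q) (hf : MemLp f q volume) :
    MemLp (heatFlow t f) q volume := memLp_vconv (kerBd_heatKernel ht) ht zero_le_one hq hf

lemma eLpNorm_heatFlow_le (ht : 0 < t) (hq : 1 ≤ q) (hf : AEStronglyMeasurable f volume) :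
    eLpNorm (heatFlow t f) q volume ≤ eLpNorm f q volume := by
  simpa [heatFlow_eq] using eLpNorm_vconv_le (kerBd_heatKernel ht) ht zero_le_one hq hf

lemma eLpNorm_top_heatFlow_le (ht : 0 < t) (hq : 1 ≤ q) (hf : AEStronglyMeasurable f volume) :
    eLpNorm (heatFlow t f) ∞ volume
      ≤ ENNReal.ofReal (t ^ (-(d : ℝ) / 2 * rexp q)) * eLpNorm f q volume := by
  rw [eLpNorm_exponent_top]
  refine eLpNormEssSup_le_of_ae_enorm_bound (ae_of_all _ fun x => ?_)
  simpa [heatFlow_eq] using enorm_vconv_le (kerBd_heatKernel ht) ht zero_le_one hq hf x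

lemma heatFlow_heatFlow (hs : 0 < s) (ht : 0 < t) (hq : 1 ≤ q) (hf : MemLp f q volume) :
    heatFlow s (heatFlow t f) = heatFlow (s + t) f := by
  simp only [heatFlow_eq]
  rw [vconv_vconv (kerBd_heatKernel hs) hs zero_le_one (kerBd_heatKernel ht) ht zero_le_one hq hf]
  congr 1; funext x
  exact conv_heatKernel hs ht x

lemma heatFlow_sub (ht : 0 < t) (hq : 1 ≤ q) (hf : MemLp f q volume) (hg : MemLp g q volume) :
    heatFlow t (f - g) = heatFlow t f - heatFlow t g :=
  vconv_sub_right (kerBd_heatKernel ht) ht zero_le_one hq hf hg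

lemma eLpNorm_heatFlow_sub_le (hs : 0 < s) (hst : s ≤ t) (hq : 1 ≤ q) (hf : MemLp f q volume) :
    eLpNorm (heatFlow t f - heatFlow s f) q volume
      ≤ ENNReal.ofReal ((1 + d) * gC d * ((t - s) / s)) * eLpNorm f q volume := by
  have ht := hs.trans_le hst
  have hC := gC_pos d
  have : 0 ≤ t - s := by linarith
  simp only [heatFlow_eq]
  rw [← vconv_sub_left (kerBd_heatKernel ht) ht zero_le_one (kerBd_heatKernel hs) hs zero_le_one hq hf]
  exact eLpNorm_vconv_le (kerBd_heatKernel_sub hs hst) hs (by positivity) hq hf.1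

/-- Continuity is required on (0, T] only and fails at time 0 for general bounded data; this is what
lets p = ∞ be treated with the other exponents. -/
lemma isCurve_heatFlow (hq : 1 ≤ q) (hf : MemLp f q volume) (T : ℝ) :
    IsCurve q T fun t => heatFlow t f where
  mem := fun t ht => memLp_heatFlow ht.1 hq hf
  cont := fun t ht => by
    have hC := gC_pos d
    have ht0 := ht.1
    have hlim : Tendsto (fun s : ℝ => ENNReal.ofReal ((1 + d) * gC d * (|s - t| / (t / 2)))
        * eLpNorm f q volume) (𝓝[Ioc 0 T] t) (𝓝 0) := by
      have h1 : Tendsto (fun s : ℝ => (1 + d) * gC d * (|s - t| / (t / 2))) (𝓝[Ioc 0 T] t)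
          (𝓝 0) := by
        have : Continuous fun s : ℝ => (1 + d) * gC d * (|s - t| / (t / 2)) := by fun_prop
        simpa using (this.tendsto t).mono_left nhdsWithin_le_nhds
      simpa using ENNReal.Tendsto.mul_const (ENNReal.tendsto_ofReal h1) (Or.inr hf.eLpNorm_ne_top)
    refine tendsto_of_tendsto_of_tendsto_of_le_of_le' tendsto_const_nhds hlim
      (Eventually.of_forall fun _ => zero_le) ?_
    have : ∀ᶠ s in 𝓝 t, t / 2 < s := eventually_gt_nhds (by linarith)
    filter_upwards [nhdsWithin_le_nhds this] with s hs
    have hs0 : 0 < s := by linarith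
    rcases le_total t s with h | h
    · refine (eLpNorm_heatFlow_sub_le ht0 h hq hf).trans ?_
      rw [abs_of_nonneg (by linarith)]
      have : 0 ≤ s - t := by linarith
      gcongr
      linarith
    · rw [eLpNorm_sub_comm]
      refine (eLpNorm_heatFlow_sub_le hs0 h hq hf).trans ?_
      rw [abs_of_nonpos (by linarith), neg_sub]
      have : 0 ≤ t - s := by linarith
      gcongr
  bdd := ⟨(eLpNorm f q volume).toReal, ENNReal.toReal_nonneg, fun s hs => by
    rw [ENNReal.ofReal_toReal hf.eLpNorm_ne_top]
    exact eLpNorm_heatFlow_le hs.1 hq hf.1⟩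

end Heat

/-! ### Divergence free vector fields -/

/-- The vector field is divergence free in the sense of distributions. -/
def DivFree (f : Sp d → Sp d) : Prop :=
  ∀ φ : Sp d → ℝ, ContDiff ℝ (⊤ : ℕ∞) φ → HasCompactSupport φ → ∫ x, fderiv ℝ φ x (f x) = 0

lemma fderiv_apply_eq_sum (φ : Sp d → ℝ) (x w : Sp d) :
    fderiv ℝ φ x w = ∑ i, pd i φ x * w i := by
  have : w = ∑ i, w i • EuclideanSpace.single i (1 : ℝ) := by
    ext j; simp [Pi.single_apply]
  conv_lhs => rw [this]
  simp [pd, mul_comm]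

lemma memLp_pd {φ : Sp d → ℝ} (hφ : ContDiff ℝ (⊤ : ℕ∞) φ) (hc : HasCompactSupport φ) (i : Fin d)
    (q : ℝ≥0∞) : MemLp (pd i φ) q volume :=
  (contDiff_pd hφ i).continuous.memLp_of_hasCompactSupport (hasCompactSupport_pd hc i)

lemma exists_holderConjugate {q : ℝ≥0∞} (hq : 1 ≤ q) : ∃ q' : ℝ≥0∞, q'.HolderConjugate q :=
  ⟨_, (ENNReal.HolderConjugate.inv_one_sub_inv' hq).symm⟩

lemma integrable_mul_of_holderConjugate {q q' : ℝ≥0∞} (h : q'.HolderConjugate q) {φ f : Sp d → ℝ}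
    (hφ : MemLp φ q' volume) (hf : MemLp f q volume) : Integrable fun x => φ x * f x :=
  memLp_one_iff_integrable.1 (hf.mul hφ)

lemma integral_fderiv_eq {q : ℝ≥0∞} (hq : 1 ≤ q) {φ : Sp d → ℝ} (hφ : ContDiff ℝ (⊤ : ℕ∞) φ)
    (hc : HasCompactSupport φ) {f : Sp d → Sp d} (hf : MemLp f q volume) :
    ∫ x, fderiv ℝ φ x (f x) = ∑ i, ∫ x, pd i φ x * f x i := by
  obtain ⟨q', h⟩ := exists_holderConjugate hq
  simp only [fderiv_apply_eq_sum]
  exact integral_finsetSum _ fun i _ =>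
    integrable_mul_of_holderConjugate h (memLp_pd hφ hc i q') (memLp_coord hf i)

/-- At scale τ = 1 the size factor is 1, so m only has to dominate the supremum and the L¹ norm.
This makes test functions admissible as kernels. -/
lemma kerBd_of_continuous {φ : Sp d → ℝ} (hφ : Continuous φ) (hc : HasCompactSupport φ) :
    ∃ m : ℝ, 0 ≤ m ∧ KerBd φ m 1 := by
  have h1 : ∫⁻ x, ‖φ x‖ₑ ≠ ∞ := (hφ.integrable_of_hasCompactSupport hc).2.ne
  obtain ⟨M, hM⟩ := hφ.bounded_above_of_compact_support hc
  refine ⟨max M (∫⁻ x, ‖φ x‖ₑ).toReal, le_max_of_le_right ENNReal.toReal_nonneg, hφ.measurable, ?_,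
    fun x => ?_⟩
  · rw [← ENNReal.ofReal_toReal h1]
    exact ENNReal.ofReal_le_ofReal (by simp)
  · rw [Real.one_rpow, mul_one, ← ofReal_norm]
    exact ENNReal.ofReal_le_ofReal ((hM x).trans (le_max_left _ _))

/-- The heat flow is a Gaussian average of translates: its pairing with ∇φ is the integral of G(z)
times the pairing of f with ∇φ(z + ·), and the latter vanishes for every z. -/
lemma divFree_heatFlow {t : ℝ} (ht : 0 < t) {q : ℝ≥0∞} (hq : 1 ≤ q) {f : Sp d → Sp d}
    (hf : MemLp f q volume) (h : DivFree f) : DivFree (heatFlow t f) := by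
  intro φ hφ hc
  obtain ⟨q', hqq⟩ := exists_holderConjugate hq
  rw [integral_fderiv_eq hq hφ hc (memLp_heatFlow ht hq hf)]
  have hG := kerBd_heatKernel (d := d) ht
  have hneg : (fun z : Sp d => heatKernel d t (-z)) = heatKernel d t := funext (heatKernel_neg t)
  have hm1 : MeasurePreserving (fun x : Sp d => -x) volume volume := Measure.measurePreserving_neg _
  have hmem : ∀ i, MemLp (fun y => f (-y) i) q volume := fun i =>
    (memLp_coord hf i).comp_measurePreserving hm1
  have hk : ∀ i, ∃ m : ℝ, 0 ≤ m ∧ KerBd (pd i φ) m 1 := fun i =>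
    kerBd_of_continuous (contDiff_pd hφ i).continuous (hasCompactSupport_pd hc i)
  have e : ∀ i, ∫ x, pd i φ x * heatFlow t f x i
      = ∫ z, heatKernel d t z * conv (pd i φ) (fun y => f (-y) i) z := by
    intro i
    obtain ⟨m, hm, hki⟩ := hk i
    have hq' : 1 ≤ q' := ENNReal.HolderConjugate.one_le q' q
    rw [integral_mul_conv hki one_pos hm (hmem i) (hG.memLp hq')]
    have e1 : ∀ x, heatFlow t f x i = conv (heatKernel d t) (fun y => f y i) x := fun x =>
      vconv_apply hG ht zero_le_one hq hf x i
    simp only [e1]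
    rw [integral_mul_conv hG ht zero_le_one (memLp_coord hf i) (memLp_pd hφ hc i q'), hneg,
      ← hm1.integral_comp (MeasurableEquiv.neg _).measurableEmbedding]
    refine integral_congr_ae (ae_of_all _ fun y => ?_)
    simp only
    congr 1
    unfold conv
    rw [← hm1.integral_comp (MeasurableEquiv.neg _).measurableEmbedding, ]
    rw [← integral_sub_left_eq_self _ volume y]
    refine integral_congr_ae (ae_of_all _ fun w => ?_)
    simp [← heatKernel_neg t w]
    rw [show -y - (w - y) = -w by abel, mul_comm]
  have hmemz : ∀ i, Integrable fun z => heatKernel d t z * conv (pd i φ) (fun y => f (-y) i) z := by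
    intro i
    obtain ⟨m, hm, hki⟩ := hk i
    exact integrable_mul_of_holderConjugate hqq (hG.memLp (ENNReal.HolderConjugate.one_le q' q))
      (hki.memLp_conv one_pos hm hq (hmem i))
  simp only [e]
  rw [← integral_finsetSum _ fun i _ => hmemz i]
  refine integral_eq_zero_of_ae (ae_of_all _ fun z => ?_)
  simp only [← Finset.mul_sum, Pi.zero_apply]
  refine mul_eq_zero_of_right _ ?_
  have hcz : HasCompactSupport fun y => φ (z + y) := hc.comp_homeomorph (Homeomorph.addLeft z)
  have hφz : ContDiff ℝ (⊤ : ℕ∞) fun y => φ (z + y) := hφ.comp (by fun_prop)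
  have h0 := h _ hφz hcz
  rw [integral_fderiv_eq hq hφz hcz hf] at h0
  rw [← h0]
  refine Finset.sum_congr rfl fun i _ => ?_
  unfold conv
  rw [← hm1.integral_comp (MeasurableEquiv.neg _).measurableEmbedding]
  refine integral_congr_ae (ae_of_all _ fun y => ?_)
  simp only [sub_neg_eq_add, neg_neg]
  congr 1
  unfold pd
  rw [fderiv_comp_add_left]

end NavierStokes

/-! ### Duality for Duhamel integrals and estimates of the bilinear operator. -/

namespace NavierStokes

variable {d : ℕ}

lemma JMeas.integrableOn_integral_mul {t : ℝ} {w : ℝ → Sp d → ℝ} (hw : JMeas t w)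
    {r r' : ℝ≥0∞} [hrr : r'.HolderConjugate r] {n : ℝ → ℝ}
    (hwm : ∀ s ∈ Ioo 0 t, AEStronglyMeasurable (w s) volume)
    (hwn : ∀ s ∈ Ioo 0 t, eLpNorm (w s) r volume ≤ ENNReal.ofReal (n s))
    (hfin : ∫⁻ s in Ioo 0 t, ENNReal.ofReal (n s) < ∞) {φ : Sp d → ℝ} (hφ : MemLp φ r' volume) :
    IntegrableOn (fun s => ∫ x, φ x * w s x) (Ioo 0 t) := by
  obtain ⟨w', hw', he⟩ := hw
  have hae : (fun s => ∫ x, φ x * w' s x) =ᵐ[volume.restrict (Ioo 0 t)]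
      fun s => ∫ x, φ x * w s x := by
    filter_upwards [ae_restrict_mem measurableSet_Ioo] with s hs
    rw [he s hs]
  refine ⟨AEStronglyMeasurable.congr ?_ hae, ?_⟩
  · have e : (fun s => ∫ x, φ x * w' s x) = fun s => ∫ x, hφ.1.mk φ x * w' s x := by
      funext s
      refine integral_congr_ae ?_
      filter_upwards [hφ.1.ae_eq_mk] with x hx
      rw [hx]
    rw [e]
    have hm := hφ.1.stronglyMeasurable_mk.measurable
    have : StronglyMeasurable (Function.uncurry fun s x => hφ.1.mk φ x * w' s x) :=
      ((hm.comp measurable_snd).mul hw').stronglyMeasurable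
    exact this.integral_prod_right.aestronglyMeasurable
  · rw [hasFiniteIntegral_iff_enorm]
    calc ∫⁻ s in Ioo 0 t, ‖∫ x, φ x * w s x‖ₑ
        ≤ ∫⁻ s in Ioo 0 t, eLpNorm φ r' volume * ENNReal.ofReal (n s) := by
          refine setLIntegral_mono_ae' measurableSet_Ioo (ae_of_all _ fun s hs => ?_)
          refine (enorm_integral_le_lintegral_enorm _).trans ?_
          rw [← eLpNorm_one_eq_lintegral_enorm]
          refine (eLpNorm_smul_le_mul_eLpNorm (p := r') (q := r) (r := 1) (hwm s hs) hφ.1).trans ?_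
          gcongr
          exact hwn s hs
      _ < ∞ := by
          rw [lintegral_const_mul' _ _ hφ.eLpNorm_ne_top]
          exact ENNReal.mul_lt_top hφ.2 hfin

section Trip

variable {p : ℝ≥0∞} {T t : ℝ} {u v : ℝ → Sp d → Sp d}
  {K : Fin d → Fin d → Fin d → ℝ → Sp d → ℝ} {n : ℝ → ℝ}

/-- The bounds on the pieces of the trilinear integral that are used for Fubini's theorem. -/
lemma exists_trip_piece_bound (hp : 2 ≤ p) (hK : Ker3 p t K n) (ht : t ≤ T)
    (hu : IsCurve p T u) (hv : IsCurve p T v) : ∃ N : ℝ → ℝ, Measurable N ∧ (∀ s, 0 ≤ N s) ∧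
      (∫⁻ s in Ioo 0 t, ENNReal.ofReal (N s) < ∞) ∧ ∀ i j k, ∀ s ∈ Ioo 0 t,
        eLpNorm (conv (K i j k s) (fun y => u s y j * v s y k)) p volume ≤ ENNReal.ofReal (N s) := by
  obtain ⟨A, hA0, hA⟩ := hu.bdd
  obtain ⟨B, hB0, hB⟩ := hv.bdd
  have hnm := hK.meas
  have hsub : ∀ {s : ℝ}, s ∈ Ioo 0 t → s ∈ Ioc 0 T := fun hs => ⟨hs.1, hs.2.le.trans ht⟩
  refine ⟨(Ioo 0 t).indicator fun s => n s * (A * B),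
    Measurable.indicator (by fun_prop) measurableSet_Ioo,
    fun s => indicator_nonneg (fun s hs => by have := hK.nonneg s hs; positivity) s, ?_,
    fun i j k s hs => ?_⟩
  · calc _ = ∫⁻ s in Ioo 0 t, ENNReal.ofReal (n s) * ENNReal.ofReal (A * B) := by
          refine setLIntegral_congr_fun measurableSet_Ioo fun s hs => ?_
          simp only [indicator_of_mem hs]
          rw [ENNReal.ofReal_mul (hK.nonneg s hs)]
      _ < ∞ := by
          rw [lintegral_mul_const' _ _ (by simp)]
          exact ENNReal.mul_lt_top hK.fin (by simp)
  · rw [indicator_of_mem hs]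
    exact eLpNorm_trip_piece_le (A := fun _ => A) (B := fun _ => B) hK (inv_add_inv_le_one hp) ht hu hv
      (fun _ _ => hA0) (fun s hs => hA s (hsub hs)) (fun s hs => hB s (hsub hs)) i j k s hs

lemma memLp_trip_piece (hp : 2 ≤ p) (hK : Ker3 p t K n) (ht0 : 0 ≤ t) (ht : t ≤ T)
    (hu : IsCurve p T u) (hv : IsCurve p T v) (i j k : Fin d) :
    MemLp (fun x => ∫ s in (0 : ℝ)..t, conv (K i j k s) (fun y => u s y j * v s y k) x) p
      volume := by
  obtain ⟨N, hN, hN0, hfin, hb⟩ := exists_trip_piece_bound hp hK ht hu hv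
  have hJ := jMeas_trip hp ht hK.fam hu hv i j k
  exact ⟨hJ.aestronglyMeasurable_integral ht0, (hJ.eLpNorm_integral_le ht0
    (one_le_of_two_le hp) hN hN0 (hb i j k)).trans_lt hfin⟩

lemma integral_mul_trip_piece (hp : 2 ≤ p) (hK : Ker3 p t K n) (ht0 : 0 ≤ t) (ht : t ≤ T)
    (hu : IsCurve p T u) (hv : IsCurve p T v) {p' : ℝ≥0∞} (hpp : p'.HolderConjugate p)
    {φ : Sp d → ℝ} (hφ : MemLp φ p' volume) (i j k : Fin d) :
    (∫ x, φ x * ∫ s in (0 : ℝ)..t, conv (K i j k s) (fun y => u s y j * v s y k) x)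
      = ∫ s in (0 : ℝ)..t, ∫ x, φ x * conv (K i j k s) (fun y => u s y j * v s y k) x := by
  obtain ⟨N, hN, hN0, hfin, hb⟩ := exists_trip_piece_bound hp hK ht hu hv
  exact (jMeas_trip hp ht hK.fam hu hv i j k).integral_mul_integral ht0 (hb i j k) hfin hφ

lemma memLp_trip (hp : 2 ≤ p) (hK : Ker3 p t K n) (ht0 : 0 ≤ t) (ht : t ≤ T)
    (hu : IsCurve p T u) (hv : IsCurve p T v) : MemLp (trip K u v t) p volume := by
  refine MemLp.of_eval_piLp fun i => ?_
  simp only [trip]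
  exact memLp_finsetSum Finset.univ fun j _ => memLp_finsetSum Finset.univ fun k _ =>
    memLp_trip_piece hp hK ht0 ht hu hv i j k

/-- A convolution passes to the kernels of the trilinear integral. -/
lemma vconv_trip (hp : 2 ≤ p) (hK : Ker3 p t K n) (ht0 : 0 ≤ t) (ht : t ≤ T)
    (hu : IsCurve p T u) (hv : IsCurve p T v) {g : Sp d → ℝ} {m τ : ℝ} (hg : KerBd g m τ)
    (hτ : 0 < τ) (hm : 0 ≤ m) :
    vconv g (trip K u v t) = trip (fun i j k s => conv g (K i j k s)) u v t := by
  have hp1 := one_le_of_two_le hp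
  obtain ⟨p', hpp⟩ := exists_holderConjugate hp1
  funext x; ext i
  rw [vconv_apply hg hτ hm hp1 (memLp_trip hp hK ht0 ht hu hv)]
  have hφ : MemLp (fun y => g (x - y)) p' volume :=
    hg.memLp_shift (ENNReal.HolderConjugate.one_le p' p) x
  have hpiece := memLp_trip_piece hp hK ht0 ht hu hv i
  have hint : ∀ j k, Integrable fun y => g (x - y) *
      ∫ s in (0 : ℝ)..t, conv (K i j k s) (fun y => u s y j * v s y k) y := fun j k =>
    integrable_mul_of_holderConjugate hpp hφ (hpiece j k)
  change ∫ y, g (x - y) * trip K u v t y i = _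
  simp only [trip, Finset.mul_sum]
  rw [integral_finsetSum _ fun j _ => integrable_finsetSum _ fun k _ => hint j k]
  refine Finset.sum_congr rfl fun j _ => ?_
  rw [integral_finsetSum _ fun k _ => hint j k]
  refine Finset.sum_congr rfl fun k _ => ?_
  refine (integral_mul_trip_piece hp hK ht0 ht hu hv hpp hφ i j k).trans ?_
  rw [intervalIntegral_eq_Ioo ht0, intervalIntegral_eq_Ioo ht0]
  refine setIntegral_congr_fun measurableSet_Ioo fun s hs => ?_
  obtain ⟨m', τ', hm', hτ', hk, -⟩ := hK.bd s hs i j k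
  exact conv_assoc hg hk hm' hτ' (one_le_half hp) ((IsCurve.src hp ht hu hv j k).mem s hs) x

/-- The adjoint of the trilinear integral, for odd kernels. -/
lemma sum_integral_mul_trip (hp : 2 ≤ p) (hK : Ker3 p t K n) (ht0 : 0 ≤ t) (ht : t ≤ T)
    (hu : IsCurve p T u) (hv : IsCurve p T v)
    (hodd : ∀ s ∈ Ioo 0 t, ∀ i j k x, K i j k s (-x) = - K i j k s x)
    {p' q' : ℝ≥0∞} (hpp : p'.HolderConjugate p) (hqq : q'.HolderConjugate (p / 2))
    {φ : Fin d → Sp d → ℝ} (hφ : ∀ i, MemLp (φ i) p' volume) (hφ' : ∀ i, MemLp (φ i) q' volume) :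
    ∑ i, ∫ x, φ i x * trip K u v t x i = ∫ s in Ioo 0 t, ∑ j, ∑ k,
      -∫ y, (∑ i, conv (K i j k s) (φ i) y) * (u s y j * v s y k) := by
  obtain ⟨N, hN, hN0, hfin, hb⟩ := exists_trip_piece_bound hp hK ht hu hv
  have hint : ∀ i j k, Integrable fun y => φ i y *
      ∫ s in (0 : ℝ)..t, conv (K i j k s) (fun y => u s y j * v s y k) y := fun i j k =>
    integrable_mul_of_holderConjugate hpp (hφ i) (memLp_trip_piece hp hK ht0 ht hu hv i j k)
  have e : ∀ i, ∫ x, φ i x * trip K u v t x i = ∑ j, ∑ k, ∫ s in Ioo 0 t,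
      ∫ x, φ i x * conv (K i j k s) (fun y => u s y j * v s y k) x := by
    intro i
    simp only [trip, Finset.mul_sum]
    rw [integral_finsetSum _ fun j _ => integrable_finsetSum _ fun k _ => hint i j k]
    refine Finset.sum_congr rfl fun j _ => ?_
    rw [integral_finsetSum _ fun k _ => hint i j k]
    refine Finset.sum_congr rfl fun k _ => ?_
    rw [integral_mul_trip_piece hp hK ht0 ht hu hv hpp (hφ i) i j k, intervalIntegral_eq_Ioo ht0]
  have hmeas : ∀ i j k, ∀ s ∈ Ioo 0 t, AEStronglyMeasurable
      (conv (K i j k s) (fun y => u s y j * v s y k)) volume := fun i j k s hs => by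
    obtain ⟨m', τ', hm', hτ', hk, -⟩ := hK.bd s hs i j k
    exact (measurable_conv hk.meas ((IsCurve.src hp ht hu hv j k).mem s hs).1).aestronglyMeasurable
  have hI : ∀ i j k, IntegrableOn (fun s =>
      ∫ x, φ i x * conv (K i j k s) (fun y => u s y j * v s y k) x) (Ioo 0 t) := fun i j k =>
    (jMeas_trip hp ht hK.fam hu hv i j k).integrableOn_integral_mul (hmeas i j k) (hb i j k) hfin (hφ i)
  simp only [e]
  have swap : ∀ f : Fin d → Fin d → Fin d → ℝ,
      ∑ i, ∑ j, ∑ k, f i j k = ∑ j, ∑ k, ∑ i, f i j k := fun f => by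
    rw [Finset.sum_comm]
    exact Finset.sum_congr rfl fun j _ => Finset.sum_comm
  rw [swap]
  have e3 : ∀ j k, ∑ i, ∫ s in Ioo 0 t, ∫ x, φ i x * conv (K i j k s) (fun y => u s y j * v s y k) x
      = ∫ s in Ioo 0 t, ∑ i, ∫ x, φ i x * conv (K i j k s) (fun y => u s y j * v s y k) x := fun j k =>
    (integral_finsetSum _ fun i _ => hI i j k).symm
  simp only [e3]
  have hI' : ∀ j k, IntegrableOn (fun s =>
      ∑ i, ∫ x, φ i x * conv (K i j k s) (fun y => u s y j * v s y k) x) (Ioo 0 t) := fun j k =>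
    integrable_finsetSum _ fun i _ => hI i j k
  have e4 : ∀ j, ∑ k, ∫ s in Ioo 0 t, ∑ i, ∫ x, φ i x * conv (K i j k s) (fun y => u s y j * v s y k) x
      = ∫ s in Ioo 0 t, ∑ k, ∑ i, ∫ x, φ i x * conv (K i j k s) (fun y => u s y j * v s y k) x :=
    fun j => (integral_finsetSum _ fun k _ => hI' j k).symm
  simp only [e4]
  rw [← integral_finsetSum _ fun j _ => integrable_finsetSum _ fun k _ => hI' j k]
  refine setIntegral_congr_fun measurableSet_Ioo fun s hs =>
    Finset.sum_congr rfl fun j _ => Finset.sum_congr rfl fun k _ => ?_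
  have hsrc := (IsCurve.src hp ht hu hv j k).mem s hs
  -- At fixed s the pairing is with a product in L^{p/2}, hence the second conjugate exponent q'.
  -- The adjoint of convolution with an odd kernel is its negative.
  have e2 : ∀ i, ∫ x, φ i x * conv (K i j k s) (fun y => u s y j * v s y k) x
      = -∫ y, conv (K i j k s) (φ i) y * (u s y j * v s y k) := by
    intro i
    obtain ⟨m', τ', hm', hτ', hk, -⟩ := hK.bd s hs i j k
    rw [integral_mul_conv hk hτ' hm' hsrc (hφ' i)]
    simp only [hodd s hs i j k]
    rw [← integral_neg]
    congr 1; funext y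
    simp [conv, integral_neg]
  simp only [e2, Finset.sum_mul]
  rw [Finset.sum_neg_distrib, integral_finsetSum]
  intro i _
  obtain ⟨m', τ', hm', hτ', hk, -⟩ := hK.bd s hs i j k
  exact integrable_mul_of_holderConjugate hqq (hk.memLp_conv hτ' hm'
    (ENNReal.HolderConjugate.one_le q' (p / 2)) (hφ' i)) hsrc

/-- By duality the kernels act on the gradient of the test function, and there they sum to zero. -/
lemma divFree_trip (hp : 2 ≤ p) (hK : Ker3 p t K n) (ht0 : 0 ≤ t) (ht : t ≤ T)
    (hu : IsCurve p T u) (hv : IsCurve p T v)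
    (hodd : ∀ s ∈ Ioo 0 t, ∀ i j k x, K i j k s (-x) = - K i j k s x)
    (hdiv : ∀ s ∈ Ioo 0 t, ∀ j k, ∀ φ : Sp d → ℝ, ContDiff ℝ (⊤ : ℕ∞) φ → HasCompactSupport φ →
      ∀ x, ∑ i, conv (K i j k s) (pd i φ) x = 0) : DivFree (trip K u v t) := by
  intro φ hφ hc
  have hp1 := one_le_of_two_le hp
  obtain ⟨p', hpp⟩ := exists_holderConjugate hp1
  obtain ⟨q', hqq⟩ := exists_holderConjugate (one_le_half hp)
  rw [integral_fderiv_eq hp1 hφ hc (memLp_trip hp hK ht0 ht hu hv),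
    sum_integral_mul_trip hp hK ht0 ht hu hv hodd hpp hqq (fun i => memLp_pd hφ hc i p')
      (fun i => memLp_pd hφ hc i q')]
  refine setIntegral_eq_zero_of_forall_eq_zero fun s hs =>
    Finset.sum_eq_zero fun j _ => Finset.sum_eq_zero fun k _ => ?_
  simp [hdiv s hs j k φ hφ hc]

end Trip

/-- The bilinear Duhamel operator `∫_0^t e^{(t+h-s)Δ} ℙ ∇ · (u ⊗ v)(s) ds`. -/
def bil (h : ℝ) (u v : ℝ → Sp d → Sp d) (t : ℝ) : Sp d → Sp d :=
  trip (fun i j k s => oseenKernel i j k (t + h - s)) u v t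

lemma duhamel_eq_bil (u : ℝ → Sp d → Sp d) (t : ℝ) : duhamel u t = bil 0 u u t := by
  unfold bil
  simp only [add_zero]
  rfl

/-- The constant of the bilinear estimate. -/
def bC (d : ℕ) : ℝ := d ^ 3 * (2 * kC d)

lemma bC_nonneg (d : ℕ) : 0 ≤ bC d := by
  have := kC_pos d
  unfold bC; positivity

section Bil

variable {p : ℝ≥0∞} {T t h : ℝ} {u v : ℝ → Sp d → Sp d}

lemma memLp_bil (hp : 2 ≤ p) (hs : sing d p < 1) (hh : 0 ≤ h) (ht0 : 0 ≤ t) (ht : t ≤ T)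
    (hu : IsCurve p T u) (hv : IsCurve p T v) : MemLp (bil h u v t) p volume :=
  memLp_trip hp (ker3_oseenKernel hs ht0 hh) ht0 ht hu hv

lemma aestronglyMeasurable_bil (hp : 2 ≤ p) (hs : sing d p < 1) (hh : 0 ≤ h) (ht0 : 0 ≤ t)
    (ht : t ≤ T) (hu : IsCurve p T u) (hv : IsCurve p T v) :
    AEStronglyMeasurable (bil h u v t) volume := (memLp_bil hp hs hh ht0 ht hu hv).1

/-- The bilinear estimate with weights. -/
lemma eLpNorm_bil_le (hp : 2 ≤ p) {p₁ r : ℝ≥0∞} (hs : sing d p₁ < 1) (hpr : p₁⁻¹ + r⁻¹ ≤ 1)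
    (hh : 0 ≤ h) (ht0 : 0 ≤ t) (ht : t ≤ T) (hu : IsCurve p T u) (hv : IsCurve p T v)
    {A : ℝ} (hA0 : 0 ≤ A) {B : ℝ → ℝ} (hBm : Measurable B) (hB0 : ∀ s ∈ Ioo 0 t, 0 ≤ B s)
    (hA : ∀ s ∈ Ioo 0 t, eLpNorm (u s) p₁ volume ≤ ENNReal.ofReal A)
    (hB : ∀ s ∈ Ioo 0 t, eLpNorm (v s) r volume ≤ ENNReal.ofReal (B s)) :
    eLpNorm (bil h u v t) r volume
      ≤ ∫⁻ s in Ioo 0 t, ENNReal.ofReal (bC d * A * ((t - s) ^ (-sing d p₁) * B s)) := by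
  refine (eLpNorm_trip_le hp (ker3_oseenKernel hs ht0 hh) hpr ht0 ht hu hv
    (measurable_const (a := A)) hBm (fun _ _ => hA0) hB0 hA hB).trans_eq ?_
  rw [← lintegral_const_mul' _ _ (by simp)]
  congr 1; funext s
  rw [← ENNReal.ofReal_mul (by positivity)]
  congr 1
  unfold bC; ring

/-- The bilinear estimate. -/
lemma eLpNorm_bil_le_const (hp : 2 ≤ p) {p₁ r : ℝ≥0∞} (hs : sing d p₁ < 1) (hpr : p₁⁻¹ + r⁻¹ ≤ 1)
    (hh : 0 ≤ h) (ht0 : 0 ≤ t) (ht : t ≤ T) (hu : IsCurve p T u) (hv : IsCurve p T v)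
    {A : ℝ} (hA0 : 0 ≤ A) {B : ℝ} (hB0 : 0 ≤ B)
    (hA : ∀ s ∈ Ioo 0 t, eLpNorm (u s) p₁ volume ≤ ENNReal.ofReal A)
    (hB : ∀ s ∈ Ioo 0 t, eLpNorm (v s) r volume ≤ ENNReal.ofReal B) :
    eLpNorm (bil h u v t) r volume
      ≤ ENNReal.ofReal (bC d / (1 - sing d p₁) * t ^ (1 - sing d p₁) * (A * B)) := by
  refine (eLpNorm_bil_le hp hs hpr hh ht0 ht hu hv hA0 (measurable_const (a := B))
    (fun _ _ => hB0) hA hB).trans_eq ?_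
  have := bC_nonneg d
  have e : ∀ s : ℝ, bC d * A * ((t - s) ^ (-sing d p₁) * B)
      = bC d * A * B * (t - s) ^ (-sing d p₁) := fun s => by ring
  simp only [e]
  rw [lintegral_const_mul_sub_rpow ht0 hs (by positivity)]
  congr 1; ring

lemma bil_add (hp : 2 ≤ p) (hs : sing d p < 1) (hh : 0 ≤ h) (ht0 : 0 ≤ t) (ht : t + h ≤ T)
    (hu : IsCurve p T u) (hv : IsCurve p T v) :
    ∀ᵐ x ∂(volume : Measure (Sp d)), bil 0 u v (t + h) x
      = bil h u v t x + bil 0 (fun s => u (t + s)) (fun s => v (t + s)) h x := by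
  have := trip_add hp ht0 hh (ker3_oseenKernel hs (by positivity) le_rfl) ht hu hv
  filter_upwards [this] with x hx
  unfold bil
  rw [hx]
  congr 1
  · rw [trip_congr ht0 (fun s _ i j k => ?_) (fun _ _ => EventuallyEq.rfl) (fun _ _ => EventuallyEq.rfl)]
    rw [add_zero]
  · rw [trip_congr hh (fun s _ i j k => ?_) (fun _ _ => EventuallyEq.rfl) (fun _ _ => EventuallyEq.rfl)]
    congr 1; ring

/-- Hölder continuity in time of the bilinear operator. -/
lemma eLpNorm_bil_sub_le (hp : 2 ≤ p) (hsp : sing d p < 1) {p₁ r : ℝ≥0∞} {θ : ℝ} (hθ : 0 ≤ θ)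
    (hs : sing d p₁ + θ < 1) (hpr : p₁⁻¹ + r⁻¹ ≤ 1)
    (hh : 0 ≤ h) (ht0 : 0 ≤ t) (ht : t + h ≤ T) (hu : IsCurve p T u) (hv : IsCurve p T v)
    {A : ℝ} (hA0 : 0 ≤ A) {B : ℝ} (hB0 : 0 ≤ B)
    (hA : ∀ s ∈ Ioo 0 (t + h), eLpNorm (u s) p₁ volume ≤ ENNReal.ofReal A)
    (hB : ∀ s ∈ Ioo 0 (t + h), eLpNorm (v s) r volume ≤ ENNReal.ofReal B) :
    eLpNorm (bil 0 u v (t + h) - bil 0 u v t) r volume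
      ≤ ENNReal.ofReal (bC d / (1 - sing d p₁) * h ^ (1 - sing d p₁) * (A * B))
        + ENNReal.ofReal (bC d * h ^ θ * (A * B)
          * (t ^ (1 - (sing d p₁ + θ)) / (1 - (sing d p₁ + θ)))) := by
  have hr : 1 ≤ r := ENNReal.inv_le_one.1 (le_add_self.trans hpr)
  have htT : t ≤ T := by linarith
  have hb := bC_nonneg d
  have hu' := (hu.shift ht0).mono (show h ≤ T - t by linarith)
  have hv' := (hv.shift ht0).mono (show h ≤ T - t by linarith)
  set Ks : Fin d → Fin d → Fin d → ℝ → Sp d → ℝ := fun i j k s x =>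
    oseenKernel i j k (t + 0 - s) x - oseenKernel i j k (t + h - s) x with hKs
  have e1 : ∀ᵐ x ∂(volume : Measure (Sp d)), bil 0 u v t x - bil h u v t x = trip Ks u v t x := by
    filter_upwards [ae_integrableOn_trip hp (ker3_oseenKernel hsp ht0 le_rfl) htT hu hv,
      ae_integrableOn_trip hp (ker3_oseenKernel hsp ht0 hh) htT hu hv] with x h1 h2
    ext i
    simp only [bil, trip, PiLp.sub_apply]
    rw [← Finset.sum_sub_distrib]
    refine Finset.sum_congr rfl fun j _ => ?_
    rw [← Finset.sum_sub_distrib]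
    refine Finset.sum_congr rfl fun k _ => ?_
    rw [intervalIntegral_eq_Ioo ht0, intervalIntegral_eq_Ioo ht0, intervalIntegral_eq_Ioo ht0,
      ← integral_sub (h1 i j k) (h2 i j k)]
    refine setIntegral_congr_fun measurableSet_Ioo fun s hs => ?_
    have hsrc := (IsCurve.src hp htT hu hv j k).mem s hs
    obtain ⟨m, τ, hm, hτ, hk, -⟩ := (ker3_oseenKernel hsp ht0 le_rfl).bd s hs i j k
    obtain ⟨m', τ', hm', hτ', hk', -⟩ := (ker3_oseenKernel hsp ht0 hh).bd s hs i j k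
    exact (conv_sub_left x (hk.integrable hτ hm (one_le_half hp) hsrc x)
      (hk'.integrable hτ' hm' (one_le_half hp) hsrc x)).symm
  -- The increment is the contribution of the new interval (t, t+h) minus the old integral with the
  -- difference of the kernels. The first is small because its interval is short, the second by
  -- Hölder continuity of the kernel.
  have e2 : bil 0 u v (t + h) - bil 0 u v t =ᵐ[volume]
      bil 0 (fun s => u (t + s)) (fun s => v (t + s)) h - trip Ks u v t := by
    filter_upwards [e1, bil_add hp hsp hh ht0 ht hu hv] with x h1 h2
    simp only [Pi.sub_apply]
    rw [h2, ← h1]; abel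
  have hKer := ker3_oseenKernel_sub hθ hs ht0 hh
  have m1 := aestronglyMeasurable_bil hp hsp le_rfl hh le_rfl hu' hv'
  have m2 : AEStronglyMeasurable (trip Ks u v t) volume :=
    aestronglyMeasurable_trip hp ht0 htT hKer.fam hu hv
  rw [eLpNorm_congr_ae e2]
  refine (eLpNorm_sub_le m1 m2 hr).trans (add_le_add ?_ ?_)
  · exact eLpNorm_bil_le_const hp (by linarith) hpr le_rfl hh le_rfl hu' hv' hA0 hB0
      (fun s hs => hA _ ⟨by linarith [hs.1], by linarith [hs.2]⟩)
      (fun s hs => hB _ ⟨by linarith [hs.1], by linarith [hs.2]⟩)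
  · refine (eLpNorm_trip_le hp hKer hpr ht0 htT hu hv (measurable_const (a := A))
      (measurable_const (a := B)) (fun _ _ => hA0) (fun _ _ => hB0)
      (fun s hs => hA _ ⟨by linarith [hs.1], by linarith [hs.2]⟩)
      (fun s hs => hB _ ⟨by linarith [hs.1], by linarith [hs.2]⟩)).trans_eq ?_
    rw [← lintegral_const_mul' _ _ (by simp)]
    have e3 : ∀ s : ℝ, ENNReal.ofReal (d ^ 3) * ENNReal.ofReal
        (2 * kC d * h ^ θ * (t - s) ^ (-(sing d p₁ + θ)) * (A * B))
        = ENNReal.ofReal (bC d * h ^ θ * (A * B) * (t - s) ^ (-(sing d p₁ + θ))) := fun s => by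
      rw [← ENNReal.ofReal_mul (by positivity)]
      congr 1
      unfold bC; ring
    simp only [e3]
    rw [lintegral_const_mul_sub_rpow ht0 hs (by positivity)]

lemma isCurve_bil (hp : 2 ≤ p) (hs : sing d p < 1) (hu : IsCurve p T u) (hv : IsCurve p T v) :
    IsCurve p T (bil 0 u v) := by
  obtain ⟨A, hA0, hA⟩ := hu.bdd
  obtain ⟨B, hB0, hB⟩ := hv.bdd
  have hb := bC_nonneg d
  have hs1 : 0 < 1 - sing d p := by linarith
  -- Any θ strictly between 0 and 1 - `sing` would do; the midpoint keeps `sing` + θ below 1.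
  set θ := (1 - sing d p) / 2 with hθ
  have hθ0 : 0 < θ := by positivity
  have hsθ : sing d p + θ < 1 := by linarith
  set D : ℝ → ℝ≥0∞ := fun h => ENNReal.ofReal (bC d / (1 - sing d p) * h ^ (1 - sing d p) * (A * B))
        + ENNReal.ofReal (bC d * h ^ θ * (A * B)
          * (T ^ (1 - (sing d p + θ)) / (1 - (sing d p + θ)))) with hD
  have key : ∀ {s t : ℝ}, 0 < s → s ≤ t → t ≤ T →
      eLpNorm (bil 0 u v t - bil 0 u v s) p volume ≤ D |t - s| := by
    intro s t hs0 hst htT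
    have h0 : 0 ≤ t - s := by linarith
    have := eLpNorm_bil_sub_le hp hs hθ0.le hsθ (inv_add_inv_le_one hp) h0 hs0.le
      (show s + (t - s) ≤ T by linarith) hu hv hA0 hB0
      (fun r hr => hA r ⟨hr.1, by linarith [hr.2]⟩) (fun r hr => hB r ⟨hr.1, by linarith [hr.2]⟩)
    rw [show s + (t - s) = t by ring] at this
    refine this.trans ?_
    simp only [hD, abs_of_nonneg h0]
    have h3 : 0 < 1 - (sing d p + θ) := by linarith
    gcongr
    linarith
  have hD0 : Tendsto D (𝓝 0) (𝓝 0) := by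
    have c1 : Continuous fun h : ℝ => bC d / (1 - sing d p) * h ^ (1 - sing d p) * (A * B) := by
      have := Real.continuous_rpow_const (q := 1 - sing d p) hs1.le
      fun_prop
    have c2 : Continuous fun h : ℝ => bC d * h ^ θ * (A * B)
          * (T ^ (1 - (sing d p + θ)) / (1 - (sing d p + θ))) := by
      have := Real.continuous_rpow_const (q := θ) hθ0.le
      fun_prop
    have h1 := ENNReal.tendsto_ofReal (c1.tendsto 0)
    have h2 := ENNReal.tendsto_ofReal (c2.tendsto 0)
    simpa [Real.zero_rpow hs1.ne', Real.zero_rpow hθ0.ne'] using h1.add h2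
  refine ⟨fun t ht => memLp_bil hp hs le_rfl ht.1.le ht.2 hu hv, fun t ht => ?_, ?_⟩
  · have hlim : Tendsto (fun s => D |t - s|) (𝓝[Ioc 0 T] t) (𝓝 0) := by
      have : Continuous fun s : ℝ => |t - s| := by fun_prop
      refine hD0.comp ?_
      simpa using (this.tendsto t).mono_left nhdsWithin_le_nhds
    refine tendsto_of_tendsto_of_tendsto_of_le_of_le' tendsto_const_nhds hlim
      (Eventually.of_forall fun _ => zero_le) ?_
    filter_upwards [self_mem_nhdsWithin] with s hsT
    rcases le_total s t with h | h
    · rw [eLpNorm_sub_comm]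
      exact key hsT.1 h ht.2
    · rw [abs_sub_comm]
      exact key ht.1 h hsT.2
  · refine ⟨bC d / (1 - sing d p) * |T| ^ (1 - sing d p) * (A * B), by positivity, fun t ht => ?_⟩
    refine (eLpNorm_bil_le_const hp hs (inv_add_inv_le_one hp) le_rfl ht.1.le ht.2 hu hv hA0 hB0
      (fun s h => hA s ⟨h.1, h.2.le.trans ht.2⟩) (fun s h => hB s ⟨h.1, h.2.le.trans ht.2⟩)).trans ?_
    have h1 := ht.1
    have h2 : t ≤ |T| := ht.2.trans (le_abs_self T)
    gcongr

/-- The heat flow of the bilinear operator. -/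
lemma heatFlow_bil (hp : 2 ≤ p) (hs : sing d p < 1) {ε : ℝ} (hε : 0 < ε) (hh : 0 ≤ h) (ht0 : 0 ≤ t)
    (ht : t ≤ T) (hu : IsCurve p T u) (hv : IsCurve p T v) :
    heatFlow ε (bil h u v t) = bil (h + ε) u v t := by
  rw [heatFlow_eq, bil, vconv_trip hp (ker3_oseenKernel hs ht0 hh) ht0 ht hu hv
    (kerBd_heatKernel hε) hε zero_le_one]
  refine trip_congr ht0 (fun s hs i j k => ?_) (fun _ _ => EventuallyEq.rfl)
    (fun _ _ => EventuallyEq.rfl)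
  rw [conv_heatKernel_oseenKernel i j k hε (by linarith [hs.2])]
  congr 1; ring

lemma divFree_bil (hp : 2 ≤ p) (hs : sing d p < 1) (ht0 : 0 ≤ t)
    (ht : t ≤ T) (hu : IsCurve p T u) (hv : IsCurve p T v) : DivFree (bil 0 u v t) :=
  divFree_trip hp (ker3_oseenKernel hs ht0 le_rfl) ht0 ht hu hv
    (fun _ _ i j k x => oseenKernel_neg i j k _ x)
    (fun s hs j k φ hφ hc x => sum_conv_oseenKernel_pd j k (by linarith [hs.2]) hφ hc x)

/-- Differences of the bilinear operator with `u u - v v = u (u - v) + (u - v) v`. -/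
lemma bil_self_sub (hp : 2 ≤ p) (hs : sing d p < 1) (ht0 : 0 ≤ t)
    (ht : t ≤ T) (hu : IsCurve p T u) (hv : IsCurve p T v) :
    ∀ᵐ x ∂(volume : Measure (Sp d)), bil 0 u u t x - bil 0 v v t x
      = bil 0 u (fun s => u s - v s) t x + bil 0 (fun s => u s - v s) v t x := by
  have hp1 := one_le_of_two_le hp
  have hK := ker3_oseenKernel (p := p) (d := d) (h := 0) hs ht0 le_rfl
  filter_upwards [trip_sub (u'' := u) (v'' := fun s => u s - v s) hp hK ht0 ht hu hu hu hv
      (fun s y j k => by simp; ring),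
    trip_sub (u'' := fun s => u s - v s) (v'' := v) hp hK ht0 ht hu hv hv hv
      (fun s y j k => by simp; ring)] with x h1 h2
  unfold bil
  rw [← h1, ← h2]; abel

lemma bil_sub_right (hp : 2 ≤ p) (hs : sing d p < 1) (ht0 : 0 ≤ t) {w : ℝ → Sp d → Sp d}
    (ht : t ≤ T) (hu : IsCurve p T u) (hv : IsCurve p T v) (hw : IsCurve p T w) :
    ∀ᵐ x ∂(volume : Measure (Sp d)), bil 0 u v t x - bil 0 u w t x
      = bil 0 u (fun s => v s - w s) t x :=
  trip_sub hp (ker3_oseenKernel hs ht0 le_rfl) ht0 ht hu hv hu hw (fun s y j k => by simp; ring)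

lemma bil_congr {u' v' : ℝ → Sp d → Sp d} (ht0 : 0 ≤ t)
    (hu : ∀ s ∈ Ioo 0 t, u s =ᵐ[volume] u' s)
    (hv : ∀ s ∈ Ioo 0 t, v s =ᵐ[volume] v' s) : bil h u v t = bil h u' v' t :=
  trip_congr ht0 (fun _ _ _ _ _ => rfl) hu hv

end Bil

end NavierStokes

/-! ### Mild solutions: restart, uniqueness, persistence and smoothing. -/

namespace NavierStokes

variable {d : ℕ}

/-- Exponential weights make the fractional integral a contraction. -/
lemma exists_exp_weight {a C : ℝ} (ha : a < 1) (hC : 0 ≤ C) : ∃ l : ℝ, 0 < l ∧ ∀ t : ℝ,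
    ∫⁻ s in Ioo 0 t, ENNReal.ofReal (C * ((t - s) ^ (-a) * Real.exp (l * s)))
      ≤ ENNReal.ofReal (Real.exp (l * t) / 2) := by
  -- After s ↦ t - s the weighted integral is at most e^{lt} times this Gamma integral, which is
  -- independent of t and tends to 0 as l grows. One l therefore works on intervals of any length.
  have hlim : Tendsto (fun l : ℝ => C * (l ^ (-(1 - a)) * Real.Gamma (1 - a))) atTop (𝓝 0) := by
    simpa using ((tendsto_rpow_neg_atTop (show 0 < 1 - a by linarith)).mul_const
      (Real.Gamma (1 - a))).const_mul C
  obtain ⟨l, hl, hl0⟩ := ((hlim.eventually (gt_mem_nhds (show (0 : ℝ) < 1 / 2 by norm_num))).and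
    (eventually_gt_atTop 0)).exists
  refine ⟨l, hl0, fun t => ?_⟩
  have e1 : ∀ s ∈ Ioo 0 t, ENNReal.ofReal (C * ((t - s) ^ (-a) * Real.exp (l * s)))
      = ENNReal.ofReal (C * Real.exp (l * t))
        * ENNReal.ofReal ((t - s) ^ ((1 - a) - 1) * Real.exp (-(l * (t - s)))) := by
    intro s hs
    rw [← ENNReal.ofReal_mul (by positivity)]
    congr 1
    have : Real.exp (l * s) = Real.exp (l * t) * Real.exp (-(l * (t - s))) := by
      rw [← Real.exp_add]; ring_nf
    rw [this, show 1 - a - 1 = -a by ring]; ring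
  rw [setLIntegral_congr_fun measurableSet_Ioo e1, lintegral_const_mul' _ _ (by simp)]
  have hm : MeasurePreserving (fun s : ℝ => t - s) volume volume :=
    Measure.measurePreserving_sub_left volume t
  set F : ℝ → ℝ≥0∞ := fun s => ENNReal.ofReal (s ^ ((1 - a) - 1) * Real.exp (-(l * s))) with hF
  have hpre : (fun s : ℝ => t - s) ⁻¹' (Ioo 0 t) = Ioo 0 t := by
    ext s; simp only [mem_preimage, mem_Ioo]; constructor <;> rintro ⟨h1, h2⟩ <;> constructor <;> linarith
  have e2 : ∫⁻ s in Ioo 0 t, F (t - s) = ∫⁻ s in Ioo 0 t, F s := by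
    have := hm.setLIntegral_comp_preimage measurableSet_Ioo (f := F) (by fun_prop) (s := Ioo 0 t)
    rwa [hpre] at this
  have e3 : ∫⁻ s in Ioi (0 : ℝ), F s = ENNReal.ofReal ((1 / l) ^ (1 - a) * Real.Gamma (1 - a)) := by
    rw [← Real.integral_rpow_mul_exp_neg_mul_Ioi (by linarith) hl0,
      ofReal_integral_eq_lintegral_ofReal]
    · have := integrableOn_rpow_mul_exp_neg_mul_rpow (s := (1 - a) - 1) (p := 1) (b := l)
        (by linarith) one_pos hl0
      refine this.congr_fun (fun x hx => ?_) measurableSet_Ioi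
      simp [Real.rpow_one]
    · filter_upwards [ae_restrict_mem measurableSet_Ioi] with s hs
      have : (0 : ℝ) < s := hs
      positivity
  calc _ = ENNReal.ofReal (C * Real.exp (l * t)) * ∫⁻ s in Ioo 0 t, F s := by rw [← e2]
    _ ≤ ENNReal.ofReal (C * Real.exp (l * t)) * ∫⁻ s in Ioi 0, F s := by
        gcongr
        exact Ioo_subset_Ioi_self
    _ ≤ _ := by
        rw [e3, ← ENNReal.ofReal_mul (by positivity)]
        refine ENNReal.ofReal_le_ofReal ?_
        have h1 : (1 / l) ^ (1 - a) = l ^ (-(1 - a)) := by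
          rw [Real.rpow_neg hl0.le, one_div, Real.inv_rpow hl0.le]
        rw [h1]
        have := Real.exp_pos (l * t)
        nlinarith

section Limits

variable {α E : Type*} [MeasurableSpace α] {μ : Measure α} [NormedAddCommGroup E]

/-- Lower semicontinuity of Lebesgue norms under convergence in another Lebesgue space. -/
lemma eLpNorm_le_of_tendsto_eLpNorm {p r : ℝ≥0∞} (hp : p ≠ 0) {v : ℕ → α → E} {u : α → E}
    (hv : ∀ n, AEStronglyMeasurable (v n) μ) (hu : AEStronglyMeasurable u μ)
    (h : Tendsto (fun n => eLpNorm (v n - u) p μ) atTop (𝓝 0)) {N : ℝ≥0∞}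
    (hN : ∀ n, eLpNorm (v n) r μ ≤ N) : eLpNorm u r μ ≤ N := by
  obtain ⟨ns, -, hns⟩ := (tendstoInMeasure_of_tendsto_eLpNorm hp hv hu h).exists_seq_tendsto_ae
  refine (Lp.eLpNorm_lim_le_liminf_eLpNorm (fun n => hv (ns n)) u hns).trans ?_
  refine liminf_le_of_frequently_le' (Frequently.of_forall fun n => hN _)

lemma tendsto_zero_of_geometric {f : ℕ → ℝ≥0∞} {D : ℝ} (h : ∀ n, f n ≤ ENNReal.ofReal (D / 2 ^ n)) :
    Tendsto f atTop (𝓝 0) := by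
  have h1 : Tendsto (fun n : ℕ => D / (2 : ℝ) ^ n) atTop (𝓝 0) :=
    tendsto_const_nhds.div_atTop (tendsto_pow_atTop_atTop_of_one_lt (by norm_num))
  have h2 := ENNReal.tendsto_ofReal h1
  rw [ENNReal.ofReal_zero] at h2
  exact tendsto_of_tendsto_of_tendsto_of_le_of_le tendsto_const_nhds h2 (fun _ => zero_le) h

end Limits

/-- Mild solutions on `(0, T]`, without the divergence constraint. -/
structure Mild (p : ℝ≥0∞) (T : ℝ) (u₀ : Sp d → Sp d) (u : ℝ → Sp d → Sp d) : Prop where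
  curve : IsCurve p T u
  eq : ∀ t ∈ Ioc 0 T, u t =ᵐ[volume] heatFlow t u₀ - bil 0 u u t

section Mild

variable {p : ℝ≥0∞} {T t h : ℝ} {u v : ℝ → Sp d → Sp d} {u₀ : Sp d → Sp d}

lemma Mild.mono (hu : Mild p T u₀ u) {T' : ℝ} (h : T' ≤ T) : Mild p T' u₀ u :=
  ⟨hu.curve.mono h, fun t ht => hu.eq t ⟨ht.1, ht.2.trans h⟩⟩

lemma heatFlow_congr {f g : Sp d → Sp d} (h : f =ᵐ[volume] g) : heatFlow t f = heatFlow t g :=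
  vconv_congr h

/-- The heat flow acts on the Duhamel term by raising its offset to ε. The mild equation holds a.e.,
but after smoothing the identity holds at every point. -/
lemma heatFlow_mild (hp : 2 ≤ p) (hs : sing d p < 1) (hu₀ : MemLp u₀ p volume)
    (hu : Mild p T u₀ u) {ε : ℝ} (hε : 0 < ε) (ht : t ∈ Ioc 0 T) :
    heatFlow ε (u t) = heatFlow (t + ε) u₀ - bil ε u u t := by
  have hp1 := one_le_of_two_le hp
  rw [heatFlow_congr (hu.eq t ht), heatFlow_sub hε hp1 (memLp_heatFlow ht.1 hp1 hu₀)
    (memLp_bil hp hs le_rfl ht.1.le ht.2 hu.curve hu.curve), heatFlow_heatFlow hε ht.1 hp1 hu₀,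
    heatFlow_bil hp hs hε le_rfl ht.1.le ht.2 hu.curve hu.curve, zero_add, add_comm]

/-- A mild solution may be restarted. -/
lemma Mild.restart (hp : 2 ≤ p) (hs : sing d p < 1) (hu₀ : MemLp u₀ p volume)
    (hu : Mild p T u₀ u) (ht : t ∈ Ioc 0 T) : Mild p (T - t) (u t) fun s => u (t + s) where
  curve := hu.curve.shift ht.1.le
  eq := fun h hh => by
    rw [heatFlow_mild hp hs hu₀ hu hh.1 ht]
    have h1 := ht.1
    have h2 := hh.1
    have h3 := hh.2
    filter_upwards [hu.eq (t + h) ⟨by linarith, by linarith⟩,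
      bil_add hp hs h2.le h1.le (show t + h ≤ T by linarith) hu.curve hu.curve] with x e1 e2
    rw [e1]
    simp only [Pi.sub_apply]
    rw [e2]; abel

/-- The bilinear estimate with a weight on the first factor. -/
lemma eLpNorm_bil_le_left (hp : 2 ≤ p) (hs : sing d p < 1)
    (ht0 : 0 ≤ t) (ht : t ≤ T) (hu : IsCurve p T u) (hv : IsCurve p T v)
    {A : ℝ → ℝ} (hA0 : ∀ s ∈ Ioo 0 t, 0 ≤ A s) (hAm : Measurable A) {B : ℝ} (hB0 : 0 ≤ B)
    (hA : ∀ s ∈ Ioo 0 t, eLpNorm (u s) p volume ≤ ENNReal.ofReal (A s))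
    (hB : ∀ s ∈ Ioo 0 t, eLpNorm (v s) p volume ≤ ENNReal.ofReal B) :
    eLpNorm (bil 0 u v t) p volume
      ≤ ∫⁻ s in Ioo 0 t, ENNReal.ofReal (bC d * B * ((t - s) ^ (-sing d p) * A s)) := by
  refine (eLpNorm_trip_le hp (ker3_oseenKernel hs ht0 le_rfl) (inv_add_inv_le_one hp) ht0 ht hu hv
    hAm (measurable_const (a := B)) hA0 (fun _ _ => hB0) hA hB).trans_eq ?_
  rw [← lintegral_const_mul' _ _ (by simp)]
  congr 1; funext s
  rw [← ENNReal.ofReal_mul (by positivity)]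
  congr 1
  unfold bC; ring

/-- Uniqueness of mild solutions. -/
lemma Mild.unique (hp : 2 ≤ p) (hs : sing d p < 1)
    (hu : Mild p T u₀ u) (hv : Mild p T u₀ v) : ∀ t ∈ Ioc 0 T, u t =ᵐ[volume] v t := by
  have hp1 := one_le_of_two_le hp
  obtain ⟨A, hA0, hA⟩ := hu.curve.bdd
  obtain ⟨B, hB0, hB⟩ := hv.curve.bdd
  have hb := bC_nonneg d
  have hw := hu.curve.sub hp1 hv.curve
  obtain ⟨l, hl, hint⟩ := exists_exp_weight hs (show 0 ≤ 2 * (bC d * (A + B)) by positivity)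
  -- The difference w solves w = -B(u,w) - B(w,v). In the norm weighted by e^{lt} each substitution
  -- halves the bound, on the whole interval at once; the factor 2 in the choice of l accounts for
  -- the two terms.
  have key : ∀ n : ℕ, ∀ t ∈ Ioc 0 T, eLpNorm (u t - v t) p volume
      ≤ ENNReal.ofReal ((A + B) * Real.exp (l * t) / 2 ^ n) := by
    intro n
    induction n with
    | zero =>
      intro t ht
      refine (eLpNorm_sub_le (hu.curve.mem t ht).1 (hv.curve.mem t ht).1 hp1).trans ?_
      refine (add_le_add (hA t ht) (hB t ht)).trans ?_
      rw [← ENNReal.ofReal_add hA0 hB0]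
      refine ENNReal.ofReal_le_ofReal ?_
      have : 1 ≤ Real.exp (l * t) := Real.one_le_exp (by have := ht.1; positivity)
      rw [pow_zero, div_one]
      exact le_mul_of_one_le_right (by positivity) this
    | succ n ih =>
      intro t ht
      have h1 := ht.1.le
      have hsub : ∀ {s : ℝ}, s ∈ Ioo 0 t → s ∈ Ioc 0 T := fun hs => ⟨hs.1, hs.2.le.trans ht.2⟩
      have e : u t - v t =ᵐ[volume]
          -(bil 0 u (fun s => u s - v s) t + bil 0 (fun s => u s - v s) v t) := by
        filter_upwards [hu.eq t ht, hv.eq t ht, bil_self_sub hp hs h1 ht.2 hu.curve hv.curve]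
          with x e1 e2 e3
        simp only [Pi.sub_apply, Pi.neg_apply, Pi.add_apply]
        rw [e1, e2, ← e3]
        simp only [Pi.sub_apply]; abel
      rw [eLpNorm_congr_ae e, eLpNorm_neg]
      set D : ℝ := (A + B) / 2 ^ n with hD
      have hD0 : 0 ≤ D := by positivity
      have ih' : ∀ s ∈ Ioo 0 t, eLpNorm (u s - v s) p volume ≤ ENNReal.ofReal (D * Real.exp (l * s)) :=
        fun s hs => (ih s (hsub hs)).trans_eq (by rw [hD]; ring_nf)
      refine (eLpNorm_add_le (aestronglyMeasurable_bil hp hs le_rfl h1 ht.2 hu.curve hw)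
        (aestronglyMeasurable_bil hp hs le_rfl h1 ht.2 hw hv.curve) hp1).trans ?_
      have b1 := eLpNorm_bil_le hp hs (inv_add_inv_le_one hp) le_rfl h1 ht.2 hu.curve hw
        (A := A + B) (by positivity) (B := fun s => D * Real.exp (l * s)) (by fun_prop)
        (fun s _ => by positivity)
        (fun s hs => (hA s (hsub hs)).trans (ENNReal.ofReal_le_ofReal (by linarith))) ih'
      have b2 := eLpNorm_bil_le_left hp hs h1 ht.2 hw hv.curve (B := A + B)
        (A := fun s => D * Real.exp (l * s)) (fun s _ => by positivity) (by fun_prop) (by positivity)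
        ih' (fun s hs => (hB s (hsub hs)).trans (ENNReal.ofReal_le_ofReal (by linarith)))
      refine (add_le_add b1 b2).trans ?_
      rw [← two_mul]
      calc 2 * ∫⁻ s in Ioo 0 t, ENNReal.ofReal (bC d * (A + B) *
            ((t - s) ^ (-sing d p) * (D * Real.exp (l * s))))
          = ENNReal.ofReal D * ∫⁻ s in Ioo 0 t, ENNReal.ofReal (2 * (bC d * (A + B)) *
            ((t - s) ^ (-sing d p) * Real.exp (l * s))) := by
            rw [← lintegral_const_mul' _ _ (by simp), ← lintegral_const_mul' _ _ (by simp)]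
            congr 1; funext s
            rw [← ENNReal.ofReal_mul hD0, show (2 : ℝ≥0∞) = ENNReal.ofReal 2 by simp,
              ← ENNReal.ofReal_mul (by norm_num)]
            congr 1; ring
        _ ≤ ENNReal.ofReal D * ENNReal.ofReal (Real.exp (l * t) / 2) := by gcongr; exact hint t
        _ = _ := by
            rw [← ENNReal.ofReal_mul hD0, hD]
            congr 1; ring
  intro t ht
  have h0 : eLpNorm (u t - v t) p volume = 0 := by
    have := tendsto_zero_of_geometric (f := fun _ => eLpNorm (u t - v t) p volume) fun n => key n t ht
    exact tendsto_nhds_unique tendsto_const_nhds this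
  rw [eLpNorm_eq_zero_iff ((hu.curve.mem t ht).1.sub (hv.curve.mem t ht).1)
    (zero_lt_one.trans_le hp1).ne'] at h0
  filter_upwards [h0] with x hx
  simpa [sub_eq_zero] using hx

/-- Persistence of bounds in other Lebesgue spaces. -/
lemma Mild.eLpNorm_le (hp : 2 ≤ p) (hs : sing d p < 1) (hu₀ : MemLp u₀ p volume)
    (hu : Mild p T u₀ u) {r : ℝ≥0∞} (hpr : p⁻¹ + r⁻¹ ≤ 1) {M : ℝ} (hM0 : 0 ≤ M)
    (hM : ∀ t ∈ Ioc 0 T, eLpNorm (u t) p volume ≤ ENNReal.ofReal M)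
    {N : ℝ → ℝ} (hNm : Measurable N) (hN0 : ∀ t ∈ Ioc 0 T, 0 ≤ N t)
    (hheat : ∀ t ∈ Ioc 0 T, eLpNorm (heatFlow t u₀) r volume ≤ ENNReal.ofReal (N t / 2))
    (hint : ∀ t ∈ Ioc 0 T, ∫⁻ s in Ioo 0 t, ENNReal.ofReal (bC d * M * ((t - s) ^ (-sing d p) * N s))
      ≤ ENNReal.ofReal (N t / 2)) :
    ∀ t ∈ Ioc 0 T, eLpNorm (u t) r volume ≤ ENNReal.ofReal (N t) := by
  have hp1 := one_le_of_two_le hp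
  have hr : 1 ≤ r := ENNReal.inv_le_one.1 (le_add_self.trans hpr)
  have hb := bC_nonneg d
  -- The iteration v ↦ e^{tΔ}u₀ - B(u,v) is linear, with u frozen and controlled in L^p only.
  -- Starting from 0, the iterates inherit the L^r bound by induction and converge in L^p to u, so
  -- lower semicontinuity of the L^r norm transfers the bound.
  let w : ℕ → ℝ → Sp d → Sp d := fun n => Nat.rec (fun _ _ => 0)
    (fun _ v t => heatFlow t u₀ - bil 0 u v t) n
  have hw1 : ∀ n t, w (n + 1) t = heatFlow t u₀ - bil 0 u (w n) t := fun n t => rfl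
  have hw0 : ∀ t, w 0 t = fun _ => 0 := fun t => rfl
  have hcurve : ∀ n, IsCurve p T (w n) := by
    intro n
    induction n with
    | zero =>
      refine ⟨fun t _ => ?_, fun t _ => ?_, 0, le_rfl, fun t _ => ?_⟩
      · rw [hw0]; exact MemLp.zero
      · simpa [hw0] using tendsto_const_nhds
      · simp [hw0]
    | succ n ih => exact (isCurve_heatFlow hp1 hu₀ T).sub hp1 (isCurve_bil hp hs hu.curve ih)
  have hsub : ∀ {s t : ℝ}, t ∈ Ioc 0 T → s ∈ Ioo 0 t → s ∈ Ioc 0 T := fun ht hs =>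
    ⟨hs.1, hs.2.le.trans ht.2⟩
  have hbound : ∀ n, ∀ t ∈ Ioc 0 T, eLpNorm (w n t) r volume ≤ ENNReal.ofReal (N t) := by
    intro n
    induction n with
    | zero => intro t _; simp [hw0]
    | succ n ih =>
      intro t ht
      have h1 := ht.1.le
      have hNt := hN0 t ht
      rw [hw1]
      refine (eLpNorm_sub_le (memLp_heatFlow ht.1 hp1 hu₀).1
        (aestronglyMeasurable_bil hp hs le_rfl h1 ht.2 hu.curve (hcurve n)) hr).trans ?_
      rw [show N t = N t / 2 + N t / 2 by ring, ENNReal.ofReal_add (by positivity) (by positivity)]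
      refine add_le_add (hheat t ht) ((eLpNorm_bil_le hp hs hpr le_rfl h1 ht.2 hu.curve (hcurve n) hM0 hNm
        (fun s hs => hN0 s (hsub ht hs)) (fun s hs => hM s (hsub ht hs))
        (fun s hs => ih s (hsub ht hs))).trans (hint t ht))
  obtain ⟨l, hl, hl'⟩ := exists_exp_weight hs (show 0 ≤ bC d * M by positivity)
  have hconv : ∀ n, ∀ t ∈ Ioc 0 T,
      eLpNorm (w n t - u t) p volume ≤ ENNReal.ofReal (M * Real.exp (l * t) / 2 ^ n) := by
    intro n
    induction n with
    | zero =>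
      intro t ht
      rw [hw0, show (fun _ => (0 : Sp d)) - u t = - u t by funext x; simp, eLpNorm_neg]
      refine (hM t ht).trans (ENNReal.ofReal_le_ofReal ?_)
      have : 1 ≤ Real.exp (l * t) := Real.one_le_exp (by have := ht.1; positivity)
      rw [pow_zero, div_one]
      exact le_mul_of_one_le_right hM0 this
    | succ n ih =>
      intro t ht
      have h1 := ht.1.le
      have hc := hu.curve.sub hp1 (hcurve n)
      have e : w (n + 1) t - u t =ᵐ[volume] bil 0 u (fun s => u s - w n s) t := by
        filter_upwards [hu.eq t ht, bil_sub_right hp hs h1 ht.2 hu.curve hu.curve (hcurve n)]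
          with x e1 e3
        rw [← e3, hw1]
        simp only [Pi.sub_apply]
        rw [e1]
        simp only [Pi.sub_apply]; abel
      rw [eLpNorm_congr_ae e]
      set D : ℝ := M / 2 ^ n with hD
      have hD0 : 0 ≤ D := by positivity
      have b1 := eLpNorm_bil_le hp hs (inv_add_inv_le_one hp) le_rfl h1 ht.2 hu.curve hc
        (A := M) hM0 (B := fun s => D * Real.exp (l * s)) (by fun_prop)
        (fun s _ => by positivity) (fun s hs => hM s (hsub ht hs)) (fun s hs => by
          rw [eLpNorm_sub_comm]
          exact (ih s (hsub ht hs)).trans_eq (by rw [hD]; ring_nf))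
      refine b1.trans ?_
      calc _ = ENNReal.ofReal D * ∫⁻ s in Ioo 0 t, ENNReal.ofReal (bC d * M *
            ((t - s) ^ (-sing d p) * Real.exp (l * s))) := by
            rw [← lintegral_const_mul' _ _ (by simp)]
            congr 1; funext s
            rw [← ENNReal.ofReal_mul hD0]
            congr 1; ring
        _ ≤ ENNReal.ofReal D * ENNReal.ofReal (Real.exp (l * t) / 2) := by gcongr; exact hl' t
        _ = _ := by
            rw [← ENNReal.ofReal_mul hD0, hD]
            congr 1; ring
  intro t ht
  exact eLpNorm_le_of_tendsto_eLpNorm (zero_lt_one.trans_le hp1).ne'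
    (fun n => ((hcurve n).mem t ht).1) (hu.curve.mem t ht).1
    (tendsto_zero_of_geometric fun n => hconv n t ht) fun n => hbound n t ht

lemma inv_add_inv_two_le_one (hp : 2 ≤ p) : p⁻¹ + 2⁻¹ ≤ 1 :=
  (add_le_add (ENNReal.inv_le_inv.2 hp) le_rfl).trans_eq ENNReal.inv_two_add_inv_two

/-- Boundedness in `L^2`. -/
lemma Mild.exists_eLpNorm_two_le (hp : 2 ≤ p) (hs : sing d p < 1) (hu₀ : MemLp u₀ p volume)
    (hu₂ : MemLp u₀ 2 volume) (hu : Mild p T u₀ u) :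
    ∃ A : ℝ, 0 ≤ A ∧ ∀ t ∈ Ioc 0 T, eLpNorm (u t) 2 volume ≤ ENNReal.ofReal A := by
  obtain ⟨M, hM0, hM⟩ := hu.curve.bdd
  have hb := bC_nonneg d
  obtain ⟨l, hl, hl'⟩ := exists_exp_weight hs (show 0 ≤ bC d * M by positivity)
  set A := (eLpNorm u₀ 2 volume).toReal with hA
  have hA0 : 0 ≤ A := ENNReal.toReal_nonneg
  have hA' : eLpNorm u₀ 2 volume = ENNReal.ofReal A := (ENNReal.ofReal_toReal hu₂.eLpNorm_ne_top).symm
  have key := hu.eLpNorm_le hp hs hu₀ (inv_add_inv_two_le_one hp) hM0 hM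
    (N := fun t => 2 * A * Real.exp (l * t)) (by fun_prop) (fun t _ => by positivity)
    (fun t ht => ?_) (fun t ht => ?_)
  · refine ⟨2 * A * Real.exp (l * T), by positivity, fun t ht => (key t ht).trans ?_⟩
    have := ht.2
    gcongr
  · refine (eLpNorm_heatFlow_le ht.1 (by norm_num) hu₂.1).trans ?_
    rw [hA']
    refine ENNReal.ofReal_le_ofReal ?_
    have : 1 ≤ Real.exp (l * t) := Real.one_le_exp (by have := ht.1; positivity)
    nlinarith
  · calc _ = ENNReal.ofReal (2 * A) * ∫⁻ s in Ioo 0 t, ENNReal.ofReal (bC d * M *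
            ((t - s) ^ (-sing d p) * Real.exp (l * s))) := by
            rw [← lintegral_const_mul' _ _ ENNReal.ofReal_ne_top]
            congr 1; funext s
            rw [← ENNReal.ofReal_mul (by positivity)]
            congr 1; ring
        _ ≤ ENNReal.ofReal (2 * A) * ENNReal.ofReal (Real.exp (l * t) / 2) := by gcongr; exact hl' t
        _ = _ := by
            rw [← ENNReal.ofReal_mul (by positivity)]
            congr 1; ring

/-- Splitting at t/2: on each half one of the two powers is bounded by its value at t/2 and the
other one is integrated. -/
lemma lintegral_sub_rpow_mul_rpow_le {a b t : ℝ} (ha : a < 1) (hb : b < 1) (ha0 : 0 ≤ a)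
    (hb0 : 0 ≤ b) (ht : 0 < t) :
    ∫⁻ s in Ioo 0 t, ENNReal.ofReal ((t - s) ^ (-a) * s ^ (-b))
      ≤ ENNReal.ofReal ((2 ^ b / (1 - a) + 2 ^ a / (1 - b)) * t ^ (1 - a) * t ^ (-b)) := by
  have ha1 : 0 < 1 - a := by linarith
  have hb1 : 0 < 1 - b := by linarith
  have hsymm : ∫⁻ s in Ioo 0 t, ENNReal.ofReal (s ^ (-b)) = ENNReal.ofReal (t ^ (1 - b) / (1 - b)) := by
    rw [← lintegral_sub_rpow ht.le hb]
    have hm : MeasurePreserving (fun s : ℝ => t - s) volume volume :=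
      Measure.measurePreserving_sub_left volume t
    have hpre : (fun s : ℝ => t - s) ⁻¹' (Ioo 0 t) = Ioo 0 t := by
      ext s; simp only [mem_preimage, mem_Ioo]; constructor <;> rintro ⟨h1, h2⟩ <;> constructor <;> linarith
    have := hm.setLIntegral_comp_preimage measurableSet_Ioo
      (f := fun s => ENNReal.ofReal (s ^ (-b))) (by fun_prop) (s := Ioo 0 t)
    rw [hpre] at this
    exact this.symm
  calc _ ≤ ∫⁻ s in Ioo 0 t, (ENNReal.ofReal ((t / 2) ^ (-b)) * ENNReal.ofReal ((t - s) ^ (-a))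
          + ENNReal.ofReal ((t / 2) ^ (-a)) * ENNReal.ofReal (s ^ (-b))) := by
        refine setLIntegral_mono' measurableSet_Ioo fun s hs => ?_
        have h1 := hs.1
        have h2 : 0 < t - s := by linarith [hs.2]
        rw [← ENNReal.ofReal_mul (by positivity), ← ENNReal.ofReal_mul (by positivity),
          ← ENNReal.ofReal_add (by positivity) (by positivity)]
        refine ENNReal.ofReal_le_ofReal ?_
        rcases le_total (t / 2) s with h | h
        · have := Real.rpow_le_rpow_of_nonpos (by positivity) h (neg_nonpos.2 hb0)
          have h3 : 0 ≤ (t - s) ^ (-a) := by positivity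
          have h4 : 0 ≤ (t / 2) ^ (-a) * s ^ (-b) := by positivity
          nlinarith
        · have := Real.rpow_le_rpow_of_nonpos (by positivity) (show t / 2 ≤ t - s by linarith)
            (neg_nonpos.2 ha0)
          have h3 : 0 ≤ s ^ (-b) := by positivity
          have h4 : 0 ≤ (t / 2) ^ (-b) * (t - s) ^ (-a) := by positivity
          nlinarith
    _ = _ := by
        rw [lintegral_add_left (by fun_prop), lintegral_const_mul' _ _ (by simp),
          lintegral_const_mul' _ _ (by simp), hsymm, lintegral_sub_rpow ht.le ha,
          ← ENNReal.ofReal_mul (by positivity), ← ENNReal.ofReal_mul (by positivity),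
          ← ENNReal.ofReal_add (by positivity) (by positivity)]
        congr 1
        have e1 : ∀ c : ℝ, (t / 2) ^ (-c) = t ^ (-c) * 2 ^ c := fun c => by
          rw [Real.div_rpow ht.le (by norm_num), Real.rpow_neg (by norm_num : (0 : ℝ) ≤ 2), div_inv_eq_mul]
        have e2 : t ^ (-a) * t ^ (1 - b) = t ^ (1 - a) * t ^ (-b) := by
          rw [← Real.rpow_add ht, ← Real.rpow_add ht]; ring_nf
        rw [e1, e1]
        linear_combination (2 ^ a / (1 - b)) * e2

/-- Smoothing: mild solutions are bounded for short positive times. -/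
lemma exists_smoothing (hp : 2 ≤ p) (hs : sing d p < 1) {M : ℝ} (hM0 : 0 ≤ M) : ∃ η : ℝ, 0 < η ∧
    ∀ (u₀ : Sp d → Sp d) (u : ℝ → Sp d → Sp d) (T : ℝ), MemLp u₀ p volume → Mild p T u₀ u → T ≤ η →
      eLpNorm u₀ p volume ≤ ENNReal.ofReal M →
      (∀ t ∈ Ioc 0 T, eLpNorm (u t) p volume ≤ ENNReal.ofReal M) →
      ∀ t ∈ Ioc 0 T, eLpNorm (u t) ∞ volume
        ≤ ENNReal.ofReal (2 * M * t ^ (-((d : ℝ) / 2 * rexp p))) := by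
  have hp1 := one_le_of_two_le hp
  have hb := bC_nonneg d
  have hr := rexp_nonneg p
  set b : ℝ := (d : ℝ) / 2 * rexp p with hbdef
  have hb0 : 0 ≤ b := by positivity
  have hab : sing d p = 1 / 2 + b := rfl
  have ha1 : 0 < 1 - sing d p := by linarith
  set κ : ℝ := 2 ^ b / (1 - sing d p) + 2 ^ sing d p / (1 - b) with hκ
  have hκ0 : 0 ≤ κ := by
    have : 0 < 1 - b := by linarith
    positivity
  -- The weight N(t) = 2 M t^(-b) reproduces itself under the bilinear estimate up to the factor 2
  -- `bC` M κ t^(1-sing) relative to N(t)/2; η makes this factor at most 1 for t ≤ η.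
  have hlim : Tendsto (fun η : ℝ => bC d * M * (κ * η ^ (1 - sing d p))) (𝓝[>] 0) (𝓝 0) := by
    have : Continuous fun η : ℝ => bC d * M * (κ * η ^ (1 - sing d p)) := by
      have := Real.continuous_rpow_const (q := 1 - sing d p) ha1.le
      fun_prop
    have := (this.tendsto 0).mono_left (nhdsWithin_le_nhds (s := Ioi 0))
    simpa [Real.zero_rpow ha1.ne'] using this
  obtain ⟨η, hη, hη0⟩ := ((hlim.eventually (gt_mem_nhds (show (0 : ℝ) < 1 / 2 by norm_num))).and
    self_mem_nhdsWithin).exists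
  have hη0 : 0 < η := hη0
  refine ⟨η, hη0, fun u₀ u T hu₀ hu hT hM₀ hM => ?_⟩
  refine hu.eLpNorm_le hp hs hu₀ (by simpa using hp1) hM0 hM (by fun_prop)
    (fun t ht => by have := ht.1; positivity) (fun t ht => ?_) (fun t ht => ?_)
  · refine (eLpNorm_top_heatFlow_le ht.1 hp1 hu₀.1).trans ?_
    have h1 := ht.1
    rw [show 2 * M * t ^ (-b) / 2 = t ^ (-b) * M by ring, ENNReal.ofReal_mul (by positivity),
      show -(d : ℝ) / 2 * rexp p = -b by rw [hbdef]; ring]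
    gcongr
  · have h1 := ht.1
    calc _ = ENNReal.ofReal (bC d * M * (2 * M)) *
          ∫⁻ s in Ioo 0 t, ENNReal.ofReal ((t - s) ^ (-sing d p) * s ^ (-b)) := by
            rw [← lintegral_const_mul' _ _ (by simp)]
            congr 1; funext s
            rw [← ENNReal.ofReal_mul (by positivity)]
            congr 1; ring
      _ ≤ ENNReal.ofReal (bC d * M * (2 * M)) * ENNReal.ofReal (κ * t ^ (1 - sing d p) * t ^ (-b)) := by
            gcongr
            exact lintegral_sub_rpow_mul_rpow_le hs (by linarith) (sing_pos d p).le hb0 h1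
      _ ≤ _ := by
            rw [← ENNReal.ofReal_mul (by positivity)]
            refine ENNReal.ofReal_le_ofReal ?_
            have h2 : t ^ (1 - sing d p) ≤ η ^ (1 - sing d p) :=
              Real.rpow_le_rpow h1.le (ht.2.trans hT) ha1.le
            have h3 : bC d * M * (κ * t ^ (1 - sing d p)) ≤ 1 / 2 :=
              le_trans (by gcongr) hη.le
            have h4 : 0 ≤ 2 * M * t ^ (-b) := by positivity
            nlinarith

/-- Mild solutions are bounded away from the initial time. -/
lemma Mild.exists_eLpNorm_top_le (hp : 2 ≤ p) (hs : sing d p < 1) (hu₀ : MemLp u₀ p volume)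
    (hu : Mild p T u₀ u) {δ : ℝ} (hδ : 0 < δ) :
    ∃ A : ℝ, 0 ≤ A ∧ ∀ t ∈ Icc δ T, eLpNorm (u t) ∞ volume ≤ ENNReal.ofReal A := by
  obtain ⟨M, hM0, hM⟩ := hu.curve.bdd
  obtain ⟨η, hη, key⟩ := exists_smoothing (d := d) hp hs hM0
  -- Each time t ≥ δ is reached by a restart at t - τ > 0, so the smoothing estimate is always used
  -- at the same elapsed time τ and the bound is uniform.
  set τ := min η (δ / 2) with hτ
  have hτ0 : 0 < τ := by positivity
  refine ⟨2 * M * τ ^ (-((d : ℝ) / 2 * rexp p)), by positivity, fun t ht => ?_⟩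
  have h1 : τ ≤ δ / 2 := min_le_right _ _
  have h2 := ht.1
  have h3 := ht.2
  have hmem : t - τ ∈ Ioc 0 T := ⟨by linarith, by linarith⟩
  have hr := (hu.restart hp hs hu₀ hmem).mono (show τ ≤ T - (t - τ) by linarith)
  have := key _ _ _ (hu.curve.mem _ hmem) hr (min_le_left _ _) (hM _ hmem) (fun s hs =>
    hM _ ⟨by linarith [hs.1], by linarith [hs.2]⟩) τ ⟨hτ0, le_rfl⟩
  simpa using this

end Mild

end NavierStokes

/-! ### Local existence, continuation, and the link with the stated definition. -/

namespace NavierStokes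

variable {d : ℕ}

/-- Rapidly Cauchy sequences of curves converge. -/
lemma IsCurve.exists_limit {p : ℝ≥0∞} (hp : 1 ≤ p) {T D : ℝ} (hD : 0 ≤ D)
    {w : ℕ → ℝ → Sp d → Sp d} (hw : ∀ n, IsCurve p T (w n))
    (h : ∀ n, ∀ t ∈ Ioc 0 T, eLpNorm (w (n + 1) t - w n t) p volume ≤ ENNReal.ofReal (D / 2 ^ n)) :
    ∃ u, IsCurve p T u ∧
      ∀ n, ∀ t ∈ Ioc 0 T, eLpNorm (w n t - u t) p volume ≤ ENNReal.ofReal (2 * D / 2 ^ n) := by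
  have hp0 : p ≠ 0 := (zero_lt_one.trans_le hp).ne'
  have hcau : ∀ t ∈ Ioc 0 T, ∀ n m, eLpNorm (w n t - w (m + n) t) p volume
      ≤ ENNReal.ofReal (2 * D / 2 ^ n - 2 * D / 2 ^ (m + n)) := by
    intro t ht n m
    induction m with
    | zero => simp
    | succ m ih =>
      have e : w n t - w (m + 1 + n) t
          = (w n t - w (m + n) t) - (w (m + n + 1) t - w (m + n) t) := by
        rw [show m + 1 + n = m + n + 1 by ring]; abel
      rw [e]
      refine (eLpNorm_sub_le (((hw _).mem t ht).sub ((hw _).mem t ht)).1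
        (((hw _).mem t ht).sub ((hw _).mem t ht)).1 hp).trans ?_
      refine (add_le_add ih (h (m + n) t ht)).trans ?_
      rw [← ENNReal.ofReal_add]
      · refine ENNReal.ofReal_le_ofReal (le_of_eq ?_)
        rw [show m + 1 + n = (m + n) + 1 by ring, pow_succ]
        field_simp
        ring
      · rw [sub_nonneg]
        gcongr
        · norm_num
        · omega
      · positivity
  have hlim : ∀ t, ∃ f : Sp d → Sp d, t ∈ Ioc 0 T → MemLp f p volume ∧
      Tendsto (fun n => eLpNorm (w n t - f) p volume) atTop (𝓝 0) := by
    intro t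
    by_cases ht : t ∈ Ioc 0 T
    swap
    · exact ⟨0, fun h => absurd h ht⟩
    -- The two Cauchy tails give 2D + 2D; the extra 1 provides the strict inequality required by the
    -- completeness statement, also when D = 0.
    have hBs : Summable fun n : ℕ => (2 * D + 2 * D + 1) / (2 : ℝ) ^ n := by
      have := (summable_geometric_of_lt_one (r := (1 / 2 : ℝ)) (by norm_num) (by norm_num)).mul_left
        (2 * D + 2 * D + 1)
      simpa [div_eq_mul_inv] using this
    obtain ⟨f, hf, hf'⟩ := Lp.cauchy_complete_eLpNorm hp (fun n => (hw n).mem t ht)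
      (B := fun n => ENNReal.ofReal ((2 * D + 2 * D + 1) / 2 ^ n))
      (by rw [← ENNReal.ofReal_tsum_of_nonneg (fun n => by positivity) hBs]; exact ENNReal.ofReal_ne_top)
      (fun N n m hn hm => by
        have key : ∀ m, N ≤ m → eLpNorm (w N t - w m t) p volume ≤ ENNReal.ofReal (2 * D / 2 ^ N) := by
          intro m hm
          obtain ⟨k, rfl⟩ := Nat.exists_eq_add_of_le' hm
          exact (hcau t ht N k).trans (ENNReal.ofReal_le_ofReal (by
            have : 0 ≤ 2 * D / 2 ^ (k + N) := by positivity
            linarith))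
        have e : w n t - w m t = (w N t - w m t) - (w N t - w n t) := by abel
        rw [e]
        refine ((eLpNorm_sub_le (((hw _).mem t ht).sub ((hw _).mem t ht)).1
          (((hw _).mem t ht).sub ((hw _).mem t ht)).1 hp).trans (add_le_add (key m hm) (key n hn))).trans_lt ?_
        rw [← ENNReal.ofReal_add (by positivity) (by positivity)]
        refine (ENNReal.ofReal_lt_ofReal_iff (by positivity)).2 ?_
        rw [← add_div]
        exact div_lt_div_of_pos_right (by linarith) (by positivity))
    exact ⟨f, fun _ => ⟨hf, hf'⟩⟩
  choose u hu using hlim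
  have hum : ∀ t ∈ Ioc 0 T, MemLp (u t) p volume := fun t ht => (hu t ht).1
  have hest : ∀ n, ∀ t ∈ Ioc 0 T,
      eLpNorm (w n t - u t) p volume ≤ ENNReal.ofReal (2 * D / 2 ^ n) := by
    intro n t ht
    refine eLpNorm_le_of_tendsto_eLpNorm hp0 (v := fun m => w n t - w (m + n) t) (r := p) (p := p)
      (fun m => (((hw _).mem t ht).sub ((hw _).mem t ht)).1) (((hw _).mem t ht).sub (hum t ht)).1 ?_
      fun m => (hcau t ht n m).trans (ENNReal.ofReal_le_ofReal (by
            have : 0 ≤ 2 * D / 2 ^ (m + n) := by positivity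
            linarith))
    have h1 := ((tendsto_add_atTop_iff_nat n).2 (hu t ht).2)
    refine h1.congr fun m => ?_
    rw [eLpNorm_sub_comm]
    congr 1; abel
  refine ⟨u, ⟨hum, fun t ht => ?_, ?_⟩, hest⟩
  · rw [ENNReal.tendsto_nhds_zero]
    intro ε hε
    have hg := tendsto_zero_of_geometric (f := fun n : ℕ => ENNReal.ofReal (2 * D / 2 ^ n)) fun n => le_rfl
    have hε3 : 0 < ε / 3 := ENNReal.div_pos hε.ne' (by simp)
    obtain ⟨n, hn⟩ := ((ENNReal.tendsto_nhds_zero.1 hg) (ε / 3) hε3).exists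
    filter_upwards [(ENNReal.tendsto_nhds_zero.1 ((hw n).cont t ht)) (ε / 3) hε3,
      self_mem_nhdsWithin] with s hs hsT
    have e : u s - u t = ((w n s - w n t) - (w n s - u s)) + (w n t - u t) := by abel
    rw [e]
    have m1 := ((hw n).mem s hsT).sub ((hw n).mem t ht)
    have m2 := ((hw n).mem s hsT).sub (hum s hsT)
    have m3 := ((hw n).mem t ht).sub (hum t ht)
    refine (eLpNorm_add_le (m1.sub m2).1 m3.1 hp).trans ?_
    refine (add_le_add_left (eLpNorm_sub_le m1.1 m2.1 hp) _).trans ?_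
    calc _ ≤ ε / 3 + ε / 3 + ε / 3 :=
          add_le_add (add_le_add hs ((hest n s hsT).trans hn)) ((hest n t ht).trans hn)
      _ = ε := ENNReal.add_thirds ε
  · obtain ⟨M, hM0, hM⟩ := (hw 0).bdd
    refine ⟨M + 2 * D, by positivity, fun t ht => ?_⟩
    have e : u t = w 0 t - (w 0 t - u t) := by abel
    rw [e, ENNReal.ofReal_add hM0 (by positivity)]
    refine (eLpNorm_sub_le ((hw 0).mem t ht).1 (((hw 0).mem t ht).sub (hum t ht)).1 hp).trans ?_
    exact add_le_add (hM t ht) ((hest 0 t ht).trans_eq (by simp))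

/-- The constant of the bilinear estimate in `L^p`. -/
def eC (d : ℕ) (p : ℝ≥0∞) : ℝ := bC d / (1 - sing d p)

lemma eC_nonneg {p : ℝ≥0∞} (hs : sing d p < 1) : 0 ≤ eC d p :=
  div_nonneg (bC_nonneg d) (by linarith)

section Existence

variable {p : ℝ≥0∞} {T t : ℝ} {u v : ℝ → Sp d → Sp d} {u₀ : Sp d → Sp d}

/-- The quadratic term is Lipschitz on balls: u ⊗ u - v ⊗ v = u ⊗ (u-v) + (u-v) ⊗ v, and the two
summands give the factor 2. -/
lemma eLpNorm_bil_self_sub_le (hp : 2 ≤ p) (hs : sing d p < 1) (ht : t ∈ Ioc 0 T)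
    (hu : IsCurve p T u) (hv : IsCurve p T v) {A δ : ℝ} (hA0 : 0 ≤ A) (hδ : 0 ≤ δ)
    (hA : ∀ s ∈ Ioc 0 T, eLpNorm (u s) p volume ≤ ENNReal.ofReal A)
    (hB : ∀ s ∈ Ioc 0 T, eLpNorm (v s) p volume ≤ ENNReal.ofReal A)
    (huv : ∀ s ∈ Ioc 0 T, eLpNorm (u s - v s) p volume ≤ ENNReal.ofReal δ) :
    eLpNorm (bil 0 u u t - bil 0 v v t) p volume
      ≤ ENNReal.ofReal (2 * (eC d p * T ^ (1 - sing d p) * (A * δ))) := by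
  have hp1 := one_le_of_two_le hp
  have hC := eC_nonneg hs
  have h1 := ht.1.le
  have hw := hu.sub hp1 hv
  have hsub : ∀ {s : ℝ}, s ∈ Ioo 0 t → s ∈ Ioc 0 T := fun hs => ⟨hs.1, hs.2.le.trans ht.2⟩
  have hT : t ^ (1 - sing d p) ≤ T ^ (1 - sing d p) := Real.rpow_le_rpow h1 ht.2 (by linarith)
  have e : bil 0 u u t - bil 0 v v t =ᵐ[volume]
      bil 0 u (fun s => u s - v s) t + bil 0 (fun s => u s - v s) v t :=
    bil_self_sub hp hs h1 ht.2 hu hv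
  rw [eLpNorm_congr_ae e]
  refine (eLpNorm_add_le (aestronglyMeasurable_bil hp hs le_rfl h1 ht.2 hu hw)
    (aestronglyMeasurable_bil hp hs le_rfl h1 ht.2 hw hv) hp1).trans ?_
  have hTp : 0 ≤ T ^ (1 - sing d p) := Real.rpow_nonneg (h1.trans ht.2) _
  rw [two_mul, ENNReal.ofReal_add (by positivity) (by positivity)]
  refine add_le_add ?_ ?_
  · refine (eLpNorm_bil_le_const hp hs (inv_add_inv_le_one hp) le_rfl h1 ht.2 hu hw hA0 hδ
      (fun s hs => hA s (hsub hs)) (fun s hs => huv s (hsub hs))).trans ?_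
    change ENNReal.ofReal (eC d p * _ * _) ≤ _
    gcongr
  · refine (eLpNorm_bil_le_const hp hs (inv_add_inv_le_one hp) le_rfl h1 ht.2 hw hv hδ hA0
      (fun s hs => huv s (hsub hs)) (fun s hs => hB s (hsub hs))).trans ?_
    change ENNReal.ofReal (eC d p * _ * _) ≤ _
    rw [mul_comm δ A]
    gcongr

/-- Local existence. -/
lemma exists_mild (hp : 2 ≤ p) (hs : sing d p < 1) (hu₀ : MemLp u₀ p volume) {A : ℝ} (hA0 : 0 ≤ A)
    (hA : eLpNorm u₀ p volume ≤ ENNReal.ofReal A) (hT : 0 ≤ T)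
    (hsmall : 8 * (eC d p * T ^ (1 - sing d p) * A) ≤ 1) :
    ∃ u, Mild p T u₀ u ∧ ∀ t ∈ Ioc 0 T, eLpNorm (u t) p volume ≤ ENNReal.ofReal (2 * A) := by
  have hp1 := one_le_of_two_le hp
  have hp0 : p ≠ 0 := (zero_lt_one.trans_le hp1).ne'
  have hC := eC_nonneg hs
  have hTp : 0 ≤ T ^ (1 - sing d p) := Real.rpow_nonneg hT _
  obtain ⟨w, hw0, hw1⟩ : ∃ w : ℕ → ℝ → Sp d → Sp d, (∀ t, w 0 t = fun _ => 0) ∧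
      ∀ n t, w (n + 1) t = heatFlow t u₀ - bil 0 (w n) (w n) t :=
    ⟨fun n => Nat.rec (fun _ _ => 0) (fun _ v t => heatFlow t u₀ - bil 0 v v t) n,
      fun _ => rfl, fun _ _ => rfl⟩
  have hcurve : ∀ n, IsCurve p T (w n) := by
    intro n
    induction n with
    | zero =>
      refine ⟨fun t _ => ?_, fun t _ => ?_, 0, le_rfl, fun t _ => ?_⟩
      · rw [hw0]; exact MemLp.zero
      · simpa [hw0] using tendsto_const_nhds
      · simp [hw0]
    | succ n ih =>
      rw [show w (n + 1) = _ from funext (hw1 n)]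
      exact (isCurve_heatFlow hp1 hu₀ T).sub hp1 (isCurve_bil hp hs ih ih)
  -- Origin of the 8 in the smallness condition: it gives C T^γ (2A)² ≤ A/2, so the ball of radius
  -- 2A is preserved, and 2 C T^γ (2A) ≤ 1/2, the contraction factor used for consecutive iterates.
  have hbound : ∀ n, ∀ t ∈ Ioc 0 T, eLpNorm (w n t) p volume ≤ ENNReal.ofReal (2 * A) := by
    intro n
    induction n with
    | zero => intro t _; simp [hw0]
    | succ n ih =>
      intro t ht
      have h1 := ht.1.le
      rw [hw1]
      refine (eLpNorm_sub_le (memLp_heatFlow ht.1 hp1 hu₀).1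
        (aestronglyMeasurable_bil hp hs le_rfl h1 ht.2 (hcurve n) (hcurve n)) hp1).trans ?_
      rw [two_mul, ENNReal.ofReal_add hA0 hA0]
      refine add_le_add ((eLpNorm_heatFlow_le ht.1 hp1 hu₀.1).trans hA) ?_
      refine (eLpNorm_bil_le_const hp hs (inv_add_inv_le_one hp) le_rfl h1 ht.2 (hcurve n) (hcurve n)
        (A := 2 * A) (B := 2 * A) (by positivity) (by positivity)
        (fun s hs => ih s ⟨hs.1, hs.2.le.trans ht.2⟩)
        (fun s hs => ih s ⟨hs.1, hs.2.le.trans ht.2⟩)).trans ?_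
      change ENNReal.ofReal (eC d p * _ * _) ≤ _
      refine ENNReal.ofReal_le_ofReal ?_
      have hT' : t ^ (1 - sing d p) ≤ T ^ (1 - sing d p) := Real.rpow_le_rpow h1 ht.2 (by linarith)
      calc _ ≤ eC d p * T ^ (1 - sing d p) * (2 * A * (2 * A)) := by gcongr
        _ = 8 * (eC d p * T ^ (1 - sing d p) * A) * (A / 2) := by ring
        _ ≤ 1 * (A / 2) := by gcongr
        _ ≤ A := by linarith
  have hdiff : ∀ n, ∀ t ∈ Ioc 0 T,
      eLpNorm (w (n + 1) t - w n t) p volume ≤ ENNReal.ofReal (2 * A / 2 ^ n) := by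
    intro n
    induction n with
    | zero =>
      intro t ht
      rw [hw0, show w (0 + 1) t - (fun _ => (0 : Sp d)) = w (0 + 1) t by funext x; simp]
      simpa using hbound 1 t ht
    | succ n ih =>
      intro t ht
      have e : w (n + 1 + 1) t - w (n + 1) t
          = -(bil 0 (w (n + 1)) (w (n + 1)) t - bil 0 (w n) (w n) t) := by
        rw [hw1 (n + 1), hw1 n]; abel
      rw [e, eLpNorm_neg]
      refine (eLpNorm_bil_self_sub_le hp hs ht (hcurve _) (hcurve _) (A := 2 * A) (by positivity)
        (by positivity) (hbound _) (hbound _) ih).trans (ENNReal.ofReal_le_ofReal ?_)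
      calc _ = 8 * (eC d p * T ^ (1 - sing d p) * A) * (2 * A / 2 ^ (n + 1)) := by
            rw [pow_succ]; field_simp; ring
        _ ≤ 1 * (2 * A / 2 ^ (n + 1)) := by gcongr
        _ = _ := one_mul _
  obtain ⟨u, hu, hlim⟩ := IsCurve.exists_limit hp1 (D := 2 * A) (by positivity) hcurve hdiff
  have hub : ∀ t ∈ Ioc 0 T, eLpNorm (u t) p volume ≤ ENNReal.ofReal (2 * A) := fun t ht =>
    eLpNorm_le_of_tendsto_eLpNorm hp0 (fun n => ((hcurve n).mem t ht).1) (hu.mem t ht).1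
      (tendsto_zero_of_geometric fun n => hlim n t ht) fun n => hbound n t ht
  refine ⟨u, ⟨hu, fun t ht => ?_⟩, hub⟩
  have h1 := ht.1.le
  have mh := memLp_heatFlow ht.1 hp1 hu₀
  have mb := memLp_bil hp hs le_rfl h1 ht.2 hu hu
  have key : ∀ n : ℕ, eLpNorm (u t - (heatFlow t u₀ - bil 0 u u t)) p volume
      ≤ ENNReal.ofReal (8 * A / 2 ^ n) := by
    intro n
    have e : u t - (heatFlow t u₀ - bil 0 u u t)
        = -(bil 0 (w n) (w n) t - bil 0 u u t) - (w (n + 1) t - u t)+ 0 := by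
      rw [hw1, add_zero]; abel
    rw [e, add_zero]
    refine (eLpNorm_sub_le ((memLp_bil hp hs le_rfl h1 ht.2 (hcurve n) (hcurve n)).sub mb).neg.1
      (((hcurve (n + 1)).mem t ht).sub (hu.mem t ht)).1 hp1).trans ?_
    rw [eLpNorm_neg]
    refine (add_le_add (eLpNorm_bil_self_sub_le hp hs ht (hcurve n) hu (A := 2 * A) (by positivity)
        (by positivity) (hbound n) hub (hlim n)) (hlim (n + 1) t ht)).trans ?_
    rw [← ENNReal.ofReal_add (by positivity) (by positivity)]
    refine ENNReal.ofReal_le_ofReal ?_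
    have h2 : 2 * (eC d p * T ^ (1 - sing d p) * (2 * A * (2 * (2 * A) / 2 ^ n)))
        = 8 * (eC d p * T ^ (1 - sing d p) * A) * (2 * A / 2 ^ n) := by ring
    have h3 : 8 * (eC d p * T ^ (1 - sing d p) * A) * (2 * A / 2 ^ n) ≤ 1 * (2 * A / 2 ^ n) := by gcongr
    have h4 : 2 * (2 * A) / 2 ^ (n + 1) = 2 * A / 2 ^ n := by rw [pow_succ]; field_simp
    have h5 : 8 * A / 2 ^ n = 4 * (2 * A / 2 ^ n) := by ring
    have h6 : 0 ≤ 2 * A / 2 ^ n := by positivity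
    rw [h2, h4, h5]; linarith
  have h0 : eLpNorm (u t - (heatFlow t u₀ - bil 0 u u t)) p volume = 0 :=
    tendsto_nhds_unique tendsto_const_nhds
      (tendsto_zero_of_geometric (f := fun _ => eLpNorm (u t - (heatFlow t u₀ - bil 0 u u t)) p volume) key)
  rw [eLpNorm_eq_zero_iff ((hu.mem t ht).sub (mh.sub mb)).1 hp0] at h0
  filter_upwards [h0] with x hx
  simpa [sub_eq_zero] using hx

/-- Continuation of mild solutions. -/
lemma Mild.glue (hp : 2 ≤ p) (hs : sing d p < 1) (hu₀ : MemLp u₀ p volume) {t₀ t₁ τ : ℝ}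
    (ht₀ : 0 < t₀) (ht₁ : t₀ < t₁) (hτ : t₁ ≤ t₀ + τ) (hu : Mild p t₁ u₀ u)
    (hv : Mild p τ (u t₀) v) :
    Mild p (t₀ + τ) u₀ fun s => if s ≤ t₁ then u s else v (s - t₀) := by
  have hp1 := one_le_of_two_le hp
  set w : ℝ → Sp d → Sp d := fun s => if s ≤ t₁ then u s else v (s - t₀) with hw
  have hwu : ∀ s, s ≤ t₁ → w s = u s := fun s hs => if_pos hs
  -- The pieces overlap on (t₀, t₁], where uniqueness for the restarted problem identifies them.
  -- Hence w is v(· - t₀) on a full neighbourhood of the junction t₁ within the interval, and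
  -- continuity there is that of v.
  have hwv : ∀ s ∈ Ioc t₀ (t₀ + τ), w s =ᵐ[volume] v (s - t₀) := by
    intro s hsm
    by_cases h : s ≤ t₁
    · rw [hwu s h]
      have := (hu.restart hp hs hu₀ ⟨ht₀, ht₁.le⟩).unique hp hs (hv.mono (by linarith)) (s - t₀)
        ⟨by linarith [hsm.1], by linarith⟩
      simpa using this
    · simp only [hw, if_neg h]; exact EventuallyEq.rfl
  have hcurve : IsCurve p (t₀ + τ) w := by
    refine ⟨fun t ht => ?_, fun t ht => ?_, ?_⟩
    · rcases le_or_gt t t₁ with h | h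
      · rw [hwu t h]; exact hu.curve.mem t ⟨ht.1, h⟩
      · exact (memLp_congr_ae (hwv t ⟨by linarith, ht.2⟩)).2
          (hv.curve.mem _ ⟨by linarith, by linarith [ht.2]⟩)
    · rcases lt_or_ge t t₁ with h | h
      · rw [hwu t h.le]
        have hev : ∀ᶠ s in 𝓝[Ioc 0 (t₀ + τ)] t, s ∈ Ioc 0 t₁ := by
          filter_upwards [self_mem_nhdsWithin, nhdsWithin_le_nhds (eventually_lt_nhds h)] with s h1 h2
          exact ⟨h1.1, h2.le⟩
        refine ((hu.curve.cont t ⟨ht.1, h.le⟩).mono_left (nhdsWithin_le_iff.2 hev)).congr' ?_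
        filter_upwards [hev] with s h1
        rw [hwu s h1.2]
      · have ht0 : t₀ < t := ht₁.trans_le h
        have hev : ∀ᶠ s in 𝓝[Ioc 0 (t₀ + τ)] t, s ∈ Ioc t₀ (t₀ + τ) := by
          filter_upwards [self_mem_nhdsWithin, nhdsWithin_le_nhds (eventually_gt_nhds ht0)] with s h1 h2
          exact ⟨h2, h1.2⟩
        have hcomp : Tendsto (fun s => s - t₀) (𝓝[Ioc 0 (t₀ + τ)] t) (𝓝[Ioc 0 τ] (t - t₀)) := by
          refine tendsto_nhdsWithin_iff.2 ⟨?_, ?_⟩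
          · have : Continuous fun s : ℝ => s - t₀ := by fun_prop
            exact (this.tendsto t).mono_left nhdsWithin_le_nhds
          · filter_upwards [hev] with s h1
            exact ⟨by linarith [h1.1], by linarith [h1.2]⟩
        refine ((hv.curve.cont (t - t₀) ⟨by linarith, by linarith [ht.2]⟩).comp hcomp).congr' ?_
        filter_upwards [hev] with s h1
        exact (eLpNorm_congr_ae ((hwv s h1).sub (hwv t ⟨ht0, ht.2⟩))).symm
    · obtain ⟨M, hM0, hM⟩ := hu.curve.bdd
      obtain ⟨N, hN0, hN⟩ := hv.curve.bdd
      refine ⟨M + N, by positivity, fun t ht => ?_⟩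
      rcases le_or_gt t t₁ with h | h
      · rw [hwu t h]
        exact (hM t ⟨ht.1, h⟩).trans (ENNReal.ofReal_le_ofReal (by linarith))
      · rw [eLpNorm_congr_ae (hwv t ⟨by linarith, ht.2⟩)]
        exact (hN _ ⟨by linarith, by linarith [ht.2]⟩).trans (ENNReal.ofReal_le_ofReal (by linarith))
  refine ⟨hcurve, fun t ht => ?_⟩
  rcases le_or_gt t t₁ with h | h
  · rw [hwu t h, bil_congr (u' := u) (v' := u) ht.1.le
      (fun s h1 => by rw [hwu s (h1.2.le.trans h)]) (fun s h1 => by rw [hwu s (h1.2.le.trans h)])]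
    exact hu.eq t ⟨ht.1, h⟩
  · have ht0 : t₀ < t := ht₁.trans h
    have hsub : 0 < t - t₀ := by linarith
    -- The equation of v, with the heat flow of u(t₀) expanded by the equation of u, matches the
    -- splitting at t₀ of the Duhamel integral of w.
    have e1 := hv.eq (t - t₀) ⟨hsub, by linarith [ht.2]⟩
    rw [heatFlow_mild hp hs hu₀ hu hsub ⟨ht₀, ht₁.le⟩, show t₀ + (t - t₀) = t by ring] at e1
    have e2 := bil_add hp hs hsub.le ht₀.le (show t₀ + (t - t₀) ≤ t₀ + τ by linarith [ht.2])
      hcurve hcurve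
    rw [show t₀ + (t - t₀) = t by ring] at e2
    have hshift : ∀ s ∈ Ioo 0 (t - t₀), w (t₀ + s) =ᵐ[volume] v s := fun s h1 => by
      have := hwv (t₀ + s) ⟨by linarith [h1.1], by linarith [h1.2, ht.2]⟩
      simpa using this
    rw [bil_congr (h := 0) hsub.le hshift hshift,
      bil_congr (h := t - t₀) (u := w) (v := w) (u' := u) (v' := u) ht₀.le
      (fun s h1 => by rw [hwu s (h1.2.le.trans ht₁.le)])
      (fun s h1 => by rw [hwu s (h1.2.le.trans ht₁.le)])] at e2
    filter_upwards [e1, e2, hwv t ⟨ht0, ht.2⟩] with x h1 h2 h3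
    rw [h3, h1]
    simp only [Pi.sub_apply]
    rw [h2]; abel

end Existence

/-! ### Mild solutions in the sense of the definition -/

lemma DivFree.congr {f g : Sp d → Sp d} (hf : DivFree f) (h : g =ᵐ[volume] f) : DivFree g := by
  intro φ hφ hc
  rw [← hf φ hφ hc]
  exact integral_congr_ae (by filter_upwards [h] with x hx; rw [hx])

lemma DivFree.sub {q : ℝ≥0∞} (hq : 1 ≤ q) {f g : Sp d → Sp d} (hf : DivFree f) (hg : DivFree g)
    (hfm : MemLp f q volume) (hgm : MemLp g q volume) : DivFree (f - g) := by
  intro φ hφ hc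
  obtain ⟨q', h⟩ := exists_holderConjugate hq
  rw [integral_fderiv_eq hq hφ hc (hfm.sub hgm)]
  have : ∀ i, ∫ x, pd i φ x * (f - g) x i = (∫ x, pd i φ x * f x i) - ∫ x, pd i φ x * g x i := by
    intro i
    rw [← integral_sub (integrable_mul_of_holderConjugate h (memLp_pd hφ hc i q') (memLp_coord hfm i))
      (integrable_mul_of_holderConjugate h (memLp_pd hφ hc i q') (memLp_coord hgm i))]
    exact integral_congr_ae (ae_of_all _ fun x => by simp; ring)
  simp only [this]
  rw [Finset.sum_sub_distrib, ← integral_fderiv_eq hq hφ hc hfm, ← integral_fderiv_eq hq hφ hc hgm,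
    hf φ hφ hc, hg φ hφ hc, sub_zero]

section Def

variable {p : ℝ≥0∞} {T t : ℝ} {u : ℝ → Sp d → Sp d} {u₀ : Sp d → Sp d}

lemma Mild.divFree (hp : 2 ≤ p) (hs : sing d p < 1) (hu₀ : MemLp u₀ p volume) (hd : DivFree u₀)
    (hu : Mild p T u₀ u) (ht : t ∈ Ioc 0 T) : DivFree (u t) := by
  have hp1 := one_le_of_two_le hp
  exact ((divFree_heatFlow ht.1 hp1 hu₀ hd).sub hp1
    (divFree_bil hp hs ht.1.le ht.2 hu.curve hu.curve) (memLp_heatFlow ht.1 hp1 hu₀)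
    (memLp_bil hp hs le_rfl ht.1.le ht.2 hu.curve hu.curve)).congr (hu.eq t ht)

lemma IsMildSolution.mono {I J : Set ℝ} (h : IsMildSolution p u₀ I u) (hJ : J ⊆ I) :
    IsMildSolution p u₀ J u where
  mem := fun t ht => h.mem t (hJ ht)
  cont := fun t ht => (h.cont t (hJ ht)).mono_left (nhdsWithin_mono _ hJ)
  bdd := fun t ht => h.bdd t (hJ ht)
  duhamel_eq := fun t ht => h.duhamel_eq t (hJ ht)

lemma IsMildSolution.mild (hT : 0 < T) (h : IsMildSolution p u₀ (Ioc 0 T) u) : Mild p T u₀ u where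
  curve := by
    refine ⟨fun t ht => (h.mem t ht).1, h.cont, ?_⟩
    obtain ⟨M, hM, hb⟩ := h.bdd T ⟨hT, le_rfl⟩
    exact ⟨M.toReal, ENNReal.toReal_nonneg, fun s hs => by
      rw [ENNReal.ofReal_toReal hM.ne]; exact hb s hs⟩
  eq := fun t ht => by
    filter_upwards [h.duhamel_eq t ht] with x hx
    rw [hx, duhamel_eq_bil]; rfl

lemma Mild.isMildSolution (hp : 2 ≤ p) (hs : sing d p < 1) (hu₀ : InLpSigma p u₀)
    (hu : Mild p T u₀ u) : IsMildSolution p u₀ (Ioc 0 T) u where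
  mem := fun t ht => ⟨hu.curve.mem t ht, hu.divFree hp hs hu₀.1 hu₀.2 ht⟩
  cont := hu.curve.cont
  bdd := fun t ht => by
    obtain ⟨M, -, hM⟩ := hu.curve.bdd
    exact ⟨ENNReal.ofReal M, by simp, fun s h1 => hM s ⟨h1.1, h1.2.trans ht.2⟩⟩
  duhamel_eq := fun t ht => by
    filter_upwards [hu.eq t ht] with x hx
    rw [hx, duhamel_eq_bil]; rfl

end Def

end NavierStokes

/-! ### Calculus for the energy balance: derivatives, cut-offs and cancellation. -/

namespace NavierStokes

variable {d : ℕ}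

/-! ### Derivatives of the heat flow -/

/-- From ‖z‖² ≤ 2‖z+w‖² + 2. A Gaussian of doubled time dominates all shifts by at most 1, which
allows differentiation under the convolution with an arbitrary L^q function. -/
lemma heatKernel_add_le {t : ℝ} (ht : 0 < t) (z w : Sp d) (hw : ‖w‖ ≤ 1) :
    heatKernel d t (z + w) ≤ 2 ^ ((d : ℝ) / 2) * Real.exp (1 / (4 * t)) * heatKernel d (2 * t) z := by
  unfold heatKernel
  have hpi := Real.pi_pos
  have h1 : ‖z‖ ^ 2 ≤ 2 * ‖z + w‖ ^ 2 + 2 := by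
    have h2 : ‖z‖ ≤ ‖z + w‖ + ‖w‖ := by simpa using norm_sub_le (z + w) w
    have h3 := norm_nonneg (z + w)
    have h4 := norm_nonneg z
    nlinarith [sq_nonneg (‖z + w‖ - ‖w‖), norm_nonneg w]
  have e1 : (4 * Real.pi * (2 * t)) ^ (-(d : ℝ) / 2)
      = (2 ^ ((d : ℝ) / 2))⁻¹ * (4 * Real.pi * t) ^ (-(d : ℝ) / 2) := by
    rw [show 4 * Real.pi * (2 * t) = 2 * (4 * Real.pi * t) by ring,
      Real.mul_rpow (by norm_num) (by positivity), neg_div, Real.rpow_neg (by norm_num : (0 : ℝ) ≤ 2)]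
  have e2 : Real.exp (-‖z + w‖ ^ 2 / (4 * t))
      ≤ Real.exp (1 / (4 * t)) * Real.exp (-‖z‖ ^ 2 / (4 * (2 * t))) := by
    rw [← Real.exp_add]
    refine Real.exp_le_exp.2 ?_
    rw [show 1 / (4 * t) + -‖z‖ ^ 2 / (4 * (2 * t)) = (2 - ‖z‖ ^ 2) / 2 / (4 * t) by field_simp; ring]
    gcongr
    linarith
  rw [e1]
  have h2 : (0 : ℝ) < 2 ^ ((d : ℝ) / 2) := by positivity
  calc _ ≤ (4 * Real.pi * t) ^ (-(d : ℝ) / 2) *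
        (Real.exp (1 / (4 * t)) * Real.exp (-‖z‖ ^ 2 / (4 * (2 * t)))) := by gcongr
    _ = _ := by field_simp

lemma hasLineDerivAt_heatKernel (k : Fin d) (t : ℝ) (x : Sp d) :
    HasLineDerivAt ℝ (heatKernel d t) (g1 k t x) x (EuclideanSpace.single k 1) := by
  have := (differentiable_heatKernel (d := d) t x).hasFDerivAt.hasLineDerivAt
    (EuclideanSpace.single k 1)
  rwa [← pd_heatKernel]

lemma hasLineDerivAt_conv_heatKernel (k : Fin d) {t : ℝ} (ht : 0 < t) {q : ℝ≥0∞} (hq : 1 ≤ q)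
    {f : Sp d → ℝ} (hf : MemLp f q volume) (x : Sp d) :
    HasLineDerivAt ℝ (conv (heatKernel d t) f) (conv (g1 k t) f x) x (EuclideanSpace.single k 1) := by
  set e : Sp d := EuclideanSpace.single k 1 with he
  have hen : ‖e‖ = 1 := by simp [he]
  have hC := gC_pos d
  set c : ℝ := t ^ (-(1 / 2) : ℝ) * (gC d * (2 ^ ((d : ℝ) / 2) * Real.exp (1 / (4 * (2 * t)))))
  have hG := kerBd_heatKernel (d := d) ht
  have hg := kerBd_g1 (d := d) k ht
  have hG4 := kerBd_heatKernel (d := d) (show 0 < 2 * (2 * t) by positivity)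
  have key := hasDerivAt_integral_of_dominated_loc_of_deriv_le (μ := (volume : Measure (Sp d)))
    (F := fun (r : ℝ) y => heatKernel d t (x + r • e - y) * f y)
    (F' := fun (r : ℝ) y => g1 k t (x + r • e - y) * f y) (x₀ := (0 : ℝ)) (s := Metric.ball 0 1)
    (bound := fun y => c * ‖heatKernel d (2 * (2 * t)) (x - y) * f y‖)
    (Metric.ball_mem_nhds _ one_pos)
    (Eventually.of_forall fun r => (hG.integrable ht zero_le_one hq hf (x + r • e)).1)
    (by simpa using hG.integrable ht zero_le_one hq hf x)
    (by simpa using (hg.integrable ht (by positivity) hq hf x).1)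
    (ae_of_all _ fun y r hr => ?_)
    ((hG4.integrable (by positivity) zero_le_one hq hf x).norm.const_mul c)
    (ae_of_all _ fun y r _ => ?_)
  · have := key.2
    simpa [HasLineDerivAt, conv] using this
  · rw [norm_mul, norm_mul, ← mul_assoc]
    refine mul_le_mul_of_nonneg_right ?_ (norm_nonneg _)
    rw [Real.norm_eq_abs, Real.norm_of_nonneg (heatKernel_pos (by positivity) _).le]
    refine (abs_g1_le k ht _).trans ?_
    have hr1 : ‖r • e‖ ≤ 1 := by
      rw [norm_smul, hen, mul_one]
      exact (mem_ball_zero_iff.1 hr).le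
    have := heatKernel_add_le (show 0 < 2 * t by positivity) (x - y) (r • e) hr1
    rw [show x + r • e - y = x - y + r • e by abel]
    calc _ ≤ t ^ (-(1 / 2) : ℝ) * (gC d * (2 ^ ((d : ℝ) / 2) * Real.exp (1 / (4 * (2 * t))) *
          heatKernel d (2 * (2 * t)) (x - y))) := by gcongr
      _ = _ := by ring
  · have h1 : HasLineDerivAt ℝ (heatKernel d t) (g1 k t (x + r • e - y)) (x + r • e - y) e :=
      hasLineDerivAt_heatKernel k t _
    have h2 : HasDerivAt (fun s : ℝ => heatKernel d t (x + r • e - y + s • e))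
        (g1 k t (x + r • e - y)) (r - r) := by simpa [HasLineDerivAt] using h1
    have h3 := (h2.comp_sub_const r r).mul_const (f y)
    refine h3.congr_of_eventuallyEq (Eventually.of_forall fun s => ?_)
    simp only
    congr 2
    rw [sub_smul]; abel

/-! ### Divergence free fields and noncompactly supported tests -/

/-- The test function is multiplied by cut-offs χ(c x) with c → 0. The derivative of the cut-off
carries a factor c, and the conjugate integrability of ψ and ∇ψ gives the dominating function. -/
lemma DivFree.sum_integral_eq_zero {q q' : ℝ≥0∞} (hqq : q'.HolderConjugate q) {f : Sp d → Sp d}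
    (hf : MemLp f q volume) (hd : DivFree f) {ψ : Sp d → ℝ} (hψ : ContDiff ℝ (⊤ : ℕ∞) ψ)
    (h0 : MemLp ψ q' volume) (h1 : ∀ i, MemLp (pd i ψ) q' volume) :
    ∑ i, ∫ x, pd i ψ x * f x i = 0 := by
  have hq : 1 ≤ q := ENNReal.HolderConjugate.one_le q q'
  have hfi : ∀ i, MemLp (fun x => f x i) q volume := memLp_coord hf
  let χ : ContDiffBump (0 : Sp d) := ⟨1, 2, one_pos, one_lt_two⟩
  have hχ : ContDiff ℝ (⊤ : ℕ∞) χ := χ.contDiff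
  have hχc : HasCompactSupport χ := χ.hasCompactSupport
  have hdχ : ∃ C : ℝ, 0 ≤ C ∧ ∀ i x, |pd i χ x| ≤ C := by
    have : ∀ i, ∃ C : ℝ, ∀ x, ‖pd i χ x‖ ≤ C := fun i =>
      (contDiff_pd hχ i).continuous.bounded_above_of_compact_support (hasCompactSupport_pd hχc i)
    choose C hC using this
    refine ⟨∑ i, |C i|, by positivity, fun i x => (hC i x).trans ((le_abs_self _).trans ?_)⟩
    exact Finset.single_le_sum (f := fun i => |C i|) (fun _ _ => abs_nonneg _) (Finset.mem_univ i)
  obtain ⟨C, hC0, hC⟩ := hdχ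
  let c : ℕ → ℝ := fun n => 1 / ((n : ℝ) + 1)
  have hc0 : ∀ n, 0 < c n := fun n => by positivity
  have hc1 : ∀ n, c n ≤ 1 := fun n => by
    simp only [c]
    rw [div_le_one (by positivity)]
    have : (0 : ℝ) ≤ n := by positivity
    linarith
  have hclim : Tendsto c atTop (𝓝 0) := tendsto_one_div_add_atTop_nhds_zero_nat
  let X : ℕ → Sp d → ℝ := fun n x => χ (c n • x)
  have hX : ∀ n, ContDiff ℝ (⊤ : ℕ∞) (X n) := fun n => hχ.comp (by fun_prop)
  have hXd : ∀ n, Differentiable ℝ (X n) := fun n => (hX n).differentiable (by simp)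
  have hXc : ∀ n, HasCompactSupport (X n) := fun n => hχc.comp_smul (hc0 n).ne'
  have hpdX : ∀ n i x, pd i (X n) x = c n * pd i χ (c n • x) := by
    intro n i x
    have h2 : HasFDerivAt χ (fderiv ℝ χ (c n • x)) (c n • x) :=
      (hχ.differentiable (by simp) _).hasFDerivAt
    have h3 : HasFDerivAt (fun x : Sp d => c n • x) (c n • ContinuousLinearMap.id ℝ (Sp d)) x :=
      (hasFDerivAt_id x).const_smul (c n)
    have h4 := h2.comp x h3
    simp only [pd]
    rw [show X n = χ ∘ fun x : Sp d => c n • x from rfl, h4.fderiv]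
    simp
  have hψd : Differentiable ℝ ψ := hψ.differentiable (by simp)
  have hzero : ∀ n, ∑ i, ∫ x, pd i (fun x => X n x * ψ x) x * f x i = 0 := by
    intro n
    have hs : ContDiff ℝ (⊤ : ℕ∞) fun x => X n x * ψ x := (hX n).mul hψ
    have hcs : HasCompactSupport fun x => X n x * ψ x := (hXc n).mul_right
    rw [← integral_fderiv_eq hq hs hcs hf]
    exact hd _ hs hcs
  have hlim : ∀ i, Tendsto (fun n => ∫ x, pd i (fun x => X n x * ψ x) x * f x i) atTop
      (𝓝 (∫ x, pd i ψ x * f x i)) := by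
    intro i
    have e : ∀ n x, pd i (fun x => X n x * ψ x) x
        = c n * pd i χ (c n • x) * ψ x + X n x * pd i ψ x := fun n x => by
      rw [pd_mul i x (hXd n x) (hψd x), hpdX]
    simp only [e]
    have hcont1 : Continuous (pd i χ) := (contDiff_pd hχ i).continuous
    have hcont2 : Continuous (pd i ψ) := (contDiff_pd hψ i).continuous
    refine tendsto_integral_of_dominated_convergence
      (fun x => C * ‖ψ x * f x i‖ + ‖pd i ψ x * f x i‖) (fun n => ?_) ?_ (fun n => ?_) ?_
    · have : Continuous fun x => c n * pd i χ (c n • x) * ψ x + X n x * pd i ψ x := by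
        have := (hX n).continuous
        have := hψ.continuous
        fun_prop
      exact this.aestronglyMeasurable.mul (hfi i).1
    · exact ((integrable_mul_of_holderConjugate hqq h0 (hfi i)).norm.const_mul C).add
        (integrable_mul_of_holderConjugate hqq (h1 i) (hfi i)).norm
    · refine ae_of_all _ fun x => ?_
      rw [add_mul, norm_mul (ψ x), norm_mul (pd i ψ x)]
      refine (norm_add_le _ _).trans (add_le_add ?_ ?_)
      · rw [norm_mul, norm_mul, norm_mul, mul_assoc]
        refine mul_le_mul_of_nonneg_right ?_ (by positivity)
        rw [Real.norm_of_nonneg (hc0 n).le]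
        have := hC i (c n • x)
        rw [Real.norm_eq_abs]
        nlinarith [hc1 n, hc0 n, abs_nonneg (pd i χ (c n • x))]
      · rw [norm_mul, norm_mul, mul_assoc]
        refine mul_le_of_le_one_left (by positivity) ?_
        rw [Real.norm_of_nonneg χ.nonneg]
        exact χ.le_one
    · refine ae_of_all _ fun x => ?_
      have t1 : Tendsto (fun n => c n • x) atTop (𝓝 0) := by
        simpa using hclim.smul_const x
      have t2 : Tendsto (fun n => X n x) atTop (𝓝 1) := by
        have := (hχ.continuous.tendsto 0).comp t1
        have h1 : χ (0 : Sp d) = 1 := χ.one_of_mem_closedBall (by simp [χ])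
        rwa [h1] at this
      have t3 : Tendsto (fun n => pd i χ (c n • x)) atTop (𝓝 (pd i χ 0)) :=
        (hcont1.tendsto 0).comp t1
      have := (((hclim.mul t3).mul_const (ψ x)).add (t2.mul_const (pd i ψ x))).mul_const (f x i)
      simpa using this
  have := tendsto_finsetSum Finset.univ fun i _ => hlim i
  simp only [hzero] at this
  exact (tendsto_nhds_unique tendsto_const_nhds this).symm

lemma pd_comp_sub_left {k : Sp d → ℝ} (hk : Differentiable ℝ k) (i : Fin d) (x y : Sp d) :
    pd i (fun y => k (x - y)) y = - pd i k (x - y) := by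
  have h1 : HasFDerivAt k (fderiv ℝ k (x - y)) (x - y) := (hk _).hasFDerivAt
  have h2 : HasFDerivAt (fun y => x - y) (-ContinuousLinearMap.id ℝ (Sp d)) y :=
    (hasFDerivAt_id y).const_sub x
  have h3 := h1.comp y h2
  simp only [pd]
  rw [show (fun y => k (x - y)) = k ∘ fun y => x - y from rfl, h3.fderiv]
  simp

/-- Divergences of smooth convolutions vanish. -/
lemma DivFree.sum_conv_pd_eq_zero {q : ℝ≥0∞} (hq : 1 ≤ q) {f : Sp d → Sp d}
    (hf : MemLp f q volume) (hd : DivFree f) {k : Sp d → ℝ} (hk : ContDiff ℝ (⊤ : ℕ∞) k)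
    {m τ : ℝ} (h0 : KerBd k m τ) {m' τ' : ℝ} (h1 : ∀ i, KerBd (pd i k) m' τ') (x : Sp d) :
    ∑ i, conv (pd i k) (fun y => f y i) x = 0 := by
  obtain ⟨q', hqq⟩ := exists_holderConjugate hq
  have hq' : 1 ≤ q' := ENNReal.HolderConjugate.one_le q' q
  have hkd : Differentiable ℝ k := hk.differentiable (by simp)
  have e : ∀ i, pd i (fun y => k (x - y)) = fun y => - pd i k (x - y) := fun i =>
    funext fun y => pd_comp_sub_left hkd i x y
  have := hd.sum_integral_eq_zero hqq hf (ψ := fun y => k (x - y)) (hk.comp (by fun_prop))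
    (h0.memLp_shift hq' x) (fun i => by rw [e]; exact ((h1 i).memLp_shift hq' x).neg)
  simp only [e, neg_mul, integral_neg, Finset.sum_neg_distrib, neg_eq_zero] at this
  exact this

lemma DivFree.sum_conv_g1 {q : ℝ≥0∞} (hq : 1 ≤ q) {f : Sp d → Sp d}
    (hf : MemLp f q volume) (hd : DivFree f) {t : ℝ} (ht : 0 < t) (x : Sp d) :
    ∑ i, conv (g1 i t) (fun y => f y i) x = 0 := by
  have := hd.sum_conv_pd_eq_zero hq hf (contDiff_heatKernel t) (kerBd_heatKernel ht)
    (m' := gC d * t ^ (-(1 / 2) : ℝ)) (τ' := t) (fun i => by rw [pd_heatKernel]; exact kerBd_g1 i ht) x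
  simpa only [pd_heatKernel] using this

lemma DivFree.sum_conv_g3 {q : ℝ≥0∞} (hq : 1 ≤ q) {f : Sp d → Sp d}
    (hf : MemLp f q volume) (hd : DivFree f) (j k : Fin d) {t : ℝ} (ht : 0 < t) (x : Sp d) :
    ∑ i, conv (g3 i j k t) (fun y => f y i) x = 0 := by
  have := hd.sum_conv_pd_eq_zero hq hf (contDiff_g2 j k t) (kerBd_g2 j k ht)
    (m' := gC d * t ^ (-(3 / 2) : ℝ)) (τ' := t) (fun i => by rw [pd_g2]; exact kerBd_g3 i j k ht) x
  simpa only [pd_g2] using this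

/-- On divergence free fields, the Leray projection disappears from the Oseen kernel. -/
lemma DivFree.sum_conv_oseenKernel {q : ℝ≥0∞} (hq : 1 ≤ q) {f : Sp d → Sp d}
    (hf : MemLp f q volume) (hd : DivFree f) (j k : Fin d) {t : ℝ} (ht : 0 < t) (x : Sp d) :
    ∑ i, conv (oseenKernel i j k t) (fun y => f y i) x = conv (g1 k t) (fun y => f y j) x := by
  have hC := gC_pos d
  have hfi := memLp_coord hf
  have e : ∀ i, conv (oseenKernel i j k t) (fun y => f y i) x
      = kd i j * conv (g1 k t) (fun y => f y i) x + ∫ s in Ioi t, conv (g3 i j k s) (fun y => f y i) x := by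
    intro i
    rw [← (conv_g3int i j k ht hq (hfi i) x).1]
    unfold conv
    rw [← integral_const_mul, ← integral_add
      (((kerBd_g1 k ht).integrable ht (by positivity) hq (hfi i) x).const_mul _)
      ((kerBd_g3int i j k ht).integrable ht (by positivity) hq (hfi i) x)]
    refine integral_congr_ae (ae_of_all _ fun y => ?_)
    simp only [oseenKernel_eq, g3int]; ring
  simp only [e]
  rw [Finset.sum_add_distrib, ← integral_finsetSum _ fun i _ => (conv_g3int i j k ht hq (hfi i) x).2]
  have h0 : ∫ s in Ioi t, ∑ i, conv (g3 i j k s) (fun y => f y i) x = 0 :=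
    setIntegral_eq_zero_of_forall_eq_zero fun s (hs : t < s) =>
      hd.sum_conv_g3 hq hf j k (ht.trans hs) x
  rw [h0]
  simp [kd]

/-! ### The cancellation in the energy identity -/

lemma integrable_mul_mul {a b c : Sp d → ℝ} (ha : MemLp a 2 volume) (hb : MemLp b 2 volume)
    (hc : MemLp c ∞ volume) : Integrable fun x => a x * b x * c x := by
  have h1 : MemLp (fun x => a x * b x) 1 volume := hb.mul ha
  exact memLp_one_iff_integrable.1 (hc.mul h1)

/-- The transport term does no work on the heat flow of the solution. -/
lemma DivFree.sum_integral_mul_conv_eq_zero {U : Sp d → Sp d} (hU : MemLp U ∞ volume)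
    (hd : DivFree U) {f : Sp d → ℝ} (hf : MemLp f 2 volume) {σ : ℝ} (hσ : 0 < σ) :
    ∑ k, ∫ x, conv (g1 k σ) f x * conv (heatKernel d σ) f x
      * conv (heatKernel d σ) (fun y => U y k) x = 0 := by
  have hC := gC_pos d
  have hG := kerBd_heatKernel (d := d) hσ
  have hg := fun k : Fin d => kerBd_g1 (d := d) k hσ
  set V := conv (heatKernel d σ) f with hV
  have mV : MemLp V 2 volume := hG.memLp_conv hσ zero_le_one (by norm_num) hf
  have mD : ∀ k, MemLp (conv (g1 k σ) f) 2 volume := fun k =>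
    (hg k).memLp_conv hσ (by positivity) (by norm_num) hf
  have mH : ∀ k, MemLp (conv (heatKernel d σ) (fun y => U y k)) ∞ volume := fun k =>
    hG.memLp_conv hσ zero_le_one (by simp) (memLp_coord hU k)
  have mH' : ∀ k, MemLp (conv (g1 k σ) (fun y => U y k)) ∞ volume := fun k =>
    (hg k).memLp_conv hσ (by positivity) (by simp) (memLp_coord hU k)
  -- Since V ∂ₖV = ½ ∂ₖ(V²), the derivative moves onto the regularized U; the sum over k is then the
  -- divergence of e^{σΔ}U, which vanishes.
  have ibp : ∀ k, ∫ x, conv (g1 k σ) f x * V x * conv (heatKernel d σ) (fun y => U y k) x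
      = -(1 / 2) * ∫ x, V x * V x * conv (g1 k σ) (fun y => U y k) x := by
    intro k
    have hfd : ∀ x, HasLineDerivAt ℝ (fun x => V x * V x) (2 * (conv (g1 k σ) f x * V x)) x
        (EuclideanSpace.single k 1) := by
      intro x
      have h := hasLineDerivAt_conv_heatKernel k hσ (q := 2) (by norm_num) hf x
      unfold HasLineDerivAt at h ⊢
      refine (h.mul h).congr_deriv ?_
      simp; ring
    have := integral_bilinear_hasLineDerivAt_right_eq_neg_left_of_integrable
      (μ := (volume : Measure (Sp d)))
      (f := fun x => V x * V x) (f' := fun x => 2 * (conv (g1 k σ) f x * V x))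
      (g := conv (heatKernel d σ) (fun y => U y k)) (g' := conv (g1 k σ) (fun y => U y k))
      (v := EuclideanSpace.single k 1) (B := ContinuousLinearMap.mul ℝ ℝ)
      (by simpa [mul_assoc] using (integrable_mul_mul (mD k) mV (mH k)).const_mul 2)
      (by simpa using integrable_mul_mul mV mV (mH' k))
      (by simpa using integrable_mul_mul mV mV (mH k))
      (fun x _ => hfd x)
      (fun x _ => hasLineDerivAt_conv_heatKernel k hσ (by simp) (memLp_coord hU k) x)
    simp only [ContinuousLinearMap.mul_apply'] at this
    rw [this]
    simp only [mul_assoc, integral_const_mul]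
    ring
  simp only [ibp]
  rw [← Finset.mul_sum, ← integral_finsetSum _ fun k _ => integrable_mul_mul mV mV (mH' k)]
  simp only [← Finset.mul_sum, hd.sum_conv_g1 (by simp) hU hσ]
  simp

end NavierStokes

/-! ### The transport term in the regularized energy balance. -/

namespace NavierStokes

variable {d : ℕ}

/-! ### Pairings in `L^2` -/

/-- The `L^2` scalar product of vector fields. -/
def pair (f g : Sp d → Sp d) : ℝ := ∑ i, ∫ x, f x i * g x i

lemma integrable_coord_mul {f g : Sp d → Sp d} (hf : MemLp f 2 volume) (hg : MemLp g 2 volume)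
    (i : Fin d) : Integrable fun x => f x i * g x i :=
  integrable_mul_of_holderConjugate (q := 2) (q' := 2) inferInstance (memLp_coord hf i) (memLp_coord hg i)

lemma pair_self_sub {f g : Sp d → Sp d} (hf : MemLp f 2 volume) (hg : MemLp g 2 volume) :
    pair (f - g) (f - g) = pair f f - 2 * pair f g + pair g g := by
  unfold pair
  rw [Finset.mul_sum, ← Finset.sum_sub_distrib, ← Finset.sum_add_distrib]
  refine Finset.sum_congr rfl fun i _ => ?_
  have hsub : Integrable fun x => f x i * f x i - 2 * (f x i * g x i) :=
    (integrable_coord_mul hf hf i).sub ((integrable_coord_mul hf hg i).const_mul 2)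
  rw [← integral_const_mul, ← integral_sub (integrable_coord_mul hf hf i)
    ((integrable_coord_mul hf hg i).const_mul 2), ← integral_add hsub
    (integrable_coord_mul hg hg i)]
  refine integral_congr_ae (ae_of_all _ fun x => ?_)
  simp; ring

lemma pair_self {f : Sp d → Sp d} (hf : MemLp f 2 volume) :
    pair f f = (eLpNorm f 2 volume).toReal ^ 2 := by
  unfold pair
  rw [← integral_finsetSum _ fun i _ => integrable_coord_mul hf hf i,
    hf.eLpNorm_eq_integral_rpow_norm (by simp) (by simp)]
  have h0 : 0 ≤ ∫ x, ‖f x‖ ^ ENNReal.toReal 2 := integral_nonneg fun x => by positivity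
  rw [ENNReal.toReal_ofReal (by positivity), ENNReal.toReal_ofNat, ← Real.rpow_natCast,
    ← Real.rpow_mul (by simpa using h0)]
  simp only [Real.rpow_ofNat]
  norm_num
  refine integral_congr_ae (ae_of_all _ fun x => ?_)
  have := EuclideanSpace.norm_sq_eq (f x)
  simp only [Real.norm_eq_abs, sq_abs] at this
  simp only [this]
  simp only [sq]

lemma pair_self_le {f : Sp d → Sp d} (hf : MemLp f 2 volume) {A : ℝ} (hA : 0 ≤ A)
    (h : eLpNorm f 2 volume ≤ ENNReal.ofReal A) : pair f f ≤ A ^ 2 := by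
  rw [pair_self hf]
  have := ENNReal.toReal_mono (by simp) h
  rw [ENNReal.toReal_ofReal hA] at this
  gcongr

lemma abs_integral_mul_mul_le {a b c : Sp d → ℝ} (ha : AEStronglyMeasurable a volume)
    (hb : AEStronglyMeasurable b volume) (hc : AEStronglyMeasurable c volume) {α β γ : ℝ}
    (hα : 0 ≤ α) (hβ : 0 ≤ β) (hγ : 0 ≤ γ) (h1 : eLpNorm a 2 volume ≤ ENNReal.ofReal α)
    (h2 : eLpNorm b 2 volume ≤ ENNReal.ofReal β) (h3 : eLpNorm c ∞ volume ≤ ENNReal.ofReal γ) :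
    |∫ x, a x * b x * c x| ≤ α * β * γ := by
  have e1 : eLpNorm (fun x => a x * b x) 1 volume ≤ ENNReal.ofReal α * ENNReal.ofReal β :=
    (eLpNorm_smul_le_mul_eLpNorm (p := 2) (q := 2) (r := 1) hb ha).trans (mul_le_mul' h1 h2)
  have e2 : eLpNorm (fun x => a x * b x * c x) 1 volume
      ≤ ENNReal.ofReal α * ENNReal.ofReal β * ENNReal.ofReal γ :=
    (eLpNorm_smul_le_mul_eLpNorm (p := 1) (q := ∞) (r := 1) hc (ha.mul hb)).trans (mul_le_mul' e1 h3)
  have e3 : ‖∫ x, a x * b x * c x‖ₑ ≤ ENNReal.ofReal (α * β * γ) := by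
    refine (enorm_integral_le_lintegral_enorm _).trans ?_
    rw [← eLpNorm_one_eq_lintegral_enorm, ENNReal.ofReal_mul (by positivity), ENNReal.ofReal_mul hα]
    exact e2
  rw [← ofReal_norm, ENNReal.ofReal_le_ofReal_iff (by positivity)] at e3
  exact e3

/-! ### The energy inequality for bounded Hölder continuous curves -/

lemma conv_g1_conv_heatKernel (k : Fin d) {a b : ℝ} (ha : 0 < a) (hb : 0 < b) {q : ℝ≥0∞} (hq : 1 ≤ q)
    {f : Sp d → ℝ} (hf : MemLp f q volume) (x : Sp d) :
    conv (g1 k a) (conv (heatKernel d b) f) x = conv (g1 k (a + b)) f x := by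
  rw [conv_assoc (kerBd_g1 k ha) (kerBd_heatKernel hb) zero_le_one hb hq hf]
  congr 1; funext y
  rw [conv_comm, conv_heatKernel_g1 k hb ha, add_comm]

/-- Gradient bound for the heat flow of functions with a heat-Hölder bound. -/
lemma exists_gradient_bound {A C : ℝ} (hA : 0 ≤ A) (hC : 0 ≤ C) : ∃ D : ℝ, 0 ≤ D ∧
    ∀ v : Sp d → Sp d, MemLp v 2 volume → eLpNorm v 2 volume ≤ ENNReal.ofReal A →
      (∀ σ ∈ Ioc (0 : ℝ) 1,
        eLpNorm (v - heatFlow σ v) 2 volume ≤ ENNReal.ofReal (C * σ ^ (3 / 8 : ℝ))) →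
      ∀ σ ∈ Ioc (0 : ℝ) 1, ∀ j k, eLpNorm (conv (g1 k σ) fun y => v y j) 2 volume
        ≤ ENNReal.ofReal (D * σ ^ (-(1 / 8) : ℝ)) := by
  have hg := gC_pos d
  set r : ℝ := 2 ^ (-(1 / 8) : ℝ) with hr
  have hr1 : r < 1 := Real.rpow_lt_one_of_one_lt_of_neg (by norm_num) (by norm_num)
  -- D closes the recursion over dyadic scales. By the semigroup law ∂ₖe^{σΔ}v = ∂ₖe^{σΔ}(v -
  -- e^{σΔ}v) + ∂ₖe^{2σΔ}v; the first term is at most `gC` C σ^(-1/2+3/8), the second contracts by r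
  -- = 2^(-1/8), and `gC` C + D r ≤ D. The remaining summand of D covers the scales σ ≥ 1/2.
  set D := (gC d * 2 * A + gC d * C) / (1 - r) with hD
  have hr2 : 0 < 1 - r := by linarith
  have hr0 : 0 < r := by positivity
  have hD0 : 0 ≤ D := by positivity
  have hDr : D * (1 - r) = gC d * 2 * A + gC d * C := by rw [hD]; field_simp
  refine ⟨D, hD0, fun v hv hvA hvC => ?_⟩
  have key : ∀ n : ℕ, ∀ σ ∈ Ioc (0 : ℝ) 1, (1 / 2 : ℝ) ^ (n + 1) ≤ σ → ∀ j k,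
      eLpNorm (conv (g1 k σ) fun y => v y j) 2 volume ≤ ENNReal.ofReal (D * σ ^ (-(1 / 8) : ℝ)) := by
    have base : ∀ σ ∈ Ioc (0 : ℝ) 1, 1 / 2 ≤ σ → ∀ j k,
        eLpNorm (conv (g1 k σ) fun y => v y j) 2 volume ≤ ENNReal.ofReal (D * σ ^ (-(1 / 8) : ℝ)) := by
      intro σ hσ hσ2 j k
      have h1 := hσ.1
      refine ((kerBd_g1 k h1).eLpNorm_conv_le h1 (by positivity) (by norm_num)
        (memLp_coord hv j).1).trans ?_
      refine (mul_le_mul' le_rfl ((eLpNorm_coord_le v j 2).trans hvA)).trans ?_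
      rw [← ENNReal.ofReal_mul (by positivity)]
      refine ENNReal.ofReal_le_ofReal ?_
      have h2 : 1 ≤ σ ^ (-(1 / 8) : ℝ) := Real.one_le_rpow_of_pos_of_le_one_of_nonpos h1 hσ.2 (by norm_num)
      have h3 : σ ^ (-(1 / 2) : ℝ) ≤ 2 := by
        refine (Real.rpow_le_rpow_of_nonpos (by norm_num) hσ2 (by norm_num)).trans ?_
        rw [one_div, Real.inv_rpow (by norm_num), Real.rpow_neg (by norm_num), inv_inv]
        calc (2 : ℝ) ^ (2⁻¹ : ℝ) ≤ 2 ^ (1 : ℝ) := Real.rpow_le_rpow_of_exponent_le (by norm_num) (by norm_num)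
          _ = 2 := Real.rpow_one 2
      have h4 : gC d * 2 * A ≤ D := by
        have : 0 ≤ gC d * C := by positivity
        nlinarith
      calc gC d * σ ^ (-(1 / 2) : ℝ) * A ≤ gC d * 2 * A := by gcongr
        _ ≤ D * 1 := by linarith
        _ ≤ _ := by gcongr
    intro n
    induction n with
    | zero => intro σ hσ h; exact base σ hσ (by simpa using h)
    | succ n ih =>
      intro σ hσ hσn j k
      rcases le_or_gt (1 / 2) σ with h | h
      · exact base σ hσ h j k
      have h1 := hσ.1
      have ih' := ih (2 * σ) ⟨by positivity, by linarith⟩ (by rw [pow_succ] at hσn; linarith) j k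
      have hvj := memLp_coord hv j
      have hflow := memLp_coord (memLp_heatFlow h1 (by norm_num) hv) j
      have e : (conv (g1 k σ) fun y => v y j)
          = (conv (g1 k σ) ((fun y => v y j) - fun y => heatFlow σ v y j))
            + conv (g1 k (2 * σ)) fun y => v y j := by
        funext x
        rw [Pi.add_apply, conv_sub_right (kerBd_g1 k h1) h1 (by positivity) (q := 2) (by norm_num) hvj hflow]
        have : (fun y => heatFlow σ v y j) = conv (heatKernel d σ) fun y => v y j := funext fun y =>
          vconv_apply (kerBd_heatKernel h1) h1 zero_le_one (by norm_num) hv y j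
        rw [this, conv_g1_conv_heatKernel k h1 h1 (by norm_num) hvj, two_mul]
        ring
      have b1 : eLpNorm (conv (g1 k σ) ((fun y => v y j) - fun y => heatFlow σ v y j)) 2 volume
          ≤ ENNReal.ofReal (gC d * σ ^ (-(1 / 2) : ℝ) * (C * σ ^ (3 / 8 : ℝ))) := by
        refine ((kerBd_g1 k h1).eLpNorm_conv_le h1 (by positivity) (by norm_num)
          (hvj.sub hflow).1).trans ?_
        rw [ENNReal.ofReal_mul (p := gC d * σ ^ (-(1 / 2) : ℝ)) (by positivity)]
        refine mul_le_mul' le_rfl ?_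
        exact (eLpNorm_coord_le (v - heatFlow σ v) j 2).trans (hvC σ hσ)
      rw [e]
      refine (eLpNorm_add_le ((kerBd_g1 k h1).memLp_conv h1 (by positivity) (by norm_num)
        (hvj.sub hflow)).1 ((kerBd_g1 k (show 0 < 2 * σ by positivity)).memLp_conv (by positivity)
          (by positivity) (by norm_num) hvj).1 (by norm_num)).trans ?_
      refine (add_le_add b1 ih').trans ?_
      rw [← ENNReal.ofReal_add (by positivity) (by positivity)]
      refine ENNReal.ofReal_le_ofReal ?_
      have e1 : (2 * σ) ^ (-(1 / 8) : ℝ) = r * σ ^ (-(1 / 8) : ℝ) := Real.mul_rpow (by norm_num) h1.le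
      have e2 : σ ^ (-(1 / 2) : ℝ) * σ ^ (3 / 8 : ℝ) = σ ^ (-(1 / 8) : ℝ) := by
        rw [← Real.rpow_add h1]; norm_num
      have e3 : gC d * σ ^ (-(1 / 2) : ℝ) * (C * σ ^ (3 / 8 : ℝ)) = gC d * C * σ ^ (-(1 / 8) : ℝ) := by
        rw [← e2]; ring
      rw [e1, e3]
      have h5 : 0 ≤ σ ^ (-(1 / 8) : ℝ) := by positivity
      have h6 : gC d * C + D * r ≤ D := by
        have : 0 ≤ gC d * 2 * A := by positivity
        nlinarith
      nlinarith
  intro σ hσ j k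
  obtain ⟨n, hn⟩ := exists_pow_lt_of_lt_one hσ.1 (show (1 / 2 : ℝ) < 1 by norm_num)
  refine key n σ hσ (le_trans ?_ hn.le) j k
  exact pow_le_pow_of_le_one (by norm_num) (by norm_num) (Nat.le_succ n)

/-- The transport term is small if the two fields are close to their regularizations. -/
lemma abs_transport_le {U v : Sp d → Sp d} {M D δ₁ δ₂ σ : ℝ} (hσ : 0 < σ) (hM : 0 ≤ M) (hD : 0 ≤ D)
    (hδ₁ : 0 ≤ δ₁) (hδ₂ : 0 ≤ δ₂) (hU : MemLp U 2 volume) (hv : MemLp v 2 volume)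
    (hUM : eLpNorm U ∞ volume ≤ ENNReal.ofReal M) (hvM : eLpNorm v ∞ volume ≤ ENNReal.ofReal M)
    (hd : DivFree U)
    (hgrad : ∀ j k, eLpNorm (conv (g1 k σ) fun y => v y j) 2 volume ≤ ENNReal.ofReal D)
    (h₁ : eLpNorm (U - heatFlow σ U) 2 volume ≤ ENNReal.ofReal δ₁)
    (h₂ : eLpNorm (U - heatFlow σ v) 2 volume ≤ ENNReal.ofReal δ₂) :
    |∑ j, ∑ k, ∫ x, conv (g1 k σ) (fun y => v y j) x * (U x j * U x k)|
      ≤ d ^ 2 * (D * (δ₁ + δ₂) * M) := by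
  have hg := gC_pos d
  have hUt : MemLp U ∞ volume := ⟨hU.1, hUM.trans_lt (by simp)⟩
  have hvt : MemLp v ∞ volume := ⟨hv.1, hvM.trans_lt (by simp)⟩
  have mD : ∀ j k, MemLp (conv (g1 k σ) fun y => v y j) 2 volume := fun j k =>
    (kerBd_g1 k hσ).memLp_conv hσ (by positivity) (by norm_num) (memLp_coord hv j)
  have mH := memLp_heatFlow hσ (by norm_num) hU
  have mHt := memLp_heatFlow hσ (by simp) hUt
  have mV := memLp_heatFlow hσ (by norm_num) hv
  have mVt := memLp_heatFlow hσ (by simp) hvt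
  have hVM : eLpNorm (heatFlow σ v) ∞ volume ≤ ENNReal.ofReal M :=
    (eLpNorm_heatFlow_le hσ (by simp) hv.1).trans hvM
  -- With V = e^{σΔ}v and H = e^{σΔ}U: UⱼUₖ = VⱼHₖ + (U-H)ₖVⱼ + (U-V)ⱼUₖ. The first product does no
  -- work, and each of the others contains a small difference.
  have split : ∀ j k, ∫ x, conv (g1 k σ) (fun y => v y j) x * (U x j * U x k)
      = (∫ x, conv (g1 k σ) (fun y => v y j) x * heatFlow σ v x j * heatFlow σ U x k)
      + ((∫ x, conv (g1 k σ) (fun y => v y j) x * (U - heatFlow σ U) x k * heatFlow σ v x j)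
      + ∫ x, conv (g1 k σ) (fun y => v y j) x * (U - heatFlow σ v) x j * U x k) := by
    intro j k
    have i1 := integrable_mul_mul (mD j k) (memLp_coord mV j) (memLp_coord mHt k)
    have i2 := integrable_mul_mul (mD j k) (memLp_coord (hU.sub mH) k) (memLp_coord mVt j)
    have i3 := integrable_mul_mul (mD j k) (memLp_coord (hU.sub mV) j) (memLp_coord hUt k)
    have i23 : Integrable fun x => conv (g1 k σ) (fun y => v y j) x * (U - heatFlow σ U) x k
        * heatFlow σ v x j + conv (g1 k σ) (fun y => v y j) x * (U - heatFlow σ v) x j * U x k :=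
      i2.add i3
    rw [← integral_add i2 i3, ← integral_add i1 i23]
    refine integral_congr_ae (ae_of_all _ fun x => ?_)
    simp; ring
  have cancel : ∑ j, ∑ k, ∫ x, conv (g1 k σ) (fun y => v y j) x * heatFlow σ v x j
      * heatFlow σ U x k = 0 := by
    refine Finset.sum_eq_zero fun j _ => ?_
    rw [← hd.sum_integral_mul_conv_eq_zero hUt (memLp_coord hv j) hσ]
    refine Finset.sum_congr rfl fun k _ => ?_
    refine integral_congr_ae (ae_of_all _ fun x => ?_)
    simp only
    rw [show heatFlow σ v x j = conv (heatKernel d σ) (fun y => v y j) x from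
        vconv_apply (kerBd_heatKernel hσ) hσ zero_le_one (by norm_num) hv x j,
      show heatFlow σ U x k = conv (heatKernel d σ) (fun y => U y k) x from
        vconv_apply (kerBd_heatKernel hσ) hσ zero_le_one (by norm_num) hU x k]
  simp only [split, Finset.sum_add_distrib]
  rw [cancel, zero_add, ← Finset.sum_add_distrib]
  simp only [← Finset.sum_add_distrib]
  refine (Finset.abs_sum_le_sum_abs _ _).trans ?_
  have hterm : ∀ j k : Fin d,
      |(∫ x, conv (g1 k σ) (fun y => v y j) x * (U - heatFlow σ U) x k * heatFlow σ v x j)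
      + ∫ x, conv (g1 k σ) (fun y => v y j) x * (U - heatFlow σ v) x j * U x k|
      ≤ D * (δ₁ + δ₂) * M := by
    intro j k
    refine (abs_add_le _ _).trans ?_
    have b1 := abs_integral_mul_mul_le (mD j k).1 (memLp_coord (hU.sub mH) k).1 (memLp_coord mVt j).1
      hD hδ₁ hM (hgrad j k) ((eLpNorm_coord_le _ k 2).trans h₁) ((eLpNorm_coord_le _ j ∞).trans hVM)
    have b2 := abs_integral_mul_mul_le (mD j k).1 (memLp_coord (hU.sub mV) j).1 (memLp_coord hUt k).1
      hD hδ₂ hM (hgrad j k) ((eLpNorm_coord_le _ j 2).trans h₂) ((eLpNorm_coord_le _ k ∞).trans hUM)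
    refine (add_le_add b1 b2).trans_eq ?_
    ring
  calc _ ≤ ∑ j : Fin d, ∑ k : Fin d, D * (δ₁ + δ₂) * M :=
        Finset.sum_le_sum fun j _ => (Finset.abs_sum_le_sum_abs _ _).trans
          (Finset.sum_le_sum fun k _ => hterm j k)
    _ = _ := by
        simp only [Finset.sum_const, Finset.card_univ, Fintype.card_fin, nsmul_eq_mul]
        ring

end NavierStokes

/-! ### The energy inequality for bounded Hölder continuous curves. -/

namespace NavierStokes

variable {d : ℕ}

/-- A fixed offset ε > 0 removes the time singularity, so the weight is constant in s and no
relation between p and d is needed. -/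
lemma ker3_oseenKernel_const (p : ℝ≥0∞) {t ε : ℝ} (hε : 0 < ε) :
    Ker3 p t (fun i j k s => (oseenKernel i j k (t + ε - s) : Sp d → ℝ))
      fun _ => 2 * kC d * ε ^ (-sing d p) where
  fam := fun i j k => kerFam_oseenKernel i j k (by linarith)
  meas := measurable_const
  nonneg := fun s hs => by
    have := kC_pos d
    positivity
  fin := by simp [ENNReal.mul_lt_top]
  bd := fun s hs i j k => by
    have hC := kC_pos d
    have h1 : 0 < t + ε - s := by linarith [hs.2]
    refine ⟨_, _, by positivity, h1, kerBd_oseenKernel i j k h1, ?_⟩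
    have e : kC d * (2 * (t + ε - s) ^ (-(1 / 2) : ℝ)) * (t + ε - s) ^ (-(d : ℝ) / 2 * rexp p)
        = 2 * kC d * (t + ε - s) ^ (-sing d p) := by
      rw [sing, neg_add, Real.rpow_add h1]
      ring_nf
    rw [e]
    have := Real.rpow_le_rpow_of_nonpos hε (show ε ≤ t + ε - s by linarith [hs.2])
      (neg_nonpos.2 (sing_pos d p).le)
    gcongr

/-- One factor is taken in L^∞ and the other in L². The bound is linear in the step h, so its square
is negligible for h small compared with ε. -/
lemma eLpNorm_bil_two_le {ε h A M : ℝ} (hε : 0 < ε) (hh : 0 ≤ h) (hA : 0 ≤ A) (hM : 0 ≤ M)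
    {z : ℝ → Sp d → Sp d} (hz : IsCurve 2 h z)
    (h2 : ∀ s ∈ Ioo 0 h, eLpNorm (z s) 2 volume ≤ ENNReal.ofReal A)
    (ht : ∀ s ∈ Ioo 0 h, eLpNorm (z s) ∞ volume ≤ ENNReal.ofReal M) :
    eLpNorm (bil ε z z h) 2 volume
      ≤ ENNReal.ofReal (bC d * (M * A) * (h * ε ^ (-(1 / 2) : ℝ))) := by
  have hk := kC_pos d
  have hs : sing d ∞ = 1 / 2 := by simp [sing, rexp]
  refine (eLpNorm_trip_le (p := 2) le_rfl (ker3_oseenKernel_const ∞ hε) (r := 2) (by simp) hh le_rfl hz hz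
    (A := fun _ => M) (B := fun _ => A) measurable_const measurable_const (fun _ _ => hM)
    (fun _ _ => hA) ht h2).trans ?_
  rw [setLIntegral_const, Real.volume_Ioo, sub_zero, hs, ← ENNReal.ofReal_mul (by positivity),
    ← ENNReal.ofReal_mul (by positivity)]
  refine ENNReal.ofReal_le_ofReal (le_of_eq ?_)
  rw [bC]; ring

/-- A curve of divergence free fields, bounded in `L^2` and in `L^∞` and Hölder continuous in
`L^2`, that satisfies the regularized Duhamel formula. -/
structure EnergyCurve (L A M C : ℝ) (u : ℝ → Sp d → Sp d) : Prop where
  mem : ∀ t ∈ Icc 0 L, MemLp (u t) 2 volume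
  two : ∀ t ∈ Icc 0 L, eLpNorm (u t) 2 volume ≤ ENNReal.ofReal A
  top : ∀ t ∈ Icc 0 L, eLpNorm (u t) ∞ volume ≤ ENNReal.ofReal M
  div : ∀ t ∈ Icc 0 L, DivFree (u t)
  hol : ∀ s t, 0 ≤ s → s ≤ t → t ≤ L →
    eLpNorm (u t - u s) 2 volume ≤ ENNReal.ofReal (C * (t - s) ^ (3 / 8 : ℝ))
  heat : ∀ t ∈ Icc 0 L, ∀ σ ∈ Ioc (0 : ℝ) 1,
    eLpNorm (u t - heatFlow σ (u t)) 2 volume ≤ ENNReal.ofReal (C * σ ^ (3 / 8 : ℝ))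
  step : ∀ t h ε, 0 ≤ t → 0 < h → t + h ≤ L → 0 < ε → heatFlow ε (u (t + h))
    = heatFlow (h + ε) (u t) - bil ε (fun s => u (t + s)) (fun s => u (t + s)) h

section Energy

variable {L A M C D : ℝ} {u : ℝ → Sp d → Sp d}

lemma EnergyCurve.isCurve (hu : EnergyCurve L A M C u) (hA : 0 ≤ A) {t h : ℝ} (ht : 0 ≤ t)
    (hL : t + h ≤ L) : IsCurve 2 h fun s => u (t + s) where
  mem := fun s hs => hu.mem _ ⟨by linarith [hs.1], by linarith [hs.2]⟩
  cont := fun s hs => by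
    have hlim : Tendsto (fun r => ENNReal.ofReal (C * |r - s| ^ (3 / 8 : ℝ))) (𝓝[Ioc 0 h] s) (𝓝 0) := by
      have : Continuous fun r : ℝ => ENNReal.ofReal (C * |r - s| ^ (3 / 8 : ℝ)) :=
        ENNReal.continuous_ofReal.comp (continuous_const.mul
          ((continuous_abs.comp (continuous_id.sub continuous_const)).rpow_const
            fun _ => Or.inr (by norm_num)))
      simpa using (this.tendsto s).mono_left nhdsWithin_le_nhds
    refine tendsto_of_tendsto_of_tendsto_of_le_of_le' tendsto_const_nhds hlim
      (Eventually.of_forall fun _ => bot_le) ?_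
    filter_upwards [self_mem_nhdsWithin] with r hr
    rcases le_total s r with h' | h'
    · have := hu.hol (t + s) (t + r) (by linarith [hs.1]) (by linarith) (by linarith [hr.2])
      rwa [show t + r - (t + s) = |r - s| by rw [abs_of_nonneg (by linarith)]; ring] at this
    · have := hu.hol (t + r) (t + s) (by linarith [hr.1]) (by linarith) (by linarith [hs.2])
      rwa [show t + s - (t + r) = |r - s| by rw [abs_of_nonpos (by linarith)]; ring,
        eLpNorm_sub_comm] at this
  bdd := ⟨A, hA, fun s hs => hu.two _ ⟨by linarith [hs.1], by linarith [hs.2]⟩⟩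

/-- For s ≤ σ the field u(t+s) differs from e^{σΔ}u(t) by O(σ^(3/8)); the constant 3C is C for the
heat defect of u(t+s) plus 2C for this difference. The gradient costs σ^(-1/8), and σ^(1/4) remains.
A Hölder exponent above 1/4 is what makes this power positive. -/
lemma EnergyCurve.abs_transport_le (hu : EnergyCurve L A M C u) (hM : 0 ≤ M)
    (hC : 0 ≤ C) (hD : 0 ≤ D)
    (hgrad : ∀ t ∈ Icc 0 L, ∀ σ ∈ Ioc (0 : ℝ) 1, ∀ j k,
      eLpNorm (conv (g1 k σ) fun y => u t y j) 2 volume ≤ ENNReal.ofReal (D * σ ^ (-(1 / 8) : ℝ)))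
    {t s σ : ℝ} (ht : 0 ≤ t) (hs : 0 ≤ s) (hL : t + s ≤ L) (hσ : σ ∈ Ioc (0 : ℝ) 1) (hsσ : s ≤ σ) :
    |∑ j, ∑ k, ∫ x, conv (g1 k σ) (fun y => u t y j) x * (u (t + s) x j * u (t + s) x k)|
      ≤ d ^ 2 * (3 * C * D * M) * σ ^ (1 / 4 : ℝ) := by
  have h1 := hσ.1
  have mt : t ∈ Icc 0 L := ⟨ht, by linarith⟩
  have ms : t + s ∈ Icc 0 L := ⟨by linarith, hL⟩
  have mσ := memLp_heatFlow h1 (by norm_num) (hu.mem t mt)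
  have h2 : eLpNorm (u (t + s) - heatFlow σ (u t)) 2 volume
      ≤ ENNReal.ofReal (2 * (C * σ ^ (3 / 8 : ℝ))) := by
    rw [← sub_add_sub_cancel (u (t + s)) (u t) (heatFlow σ (u t)), two_mul,
      ENNReal.ofReal_add (by positivity) (by positivity)]
    refine (eLpNorm_add_le ((hu.mem _ ms).sub (hu.mem t mt)).1 ((hu.mem t mt).sub mσ).1
      (by norm_num)).trans (add_le_add ((hu.hol t (t + s) ht (by linarith) hL).trans
        (ENNReal.ofReal_le_ofReal ?_)) (hu.heat t mt σ hσ))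
    rw [add_sub_cancel_left]
    gcongr
  have key := NavierStokes.abs_transport_le h1 hM (by positivity) (by positivity) (by positivity)
    (hu.mem _ ms) (hu.mem t mt) (hu.top _ ms) (hu.top t mt) (hu.div _ ms) (hgrad t mt σ hσ)
    (hu.heat _ ms σ hσ) h2
  refine key.trans_eq ?_
  have e : σ ^ (1 / 4 : ℝ) = σ ^ (-(1 / 8) : ℝ) * σ ^ (3 / 8 : ℝ) := by
    rw [← Real.rpow_add h1]; norm_num
  rw [e]; ring

/-- Write e^{εΔ}u(t+h) = g - W and expand the square. The heat flow gives ‖g‖ ≤ ‖e^{εΔ}u(t)‖; the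
condition h ≤ ε² turns ‖W‖² = O(h²/ε) into h O(ε); and ⟨g, W⟩ is a time integral of transport terms
over an interval of length h. -/
lemma EnergyCurve.energy_step (hu : EnergyCurve L A M C u) (hA : 0 ≤ A) (hM : 0 ≤ M)
    (hC : 0 ≤ C) (hD : 0 ≤ D)
    (hgrad : ∀ t ∈ Icc 0 L, ∀ σ ∈ Ioc (0 : ℝ) 1, ∀ j k,
      eLpNorm (conv (g1 k σ) fun y => u t y j) 2 volume ≤ ENNReal.ofReal (D * σ ^ (-(1 / 8) : ℝ)))
    {t h ε : ℝ} (ht : 0 ≤ t) (hh : 0 < h) (hL : t + h ≤ L) (hε : 0 < ε) (hε4 : ε ≤ 1 / 4)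
    (hhε : h ≤ ε ^ 2) :
    pair (heatFlow ε (u (t + h))) (heatFlow ε (u (t + h))) ≤ pair (heatFlow ε (u t)) (heatFlow ε (u t))
      + h * (2 * (d ^ 2 * (3 * C * D * M) * (4 * ε) ^ (1 / 4 : ℝ)) + (bC d * (M * A)) ^ 2 * ε) := by
  have hbC := bC_nonneg d
  have hhε' : h ≤ ε := hhε.trans (by nlinarith)
  have mt : t ∈ Icc 0 L := ⟨ht, by linarith⟩
  have hz := hu.isCurve hA ht hL
  have hin : ∀ s ∈ Ioo 0 h, t + s ∈ Icc 0 L := fun s hs => ⟨by linarith [hs.1], by linarith [hs.2]⟩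
  have hhe : 0 < h + ε := by linarith
  set g := heatFlow (h + ε) (u t) with hg
  set W := bil ε (fun s => u (t + s)) (fun s => u (t + s)) h with hW
  have mg : MemLp g 2 volume := memLp_heatFlow hhe (by norm_num) (hu.mem t mt)
  have mgt : MemLp g ∞ volume := memLp_heatFlow hhe (by simp)
    ⟨(hu.mem t mt).1, (hu.top t mt).trans_lt (by simp)⟩
  have mW : MemLp W 2 volume := memLp_trip le_rfl (ker3_oseenKernel_const 2 hε) hh.le le_rfl hz hz
  rw [hu.step t h ε ht hh hL hε, pair_self_sub mg mW]
  have hgg : pair g g ≤ pair (heatFlow ε (u t)) (heatFlow ε (u t)) := by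
    have me := memLp_heatFlow hε (by norm_num) (hu.mem t mt)
    rw [pair_self mg, pair_self me]
    gcongr
    · exact me.2.ne
    · rw [hg, ← heatFlow_heatFlow hh hε (by norm_num) (hu.mem t mt)]
      exact eLpNorm_heatFlow_le hh (by norm_num) me.1
  have hWW : pair W W ≤ h * ((bC d * (M * A)) ^ 2 * ε) := by
    refine (pair_self_le mW (by positivity) (eLpNorm_bil_two_le hε hh.le hA hM hz
      (fun s hs => hu.two _ (hin s hs)) (fun s hs => hu.top _ (hin s hs)))).trans ?_
    have e : (ε ^ (-(1 / 2) : ℝ)) ^ 2 = ε⁻¹ := by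
      rw [← Real.rpow_natCast, ← Real.rpow_mul hε.le, ← Real.rpow_neg_one]; norm_num
    have e' : h * ε⁻¹ ≤ ε := by
      rw [← div_eq_mul_inv, div_le_iff₀ hε]; nlinarith
    calc (bC d * (M * A) * (h * ε ^ (-(1 / 2) : ℝ))) ^ 2
        = h * ((bC d * (M * A)) ^ 2 * (h * ε⁻¹)) := by rw [← e]; ring
      _ ≤ _ := by gcongr
  have hgW : |pair g W| ≤ h * (d ^ 2 * (3 * C * D * M) * (4 * ε) ^ (1 / 4 : ℝ)) := by
    have e : pair g W = ∫ s in Ioo 0 h, ∑ j, ∑ k, -∫ y, (∑ i, conv (oseenKernel i j k (h + ε - s))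
        (fun x => g x i) y) * (u (t + s) y j * u (t + s) y k) :=
      sum_integral_mul_trip (p := 2) (p' := 2) (q' := ∞) le_rfl (ker3_oseenKernel_const 2 hε) hh.le le_rfl
        hz hz (fun _ _ i j k x => oseenKernel_neg i j k _ x) inferInstance
        (by rw [ENNReal.div_self (by simp) (by simp)]; infer_instance)
        (φ := fun i x => g x i) (memLp_coord mg) (memLp_coord mgt)
    rw [e, ← Real.norm_eq_abs]
    refine (norm_setIntegral_le_of_norm_le_const (C := d ^ 2 * (3 * C * D * M) * (4 * ε) ^ (1 / 4 : ℝ))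
      (by rw [Real.volume_Ioo]; exact ENNReal.ofReal_lt_top) fun s hs => ?_).trans_eq ?_
    · have h1 : 0 < h + ε - s := by linarith [hs.2]
      -- On the divergence free field g the projection drops out and the heat times add up to σ =
      -- 2(h + ε) - s, which lies between s and 4ε since h ≤ ε. The bound ε ≤ 1/4 gives σ ≤ 1.
      have hconv : ∀ j k y, ∑ i, conv (oseenKernel i j k (h + ε - s)) (fun x => g x i) y
          = conv (g1 k (h + ε - s + (h + ε))) (fun y => u t y j) y := by
        intro j k y
        rw [(divFree_heatFlow hhe (by norm_num) (hu.mem t mt) (hu.div t mt)).sum_conv_oseenKernel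
            (by norm_num) mg j k h1 y,
          ← conv_g1_conv_heatKernel k h1 hhe (by norm_num) (memLp_coord (hu.mem t mt) j)]
        congr 1; funext x
        exact vconv_apply (kerBd_heatKernel hhe) hhe zero_le_one (by norm_num) (hu.mem t mt) x j
      simp only [hconv, Finset.sum_neg_distrib, norm_neg]
      refine (hu.abs_transport_le hM hC hD hgrad ht hs.1.le (hin s hs).2
        ⟨by linarith, by linarith [hs.1]⟩ (by linarith [hs.2])).trans ?_
      gcongr
      linarith [hs.1]
    · rw [Real.volume_real_Ioo_of_le hh.le]; ring
  have := abs_le.1 hgW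
  linarith

/-- The energy inequality. -/
lemma EnergyCurve.eLpNorm_two_le (hu : EnergyCurve L A M C u) (hA : 0 ≤ A) (hM : 0 ≤ M)
    (hC : 0 ≤ C) (hL : 0 ≤ L) : eLpNorm (u L) 2 volume ≤ eLpNorm (u 0) 2 volume := by
  obtain ⟨D, hD, hgrad⟩ := exists_gradient_bound (d := d) hA hC
  have hgrad' : ∀ t ∈ Icc 0 L, ∀ σ ∈ Ioc (0 : ℝ) 1, ∀ j k,
      eLpNorm (conv (g1 k σ) fun y => u t y j) 2 volume ≤ ENNReal.ofReal (D * σ ^ (-(1 / 8) : ℝ)) :=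
    fun t ht => hgrad (u t) (hu.mem t ht) (hu.two t ht) (hu.heat t ht)
  set E : ℝ → ℝ := fun ε => 2 * (d ^ 2 * (3 * C * D * M) * (4 * ε) ^ (1 / 4 : ℝ))
    + (bC d * (M * A)) ^ 2 * ε with hE
  have hbC := bC_nonneg d
  have m0 : (0 : ℝ) ∈ Icc 0 L := ⟨le_rfl, hL⟩
  have mL : L ∈ Icc 0 L := ⟨hL, le_rfl⟩
  -- Induction on the number of steps, each of length min(t, ε²); the errors add up to t E(ε), and
  -- E(ε) tends to 0.
  have tele : ∀ ε, 0 < ε → ε ≤ 1 / 4 → ∀ n : ℕ, ∀ t, 0 ≤ t → t ≤ L → t ≤ n * ε ^ 2 →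
      pair (heatFlow ε (u t)) (heatFlow ε (u t)) ≤ pair (heatFlow ε (u 0)) (heatFlow ε (u 0)) + t * E ε := by
    intro ε hε hε4 n
    have hE0 : 0 ≤ E ε := by simp only [hE]; positivity
    induction n with
    | zero =>
      intro t ht _ h
      have : t = 0 := le_antisymm (by simpa using h) ht
      simp [this]
    | succ n ih =>
      intro t ht htL h
      rcases ht.eq_or_lt with rfl | ht'
      · simp
      have hε2 : 0 < ε ^ 2 := by positivity
      set η := min t (ε ^ 2) with hη
      have hη0 : 0 < η := lt_min ht' hε2
      have hηt : η ≤ t := min_le_left _ _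
      have := ih (t - η) (by linarith) (by linarith) (by
        rcases min_choice t (ε ^ 2) with h' | h'
        · rw [hη, h', sub_self]; positivity
        · rw [hη, h']; push_cast at h; linarith)
      have h2 := hu.energy_step hA hM hC hD hgrad' (t := t - η) (h := η) (ε := ε) (by linarith) hη0
        (by linarith) hε hε4 (min_le_right _ _)
      rw [sub_add_cancel] at h2
      have e : (t - η) * E ε + η * E ε = t * E ε := by ring
      simp only [hE] at this e ⊢
      linarith
  set a := (eLpNorm (u 0) 2 volume).toReal with ha
  set b := (eLpNorm (u L) 2 volume).toReal with hb
  -- The regularization is removed asymmetrically: at time 0 contractivity of the heat flow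
  -- suffices, and at time L the heat defect C ε^(3/8) is added.
  have hε : ∀ ε ∈ Ioo (0 : ℝ) (1 / 4), b ≤ √(a ^ 2 + L * E ε) + C * ε ^ (3 / 8 : ℝ) := by
    intro ε hε
    have hε0 := hε.1
    obtain ⟨n, hn⟩ := exists_nat_ge (L / ε ^ 2)
    have h1 := tele ε hε.1 hε.2.le n L hL le_rfl (by rwa [div_le_iff₀ (by positivity)] at hn)
    have n0 := memLp_heatFlow hε0 (by norm_num) (hu.mem 0 m0)
    have nL := memLp_heatFlow hε0 (by norm_num) (hu.mem L mL)
    rw [pair_self n0, pair_self nL] at h1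
    have h2 : (eLpNorm (heatFlow ε (u 0)) 2 volume).toReal ≤ a :=
      ENNReal.toReal_mono (hu.mem 0 m0).2.ne (eLpNorm_heatFlow_le hε0 (by norm_num) (hu.mem 0 m0).1)
    have h3 : (eLpNorm (heatFlow ε (u L)) 2 volume).toReal ≤ √(a ^ 2 + L * E ε) := by
      refine Real.le_sqrt_of_sq_le (h1.trans ?_)
      gcongr
    have h4 : eLpNorm (u L) 2 volume ≤ ENNReal.ofReal (C * ε ^ (3 / 8 : ℝ))
        + eLpNorm (heatFlow ε (u L)) 2 volume := by
      conv_lhs => rw [← sub_add_cancel (u L) (heatFlow ε (u L))]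
      exact (eLpNorm_add_le ((hu.mem L mL).sub nL).1 nL.1 (by norm_num)).trans
        (add_le_add (hu.heat L mL ε ⟨hε0, by linarith [hε.2]⟩) le_rfl)
    have h5 := ENNReal.toReal_mono (ENNReal.add_ne_top.2 ⟨by simp, nL.2.ne⟩) h4
    rw [ENNReal.toReal_add (by simp) nL.2.ne, ENNReal.toReal_ofReal (by positivity)] at h5
    linarith
  have hlim : Tendsto (fun ε : ℝ => √(a ^ 2 + L * E ε) + C * ε ^ (3 / 8 : ℝ)) (𝓝[>] 0) (𝓝 a) := by
    have hc : Continuous fun ε : ℝ => √(a ^ 2 + L * E ε) + C * ε ^ (3 / 8 : ℝ) := by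
      have c1 : Continuous fun ε : ℝ => (4 * ε) ^ (1 / 4 : ℝ) :=
        (continuous_const.mul continuous_id).rpow_const fun _ => Or.inr (by norm_num)
      have c2 : Continuous fun ε : ℝ => ε ^ (3 / 8 : ℝ) :=
        continuous_id.rpow_const fun _ => Or.inr (by norm_num)
      simp only [hE]
      fun_prop
    have := (hc.tendsto 0).mono_left (nhdsWithin_le_nhds (s := Ioi 0))
    have e : √(a ^ 2 + L * E 0) + C * (0 : ℝ) ^ (3 / 8 : ℝ) = a := by
      simp only [hE]
      rw [mul_zero, Real.zero_rpow (by norm_num), Real.zero_rpow (by norm_num)]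
      simp [ha]
    rwa [e] at this
  have hab : b ≤ a := ge_of_tendsto hlim (by
    filter_upwards [Ioo_mem_nhdsGT (show (0 : ℝ) < 1 / 4 by norm_num)] with ε h
    exact hε ε h)
  exact (ENNReal.toReal_le_toReal (hu.mem L mL).2.ne (hu.mem 0 m0).2.ne).1 hab

end Energy

end NavierStokes

/-! ### The energy inequality for mild solutions. -/

namespace NavierStokes

variable {d : ℕ}

lemma sing_top : sing d ∞ = 1 / 2 := by simp [sing, rexp]

section

variable {p : ℝ≥0∞} {T A M δ : ℝ} {u : ℝ → Sp d → Sp d} {u₀ : Sp d → Sp d}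

/-- For the bilinear part the L^∞ bound gives singularity 1/2, and 1/2 + 3/8 < 1 leaves room for the
Hölder exponent. The heat part is even Lipschitz away from time 0, with constant of order 1/δ, and
the surplus power of t - s is absorbed by powers of T. -/
lemma Mild.exists_holder (hp : 2 ≤ p) (hs : sing d p < 1) (hu₂ : MemLp u₀ 2 volume) (hu : Mild p T u₀ u) (hδ : 0 < δ) (hA0 : 0 ≤ A) (hM0 : 0 ≤ M)
    (hA : ∀ t ∈ Ioc 0 T, eLpNorm (u t) 2 volume ≤ ENNReal.ofReal A)
    (hM : ∀ t ∈ Ioc 0 T, eLpNorm (u t) ∞ volume ≤ ENNReal.ofReal M) :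
    ∃ C : ℝ, 0 ≤ C ∧ ∀ s t, δ ≤ s → s ≤ t → t ≤ T →
      eLpNorm (u t - u s) 2 volume ≤ ENNReal.ofReal (C * (t - s) ^ (3 / 8 : ℝ)) := by
  have hbC := bC_nonneg d
  have hg := gC_pos d
  rcases lt_or_ge T 0 with hT | hT
  · exact ⟨0, le_rfl, fun s t h1 h2 h3 => by linarith⟩
  set N := (eLpNorm u₀ 2 volume).toReal with hN
  have hN' : eLpNorm u₀ 2 volume = ENNReal.ofReal N := (ENNReal.ofReal_toReal hu₂.2.ne).symm
  have hN0 : 0 ≤ N := ENNReal.toReal_nonneg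
  set C₁ := (1 + d) * gC d * (T ^ (5 / 8 : ℝ) / δ) * N with hC₁
  set C₂ := bC d / (1 / 2) * T ^ (1 / 8 : ℝ) * (M * A) with hC₂
  set C₃ := bC d * (M * A) * (T ^ (1 / 8 : ℝ) / (1 / 8)) with hC₃
  refine ⟨C₁ + (C₂ + C₃), by positivity, fun s t hs' hst htT => ?_⟩
  have hs0 : 0 < s := hδ.trans_le hs'
  have hh : 0 ≤ t - s := by linarith
  have hhT : t - s ≤ T := by linarith
  have ms : s ∈ Ioc 0 T := ⟨hs0, by linarith⟩
  have mt : t ∈ Ioc 0 T := ⟨by linarith, htT⟩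
  have hpow : ∀ a b : ℝ, 0 ≤ a → 0 ≤ b → (t - s) ^ (a + b) ≤ T ^ a * (t - s) ^ b := by
    intro a b ha hb
    rw [Real.rpow_add_of_nonneg hh ha hb]
    gcongr
  have e : u t - u s =ᵐ[volume] (heatFlow t u₀ - heatFlow s u₀) - (bil 0 u u t - bil 0 u u s) := by
    filter_upwards [hu.eq t mt, hu.eq s ms] with x h1 h2
    simp only [Pi.sub_apply] at *
    rw [h1, h2]; abel
  rw [eLpNorm_congr_ae e]
  have b1 : eLpNorm (heatFlow t u₀ - heatFlow s u₀) 2 volume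
      ≤ ENNReal.ofReal (C₁ * (t - s) ^ (3 / 8 : ℝ)) := by
    refine (eLpNorm_heatFlow_sub_le hs0 hst (by norm_num) hu₂).trans ?_
    rw [hN', ← ENNReal.ofReal_mul (by positivity)]
    refine ENNReal.ofReal_le_ofReal ?_
    have := hpow (5 / 8) (3 / 8) (by norm_num) (by norm_num)
    rw [show (5 / 8 + 3 / 8 : ℝ) = 1 by norm_num, Real.rpow_one] at this
    calc (1 + d) * gC d * ((t - s) / s) * N
        ≤ (1 + d) * gC d * ((T ^ (5 / 8 : ℝ) * (t - s) ^ (3 / 8 : ℝ)) / δ) * N := by gcongr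
      _ = _ := by rw [hC₁]; ring
  have b2 : eLpNorm (bil 0 u u t - bil 0 u u s) 2 volume
      ≤ ENNReal.ofReal ((C₂ + C₃) * (t - s) ^ (3 / 8 : ℝ)) := by
    have := eLpNorm_bil_sub_le (p₁ := ∞) (r := 2) (θ := 3 / 8) (t := s) (h := t - s) (T := T) hp hs
      (by norm_num) (by rw [sing_top]; norm_num) (by simp) hh hs0.le (by linarith) hu.curve hu.curve
      hM0 hA0 (fun r hr => hM r ⟨hr.1, by linarith [hr.2]⟩) (fun r hr => hA r ⟨hr.1, by linarith [hr.2]⟩)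
    rw [add_sub_cancel, sing_top] at this
    refine this.trans ?_
    rw [← ENNReal.ofReal_add (by positivity) (by
      norm_num
      positivity)]
    refine ENNReal.ofReal_le_ofReal ?_
    have h1 := hpow (1 / 8) (3 / 8) (by norm_num) (by norm_num)
    norm_num at h1
    have h2 : s ^ (1 / 8 : ℝ) ≤ T ^ (1 / 8 : ℝ) := by gcongr; exact ms.2
    rw [show (1 - 1 / 2 : ℝ) = 1 / 2 by norm_num, show (1 - (1 / 2 + 3 / 8) : ℝ) = 1 / 8 by norm_num,
      add_mul]
    refine add_le_add ?_ ?_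
    · calc bC d / (1 / 2) * (t - s) ^ (1 / 2 : ℝ) * (M * A)
          ≤ bC d / (1 / 2) * (T ^ (1 / 8 : ℝ) * (t - s) ^ (3 / 8 : ℝ)) * (M * A) := by gcongr
        _ = _ := by rw [hC₂]; ring
    · calc bC d * (t - s) ^ (3 / 8 : ℝ) * (M * A) * (s ^ (1 / 8 : ℝ) / (1 / 8))
          ≤ bC d * (t - s) ^ (3 / 8 : ℝ) * (M * A) * (T ^ (1 / 8 : ℝ) / (1 / 8)) := by gcongr
        _ = _ := by rw [hC₃]; ring
  refine (eLpNorm_sub_le ((memLp_heatFlow mt.1 (by norm_num) hu₂).1.sub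
    (memLp_heatFlow ms.1 (by norm_num) hu₂).1)
    ((aestronglyMeasurable_bil hp hs le_rfl mt.1.le mt.2 hu.curve hu.curve).sub
      (aestronglyMeasurable_bil hp hs le_rfl ms.1.le ms.2 hu.curve hu.curve)) (by norm_num)).trans
    ((add_le_add b1 b2).trans_eq ?_)
  rw [← ENNReal.ofReal_add (by positivity) (by positivity), ← add_mul]

/-- The mild equation restarted at t and read at time t + σ expresses u(t) - e^{σΔ}u(t) through the
time increment of u and a short Duhamel term. This needs t + σ ≤ T, hence T' < T; for σ > T - T' the
trivial bound 2A is already of the required form. -/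
lemma Mild.exists_heat_bound (hp : 2 ≤ p) (hs : sing d p < 1) (hu₀ : MemLp u₀ p volume)
    (hu₂ : MemLp u₀ 2 volume) (hu : Mild p T u₀ u) (hδ : 0 < δ) (hA0 : 0 ≤ A) (hM0 : 0 ≤ M)
    (hA : ∀ t ∈ Ioc 0 T, eLpNorm (u t) 2 volume ≤ ENNReal.ofReal A)
    (hM : ∀ t ∈ Ioc 0 T, eLpNorm (u t) ∞ volume ≤ ENNReal.ofReal M) {T' : ℝ} (hT' : T' < T) :
    ∃ C : ℝ, 0 ≤ C ∧ ∀ t ∈ Icc δ T', ∀ σ ∈ Ioc (0 : ℝ) 1,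
      eLpNorm (u t - heatFlow σ (u t)) 2 volume ≤ ENNReal.ofReal (C * σ ^ (3 / 8 : ℝ)) := by
  have hbC := bC_nonneg d
  obtain ⟨C, hC0, hC⟩ := hu.exists_holder hp hs hu₂ hδ hA0 hM0 hA hM
  set ρ := T - T' with hρ
  have hρ0 : 0 < ρ := by linarith
  set C₁ := bC d / (1 / 2) * (M * A) with hC₁
  refine ⟨C + C₁ + 2 * A / ρ ^ (3 / 8 : ℝ), by positivity, fun t ht σ hσ => ?_⟩
  have hσ0 := hσ.1
  have hρ1 : 0 < ρ ^ (3 / 8 : ℝ) := by positivity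
  have mt : t ∈ Ioc 0 T := ⟨hδ.trans_le ht.1, ht.2.trans hT'.le⟩
  have ut : MemLp (u t) 2 volume := ⟨(hu.curve.mem t mt).1, (hA t mt).trans_lt (by simp)⟩
  have mh := memLp_heatFlow hσ0 (by norm_num) ut
  rcases le_or_gt σ ρ with h | h
  · have mtσ : t + σ ∈ Ioc 0 T := ⟨by linarith [mt.1], by linarith [ht.2]⟩
    have hre := hu.restart hp hs hu₀ mt
    have hin : ∀ s ∈ Ioo 0 σ, t + s ∈ Ioc 0 T := fun s hs =>
      ⟨by linarith [mt.1, hs.1], by linarith [mtσ.2, hs.2]⟩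
    set B := bil 0 (fun s => u (t + s)) (fun s => u (t + s)) σ with hB
    have hBm : AEStronglyMeasurable B volume :=
      aestronglyMeasurable_bil hp hs le_rfl hσ0.le (by linarith [mtσ.2]) hre.curve hre.curve
    have e : u t - heatFlow σ (u t) =ᵐ[volume] -(u (t + σ) - u t) - B := by
      filter_upwards [hre.eq σ ⟨hσ0, by linarith [mtσ.2]⟩] with x hx
      simp only [Pi.sub_apply, Pi.neg_apply] at *
      rw [hx]; abel
    have b1 := hC t (t + σ) ht.1 (by linarith) mtσ.2
    rw [add_sub_cancel_left, ← eLpNorm_neg] at b1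
    have b2 : eLpNorm B 2 volume ≤ ENNReal.ofReal (C₁ * σ ^ (3 / 8 : ℝ)) := by
      refine (eLpNorm_bil_le_const (p₁ := ∞) (r := 2) (T := T - t) hp (by rw [sing_top]; norm_num)
        (by simp) le_rfl hσ0.le (by linarith [mtσ.2]) hre.curve hre.curve hM0 hA0
        (fun s hs => hM _ (hin s hs)) (fun s hs => hA _ (hin s hs))).trans ?_
      refine ENNReal.ofReal_le_ofReal ?_
      rw [sing_top, show (1 - 1 / 2 : ℝ) = 1 / 2 by norm_num]
      calc bC d / (1 / 2) * σ ^ (1 / 2 : ℝ) * (M * A)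
          ≤ bC d / (1 / 2) * σ ^ (3 / 8 : ℝ) * (M * A) := by
            have := Real.rpow_le_rpow_of_exponent_ge hσ0 hσ.2 (show (3 / 8 : ℝ) ≤ 1 / 2 by norm_num)
            gcongr
        _ = _ := by rw [hC₁]; ring
    rw [eLpNorm_congr_ae e]
    refine (eLpNorm_sub_le ((hu.curve.mem _ mtσ).1.sub ut.1).neg hBm (by norm_num)).trans
      ((add_le_add b1 b2).trans ?_)
    rw [← ENNReal.ofReal_add (by positivity) (by positivity), ← add_mul]
    refine ENNReal.ofReal_le_ofReal (mul_le_mul_of_nonneg_right ?_ (by positivity))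
    exact le_add_of_nonneg_right (by positivity)
  · refine (eLpNorm_sub_le ut.1 mh.1 (by norm_num)).trans ((add_le_add (hA t mt)
      ((eLpNorm_heatFlow_le hσ0 (by norm_num) ut.1).trans (hA t mt))).trans ?_)
    rw [← ENNReal.ofReal_add hA0 hA0]
    refine ENNReal.ofReal_le_ofReal ?_
    have h1 : ρ ^ (3 / 8 : ℝ) ≤ σ ^ (3 / 8 : ℝ) := by gcongr
    calc A + A = 2 * A / ρ ^ (3 / 8 : ℝ) * ρ ^ (3 / 8 : ℝ) := by field_simp; ring
      _ ≤ (C + C₁ + 2 * A / ρ ^ (3 / 8 : ℝ)) * σ ^ (3 / 8 : ℝ) := by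
        gcongr
        exact le_add_of_nonneg_left (by positivity)

/-- The solution is restarted at δ/2, where it is bounded, so that from time δ on both the L^∞ bound
and the Hölder bounds, which need a positive elapsed time, are available. -/
lemma Mild.eLpNorm_two_le_of_pos (hp : 2 ≤ p) (hs : sing d p < 1) (hu₀ : MemLp u₀ p volume)
    (hu₂ : MemLp u₀ 2 volume) (hd : DivFree u₀) (hu : Mild p T u₀ u) (hδ : 0 < δ) {t : ℝ}
    (hδt : δ ≤ t) (ht : t < T) : eLpNorm (u t) 2 volume ≤ eLpNorm (u δ) 2 volume := by
  obtain ⟨A, hA0, hA⟩ := hu.exists_eLpNorm_two_le hp hs hu₀ hu₂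
  obtain ⟨M, hM0, hM⟩ := hu.exists_eLpNorm_top_le hp hs hu₀ (half_pos hδ)
  set a := δ / 2 with ha
  have ha0 : 0 < a := half_pos hδ
  have ma : a ∈ Ioc 0 T := ⟨ha0, by linarith⟩
  have hw := hu.restart hp hs hu₀ ma
  have m2 : ∀ s ∈ Ioc 0 T, MemLp (u s) 2 volume := fun s hs =>
    ⟨(hu.curve.mem s hs).1, (hA s hs).trans_lt (by simp)⟩
  have hA' : ∀ s ∈ Ioc 0 (T - a), eLpNorm (u (a + s)) 2 volume ≤ ENNReal.ofReal A := fun s hs =>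
    hA _ ⟨by linarith [hs.1], by linarith [hs.2]⟩
  have hM' : ∀ s ∈ Ioc 0 (T - a), eLpNorm (u (a + s)) ∞ volume ≤ ENNReal.ofReal M := fun s hs =>
    hM _ ⟨by linarith [hs.1], by linarith [hs.2]⟩
  obtain ⟨C₁, hC₁0, hC₁⟩ := hw.exists_holder hp hs (m2 a ma) ha0 hA0 hM0 hA' hM'
  obtain ⟨C₂, hC₂0, hC₂⟩ := hw.exists_heat_bound hp hs (hu.curve.mem a ma) (m2 a ma) ha0 hA0 hM0 hA' hM'
    (T' := t - a) (by linarith)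
  have hin : ∀ s ∈ Icc 0 (t - δ), δ + s ∈ Ioc 0 T := fun s hs =>
    ⟨by linarith [hs.1], by linarith [hs.2]⟩
  have key : EnergyCurve (t - δ) A M (C₁ + C₂) fun s => u (δ + s) :=
    { mem := fun s hs => m2 _ (hin s hs)
      two := fun s hs => hA _ (hin s hs)
      top := fun s hs => hM _ ⟨by linarith [hs.1], (hin s hs).2⟩
      div := fun s h => hu.divFree hp hs hu₀ hd (hin s h)
      hol := fun s r h1 h2 h3 => by
        have := hC₁ (a + s) (a + r) (by linarith) (by linarith) (by linarith)
        rw [show a + (a + r) = δ + r by rw [ha]; ring, show a + (a + s) = δ + s by rw [ha]; ring,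
          add_sub_add_left_eq_sub] at this
        have h4 : 0 ≤ r - s := by linarith
        refine this.trans (ENNReal.ofReal_le_ofReal ?_)
        gcongr
        linarith
      heat := fun s hs σ hσ => by
        have := hC₂ (a + s) ⟨by linarith [hs.1], by linarith [hs.2]⟩ σ hσ
        simp only [show a + (a + s) = δ + s by rw [ha]; ring] at this
        have h4 := hσ.1
        refine this.trans (ENNReal.ofReal_le_ofReal ?_)
        gcongr
        linarith
      step := fun s h ε h1 h2 h3 hε => by
        have ms : δ + s ∈ Ioc 0 T := hin s ⟨h1, by linarith⟩
        have := heatFlow_mild hp hs (hu.curve.mem _ ms) (hu.restart hp hs hu₀ ms) hε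
          (t := h) ⟨h2, by linarith⟩
        simp only [add_assoc] at this ⊢
        exact this }
  have := key.eLpNorm_two_le hA0 hM0 (by positivity) (by linarith)
  simpa using this

/-- The energy inequality for mild solutions. -/
lemma Mild.eLpNorm_two_le (hp : 2 ≤ p) (hs : sing d p < 1) (hu₀ : MemLp u₀ p volume)
    (hu₂ : MemLp u₀ 2 volume) (hd : DivFree u₀) (hu : Mild p T u₀ u) {t : ℝ}
    (ht : t ∈ Ioo 0 T) : eLpNorm (u t) 2 volume ≤ eLpNorm u₀ 2 volume := by
  obtain ⟨A, hA0, hA⟩ := hu.exists_eLpNorm_two_le hp hs hu₀ hu₂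
  obtain ⟨B, hB0, hB⟩ := hu.curve.bdd
  have hγ : 0 < 1 - sing d p := by linarith
  -- The Duhamel formula bounds ‖u(δ)‖₂ by ‖u₀‖₂ plus a positive power of δ, so δ → 0 requires no
  -- continuity of u at time 0.
  have key : ∀ δ ∈ Ioo 0 t, eLpNorm (u t) 2 volume ≤ eLpNorm u₀ 2 volume
      + ENNReal.ofReal (bC d / (1 - sing d p) * δ ^ (1 - sing d p) * (B * A)) := by
    intro δ hδ
    have hδT : δ ≤ T := by linarith [hδ.2, ht.2]
    refine (hu.eLpNorm_two_le_of_pos hp hs hu₀ hu₂ hd hδ.1 hδ.2.le ht.2).trans ?_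
    rw [eLpNorm_congr_ae (hu.eq δ ⟨hδ.1, hδT⟩)]
    refine (eLpNorm_sub_le (memLp_heatFlow hδ.1 (by norm_num) hu₂).1
      (aestronglyMeasurable_bil hp hs le_rfl hδ.1.le hδT hu.curve hu.curve) (by norm_num)).trans ?_
    exact add_le_add (eLpNorm_heatFlow_le hδ.1 (by norm_num) hu₂.1)
      (eLpNorm_bil_le_const hp hs (inv_add_inv_two_le_one hp) le_rfl hδ.1.le hδT hu.curve hu.curve
        hB0 hA0 (fun s hs => hB s ⟨hs.1, hs.2.le.trans hδT⟩) (fun s hs => hA s ⟨hs.1, hs.2.le.trans hδT⟩))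
  have hlim : Tendsto (fun δ : ℝ => eLpNorm u₀ 2 volume
      + ENNReal.ofReal (bC d / (1 - sing d p) * δ ^ (1 - sing d p) * (B * A))) (𝓝[>] 0)
      (𝓝 (eLpNorm u₀ 2 volume)) := by
    have hc : Continuous fun δ : ℝ =>
        ENNReal.ofReal (bC d / (1 - sing d p) * δ ^ (1 - sing d p) * (B * A)) :=
      ENNReal.continuous_ofReal.comp ((continuous_const.mul
        (continuous_id.rpow_const fun _ => Or.inr hγ.le)).mul continuous_const)
    have := (hc.tendsto 0).mono_left (nhdsWithin_le_nhds (s := Ioi 0))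
    rw [Real.zero_rpow hγ.ne'] at this
    simpa using tendsto_const_nhds.add this
  exact ge_of_tendsto hlim (by
    filter_upwards [Ioo_mem_nhdsGT ht.1] with δ h
    exact key δ h)

end

end NavierStokes

namespace NavierStokes

variable {d : ℕ}

/-! ### Sparseness -/

lemma rexp_lt_half {p : ℝ≥0∞} (hp : 2 < p) : rexp p < 1 / 2 := by
  have h : p⁻¹ < 2⁻¹ := ENNReal.inv_lt_inv.2 hp
  have := (ENNReal.toReal_lt_toReal (h.trans_le le_top).ne (by simp)).2 h
  simpa [rexp] using this

lemma volume_lt_norm_le {f : Sp d → Sp d} (hf : AEStronglyMeasurable f volume) {E lam : ℝ}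
    (hE : 0 ≤ E) (h : eLpNorm f 2 volume ≤ ENNReal.ofReal E) (hlam : 0 < lam) :
    volume {x | lam < ‖f x‖} ≤ ENNReal.ofReal ((E / lam) ^ 2) := by
  have h1 := mul_meas_ge_le_pow_eLpNorm' volume (p := 2) (by simp) (by simp) hf (ENNReal.ofReal lam)
  have h2 : ENNReal.ofReal (lam ^ 2) * volume {x | lam < ‖f x‖} ≤ ENNReal.ofReal (E ^ 2) := by
    rw [ENNReal.ofReal_pow hlam.le, ENNReal.ofReal_pow hE]
    simp only [ENNReal.toReal_ofNat, ENNReal.rpow_ofNat] at h1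
    calc _ ≤ ENNReal.ofReal lam ^ 2 * volume {x | ENNReal.ofReal lam ≤ ‖f x‖ₑ} := by
          gcongr with x
          intro hx
          rw [← ofReal_norm]
          exact ENNReal.ofReal_le_ofReal (le_of_lt hx)
      _ ≤ eLpNorm f 2 volume ^ 2 := h1
      _ ≤ _ := by gcongr
  rw [div_pow, ENNReal.ofReal_div_of_pos (by positivity)]
  rw [ENNReal.le_div_iff_mul_le (Or.inl (by simpa using hlam.ne')) (Or.inl (by simp)), mul_comm]
  exact h2

/-- The part of a field below a suitable threshold is small in `L^p`. -/
lemma eLpNorm_restrict_norm_le {p : ℝ≥0∞} (hp : 2 < p) {f : Sp d → Sp d}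
    {E B : ℝ} (hE : 0 < E) (hB : 0 < B) (h : eLpNorm f 2 volume ≤ ENNReal.ofReal E) {lam m : ℝ}
    (hm : m = 1 / (1 / 2 - rexp p)) (hlam : lam = B ^ (m / 2) * E ^ (1 - m / 2)) {S : Set (Sp d)}
    (hS : MeasurableSet S) (hSf : ∀ x ∈ S, ‖f x‖ ≤ lam) :
    eLpNorm f p (volume.restrict S) ≤ ENNReal.ofReal B := by
  have hr := rexp_lt_half hp
  rcases eq_or_ne p ∞ with rfl | hp'
  · have hm2 : m = 2 := by rw [hm]; simp [rexp]
    have hl : lam = B := by rw [hlam, hm2]; norm_num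
    rw [eLpNorm_exponent_top]
    refine eLpNormEssSup_le_of_ae_bound ?_
    filter_upwards [ae_restrict_mem hS] with x hx
    exact (hSf x hx).trans_eq hl
  · set P := p.toReal with hP
    have hP2 : 2 < P := by
      have := (ENNReal.toReal_lt_toReal (by simp) hp').2 hp
      simpa using this
    have hlam0 : 0 < lam := by rw [hlam]; positivity
    -- Here m = 2p/(p-2). The threshold is the solution of λ^(p-2) E² = B^p; for p = ∞ it is λ = B,
    -- the case m = 2.
    have hmP : m / 2 * (P - 2) = P := by
      have : P - 2 ≠ 0 := by linarith
      have h2 : rexp p = P⁻¹ := ENNReal.toReal_inv p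
      rw [hm, h2]
      have : (1 / 2 - P⁻¹ : ℝ) = (P - 2) / (2 * P) := by field_simp
      rw [this]
      field_simp
    have hpow : lam ^ (P - 2) * E ^ 2 = B ^ P := by
      rw [hlam, Real.mul_rpow (by positivity) (by positivity), ← Real.rpow_mul hB.le,
        ← Real.rpow_mul hE.le, hmP, sub_mul, hmP, one_mul, sub_sub_cancel_left, mul_assoc,
        ← Real.rpow_natCast, ← Real.rpow_add hE]
      norm_num
    rw [eLpNorm_eq_lintegral_rpow_enorm_toReal (by rintro rfl; simp at hp) hp', ← hP]
    have hint : ∫⁻ x in S, ‖f x‖ₑ ^ P ≤ ENNReal.ofReal B ^ P := by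
      calc ∫⁻ x in S, ‖f x‖ₑ ^ P ≤ ∫⁻ x in S, ENNReal.ofReal lam ^ (P - 2) * ‖f x‖ₑ ^ (2 : ℝ) := by
            refine setLIntegral_mono_ae' hS (ae_of_all _ fun x hx => ?_)
            have e : ‖f x‖ₑ ^ P = ‖f x‖ₑ ^ (P - 2) * ‖f x‖ₑ ^ (2 : ℝ) := by
              rw [← ENNReal.rpow_add_of_nonneg _ _ (by linarith) (by norm_num), sub_add_cancel]
            rw [e]
            refine mul_le_mul' (ENNReal.rpow_le_rpow ?_ (by linarith)) le_rfl
            rw [← ofReal_norm]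
            exact ENNReal.ofReal_le_ofReal (hSf x hx)
        _ ≤ ∫⁻ x, ENNReal.ofReal lam ^ (P - 2) * ‖f x‖ₑ ^ (2 : ℝ) := setLIntegral_le_lintegral _ _
        _ = ENNReal.ofReal lam ^ (P - 2) * eLpNorm f 2 volume ^ (2 : ℝ) := by
            rw [lintegral_const_mul' _ _ (ENNReal.rpow_ne_top_of_nonneg (by linarith) (by simp)),
              eLpNorm_eq_lintegral_rpow_enorm_toReal (by simp) (by simp), ← ENNReal.rpow_mul]
            simp
        _ ≤ ENNReal.ofReal lam ^ (P - 2) * ENNReal.ofReal E ^ (2 : ℝ) := by gcongr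
        _ = ENNReal.ofReal B ^ P := by
            rw [ENNReal.ofReal_rpow_of_pos hlam0, ENNReal.ofReal_rpow_of_pos hE,
              ENNReal.ofReal_rpow_of_pos hB, ← ENNReal.ofReal_mul (by positivity), ← hpow]
            norm_num
    calc _ ≤ (ENNReal.ofReal B ^ P) ^ (1 / P) := by gcongr
      _ = _ := by rw [← ENNReal.rpow_mul, mul_one_div_cancel (by linarith), ENNReal.rpow_one]

/-- S is the superlevel set at the threshold λ. Chebyshev gives |S| ≤ (β/2)^(-m) (‖f‖₂/‖f‖_p)^m with
m = d μ_p, which is a multiple of ℓ₀^d. The density of S in any ball is estimated by the total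
volume of S, so one factor a serves all fields and all centres. -/
lemma exists_isSparse (hd : d ≠ 0) {p : ℝ≥0∞} (hp : 2 < p) {ε β : ℝ} (hε : ε ∈ Ioo (0 : ℝ) 1)
    (hβ : β ∈ Ioo (0 : ℝ) 1) : ∃ a : ℝ, 1 ≤ a ∧ ∀ f : Sp d → Sp d, MemLp f 2 volume →
      MemLp f p volume → ¬ (f =ᵐ[volume] 0) → IsSparse p ε β (a * lengthScale p f) f := by
  have hβ0 := hβ.1
  have hε0 := hε.1
  have hr := rexp_lt_half hp
  have hp0 : p ≠ 0 := by rintro rfl; simp at hp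
  set m : ℝ := 1 / (1 / 2 - rexp p) with hm
  have hm0 : 0 < m := one_div_pos.2 (by linarith)
  have hd0 : (0 : ℝ) < d := by exact_mod_cast Nat.pos_of_ne_zero hd
  have hmu : mu d p * d = m := by
    have : (1 / 2 - rexp p : ℝ) ≠ 0 := by linarith
    rw [mu, hm]
    change 1 / (d * (1 / 2 - rexp p)) * d = _
    field_simp
  set w := (volume (Metric.ball (0 : Sp d) 1)).toReal with hw
  have hw' : volume (Metric.ball (0 : Sp d) 1) = ENNReal.ofReal w :=
    (ENNReal.ofReal_toReal measure_ball_lt_top.ne).symm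
  have hw0 : 0 < w := ENNReal.toReal_pos (Metric.measure_ball_pos _ _ one_pos).ne' measure_ball_lt_top.ne
  -- With w the volume of the unit ball, a is large enough for (β/2)^(-m) ≤ ε a^d w; a ≥ 1 permits
  -- replacing a by a^d.
  set a := max 1 ((β / 2) ^ (-m) / (ε * w)) with ha
  have ha1 : 1 ≤ a := le_max_left _ _
  have had : (β / 2) ^ (-m) ≤ ε * (a ^ d * w) := by
    have h1 : (β / 2) ^ (-m) / (ε * w) ≤ a ^ d := (le_max_right _ _).trans (le_self_pow₀ ha1 hd)
    rw [div_le_iff₀ (by positivity)] at h1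
    linarith
  refine ⟨a, ha1, fun f hf2 hfp hf0 => ?_⟩
  set E := (eLpNorm f 2 volume).toReal with hE
  set N := (eLpNorm f p volume).toReal with hN
  have hE' : eLpNorm f 2 volume = ENNReal.ofReal E := (ENNReal.ofReal_toReal hf2.2.ne).symm
  have hN' : eLpNorm f p volume = ENNReal.ofReal N := (ENNReal.ofReal_toReal hfp.2.ne).symm
  have hE0 : 0 < E := ENNReal.toReal_pos
    (fun h => hf0 ((eLpNorm_eq_zero_iff hf2.1 (by simp)).1 h)) hf2.2.ne
  have hN0 : 0 < N := ENNReal.toReal_pos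
    (fun h => hf0 ((eLpNorm_eq_zero_iff hfp.1 hp0).1 h)) hfp.2.ne
  have hls : lengthScale p f = (E / N) ^ mu d p := rfl
  have hls0 : 0 < lengthScale p f := by rw [hls]; positivity
  -- Half of β, since the inequality in the definition of sparseness is strict.
  set B := β / 2 * N with hB
  have hB0 : 0 < B := by positivity
  set lam := B ^ (m / 2) * E ^ (1 - m / 2) with hlam
  have hlam0 : 0 < lam := by positivity
  -- The field is only a.e. strongly measurable; S is built from a measurable representative in
  -- order to be a Borel set.
  set g := hf2.1.mk f with hg
  have hfg : f =ᵐ[volume] g := hf2.1.ae_eq_mk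
  have hgm : StronglyMeasurable g := hf2.1.stronglyMeasurable_mk
  have hg2 : eLpNorm g 2 volume ≤ ENNReal.ofReal E := by rw [← eLpNorm_congr_ae hfg, hE']
  have hSm : MeasurableSet {x | lam < ‖g x‖} := measurableSet_lt measurable_const hgm.norm.measurable
  refine ⟨hfp, by positivity, {x | lam < ‖g x‖}, hSm, ?_, iSup_le fun x₀ => ?_⟩
  · rw [eLpNorm_congr_ae (ae_restrict_of_ae hfg), hN', ← ENNReal.ofReal_mul hβ0.le]
    refine (eLpNorm_restrict_norm_le hp hE0 hB0 hg2 hm hlam hSm.compl fun x hx => not_lt.1 hx).trans_lt ?_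
    rw [ENNReal.ofReal_lt_ofReal_iff (by positivity), hB]
    nlinarith
  · refine ENNReal.div_le_of_le_mul ((measure_mono inter_subset_left).trans
      ((volume_lt_norm_le hgm.aestronglyMeasurable hE0.le hg2 hlam0).trans ?_))
    rw [Measure.addHaar_ball_of_pos _ _ (by positivity), hw', finrank_euclideanSpace_fin,
      ← ENNReal.ofReal_mul (by positivity), ← ENNReal.ofReal_mul hε0.le]
    refine ENNReal.ofReal_le_ofReal ?_
    have e1 : (E / lam) ^ 2 = (β / 2) ^ (-m) * (E / N) ^ m := by
      have : E / lam = (E / B) ^ (m / 2) := by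
        rw [hlam, Real.div_rpow hE0.le hB0.le, Real.rpow_sub hE0, Real.rpow_one]
        field_simp
      rw [this, ← Real.rpow_natCast, ← Real.rpow_mul (by positivity), hB,
        Real.rpow_neg (by positivity), ← Real.inv_rpow (by positivity),
        ← Real.mul_rpow (by positivity) (by positivity)]
      congr 1
      · field_simp
      · push_cast; ring
    have e2 : (a * lengthScale p f) ^ d = a ^ d * (E / N) ^ m := by
      rw [mul_pow, hls, ← Real.rpow_natCast ((E / N) ^ mu d p), ← Real.rpow_mul (by positivity), hmu]
    rw [e1, e2]
    calc _ ≤ ε * (a ^ d * w) * (E / N) ^ m := by gcongr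
      _ = _ := by ring

end NavierStokes

namespace NavierStokes

variable {d : ℕ}

/-! ### Existence time and blow-up -/

lemma timeExponent_eq (d : ℕ) (p : ℝ≥0∞) : timeExponent d p = 1 - sing d p := by
  rw [timeExponent, sing, rexp]; ring

lemma sing_lt_one {p : ℝ≥0∞} (hd : d ≠ 0) (hp : (d : ℝ≥0∞) < p) : sing d p < 1 := by
  have h : p⁻¹ < (d : ℝ≥0∞)⁻¹ := ENNReal.inv_lt_inv.2 hp
  have hd0 : (0 : ℝ) < d := by exact_mod_cast Nat.pos_of_ne_zero hd
  have := (ENNReal.toReal_lt_toReal (h.trans_le le_top).ne (by simpa using hd)).2 h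
  rw [ENNReal.toReal_inv, ENNReal.toReal_inv, ENNReal.toReal_natCast] at this
  rw [sing, rexp, ENNReal.toReal_inv]
  have h2 := mul_lt_mul_of_pos_left this hd0
  rw [mul_inv_cancel₀ hd0.ne'] at h2
  linarith

/-- An admissible constant in the guaranteed existence time. -/
def exC (d : ℕ) (p : ℝ≥0∞) : ℝ := (1 + 8 * eC d p)⁻¹

lemma exC_pos {p : ℝ≥0∞} (hs : sing d p < 1) : 0 < exC d p := by
  have := eC_nonneg hs
  rw [exC]; positivity

lemma exC_le_one {p : ℝ≥0∞} (hs : sing d p < 1) : exC d p ≤ 1 := by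
  have := eC_nonneg hs
  exact inv_le_one_of_one_le₀ (by linarith)

/-- This is the smallness condition of `exists_mild`; the summand 1 in `exC` keeps the constant at
most 1 even if `eC` is small. -/
lemma exC_mul_le {p : ℝ≥0∞} (hs : sing d p < 1) : 8 * (eC d p * exC d p) ≤ 1 := by
  have := eC_nonneg hs
  rw [exC, ← mul_assoc, ← div_eq_mul_inv, div_le_one (by positivity)]
  linarith

section

variable {p : ℝ≥0∞} {u : ℝ → Sp d → Sp d} {u₀ : Sp d → Sp d}

/-- An inequality in place of the equality of the existence statement also covers zero data and
leaves room to lengthen the interval. -/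
lemma exists_mild_of_le (hp : 2 ≤ p) (hs : sing d p < 1) (hu₀ : MemLp u₀ p volume) {T : ℝ}
    (hT : 0 < T) (h : (eLpNorm u₀ p volume).toReal * T ^ (1 - sing d p) ≤ exC d p) :
    ∃ u, Mild p T u₀ u ∧ ∀ t ∈ Ioc 0 T, eLpNorm (u t) p volume ≤ 2 * eLpNorm u₀ p volume := by
  have hN' : eLpNorm u₀ p volume = ENNReal.ofReal (eLpNorm u₀ p volume).toReal :=
    (ENNReal.ofReal_toReal hu₀.2.ne).symm
  obtain ⟨u, hu, hb⟩ := exists_mild hp hs hu₀ ENNReal.toReal_nonneg hN'.le hT.le (by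
    have h1 := mul_le_mul_of_nonneg_left h (eC_nonneg hs)
    have h2 := exC_mul_le hs
    linarith)
  refine ⟨u, hu, fun t ht => (hb t ht).trans_eq ?_⟩
  rw [ENNReal.ofReal_mul (by norm_num), ← hN']
  simp

lemma isExistenceConstant_exC (hp : 2 ≤ p) (hs : sing d p < 1) :
    IsExistenceConstant d p (exC d p) := by
  intro u₀ hu₀ T hT h
  rw [timeExponent_eq] at h
  obtain ⟨u, hu, hb⟩ := exists_mild_of_le hp hs hu₀.1 hT h.le
  exact ⟨u, hu.isMildSolution hp hs hu₀, fun t ht => hb t ⟨ht.1, ht.2.le⟩,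
    fun v hv => (hv.mild hT).unique hp hs hu⟩

lemma timeInterval_ofReal_subset (T : ℝ) : timeInterval (ENNReal.ofReal T) ⊆ Ioc 0 T :=
  fun _ ht => ⟨ht.1, ((ENNReal.ofReal_lt_ofReal_iff_of_nonneg ht.1.le).1 ht.2).le⟩

lemma Mild.le_maximalTime (hp : 2 ≤ p) (hs : sing d p < 1) (hu₀ : InLpSigma p u₀) {T : ℝ}
    (hu : Mild p T u₀ u) : ENNReal.ofReal T ≤ maximalTime p u₀ :=
  le_sSup ⟨u, (hu.isMildSolution hp hs hu₀).mono (timeInterval_ofReal_subset T)⟩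

/-- Strictness leaves room for a longer time; this turns solvability up to T* into continuation
beyond T*. -/
lemma exists_gt_mul_rpow_lt {N γ c τ : ℝ} (hγ : 0 < γ) (h : N * τ ^ γ < c) :
    ∃ τ', τ < τ' ∧ N * τ' ^ γ < c := by
  have hc : Continuous fun x : ℝ => N * x ^ γ :=
    continuous_const.mul (continuous_id.rpow_const fun _ => Or.inr hγ.le)
  have h1 : ∀ᶠ x in 𝓝[>] τ, N * x ^ γ < c := nhdsWithin_le_nhds ((hc.tendsto τ).eventually_lt_const h)
  obtain ⟨x, h2, h3⟩ := (h1.and self_mem_nhdsWithin).exists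
  exact ⟨x, h3, h2⟩

lemma maximalTime_pos (hp : 2 ≤ p) (hs : sing d p < 1) (hu₀ : InLpSigma p u₀) :
    0 < maximalTime p u₀ := by
  -- At time 0 the left side is 0, because the exponent is positive, so some positive time is still
  -- admissible.
  obtain ⟨τ, hτ, h⟩ := exists_gt_mul_rpow_lt (N := (eLpNorm u₀ p volume).toReal) (c := exC d p) (τ := 0)
    (γ := 1 - sing d p) (by linarith) (by
      rw [Real.zero_rpow (by linarith), mul_zero]; exact exC_pos hs)
  obtain ⟨u, hu, -⟩ := exists_mild_of_le hp hs hu₀.1 hτ h.le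
  exact (ENNReal.ofReal_pos.2 hτ).trans_le (hu.le_maximalTime hp hs hu₀)

lemma Ioc_subset_timeInterval {T : ℝ} {T' : ℝ≥0∞} (h : ENNReal.ofReal T < T') :
    Ioc 0 T ⊆ timeInterval T' := fun _ ht =>
  ⟨ht.1, (ENNReal.ofReal_le_ofReal ht.2).trans_lt h⟩

/-- Before T* one may work on a closed interval (0, T] reaching beyond t, where the bounds are
uniform; this also covers T* = ∞. -/
lemma IsStrongSolution.exists_mild (hu : IsStrongSolution p u₀ u) {t : ℝ}
    (ht : t ∈ timeInterval (maximalTime p u₀)) :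
    ∃ T, t < T ∧ ENNReal.ofReal T < maximalTime p u₀ ∧ Mild p T u₀ u := by
  obtain ⟨T, hT0, h1, h2⟩ := ENNReal.lt_iff_exists_real_btwn.1 ht.2
  have htT : t < T := (ENNReal.ofReal_lt_ofReal_iff_of_nonneg ht.1.le).1 h1
  exact ⟨T, htT, h2, (IsMildSolution.mono hu (Ioc_subset_timeInterval h2)).mild (ht.1.trans htT)⟩

lemma IsStrongSolution.memLp_two (hp : 2 ≤ p) (hs : sing d p < 1) (h₂ : InLpSigma 2 u₀)
    (h₀ : InLpSigma p u₀) (hu : IsStrongSolution p u₀ u) {t : ℝ}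
    (ht : t ∈ timeInterval (maximalTime p u₀)) : MemLp (u t) 2 volume := by
  obtain ⟨T, htT, -, hm⟩ := hu.exists_mild ht
  obtain ⟨A, -, hA⟩ := hm.exists_eLpNorm_two_le hp hs h₀.1 h₂.1
  exact ⟨(hm.curve.mem t ⟨ht.1, htT.le⟩).1, (hA t ⟨ht.1, htT.le⟩).trans_lt (by simp)⟩

lemma IsStrongSolution.eLpNorm_two_le (hp : 2 ≤ p) (hs : sing d p < 1) (h₂ : InLpSigma 2 u₀)
    (h₀ : InLpSigma p u₀) (hu : IsStrongSolution p u₀ u) {t : ℝ}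
    (ht : t ∈ timeInterval (maximalTime p u₀)) : eLpNorm (u t) 2 volume ≤ eLpNorm u₀ 2 volume := by
  obtain ⟨T, htT, -, hm⟩ := hu.exists_mild ht
  exact hm.eLpNorm_two_le hp hs h₀.1 h₂.1 h₂.2 ⟨ht.1, htT⟩

/-- The lower bound for the norm before the maximal time of existence. -/
lemma IsStrongSolution.exC_le (hp : 2 ≤ p) (hs : sing d p < 1)
    (h₀ : InLpSigma p u₀) (hu : IsStrongSolution p u₀ u) (hT : maximalTime p u₀ < ∞) {t : ℝ}
    (ht : t ∈ timeInterval (maximalTime p u₀)) :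
    exC d p ≤ (eLpNorm (u t) p volume).toReal
      * ((maximalTime p u₀).toReal - t) ^ (1 - sing d p) := by
  -- If the product were smaller, the datum u(t) would launch a solution of duration τ > T* - t;
  -- glued to u, it contradicts the definition of T*.
  by_contra! hlt
  obtain ⟨τ, hτ, h⟩ := exists_gt_mul_rpow_lt (by linarith) hlt
  obtain ⟨T, htT, hTT, hm⟩ := hu.exists_mild ht
  have hT' : T < (maximalTime p u₀).toReal := (ENNReal.ofReal_lt_iff_lt_toReal
    (ht.1.trans htT).le hT.ne).1 hTT
  obtain ⟨v, hv, -⟩ := exists_mild_of_le hp hs (hu.mem t ht).1 (by linarith) h.le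
  have := (hm.glue hp hs h₀.1 ht.1 htT (by linarith) hv).le_maximalTime hp hs h₀
  have h2 := (ENNReal.ofReal_le_iff_le_toReal hT.ne).1 this
  linarith

lemma mu_pos (hd : d ≠ 0) (hp : 2 < p) : 0 < mu d p := by
  have h1 := rexp_lt_half hp
  have hd0 : (0 : ℝ) < d := by exact_mod_cast Nat.pos_of_ne_zero hd
  have : 0 < 1 / 2 - (p⁻¹).toReal := by rw [rexp] at h1; linarith
  rw [mu]; positivity

/-- The energy inequality bounds the numerator and `exC_le` the denominator from below; the latter
also shows that the denominator is not 0. -/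
lemma IsStrongSolution.ratio_le (hp : 2 ≤ p) (hs : sing d p < 1) (h₂ : InLpSigma 2 u₀)
    (h₀ : InLpSigma p u₀) (hu : IsStrongSolution p u₀ u) (hT : maximalTime p u₀ < ∞) {t : ℝ}
    (ht : t ∈ timeInterval (maximalTime p u₀)) :
    (eLpNorm (u t) 2 volume).toReal / (eLpNorm (u t) p volume).toReal
      ≤ (exC d p)⁻¹ * (eLpNorm u₀ 2 volume).toReal
        * ((maximalTime p u₀).toReal - t) ^ timeExponent d p := by
  have h := hu.exC_le hp hs h₀ hT ht
  have hc := exC_pos hs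
  have hE := ENNReal.toReal_mono h₂.1.2.ne (hu.eLpNorm_two_le hp hs h₂ h₀ ht)
  have htT : t < (maximalTime p u₀).toReal :=
    (ENNReal.ofReal_lt_iff_lt_toReal ht.1.le hT.ne).1 ht.2
  have hy : 0 < ((maximalTime p u₀).toReal - t) ^ (1 - sing d p) := Real.rpow_pos_of_pos (by linarith) _
  rw [timeExponent_eq]
  set y := ((maximalTime p u₀).toReal - t) ^ (1 - sing d p)
  set N := (eLpNorm (u t) p volume).toReal
  have hN : 0 < N := by
    by_contra! hN
    nlinarith
  rw [div_le_iff₀ hN]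
  calc (eLpNorm (u t) 2 volume).toReal ≤ (eLpNorm u₀ 2 volume).toReal := hE
    _ = (eLpNorm u₀ 2 volume).toReal * ((exC d p)⁻¹ * exC d p) := by
        rw [inv_mul_cancel₀ hc.ne', mul_one]
    _ ≤ (eLpNorm u₀ 2 volume).toReal * ((exC d p)⁻¹ * (N * y)) := by gcongr
    _ = _ := by ring

end

end NavierStokes

end

/-! ### Assembly of the three assertions. -/

theorem theorem1p4 (d : ℕ) (hd : 3 ≤ d) (p : ℝ≥0∞) (hp : (d : ℝ≥0∞) < p) :
    -- the norms that enter `ℓ₀(t)` are finite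
    (∀ u₀ u, NavierStokes.InLpSigma (d := d) 2 u₀ → NavierStokes.InLpSigma p u₀ →
      NavierStokes.IsStrongSolution p u₀ u →
      ∀ t ∈ NavierStokes.timeInterval (NavierStokes.maximalTime p u₀),
        MemLp (u t) 2 volume ∧ MemLp (u t) p volume) ∧
    -- sparseness at the scale `a ℓ₀(t)`, at all times at which `ℓ₀(t)` is defined
    (∀ ε ∈ Ioo (0 : ℝ) 1, ∀ β ∈ Ioo (0 : ℝ) 1, ∃ a : ℝ, 1 ≤ a ∧
      ∀ u₀ u, NavierStokes.InLpSigma (d := d) 2 u₀ → NavierStokes.InLpSigma p u₀ →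
        NavierStokes.IsStrongSolution p u₀ u →
        ∀ t ∈ NavierStokes.timeInterval (NavierStokes.maximalTime p u₀),
          ¬ (u t =ᵐ[volume] 0) →
          NavierStokes.IsSparse p ε β (a * NavierStokes.lengthScale p (u t)) (u t)) ∧
    -- the bound in the case of a finite maximal time of existence
    (∃ c : ℝ, 0 < c ∧ c ≤ 1 ∧ NavierStokes.IsExistenceConstant d p c ∧
      ∀ u₀ u, NavierStokes.InLpSigma (d := d) 2 u₀ → NavierStokes.InLpSigma p u₀ →
        NavierStokes.IsStrongSolution p u₀ u →
        NavierStokes.maximalTime p u₀ < ∞ →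
        (∀ t ∈ NavierStokes.timeInterval (NavierStokes.maximalTime p u₀),
          ¬ (u t =ᵐ[volume] 0) ∧
          NavierStokes.lengthScale p (u t) ^ (1 / NavierStokes.mu d p) ≤
            c⁻¹ * (eLpNorm u₀ 2 volume).toReal *
              ((NavierStokes.maximalTime p u₀).toReal - t) ^ NavierStokes.timeExponent d p) ∧
        Tendsto (fun t : ℝ => c⁻¹ * (eLpNorm u₀ 2 volume).toReal *
            ((NavierStokes.maximalTime p u₀).toReal - t) ^ NavierStokes.timeExponent d p)
          (𝓝[<] (NavierStokes.maximalTime p u₀).toReal) (𝓝 0) ∧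
        Tendsto (fun t : ℝ => NavierStokes.lengthScale p (u t))
          (𝓝[<] (NavierStokes.maximalTime p u₀).toReal) (𝓝 0)) := by
  have hd0 : d ≠ 0 := by omega
  have hp2 : 2 < p := lt_of_le_of_lt (by exact_mod_cast (show 2 ≤ d by omega)) hp
  have hs := NavierStokes.sing_lt_one hd0 hp
  refine ⟨fun u₀ u h₂ h₀ hu t ht => ⟨hu.memLp_two hp2.le hs h₂ h₀ ht, (hu.mem t ht).1⟩,
    fun ε hε β hβ => ?_, NavierStokes.exC d p, NavierStokes.exC_pos hs, NavierStokes.exC_le_one hs,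
    NavierStokes.isExistenceConstant_exC hp2.le hs, fun u₀ u h₂ h₀ hu hT => ?_⟩
  · obtain ⟨a, ha, h⟩ := NavierStokes.exists_isSparse hd0 hp2 hε hβ
    exact ⟨a, ha, fun u₀ u h₂ h₀ hu t ht =>
      h (u t) (hu.memLp_two hp2.le hs h₂ h₀ ht) (hu.mem t ht).1⟩
  have hmu := NavierStokes.mu_pos hd0 hp2
  have hγ : 0 < NavierStokes.timeExponent d p := by
    rw [NavierStokes.timeExponent_eq]; linarith
  have hlim : Tendsto (fun t : ℝ => (NavierStokes.exC d p)⁻¹ * (eLpNorm u₀ 2 volume).toReal *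
      ((NavierStokes.maximalTime p u₀).toReal - t) ^ NavierStokes.timeExponent d p)
      (𝓝[<] (NavierStokes.maximalTime p u₀).toReal) (𝓝 0) := by
    have hc : Continuous fun t : ℝ => (NavierStokes.exC d p)⁻¹ * (eLpNorm u₀ 2 volume).toReal *
        ((NavierStokes.maximalTime p u₀).toReal - t) ^ NavierStokes.timeExponent d p :=
      continuous_const.mul ((continuous_const.sub continuous_id).rpow_const fun _ => Or.inr hγ.le)
    have := (hc.tendsto (NavierStokes.maximalTime p u₀).toReal).mono_left
      (nhdsWithin_le_nhds (s := Iio (NavierStokes.maximalTime p u₀).toReal))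
    simpa [Real.zero_rpow hγ.ne'] using this
  refine ⟨fun t ht => ⟨fun h0 => ?_, ?_⟩, hlim, ?_⟩
  -- A vanishing u(t) would make the right side of the lower bound 0, against positivity of the
  -- constant.
  · have h1 := hu.exC_le hp2.le hs h₀ hT ht
    rw [eLpNorm_congr_ae h0] at h1
    have := NavierStokes.exC_pos hs
    simp at h1
    linarith
  · rw [NavierStokes.lengthScale, ← Real.rpow_mul (by positivity), mul_one_div_cancel hmu.ne',
      Real.rpow_one]
    exact hu.ratio_le hp2.le hs h₂ h₀ hT ht
  -- The bound on the ratio is raised to the positive power μ_p. Positivity of T* guarantees that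
  -- times just below T* are positive and so belong to the interval of existence.
  · have hT0 := ENNReal.toReal_pos (NavierStokes.maximalTime_pos hp2.le hs h₀).ne' hT.ne
    have hlim' := hlim.rpow_const (p := NavierStokes.mu d p) (Or.inr hmu.le)
    rw [Real.zero_rpow hmu.ne'] at hlim'
    refine tendsto_of_tendsto_of_tendsto_of_le_of_le' tendsto_const_nhds hlim' ?_ ?_
    · refine Eventually.of_forall fun t => ?_
      rw [NavierStokes.lengthScale]
      positivity
    · filter_upwards [Ioo_mem_nhdsLT hT0] with t ht
      exact Real.rpow_le_rpow (by positivity) (hu.ratio_le hp2.le hs h₂ h₀ hT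
        ⟨ht.1, (ENNReal.ofReal_lt_iff_lt_toReal ht.1.le hT.ne).2 ht.2⟩) hmu.le
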